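/- **Vertices.** Let $\mathbb I=[0,1]$. For $n\ge 3$ let $P_n=(\mathrm{Int}\,\mathbb I^3)^{n-1}$; for $v=(v_1,\dots,v_{n-1})\in P_n$ put $v_0=(0,0,0)$ and $v_n=(1,1,1)$. **Plumbers' knots.** The plumbers' curve of $v\in P_n$ has the corners $$c_{3i}=v_i,\qquad c_{3i+1}=(v_{i+1}^x,v_i^y,v_i^z),\qquad c_{3i+2}=(v_{i+1}^x,v_{i+1}^y,v_i^z),$$ for $0\le i<n$, and $c_{3n}=v_n$. Its $k$-th pipe ($0\le k<3n$) is the (possibly degenerate) segment $[c_k,c_{k+1}]$; write $\Delta_k=c_{k+1}-c_k$. Pipes $3i,3i+1,3i+2$ form the $i$-th move. Two pipes are distant if at least three pipes lie between them. $K_n\subseteq P_n$, the space of plumbers' knots of $n$ moves, consists of those $v$ for which no two distant pipes meet. For $v\in K_n$ let $\varepsilon(v)>0$ be $\tfrac1{10}$ of the minimum of the distances between distant pipes and of the distances of $v_1,\dots,v_{n-1}$ from the boundary of $\mathbb I^3$. **PL knots.** $L_n\subseteq P_n$, the space of PL knots with $n$ segments, consists of those $v$ for which the map $\psi_v:[0,3]\to\mathbb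 R^3$ that runs linearly from $v_i$ to $v_{i+1}$ on $[\frac{3i}n,\frac{3(i+1)}n]$, $0\le i<n$, is injective. **The systems.** Fix any function $\alpha:\mathbb N\to\mathbb N$ with $\alpha(n)+3\le n$ for all $n\ge3$. * $I_n:L_n\to L_{n+1}$ inserts the vertex $\frac12(v_{\alpha(n)}+v_{\alpha(n)+1})$ between $v_{\alpha(n)}$ and $v_{\alpha(n)+1}$. * $\iota_n:K_n\to K_{n+1}$ inserts a vertex in the middle of the pipe $k=3a+r$, where $a=\alpha(n)+1$ and $r\in\{0,1,2\}$ is the residue of $n$ modulo $3$, borrowing length from the two neighbouring pipes if this pipe is short. Precisely, put $\lambda=\frac12\max(0,\varepsilon(v)-\|\Delta_k\|)$, $g=\lambda\Delta_{k-1}$, $h=\lambda\Delta_{k+1}$ and $m=\frac12(c_k+c_{k+1})$. Then $\iota_n(v)$ is the list $$v_0,\dots,v_{a-1},\;v_a-g,\;m+h,\;v_{a+1},\;v_{a+2},\dots,v_n\quad(r=0),$$ $$v_0,\dots,v_{a},\;m-g+h,\;v_{a+1},\;v_{a+2},\dots,v_n\quad(r=1),$$ $$v_0,\dots,v_{a},\;m-g,\;v_{a+1}+h,\;v_{a+2},\dots,v_n\quad(r=2).$$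 **The buckling maps.** For $v\in K_n$ let $\beta_k=\sqrt{(\varepsilon(v)^2-\|\Delta_k\|^2)/2}$ if $\|\Delta_k\|<\varepsilon(v)$, and $\beta_k=0$ otherwise. Let $f_n(v)$ be the list of vertices $w_0=(0,0,0)$, $w_{3n}=(1,1,1)$ and, for $0<k<3n$, $$w_k=(1-\varepsilon(v))\bigl(c_k+\beta_{k-1}\Delta_k-\beta_k\Delta_{k-1}\bigr)+\varepsilon(v)\,(\tfrac12,\tfrac12,\tfrac12).$$ **Theorem.** For all $n\ge3$ the map $\iota_n$ is a well-defined continuous injection $K_n\to K_{n+1}$, the map $I_n$ is a well-defined continuous injection $L_n\to L_{n+1}$, and $f_n$ is a well-defined continuous map $K_n\to L_{3n}$. Let $\varinjlim K_n$ and $\varinjlim L_n$ be the direct limits, as topological spaces, of the directed systems $(K_n,\iota_n)_{n\ge3}$ and $(L_n,I_n)_{n\ge3}$, with canonical maps $\iota_{n,\infty}$ and $I_{n,\infty}$. Then the $f_n$ induce a well-defined map on sets of path components $$f_*:\pi_0(\varinjlim K_n)\to\pi_0(\varinjlim L_n),\qquad f_*[\iota_{n,\infty}(v)]=[I_{3n,\infty}(f_n(v))]\quad(n\ge3,\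 v\in K_n),$$ and $f_*$ is a bijection. -/

import Mathlib

open Set

noncomputable section

namespace Plumbers

/-- Euclidean three-space; coordinates `0, 1, 2` are `x, y, z`. -/
abbrev E3 : Type := EuclideanSpace ℝ (Fin 3)

/-- The corner `(1, 1, 1)` of the unit cube. -/
def ones : E3 := WithLp.toLp 2 (fun _ => 1)

/-- Lists of vertices `v₀, v₁, v₂, …`. A list `v₀, …, vₙ` is continued by the constant `vₙ`. -/
abbrev Seq : Type := ℕ → E3

/-- `P n`: the lists `v₀ = (0,0,0), v₁, …, vₙ₋₁, vₙ = (1,1,1)` whose intermediate vertices lie in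
the open unit cube. The list is continued by `(1,1,1)`, so that `P n`, as a subspace of the
product, is the `(n-1)`-fold power of the open cube (and `P 0` is empty). -/
def P (n : ℕ) : Set Seq :=
  {v | v 0 = 0 ∧ (∀ i, n ≤ i → v i = ones) ∧ ∀ i, 0 < i → i < n → ∀ c, v i c ∈ Ioo (0 : ℝ) 1}

/-! ### Plumbers' curves -/

/-- The corners of the plumbers' curve of `v`: corner `3i` is `vᵢ`, corner `3i+1` is
`(vᵢ₊₁ˣ, vᵢʸ, vᵢᶻ)` and corner `3i+2` is `(vᵢ₊₁ˣ, vᵢ₊₁ʸ, vᵢᶻ)`. -/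
def corner (v : Seq) (k : ℕ) : E3 :=
  WithLp.toLp 2 (fun c => v ((k + 2 - (c : ℕ)) / 3) c)

/-- The displacement along the `k`-th pipe. -/
def disp (v : Seq) (k : ℕ) : E3 := corner v (k + 1) - corner v k

/-- The `k`-th pipe; pipes `3i, 3i+1, 3i+2` are `𝐱ᵢ, 𝐲ᵢ, 𝐳ᵢ`. The curve of `v ∈ P n` consists of
the pipes with `k < 3n`. -/
def pipe (v : Seq) (k : ℕ) : Set E3 := segment ℝ (corner v k) (corner v (k + 1))

/-- Plumbers' knots of `n` moves: distant pipes (those separated by at least three intervening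
pipes) do not meet. -/
def K (n : ℕ) : Set Seq :=
  {v | v ∈ P n ∧ ∀ j k, j + 4 ≤ k → k < 3 * n → Disjoint (pipe v j) (pipe v k)}

/-- The distance between two pipes. -/
def pipeDist (v : Seq) (j k : ℕ) : ℝ := sInf (image2 dist (pipe v j) (pipe v k))

/-- The global perturbation distance: a tenth of the minimum of the distances between distant
pipes and of the distances of the intermediate vertices from the boundary of the cube (for `n ≥ 3`
the latter are the distances from the boundary of the pipes that do not meet it). -/
def eps (n : ℕ) (v : Seq) : ℝ :=
  (1 / 10) * sInf ({d | ∃ j k, j + 4 ≤ k ∧ k < 3 * n ∧ d = pipeDist v j k} ∪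
    {d | ∃ i c, 0 < i ∧ i < n ∧ (d = v i c ∨ d = 1 - v i c)})

/-- The proportion of each neighbouring pipe that is borrowed when a vertex is inserted in the
`k`-th pipe: zero if that pipe has length at least `ε`, and `ε / 2` if it has length zero. -/
def borrow (n : ℕ) (v : Seq) (k : ℕ) : ℝ := max 0 (eps n v - ‖disp v k‖) / 2

/-- The map `ιₙ`, which inserts a vertex in the middle of the pipe `k = 3a + r` of the
move `a = α(n) + 1` in the direction `r = n mod 3`. If that pipe is short, then the end of the
preceding pipe and the start of the following one are cut off by the steps `g` and `h`, so that
the sequence of pipes `k-1, k, k+1` becomes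
`k-1` without `g`, half of `k`, `h`, `g`, half of `k`, `k+1` without `h`. -/
def iota (α : ℕ → ℕ) (n : ℕ) (v : Seq) : Seq :=
  let a : ℕ := α n + 1
  let r : ℕ := n % 3
  let k : ℕ := 3 * a + r
  let g : E3 := borrow n v k • disp v (k - 1)
  let h : E3 := borrow n v k • disp v (k + 1)
  let m : E3 := midpoint ℝ (corner v k) (corner v (k + 1))
  fun i =>
    if i < a then v i
    else if i = a then (if r = 0 then v a - g else v a)
    else if i = a + 1 then (if r = 0 then m + h else if r = 1 then m - g + h else m - g)
    else if i = a + 2 then (if r = 2 then v (a + 1) + h else v (a + 1))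
    else v (i - 1)

/-! ### Piecewise linear knots -/

/-- The PL map `ψ_v` with `n` segments: on `[3i/n, 3(i+1)/n]` it runs linearly from `vᵢ` to
`vᵢ₊₁`. -/
def psi (n : ℕ) (v : Seq) (t : ℝ) : E3 :=
  let u : ℝ := n * t / 3
  let i : ℕ := ⌊u⌋₊
  (i + 1 - u) • v i + (u - i) • v (i + 1)

/-- PL knots with `n` segments. -/
def L (n : ℕ) : Set Seq := {v | v ∈ P n ∧ InjOn (psi n v) (Icc 0 3)}

/-- The map `Iₙ`, which inserts the midpoint of the segment from `v_{α(n)}` to `v_{α(n)+1}`. -/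
def insertMid (α : ℕ → ℕ) (n : ℕ) (v : Seq) : Seq := fun i =>
  if i < α n + 1 then v i
  else if i = α n + 1 then midpoint ℝ (v (i - 1)) (v i)
  else v (i - 1)

/-! ### From plumbers' knots to PL knots -/

/-- The buckling function of the `k`-th pipe. -/
def buckling (n : ℕ) (v : Seq) (k : ℕ) : ℝ :=
  if ‖disp v k‖ < eps n v then √((eps n v ^ 2 - ‖disp v k‖ ^ 2) / 2) else 0

/-- The `k`-th corner (`0 < k < 3n`), moved forward into the pipe that follows it if the preceding
pipe is short, and back into the pipe that precedes it if the following pipe is short. -/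
def buckled (n : ℕ) (v : Seq) (k : ℕ) : E3 :=
  corner v k + buckling n v (k - 1) • disp v k - buckling n v k • disp v (k - 1)

/-- The map `fₙ`: the PL map through the buckled corners. Two corners at either end
lie on the boundary of the cube; to bring all intermediate vertices into the open cube they are
contracted towards its centre by the factor `1 - ε`. -/
def f (n : ℕ) (v : Seq) : Seq := fun k =>
  if k = 0 then 0
  else if k < 3 * n then (1 - eps n v) • buckled n v k + (eps n v / 2) • ones
  else ones

/-! ### Limits of the directed systems -/

/-- The disjoint union of the spaces `S n`, `n ≥ 3`. -/
abbrev Stages (S : ℕ → Set Seq) : Type := Σ n : {n : ℕ // 3 ≤ n}, S n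

/-- The direct limit of the spaces `S n`, `n ≥ 3`, along maps `g n : S n → S (n + 1)`: the quotient
space of the disjoint union by the equivalence relation generated by `v ∼ g n v`. -/
def Lim (S : ℕ → Set Seq) (g : ℕ → Seq → Seq) : Type :=
  Quot (fun a b : Stages S => b.1.1 = a.1.1 + 1 ∧ b.2.1 = g a.1.1 a.2.1)

instance (S : ℕ → Set Seq) (g : ℕ → Seq → Seq) : TopologicalSpace (Lim S g) :=
  inferInstanceAs (TopologicalSpace (Quot _))

/-- The path component in the direct limit of a point `v ∈ S n`. -/
def comp (S : ℕ → Set Seq) (g : ℕ → Seq → Seq) (n : ℕ) (hn : 3 ≤ n) (v : Seq) (hv : v ∈ S n) :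
    ZerothHomotopy (Lim S g) :=
  ZerothHomotopy.mk (Quot.mk _ (⟨⟨n, hn⟩, ⟨v, hv⟩⟩ : Stages S))

end Plumbers

end

open Set

noncomputable section

namespace Plumbers

/-! ### Interleaved coordinates of a list of vertices -/

/-! Smoothing provides an inverse of f_*. The proof constructs a map G from the components of PL
knots to the components of plumbers' knots, shows that G is bijective and takes f_* to be its
inverse. No direct comparison of f after ι with I after f is needed: well-definedness of f_* and its
formula both follow from G[f_n(v)] = [v] (`smoothing_f`).

Both systems are compared with curves γ in the cube that are sampled at fine times (`Tame`,
`FineTimes`, `Adapted`). If near each time some linear functional increases strictly along γ, and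
points far apart in time are apart in space, then the fine samples of γ form a PL knot
(`Adapted.mem_L`). If these functionals are signed coordinates, they also form a plumbers' knot,
because pipes are axis-parallel and disjoint pipes are separated by a coordinate (`Adapted.mem_K`).
The maps of both systems turn samples of γ into lists that still follow γ, and a straight segment
joins such a list to samples with one point more. Hence all fine samples of γ represent one
component of the limit (`System.exists_class`), which does not change under isotopies
(`Traces.isotopy`).

A PL knot admits local functionals, but in general not coordinates. Its average over intervals of
radius δ has the derivative (γ(t+δ) - γ(t-δ))/2δ. By injectivity this vector is nonzero, so one of
its coordinates is nonzero and remains so nearby; thus the smoothing has coordinate charts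
(`Regular.smooth_tame_coords`). G sends the component of a PL knot to that of the fine samples of
its smoothings. It respects the system because the insertion of a vertex only reparametrizes the
curve (`exists_smoothing_map`).

G is injective: applied to fine samples of the smoothing, f gives a polygon that follows the
smoothing again (`weaklyAdapted_f`), hence lies in the original component. The component in which
the polygons of all sufficiently late images of v lie is an invariant of [v], so it recovers c from
G(c) (`smoothing_injective`).

For G[f_n(v)] = [v], move v off pipes of length zero and insert one vertex near each end, which
gives u. The polygon f_n(v) deforms into the polygon along the plumbers' curve of u, because the
sign conditions that guarantee embeddedness are convex (`Represents.spine`). Sampling that polygon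
more finely amounts to dividing pipes of u, which stays in the component of u (`Boxed.exists_fine`).
Finally a segment joins fine samples of the polygon to samples of its smoothing: in short windows
each coordinate is monotone along both (`Boxed.joinedIn_smooth`).

Underneath lies the combinatorics of interleaved coordinates, where pipe k moves the value at k to
the value at k + 3. All admissible insertions of a vertex yield plumbers' knots, and segments in the
parameters connect them with each other (`Admissible.kSeq`, `Admissible.joinedIn`); so the position
α(n) is immaterial. -/

/-- The coordinates of the vertices in the order `v₀ˣ, v₀ʸ, v₀ᶻ, v₁ˣ, …`. The `k`-th pipe changes
the value `val v k` into `val v (k + 3)`. -/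
def val (v : Seq) (m : ℕ) : ℝ := v (m / 3) ⟨m % 3, Nat.mod_lt _ (by norm_num)⟩

/-- The list of vertices with prescribed interleaved coordinates. -/
def ofVal (Y : ℕ → ℝ) : Seq := fun i => WithLp.toLp 2 fun c => Y (3 * i + c)

theorem val_ofVal (Y : ℕ → ℝ) : val (ofVal Y) = Y := by
  funext m
  simp only [val, ofVal]
  congr 1
  omega

theorem val_mul_add (v : Seq) (i : ℕ) (c : Fin 3) : val v (3 * i + c) = v i c := by
  have h1 : (3 * i + (c : ℕ)) / 3 = i := by omega
  have h2 : (3 * i + (c : ℕ)) % 3 = c := by omega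
  simp only [val, h1, h2]

theorem ofVal_val (v : Seq) : ofVal (val v) = v := by
  funext i
  ext c
  simp only [ofVal]
  exact val_mul_add v i c

theorem val_injective : Function.Injective val := fun v w h => by
  rw [← ofVal_val v, h, ofVal_val]

/-- A corner is a window of three consecutive interleaved coordinates: passing to the next corner
drops `val v k` and takes in `val v (k + 3)`. Directions thereby become residues modulo 3. -/
theorem corner_apply (v : Seq) {k m : ℕ} {c : Fin 3} (h1 : k ≤ m) (h2 : m < k + 3)
    (h3 : m % 3 = c) : corner v k c = val v m := by
  have h : (k + 2 - (c : ℕ)) / 3 = m / 3 := by omega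
  simp only [corner, val, h, h3]

theorem exists_class (k : ℕ) (c : Fin 3) : ∃ m, k ≤ m ∧ m < k + 3 ∧ m % 3 = c := by
  refine ⟨3 * ((k + 2 - c) / 3) + c, ?_, ?_, ?_⟩ <;> omega

theorem disp_apply (v : Seq) (k : ℕ) (c : Fin 3) :
    disp v k c = if k % 3 = c then val v (k + 3) - val v k else 0 := by
  simp only [disp, PiLp.sub_apply]
  split_ifs with h
  · rw [corner_apply v (k := k + 1) (m := k + 3) (by omega) (by omega) (by omega),
      corner_apply v (k := k) (m := k) (by omega) (by omega) (by omega)]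
  · obtain ⟨m, h1, h2, h3⟩ := exists_class k c
    have : m ≠ k := by rintro rfl; exact h h3
    rw [corner_apply v (k := k + 1) (m := m) (by omega) (by omega) h3,
      corner_apply v h1 h2 h3, sub_self]

theorem norm_eq_abs_of_apply_eq_ite {x : E3} {a : ℕ} {r : ℝ}
    (h : ∀ c : Fin 3, x c = if a % 3 = c then r else 0) : ‖x‖ = |r| := by
  rw [EuclideanSpace.norm_eq, Fin.sum_univ_three, h 0, h 1, h 2]
  have : a % 3 = 0 ∨ a % 3 = 1 ∨ a % 3 = 2 := by omega
  rcases this with h | h | h <;> simp [h, Real.sqrt_sq_eq_abs]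

theorem norm_disp (v : Seq) (k : ℕ) : ‖disp v k‖ = |val v (k + 3) - val v k| :=
  norm_eq_abs_of_apply_eq_ite (disp_apply v k)

theorem abs_apply_le_norm (x : E3) (c : Fin 3) : |x c| ≤ ‖x‖ := by
  have := PiLp.norm_apply_le x c
  rwa [Real.norm_eq_abs] at this

/-- The factor is √3 rounded up; it is the reason why distances 10ε become coordinate gaps 5ε. -/
theorem norm_le_two_mul {x : E3} {r : ℝ} (h : ∀ c, |x c| ≤ r) : ‖x‖ ≤ 2 * r := by
  have hr : 0 ≤ r := (abs_nonneg _).trans (h 0)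
  rw [EuclideanSpace.norm_eq, Fin.sum_univ_three]
  apply Real.sqrt_le_iff.mpr
  refine ⟨by linarith, ?_⟩
  simp only [Real.norm_eq_abs]
  have h' : ∀ c, |x c| ^ 2 ≤ r ^ 2 := fun c => pow_le_pow_left₀ (abs_nonneg _) (h c) 2
  nlinarith [h' 0, h' 1, h' 2]

/-! ### Pipes as boxes -/

/-- A pipe is parallel to an axis, so it coincides with the box spanned by its end corners, and
membership can be tested coordinate by coordinate. -/
theorem mem_pipe_iff (v : Seq) (k : ℕ) (p : E3) :
    p ∈ pipe v k ↔ ∀ c, p c ∈ uIcc (corner v k c) (corner v (k + 1) c) := by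
  constructor
  · intro h c
    rw [pipe, segment_eq_image'] at h
    obtain ⟨t, ht, rfl⟩ := h
    rw [← segment_eq_uIcc, segment_eq_image']
    exact ⟨t, ht, rfl⟩
  · intro h
    obtain ⟨t, ht, hp⟩ : ∃ t ∈ Icc (0 : ℝ) 1, ∀ c : Fin 3, k % 3 = c →
        p c = corner v k c + t * (corner v (k + 1) c - corner v k c) := by
      let c : Fin 3 := ⟨k % 3, Nat.mod_lt _ (by norm_num)⟩
      have := h c
      rw [← segment_eq_uIcc, segment_eq_image'] at this
      obtain ⟨t, ht, hp⟩ := this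
      refine ⟨t, ht, fun c' hc' => ?_⟩
      have : c' = c := Fin.ext hc'.symm
      rw [this, ← hp]
      rfl
    rw [pipe, segment_eq_image']
    refine ⟨t, ht, ?_⟩
    ext c
    by_cases hc : k % 3 = c
    · rw [hp c hc]; rfl
    · have h1 : corner v (k + 1) c - corner v k c = 0 := by
        have := disp_apply v k c
        rwa [if_neg hc] at this
      have h2 := h c
      rw [sub_eq_zero.mp h1, uIcc_self, mem_singleton_iff] at h2
      rw [h2]
      change corner v k c + t * (corner v (k + 1) c - corner v k c) = _
      rw [h1]; ring

/-- Pipes `j` and `k` are separated by a coordinate. -/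
def Sep (Y : ℕ → ℝ) (j k : ℕ) : Prop :=
  ∃ a, (∀ m m', j ≤ m → m ≤ j + 3 → k ≤ m' → m' ≤ k + 3 → m % 3 = a % 3 → m' % 3 = a % 3 → Y m < Y m') ∨
    (∀ m m', j ≤ m → m ≤ j + 3 → k ≤ m' → m' ≤ k + 3 → m % 3 = a % 3 → m' % 3 = a % 3 → Y m' < Y m)

/-- Pipes `j` and `k` are separated by a coordinate, with a gap of length at least `g`. -/
def SepBy (g : ℝ) (Y : ℕ → ℝ) (j k : ℕ) : Prop :=
  ∃ a, (∀ m m', j ≤ m → m ≤ j + 3 → k ≤ m' → m' ≤ k + 3 → m % 3 = a % 3 → m' % 3 = a % 3 →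
      Y m + g ≤ Y m') ∨
    (∀ m m', j ≤ m → m ≤ j + 3 → k ≤ m' → m' ≤ k + 3 → m % 3 = a % 3 → m' % 3 = a % 3 →
      Y m' + g ≤ Y m)

theorem corner_eq_or (v : Seq) {k m : ℕ} {c : Fin 3} (h1 : k ≤ m) (h2 : m ≤ k + 3)
    (h3 : m % 3 = c) : val v m = corner v k c ∨ val v m = corner v (k + 1) c := by
  rcases h2.lt_or_eq with h | rfl
  · exact Or.inl (corner_apply v h1 h h3).symm
  · exact Or.inr (corner_apply v (by omega) (by omega) h3).symm

theorem exists_val_eq_corner (v : Seq) (k : ℕ) (c : Fin 3) :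
    (∃ m, k ≤ m ∧ m ≤ k + 3 ∧ m % 3 = c ∧ corner v k c = val v m) ∧
    (∃ m, k ≤ m ∧ m ≤ k + 3 ∧ m % 3 = c ∧ corner v (k + 1) c = val v m) := by
  obtain ⟨m, h1, h2, h3⟩ := exists_class k c
  obtain ⟨m', h1', h2', h3'⟩ := exists_class (k + 1) c
  exact ⟨⟨m, h1, by omega, h3, corner_apply v h1 h2 h3⟩,
    ⟨m', by omega, by omega, h3', corner_apply v h1' h2' h3'⟩⟩

theorem Sep.disjoint {v : Seq} {j k : ℕ} (h : Sep (val v) j k) :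
    Disjoint (pipe v j) (pipe v k) := by
  rw [Set.disjoint_left]
  intro p hp hq
  rw [mem_pipe_iff] at hp hq
  obtain ⟨e, hc⟩ := h
  have hp := hp ⟨e % 3, Nat.mod_lt _ (by norm_num)⟩
  have hq := hq ⟨e % 3, Nat.mod_lt _ (by norm_num)⟩
  obtain ⟨⟨a, a1, a2, a3, a4⟩, b, b1, b2, b3, b4⟩ :=
    exists_val_eq_corner v j ⟨e % 3, Nat.mod_lt _ (by norm_num)⟩
  obtain ⟨⟨a', a1', a2', a3', a4'⟩, b', b1', b2', b3', b4'⟩ :=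
    exists_val_eq_corner v k ⟨e % 3, Nat.mod_lt _ (by norm_num)⟩
  rw [a4, b4, mem_uIcc] at hp
  rw [a4', b4', mem_uIcc] at hq
  rcases hc with hc | hc
  · have := hc a a' a1 a2 a1' a2' a3 a3'
    have := hc a b' a1 a2 b1' b2' a3 b3'
    have := hc b a' b1 b2 a1' a2' b3 a3'
    have := hc b b' b1 b2 b1' b2' b3 b3'
    rcases hp with hp | hp <;> rcases hq with hq | hq <;> linarith [hp.1, hp.2, hq.1, hq.2]
  · have := hc a a' a1 a2 a1' a2' a3 a3'
    have := hc a b' a1 a2 b1' b2' a3 b3'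
    have := hc b a' b1 b2 a1' a2' b3 a3'
    have := hc b b' b1 b2 b1' b2' b3 b3'
    rcases hp with hp | hp <;> rcases hq with hq | hq <;> linarith [hp.1, hp.2, hq.1, hq.2]

theorem exists_near_or_gap (a b a' b' g : ℝ) (hg : 0 < g) :
    (max a b + g ≤ min a' b') ∨ (max a' b' + g ≤ min a b) ∨
      ∃ p ∈ uIcc a b, ∃ q ∈ uIcc a' b', |p - q| < g := by
  by_contra! h
  obtain ⟨h1, h2, h3⟩ := h
  have key : ∀ p ∈ Icc (min a b) (max a b), ∀ q ∈ Icc (min a' b') (max a' b'), g ≤ |p - q| := h3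
  have m1 : min a b ≤ max a b := min_le_max
  have m2 : min a' b' ≤ max a' b' := min_le_max
  rcases le_total (max a b) (min a' b') with h | h
  · have := key _ (right_mem_Icc.2 m1) _ (left_mem_Icc.2 m2)
    rw [abs_of_nonpos (by linarith)] at this
    linarith
  · rcases le_total (max a' b') (min a b) with h' | h'
    · have := key _ (left_mem_Icc.2 m1) _ (right_mem_Icc.2 m2)
      rw [abs_of_nonneg (by linarith)] at this
      linarith
    · have := key (max (min a b) (min a' b')) ⟨le_max_left _ _, max_le m1 h⟩ _
        ⟨le_max_right _ _, max_le h' m2⟩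
      rw [sub_self, abs_zero] at this
      linarith

/-- If no coordinate left a gap, each coordinate would offer values of the two pipes less than g
apart. Since pipes are boxes, these values assemble to points of the pipes at distance less than √3
g. -/
theorem sepBy_of_dist {v : Seq} {j k : ℕ} {g : ℝ} (hg : 0 < g)
    (h : ∀ p ∈ pipe v j, ∀ q ∈ pipe v k, 2 * g ≤ dist p q) : SepBy g (val v) j k := by
  by_contra hne
  have key : ∀ c : Fin 3, ∃ p ∈ uIcc (corner v j c) (corner v (j + 1) c),
      ∃ q ∈ uIcc (corner v k c) (corner v (k + 1) c), |p - q| < g := by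
    intro c
    rcases exists_near_or_gap (corner v j c) (corner v (j + 1) c) (corner v k c)
      (corner v (k + 1) c) g hg with h1 | h1 | h1
    · refine (hne ⟨c, Or.inl fun m m' a1 a2 a3 a4 a5 a6 => ?_⟩).elim
      rw [Nat.mod_eq_of_lt c.2] at a5 a6
      have e1 : val v m ≤ max (corner v j c) (corner v (j + 1) c) := by
        rcases corner_eq_or v a1 a2 a5 with e | e <;> rw [e] <;> simp
      have e2 : min (corner v k c) (corner v (k + 1) c) ≤ val v m' := by
        rcases corner_eq_or v a3 a4 a6 with e | e <;> rw [e] <;> simp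
      linarith
    · refine (hne ⟨c, Or.inr fun m m' a1 a2 a3 a4 a5 a6 => ?_⟩).elim
      rw [Nat.mod_eq_of_lt c.2] at a5 a6
      have e1 : min (corner v j c) (corner v (j + 1) c) ≤ val v m := by
        rcases corner_eq_or v a1 a2 a5 with e | e <;> rw [e] <;> simp
      have e2 : val v m' ≤ max (corner v k c) (corner v (k + 1) c) := by
        rcases corner_eq_or v a3 a4 a6 with e | e <;> rw [e] <;> simp
      linarith
    · exact h1
  choose p hp q hq hpq using key
  have h1 := h (WithLp.toLp 2 p) ((mem_pipe_iff v j _).2 hp) (WithLp.toLp 2 q)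
    ((mem_pipe_iff v k _).2 hq)
  have h2 : dist (WithLp.toLp 2 p : E3) (WithLp.toLp 2 q) < 2 * g := by
    rw [EuclideanSpace.dist_eq, Fin.sum_univ_three]
    rw [Real.sqrt_lt' (by linarith)]
    simp only [Real.dist_eq]
    have h' : ∀ c, |p c - q c| ^ 2 < g ^ 2 := fun c => pow_lt_pow_left₀ (hpq c) (abs_nonneg _)
      (by norm_num)
    nlinarith [h' 0, h' 1, h' 2]
  linarith

/-! ### The perturbation distance -/

theorem continuous_corner (k : ℕ) : Continuous fun v : Seq => corner v k := by
  simp only [corner]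
  refine (PiLp.continuous_toLp 2 _).comp (continuous_pi fun c => ?_)
  exact (EuclideanSpace.proj c).continuous.comp (continuous_apply _)

theorem continuous_disp (k : ℕ) : Continuous fun v : Seq => disp v k :=
  (continuous_corner (k + 1)).sub (continuous_corner k)

theorem isCompact_pipe (v : Seq) (k : ℕ) : IsCompact (pipe v k) := by
  rw [pipe, segment_eq_image']
  exact isCompact_Icc.image (by fun_prop)

/-- Parametrizing both pipes by the unit square makes the compact index set independent of `v`, as
`IsCompact.continuous_sInf` requires. -/
theorem pipeDist_eq (v : Seq) (j k : ℕ) : pipeDist v j k =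
    sInf ((fun p : ℝ × ℝ => dist (corner v j + p.1 • disp v j) (corner v k + p.2 • disp v k)) ''
      (Icc (0 : ℝ) 1 ×ˢ Icc (0 : ℝ) 1)) := by
  rw [pipeDist, pipe, pipe, segment_eq_image', segment_eq_image', image2_image_left,
    image2_image_right, ← image_prod]
  rfl

theorem continuous_pipeDist (j k : ℕ) : Continuous fun v : Seq => pipeDist v j k := by
  simp only [pipeDist_eq]
  refine IsCompact.continuous_sInf (isCompact_Icc.prod isCompact_Icc) ?_
  have h1 := continuous_corner j
  have h2 := continuous_corner k
  have h3 := continuous_disp j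
  have h4 := continuous_disp k
  simp only [Function.HasUncurry.uncurry, id]
  refine Continuous.dist ?_ ?_
  · exact (h1.comp continuous_fst).add
      ((continuous_fst.comp continuous_snd).smul (h3.comp continuous_fst))
  · exact (h2.comp continuous_fst).add
      ((continuous_snd.comp continuous_snd).smul (h4.comp continuous_fst))

theorem pipeDist_le {v : Seq} {j k : ℕ} {p q : E3} (hp : p ∈ pipe v j) (hq : q ∈ pipe v k) :
    pipeDist v j k ≤ dist p q :=
  csInf_le ⟨0, by rintro _ ⟨a, _, b, _, rfl⟩; exact dist_nonneg⟩ (mem_image2_of_mem hp hq)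

theorem pipeDist_pos {v : Seq} {j k : ℕ} (h : Disjoint (pipe v j) (pipe v k)) :
    0 < pipeDist v j k := by
  have hc : IsCompact (image2 dist (pipe v j) (pipe v k)) := by
    rw [← image_prod]
    exact ((isCompact_pipe v j).prod (isCompact_pipe v k)).image continuous_dist
  have hne : (image2 dist (pipe v j) (pipe v k)).Nonempty :=
    Nonempty.image2 ⟨_, left_mem_segment _ _ _⟩ ⟨_, left_mem_segment _ _ _⟩
  obtain ⟨p, hp, q, hq, hpq⟩ := hc.sInf_mem hne
  rw [pipeDist, ← hpq, dist_pos]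
  rintro rfl
  exact Set.disjoint_left.1 h hp hq

/-- The family of distances whose minimum is ten times `eps`. -/
def clearance (v : Seq) : (ℕ × ℕ) ⊕ (ℕ × Fin 3 × Bool) → ℝ
  | .inl p => pipeDist v p.1 p.2
  | .inr p => if p.2.2 then v p.1 p.2.1 else 1 - v p.1 p.2.1

def clearanceIndex (n : ℕ) : Finset ((ℕ × ℕ) ⊕ (ℕ × Fin 3 × Bool)) :=
  ((Finset.range (3 * n) ×ˢ Finset.range (3 * n)).filter fun p => p.1 + 4 ≤ p.2).disjSum
    (Finset.Ioo 0 n ×ˢ Finset.univ)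

theorem clearanceIndex_nonempty {n : ℕ} (hn : 3 ≤ n) : (clearanceIndex n).Nonempty :=
  ⟨.inr (1, 0, true), by simp [clearanceIndex]; omega⟩

/-- As a minimum over a finite index set, ε is continuous, and it is positive as soon as each member
is. -/
theorem eps_eq {n : ℕ} (hn : 3 ≤ n) (v : Seq) :
    eps n v = 1 / 10 * (clearanceIndex n).inf' (clearanceIndex_nonempty hn) (clearance v) := by
  rw [eps, Finset.inf'_eq_csInf_image]
  congr 2
  ext d
  simp only [mem_union, mem_ofPred_eq, mem_image, Finset.mem_coe, clearanceIndex,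
    Finset.mem_disjSum]
  constructor
  · rintro (⟨j, k, h1, h2, rfl⟩ | ⟨i, c, h1, h2, rfl | rfl⟩)
    · exact ⟨.inl (j, k), Or.inl ⟨_, by simp; omega, rfl⟩, rfl⟩
    · exact ⟨.inr (i, c, true), Or.inr ⟨_, by simp [h1, h2], rfl⟩, by simp [clearance]⟩
    · exact ⟨.inr (i, c, false), Or.inr ⟨_, by simp [h1, h2], rfl⟩, by simp [clearance]⟩
  · rintro ⟨_, ⟨⟨j, k⟩, h, rfl⟩ | ⟨⟨i, c, b⟩, h, rfl⟩, rfl⟩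
    · simp at h
      exact Or.inl ⟨j, k, h.2, h.1.2, rfl⟩
    · simp at h
      refine Or.inr ⟨i, c, h.1, h.2, ?_⟩
      cases b <;> simp [clearance]

theorem continuous_eps {n : ℕ} (hn : 3 ≤ n) : Continuous (eps n) := by
  have : eps n = fun v => 1 / 10 *
      (clearanceIndex n).inf' (clearanceIndex_nonempty hn) (clearance v) := funext (eps_eq hn)
  rw [this]
  refine continuous_const.mul (Continuous.finset_inf'_apply _ fun i _ => ?_)
  rcases i with p | p
  · exact continuous_pipeDist _ _
  · have : Continuous fun v : Seq => v p.1 p.2.1 :=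
      (EuclideanSpace.proj p.2.1).continuous.comp (continuous_apply _)
    simp only [clearance]
    split_ifs
    · exact this
    · exact continuous_const.sub this

theorem eps_pos {n : ℕ} (hn : 3 ≤ n) {v : Seq} (hv : v ∈ K n) : 0 < eps n v := by
  rw [eps_eq hn]
  refine mul_pos (by norm_num) ((Finset.lt_inf'_iff _).2 fun i hi => ?_)
  rcases i with ⟨j, k⟩ | ⟨i, c, b⟩
  · simp [clearanceIndex] at hi
    exact pipeDist_pos (hv.2 j k hi.2 hi.1.2)
  · simp [clearanceIndex] at hi
    have := hv.1.2.2 i hi.1 hi.2 c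
    cases b
    · simpa [clearance] using this.2
    · simpa [clearance] using this.1

theorem eps_le_dist {n : ℕ} (hn : 3 ≤ n) {v : Seq} {j k : ℕ} (hjk : j + 4 ≤ k) (hk : k < 3 * n)
    {p q : E3} (hp : p ∈ pipe v j) (hq : q ∈ pipe v k) : 10 * eps n v ≤ dist p q := by
  have h : (clearanceIndex n).inf' (clearanceIndex_nonempty hn) (clearance v) ≤ _ :=
    Finset.inf'_le (b := .inl (j, k)) (clearance v) (by simp [clearanceIndex]; omega)
  have h2 := pipeDist_le hp hq
  rw [eps_eq hn]
  simp only [clearance] at h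
  linarith

theorem eps_le_apply {n : ℕ} (hn : 3 ≤ n) (v : Seq) {i : ℕ} (h0 : 0 < i) (hi : i < n)
    (c : Fin 3) : 10 * eps n v ≤ v i c ∧ v i c ≤ 1 - 10 * eps n v := by
  have h : (clearanceIndex n).inf' (clearanceIndex_nonempty hn) (clearance v) ≤ v i c :=
    (Finset.inf'_le (b := .inr (i, c, true)) (clearance v)
      (by simp [clearanceIndex, h0, hi])).trans_eq (by simp [clearance])
  have h' : (clearanceIndex n).inf' (clearanceIndex_nonempty hn) (clearance v) ≤ 1 - v i c :=
    (Finset.inf'_le (b := .inr (i, c, false)) (clearance v)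
      (by simp [clearanceIndex, h0, hi])).trans_eq (by simp [clearance])
  rw [eps_eq hn]
  constructor <;> linarith

/-! ### Plumbers' knots in interleaved coordinates -/

/-- The interleaved coordinates of a list in `P n`. -/
structure PSeq (n : ℕ) (Y : ℕ → ℝ) : Prop where
  zero : ∀ m, m < 3 → Y m = 0
  one : ∀ m, 3 * n ≤ m → Y m = 1
  cube : ∀ m, 3 ≤ m → m < 3 * n → 0 < Y m ∧ Y m < 1

/-- The interleaved coordinates of a plumbers' knot. -/
structure KSeq (n : ℕ) (Y : ℕ → ℝ) : Prop extends PSeq n Y where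
  sep : ∀ j k, j + 4 ≤ k → k < 3 * n → Sep Y j k

/-- The interleaved coordinates of a plumbers' knot, with a lower bound for the distances. -/
structure Gap (n : ℕ) (ε : ℝ) (Y : ℕ → ℝ) : Prop where
  three_le : 3 ≤ n
  pos : 0 < ε
  zero : ∀ m, m < 3 → Y m = 0
  one : ∀ m, 3 * n ≤ m → Y m = 1
  cube : ∀ m, 3 ≤ m → m < 3 * n → 10 * ε ≤ Y m ∧ Y m ≤ 1 - 10 * ε
  gap : ∀ j k, j + 4 ≤ k → k < 3 * n → SepBy (5 * ε) Y j k

theorem mem_P_iff {n : ℕ} (v : Seq) : v ∈ P n ↔ PSeq n (val v) := by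
  constructor
  · rintro ⟨h0, h1, h2⟩
    refine ⟨fun m hm => ?_, fun m hm => ?_, fun m hm hm' => ?_⟩
    · rw [val, Nat.div_eq_of_lt hm, h0]; rfl
    · rw [val, h1 _ (by omega)]; rfl
    · exact h2 (m / 3) (by omega) (by omega) _
  · intro h
    refine ⟨?_, fun i hi => ?_, fun i hi hi' c => ?_⟩
    · ext c
      rw [← val_mul_add v 0 c, h.zero _ (by omega)]; rfl
    · ext c
      rw [← val_mul_add v i c, h.one _ (by omega)]; rfl
    · rw [← val_mul_add v i c]
      exact h.cube _ (by omega) (by omega)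

theorem KSeq.mem_K {n : ℕ} {v : Seq} (h : KSeq n (val v)) : v ∈ K n :=
  ⟨(mem_P_iff v).2 h.toPSeq, fun j k h1 h2 => (h.sep j k h1 h2).disjoint⟩

theorem gap_of_mem_K {n : ℕ} (hn : 3 ≤ n) {v : Seq} (hv : v ∈ K n) : Gap n (eps n v) (val v) := by
  have hp := (mem_P_iff v).1 hv.1
  have h0 := eps_pos hn hv
  refine ⟨hn, h0, hp.zero, hp.one, fun m hm hm' => ?_, fun j k h1 h2 => ?_⟩
  · exact eps_le_apply hn v (i := m / 3) (by omega) (by omega) _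
  · exact sepBy_of_dist (by linarith) fun p hp q hq => by
      have := eps_le_dist hn h1 h2 hp hq
      linarith

/-- Errors r on both sides cannot close a gap larger than 2r. Lower and upper bounds may come from
different old values, so that a new value may lie anywhere along an old pipe. -/
theorem SepBy.sep_of_near {g r : ℝ} {Y Z : ℕ → ℝ} {j k j' k' : ℕ} (h : SepBy g Y j k)
    (hr : 2 * r < g)
    (hj : ∀ m', j' ≤ m' → m' ≤ j' + 3 → ∃ m1 m2, j ≤ m1 ∧ m1 ≤ j + 3 ∧ m1 % 3 = m' % 3 ∧
      j ≤ m2 ∧ m2 ≤ j + 3 ∧ m2 % 3 = m' % 3 ∧ Y m1 - r ≤ Z m' ∧ Z m' ≤ Y m2 + r)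
    (hk : ∀ m', k' ≤ m' → m' ≤ k' + 3 → ∃ m1 m2, k ≤ m1 ∧ m1 ≤ k + 3 ∧ m1 % 3 = m' % 3 ∧
      k ≤ m2 ∧ m2 ≤ k + 3 ∧ m2 % 3 = m' % 3 ∧ Y m1 - r ≤ Z m' ∧ Z m' ≤ Y m2 + r) :
    Sep Z j' k' := by
  obtain ⟨a, ha | ha⟩ := h
  · refine ⟨a, Or.inl fun m m' a1 a2 a3 a4 a5 a6 => ?_⟩
    obtain ⟨m1, m2, b1, b2, b3, b4, b5, b6, b7, b8⟩ := hj m a1 a2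
    obtain ⟨l1, l2, c1, c2, c3, c4, c5, c6, c7, c8⟩ := hk m' a3 a4
    have := ha m2 l1 b4 b5 c1 c2 (by omega) (by omega)
    linarith
  · refine ⟨a, Or.inr fun m m' a1 a2 a3 a4 a5 a6 => ?_⟩
    obtain ⟨m1, m2, b1, b2, b3, b4, b5, b6, b7, b8⟩ := hj m a1 a2
    obtain ⟨l1, l2, c1, c2, c3, c4, c5, c6, c7, c8⟩ := hk m' a3 a4
    have := ha m1 l2 b1 b2 c4 c5 (by omega) (by omega)
    linarith

/-! ### Long and short pipes of a plumbers' knot -/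

namespace Gap

variable {n : ℕ} {ε : ℝ} {Y : ℕ → ℝ}

theorem toPSeq (h : Gap n ε Y) : PSeq n Y :=
  ⟨h.zero, h.one, fun m h1 h2 => by
    have := h.cube m h1 h2
    have := h.pos
    constructor <;> linarith⟩

theorem toKSeq (h : Gap n ε Y) : KSeq n Y where
  toPSeq := h.toPSeq
  sep j k h1 h2 := by
    have := h.pos
    obtain ⟨a, ha | ha⟩ := h.gap j k h1 h2
    · refine ⟨a, Or.inl fun m m' a1 a2 a3 a4 a5 a6 => ?_⟩
      linarith [ha m m' a1 a2 a3 a4 a5 a6]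
    · refine ⟨a, Or.inr fun m m' a1 a2 a3 a4 a5 a6 => ?_⟩
      linarith [ha m m' a1 a2 a3 a4 a5 a6]

theorem le (h : Gap n ε Y) : ε ≤ 1 / 20 := by
  have := h.cube 3 le_rfl (by have := h.three_le; omega)
  linarith [this.1, this.2]

theorem nonneg (h : Gap n ε Y) (m : ℕ) : 0 ≤ Y m := by
  rcases lt_or_ge m 3 with h1 | h1
  · rw [h.zero m h1]
  · rcases lt_or_ge m (3 * n) with h2 | h2
    · exact (h.toPSeq.cube m h1 h2).1.le
    · rw [h.one m h2]; norm_num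

theorem le_one (h : Gap n ε Y) (m : ℕ) : Y m ≤ 1 := by
  rcases lt_or_ge m 3 with h1 | h1
  · rw [h.zero m h1]; norm_num
  · rcases lt_or_ge m (3 * n) with h2 | h2
    · exact (h.toPSeq.cube m h1 h2).2.le
    · rw [h.one m h2]

theorem first_long (h : Gap n ε Y) {i : ℕ} (hi : i < 3) : Y i + 10 * ε ≤ Y (i + 3) := by
  have := h.cube (i + 3) (by omega) (by have := h.three_le; omega)
  rw [h.zero i hi]
  linarith

theorem last_long (h : Gap n ε Y) {i : ℕ} (hi : 3 * n ≤ i + 3) (hi' : i < 3 * n) :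
    Y i + 10 * ε ≤ Y (i + 3) := by
  have := h.cube i (by have := h.three_le; omega) hi'
  rw [h.one (i + 3) hi]
  linarith

/-- Among three consecutive pipes one is long. -/
theorem one_long (h : Gap n ε Y) {i : ℕ} (hi : i + 2 < 3 * n) :
    5 * ε ≤ |Y (i + 3) - Y i| ∨ 5 * ε ≤ |Y (i + 4) - Y (i + 1)| ∨
      5 * ε ≤ |Y (i + 5) - Y (i + 2)| := by
  have hε := h.pos
  rcases Nat.eq_zero_or_pos i with rfl | h0
  · left
    have := h.first_long (i := 0) (by norm_num)
    rw [abs_of_nonneg (by linarith)]; linarith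
  rcases Nat.lt_or_ge (i + 3) (3 * n) with h1 | h1
  · obtain ⟨j, rfl⟩ : ∃ j, i = j + 1 := ⟨i - 1, by omega⟩
    -- The pipes immediately before and after the three are distant. Whichever coordinate separates
    -- them, the pipe among the three that runs in its direction must cross the gap.
    obtain ⟨a, ha⟩ := h.gap j (j + 4) le_rfl h1
    have key : ∀ p, j + 1 ≤ p → p ≤ j + 3 → p % 3 = a % 3 → 5 * ε ≤ |Y (p + 3) - Y p| := by
      intro p p1 p2 p3
      rcases ha with ha | ha
      · have := ha p (p + 3) (by omega) p2 (by omega) (by omega) p3 (by omega)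
        exact le_trans (by linarith) (le_abs_self _)
      · have := ha p (p + 3) (by omega) p2 (by omega) (by omega) p3 (by omega)
        exact le_trans (by linarith) (neg_le_abs _)
    have : (j + 1) % 3 = a % 3 ∨ (j + 2) % 3 = a % 3 ∨ (j + 3) % 3 = a % 3 := by omega
    rcases this with h2 | h2 | h2
    · exact Or.inl (key _ (by omega) (by omega) h2)
    · exact Or.inr (Or.inl (key (j + 2) (by omega) (by omega) h2))
    · exact Or.inr (Or.inr (key (j + 3) (by omega) (by omega) h2))
  · right; right
    have := h.last_long (i := i + 2) (by omega) hi
    have : 10 * ε ≤ Y (i + 5) - Y (i + 2) := by linarith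
    rw [abs_of_nonneg (by linarith)]; linarith

/-- If two consecutive pipes are short, then the pipes before and after them are long and run in
the same direction. -/
theorem same_direction (h : Gap n ε Y) {i : ℕ} (hi : i + 2 < 3 * n)
    (h1 : |Y (i + 4) - Y (i + 1)| < 5 * ε) (h2 : |Y (i + 5) - Y (i + 2)| < 5 * ε) :
    (Y i + 5 * ε ≤ Y (i + 3) ∧ Y (i + 3) + 5 * ε ≤ Y (i + 6)) ∨
      (Y (i + 3) + 5 * ε ≤ Y i ∧ Y (i + 6) + 5 * ε ≤ Y (i + 3)) := by
  have hε := h.pos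
  have hi1 : 3 ≤ i + 1 := by
    by_contra hc
    have := h.first_long (i := i + 1) (by omega)
    have : 10 * ε ≤ Y (i + 4) - Y (i + 1) := by linarith
    rw [abs_lt] at h1; linarith
  have hi2 : i + 5 < 3 * n := by
    by_contra hc
    have := h.last_long (i := i + 2) (by omega) hi
    have : 10 * ε ≤ Y (i + 5) - Y (i + 2) := by linarith
    rw [abs_lt] at h2; linarith
  have t1 := h.one_long (i := i) hi
  have t2 := h.one_long (i := i + 1) (by omega)
  have e1 : 5 * ε ≤ |Y (i + 3) - Y i| := by
    rcases t1 with t | t | t <;> linarith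
  have e2 : 5 * ε ≤ |Y (i + 6) - Y (i + 3)| := by
    have e3 : i + 1 + 3 = i + 4 := rfl
    have e4 : i + 1 + 4 = i + 5 := rfl
    have e5 : i + 1 + 5 = i + 6 := rfl
    have e6 : i + 1 + 1 = i + 2 := rfl
    have e7 : i + 1 + 2 = i + 3 := rfl
    rw [e3, e4, e5, e6, e7] at t2
    rcases t2 with t | t | t <;> linarith
  rw [abs_lt] at h1 h2
  obtain ⟨p, rfl⟩ : ∃ p, i = p + 1 := ⟨i - 1, by omega⟩
  -- Two overlapping distant pairs are used, and shortness of the two pipes forces both separations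
  -- into the direction of pipe i = p + 1. The first (`A`) puts the starting value on one side of
  -- the two later ones, the second (`B`) puts the last value on one side of the two earlier ones;
  -- together the three values are monotone.
  obtain ⟨a, ha⟩ := h.gap p (p + 4) le_rfl (by omega)
  obtain ⟨b, hb⟩ := h.gap (p + 1) (p + 5) le_rfl (by omega)
  simp only [add_assoc, Nat.reduceAdd] at *
  have A : (Y (p + 1) + 5 * ε ≤ Y (p + 4) ∧ Y (p + 1) + 5 * ε ≤ Y (p + 7)) ∨
      (Y (p + 4) + 5 * ε ≤ Y (p + 1) ∧ Y (p + 7) + 5 * ε ≤ Y (p + 1)) := by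
    have c : (p + 1) % 3 = a % 3 ∨ (p + 2) % 3 = a % 3 ∨ (p + 3) % 3 = a % 3 := by omega
    rcases ha with ha | ha <;> rcases c with c | c | c
    · left
      exact ⟨ha (p + 1) (p + 4) (by omega) (by omega) (by omega) (by omega) c (by omega),
        ha (p + 1) (p + 7) (by omega) (by omega) (by omega) (by omega) c (by omega)⟩
    · have := ha (p + 2) (p + 5) (by omega) (by omega) (by omega) (by omega) c (by omega)
      linarith
    · have := ha (p + 3) (p + 6) (by omega) (by omega) (by omega) (by omega) c (by omega)
      linarith
    · right
      exact ⟨ha (p + 1) (p + 4) (by omega) (by omega) (by omega) (by omega) c (by omega),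
        ha (p + 1) (p + 7) (by omega) (by omega) (by omega) (by omega) c (by omega)⟩
    · have := ha (p + 2) (p + 5) (by omega) (by omega) (by omega) (by omega) c (by omega)
      linarith
    · have := ha (p + 3) (p + 6) (by omega) (by omega) (by omega) (by omega) c (by omega)
      linarith
  have B : (Y (p + 1) + 5 * ε ≤ Y (p + 7) ∧ Y (p + 4) + 5 * ε ≤ Y (p + 7)) ∨
      (Y (p + 7) + 5 * ε ≤ Y (p + 1) ∧ Y (p + 7) + 5 * ε ≤ Y (p + 4)) := by
    have c : (p + 4) % 3 = b % 3 ∨ (p + 2) % 3 = b % 3 ∨ (p + 3) % 3 = b % 3 := by omega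
    rcases hb with hb | hb <;> rcases c with c | c | c
    · left
      exact ⟨hb (p + 1) (p + 7) (by omega) (by omega) (by omega) (by omega) (by omega) (by omega),
        hb (p + 4) (p + 7) (by omega) (by omega) (by omega) (by omega) (by omega) (by omega)⟩
    · have := hb (p + 2) (p + 5) (by omega) (by omega) (by omega) (by omega) c (by omega)
      linarith
    · have := hb (p + 3) (p + 6) (by omega) (by omega) (by omega) (by omega) c (by omega)
      linarith
    · right
      exact ⟨hb (p + 1) (p + 7) (by omega) (by omega) (by omega) (by omega) (by omega) (by omega),
        hb (p + 4) (p + 7) (by omega) (by omega) (by omega) (by omega) (by omega) (by omega)⟩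
    · have := hb (p + 2) (p + 5) (by omega) (by omega) (by omega) (by omega) c (by omega)
      linarith
    · have := hb (p + 3) (p + 6) (by omega) (by omega) (by omega) (by omega) c (by omega)
      linarith
  rcases A with A | A <;> rcases B with B | B
  · left; exact ⟨A.1, B.2⟩
  · have := A.2; linarith [B.1]
  · linarith [A.2, B.1]
  · right; exact ⟨A.1, B.2⟩

end Gap

/-! ### Insertion of a vertex into a plumbers' knot -/

/-- A pipe takes two values only in its own direction, so at most four inequalities decide whether
two pipes are separated in the direction of p. -/
theorem Sep.of_sign {Z : ℕ → ℝ} {s : ℝ} (hs : s = 1 ∨ s = -1) {j k : ℕ} (p q : ℕ)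
    (hpq : p % 3 = q % 3 ∧ j ≤ p ∧ p < j + 3 ∧ k ≤ q ∧ q < k + 3)
    (h : 0 < s * (Z q - Z p) ∧ (p = j → 0 < s * (Z q - Z (p + 3))) ∧
      (q = k → 0 < s * (Z (q + 3) - Z p)) ∧
      (p = j → q = k → 0 < s * (Z (q + 3) - Z (p + 3)))) : Sep Z j k := by
  obtain ⟨h0, h1, h2, h3, h4⟩ := hpq
  obtain ⟨g1, g2, g3, g4⟩ := h
  have key : ∀ m m', j ≤ m → m ≤ j + 3 → k ≤ m' → m' ≤ k + 3 → m % 3 = p % 3 →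
      m' % 3 = p % 3 → 0 < s * (Z m' - Z m) := by
    intro m m' a1 a2 a3 a4 a5 a6
    have hm : m = p ∨ (p = j ∧ m = p + 3) := by omega
    have hm' : m' = q ∨ (q = k ∧ m' = q + 3) := by omega
    rcases hm with rfl | ⟨e, rfl⟩ <;> rcases hm' with rfl | ⟨e', rfl⟩
    · exact g1
    · exact g3 e'
    · exact g2 e
    · exact g4 e e'
  rcases hs with rfl | rfl
  · refine ⟨p, Or.inl fun m m' a1 a2 a3 a4 a5 a6 => ?_⟩
    linarith [key m m' a1 a2 a3 a4 a5 a6]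
  · refine ⟨p, Or.inr fun m m' a1 a2 a3 a4 a5 a6 => ?_⟩
    linarith [key m m' a1 a2 a3 a4 a5 a6]

theorem long_or_short (x g : ℝ) : |x| < g ∨ ∃ s : ℝ, (s = 1 ∨ s = -1) ∧ g ≤ s * x := by
  rcases lt_or_ge |x| g with h | h
  · exact Or.inl h
  · right
    rcases le_abs.1 h with h | h
    · exact ⟨1, Or.inl rfl, by linarith⟩
    · exact ⟨-1, Or.inr rfl, by linarith⟩

theorem zero_or_sign (x : ℝ) : x = 0 ∨ ∃ s : ℝ, (s = 1 ∨ s = -1) ∧ 0 < s * x := by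
  rcases lt_trichotomy x 0 with h | h | h
  · exact Or.inr ⟨-1, Or.inr rfl, by linarith⟩
  · exact Or.inl h
  · exact Or.inr ⟨1, Or.inl rfl, by linarith⟩

/-- The case split behind the separation of neighbouring new pipes: a pipe of length 2ε still
separates after two perturbations by ε/2, and if neither of two consecutive pipes is that long, the
pipes around them run in one direction. -/
theorem Gap.trichotomy {n : ℕ} {ε : ℝ} {Y : ℕ → ℝ} (h : Gap n ε Y) {i : ℕ} (hi : i + 2 < 3 * n) :
    (∃ s : ℝ, (s = 1 ∨ s = -1) ∧ 2 * ε ≤ s * (Y (i + 4) - Y (i + 1))) ∨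
    (∃ s : ℝ, (s = 1 ∨ s = -1) ∧ 2 * ε ≤ s * (Y (i + 5) - Y (i + 2))) ∨
    (|Y (i + 4) - Y (i + 1)| < 2 * ε ∧ |Y (i + 5) - Y (i + 2)| < 2 * ε ∧
      ∃ s : ℝ, (s = 1 ∨ s = -1) ∧ 5 * ε ≤ s * (Y (i + 3) - Y i) ∧
      5 * ε ≤ s * (Y (i + 6) - Y (i + 3))) := by
  rcases long_or_short (Y (i + 4) - Y (i + 1)) (2 * ε) with h1 | h1
  · rcases long_or_short (Y (i + 5) - Y (i + 2)) (2 * ε) with h2 | h2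
    · refine Or.inr (Or.inr ⟨h1, h2, ?_⟩)
      rcases h.same_direction hi (by linarith [h.pos]) (by linarith [h.pos]) with h | h
      · exact ⟨1, Or.inl rfl, by linarith, by linarith⟩
      · exact ⟨-1, Or.inr rfl, by linarith, by linarith⟩
    · exact Or.inr (Or.inl h2)
  · exact Or.inl h1

theorem sign_mul_bounds {s x r : ℝ} (hs : s = 1 ∨ s = -1) (hx : |x| ≤ r) :
    -r ≤ s * x ∧ s * x ≤ r := by
  rw [abs_le] at hx
  rcases hs with rfl | rfl <;> constructor <;> linarith

/-- The effect of the insertion of a vertex in the `k`-th pipe on the interleaved coordinates: the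
new values `A`, `B`, `C` are inserted at the positions `k + 2`, `k + 3`, `k + 4`, and the value
that moves to position `k + 5` is changed to `D`. -/
structure Inserted (n : ℕ) (ε : ℝ) (Y : ℕ → ℝ) (k : ℕ) (A B C D : ℝ) (Z : ℕ → ℝ) : Prop where
  low : ∀ i, i ≤ k + 1 → Z i = Y i
  eqA : Z (k + 2) = A
  eqB : Z (k + 3) = B
  eqC : Z (k + 4) = C
  eqD : Z (k + 5) = D
  high : ∀ i, k + 3 ≤ i → Z (i + 3) = Y i
  hA : |A - Y (k + 2)| ≤ ε / 2
  hD : |D - Y (k + 2)| ≤ ε / 2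
  hB0 : Y (k + 3) - Y k = 0 → B = Y (k + 3)
  hB : ∀ s : ℝ, (s = 1 ∨ s = -1) → 0 < s * (Y (k + 3) - Y k) →
    0 < s * (B - Y k) ∧ 0 < s * (Y (k + 3) - B)
  hC0 : Y (k + 4) - Y (k + 1) = 0 → C = Y (k + 1)
  hC : ∀ s : ℝ, (s = 1 ∨ s = -1) → 0 < s * (Y (k + 4) - Y (k + 1)) →
    0 ≤ s * (C - Y (k + 1)) ∧ 0 < s * (Y (k + 4) - C) ∧
      (Y (k + 3) - Y k = 0 → 0 < s * (C - Y (k + 1)))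
  hAD : ∀ s : ℝ, (s = 1 ∨ s = -1) → Y (k + 3) - Y k = 0 → 0 < s * (Y (k + 2) - Y (k - 1)) →
    0 < s * (Y (k + 5) - Y (k + 2)) → 0 < s * (D - A)
  -- In either mode the cluster of four new pipes stays within ε of a single old one: of pipe k in
  -- the first mode, of pipe k + 1 in the second. The second mode serves insertions close to the end
  -- of the list.
  mode : |C - Y (k + 1)| ≤ ε / 2 ∨ |B - Y (k + 3)| ≤ ε / 2

set_option linter.unusedSimpArgs false

namespace Inserted

variable {n : ℕ} {ε : ℝ} {Y : ℕ → ℝ} {k : ℕ} {A B C D : ℝ} {Z : ℕ → ℝ}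

/-- This lemma and the following ones settle the pairs of new pipes whose old models are less than
four indices apart, so that the old gaps say nothing about them. The names record the positions of
the two pipes relative to the insertion. -/
theorem sep_three (h : Inserted n ε Y (k + 3) A B C D Z) (g : Gap n ε Y) (hk : k + 3 < 3 * n)
    (hm : |C - Y (k + 4)| ≤ ε / 2) {j : ℕ} (hj : k + 4 ≤ j) (hj' : j ≤ k + 6) : Sep Z k j := by
  have hε := g.pos
  have z0 := h.low k (by omega)
  have z1 := h.low (k + 1) (by omega)
  have z2 := h.low (k + 2) (by omega)
  have z3 := h.low (k + 3) (by omega)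
  have z4 := h.low (k + 4) (by omega)
  have zA := h.eqA
  have zB := h.eqB
  have zC := h.eqC
  have zD := h.eqD
  have zh := h.high (k + 6) (by omega)
  have hA := h.hA
  have hD := h.hD
  have hB := h.hB
  simp only [add_assoc, Nat.reduceAdd] at *
  rcases g.trichotomy (i := k) (by omega) with ⟨s, hs, hl⟩ | ⟨s, hs, hl⟩ | ⟨-, -, s, hs, h1, h2⟩
  · have := sign_mul_bounds hs hm
    rcases (by omega : j = k + 4 ∨ (k + 5 ≤ j)) with rfl | hj2
    · refine Sep.of_sign hs (k + 1) (k + 4) (by omega) ⟨?_, ?_, ?_, ?_⟩ <;> intros <;> (try subst_vars) <;>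
        simp only [add_assoc, Nat.reduceAdd, *] <;> first | omega | linarith
    · refine Sep.of_sign hs (k + 1) (k + 7) (by omega) ⟨?_, ?_, ?_, ?_⟩ <;> intros <;> (try subst_vars) <;>
        simp only [add_assoc, Nat.reduceAdd, *] <;> first | omega | linarith
  · have e1 := sign_mul_bounds hs hA
    have e2 := sign_mul_bounds hs hD
    rcases (by omega : j = k + 6 ∨ j ≤ k + 5) with rfl | hj2
    · refine Sep.of_sign hs (k + 2) (k + 8) (by omega) ⟨?_, ?_, ?_, ?_⟩ <;> intros <;> (try subst_vars) <;>
        simp only [add_assoc, Nat.reduceAdd, *] <;> first | omega | linarith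
    · refine Sep.of_sign hs (k + 2) (k + 5) (by omega) ⟨?_, ?_, ?_, ?_⟩ <;> intros <;> (try subst_vars) <;>
        simp only [add_assoc, Nat.reduceAdd, *] <;> first | omega | linarith
  · have := hB s hs (by linarith)
    refine Sep.of_sign hs k (k + 6) (by omega) ⟨?_, ?_, ?_, ?_⟩ <;> intros <;> (try subst_vars) <;>
      simp only [add_assoc, Nat.reduceAdd, *] <;> first | omega | linarith

/-- If the divided pipe has positive length, the point B strictly inside it separates what comes
before from what comes after, in the direction of that pipe. At length zero this fails, and the
trichotomy takes over together with the strict inequalities for the borrowed steps; the same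
dichotomy recurs below. -/
theorem sep_two (h : Inserted n ε Y (k + 2) A B C D Z) (g : Gap n ε Y) (hk : k + 3 < 3 * n)
    {j : ℕ} (hj : k + 4 ≤ j) (hj' : j ≤ k + 6) : Sep Z k j := by
  have hε := g.pos
  have z0 := h.low k (by omega)
  have z1 := h.low (k + 1) (by omega)
  have z2 := h.low (k + 2) (by omega)
  have z3 := h.low (k + 3) (by omega)
  have zA := h.eqA
  have zB := h.eqB
  have zC := h.eqC
  have zD := h.eqD
  have zh := h.high (k + 5) (by omega)
  have zh' := h.high (k + 6) (by omega)
  have hA := h.hA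
  have hD := h.hD
  have hB := h.hB
  have hB0 := h.hB0
  have hC := h.hC
  simp only [add_assoc, Nat.reduceAdd] at *
  rcases zero_or_sign (Y (k + 5) - Y (k + 2)) with h0 | ⟨s, hs, hl⟩
  · have h5 := hB0 h0
    rcases g.trichotomy (i := k) (by omega) with ⟨s, hs, hl⟩ | ⟨s, hs, hl⟩ | ⟨-, -, s, hs, h1, h2⟩
    · have e1 := sign_mul_bounds hs hA
      have e2 := sign_mul_bounds hs hD
      rcases (by omega : j = k + 4 ∨ (k + 5 ≤ j)) with rfl | hj2
      · refine Sep.of_sign hs (k + 1) (k + 4) (by omega) ⟨?_, ?_, ?_, ?_⟩ <;> intros <;> (try subst_vars) <;>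
          simp only [add_assoc, Nat.reduceAdd, *] <;> first | omega | linarith
      · refine Sep.of_sign hs (k + 1) (k + 7) (by omega) ⟨?_, ?_, ?_, ?_⟩ <;> intros <;> (try subst_vars) <;>
          simp only [add_assoc, Nat.reduceAdd, *] <;> first | omega | linarith
    · rw [h0] at hl; linarith
    · have e1 := hC s hs (by linarith)
      have e2 := e1.2.2 h0
      refine Sep.of_sign hs k (k + 6) (by omega) ⟨?_, ?_, ?_, ?_⟩ <;> intros <;> (try subst_vars) <;>
        simp only [add_assoc, Nat.reduceAdd, *] <;> first | omega | linarith
  · have := hB s hs hl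
    rcases (by omega : j = k + 6 ∨ j ≤ k + 5) with rfl | hj2
    · refine Sep.of_sign hs (k + 2) (k + 8) (by omega) ⟨?_, ?_, ?_, ?_⟩ <;> intros <;> (try subst_vars) <;>
        simp only [add_assoc, Nat.reduceAdd, *] <;> omega
    · refine Sep.of_sign hs (k + 2) (k + 5) (by omega) ⟨?_, ?_, ?_, ?_⟩ <;> intros <;> (try subst_vars) <;>
        simp only [add_assoc, Nat.reduceAdd, *] <;> omega

theorem sep_one (h : Inserted n ε Y (k + 1) A B C D Z) (g : Gap n ε Y) (hk : k + 2 < 3 * n)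
    {j : ℕ} (hj : k + 4 ≤ j) (hj' : j ≤ k + 6) : Sep Z k j := by
  have hε := g.pos
  have z0 := h.low k (by omega)
  have z1 := h.low (k + 1) (by omega)
  have z2 := h.low (k + 2) (by omega)
  have zA := h.eqA
  have zB := h.eqB
  have zC := h.eqC
  have zD := h.eqD
  have zh := h.high (k + 4) (by omega)
  have zh' := h.high (k + 5) (by omega)
  have zh'' := h.high (k + 6) (by omega)
  have hA := h.hA
  have hD := h.hD
  have hB := h.hB
  have hB0 := h.hB0
  have hC := h.hC
  have hC0 := h.hC0
  have hAD := h.hAD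
  simp only [add_assoc, Nat.reduceAdd, Nat.add_sub_cancel] at *
  rcases zero_or_sign (Y (k + 4) - Y (k + 1)) with h0 | ⟨s, hs, hl⟩
  · have h5 := hB0 h0
    rcases g.trichotomy (i := k) (by omega) with ⟨s, hs, hl⟩ | ⟨s, hs, hl⟩ | ⟨-, -, s, hs, h1, h2⟩
    · rw [h0] at hl; linarith
    · have e1 := hC s hs (by linarith)
      have e2 := e1.2.2 h0
      rcases (by omega : j = k + 6 ∨ j ≤ k + 5) with rfl | hj2
      · refine Sep.of_sign hs (k + 2) (k + 8) (by omega) ⟨?_, ?_, ?_, ?_⟩ <;> intros <;> (try subst_vars) <;>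
          simp only [add_assoc, Nat.reduceAdd, *] <;> first | omega | linarith
      · refine Sep.of_sign hs (k + 2) (k + 5) (by omega) ⟨?_, ?_, ?_, ?_⟩ <;> intros <;> (try subst_vars) <;>
          simp only [add_assoc, Nat.reduceAdd, *] <;> first | omega | linarith
    · have e1 := sign_mul_bounds hs hA
      have e2 := sign_mul_bounds hs hD
      have e3 := hAD s hs h0 (by linarith) (by linarith)
      refine Sep.of_sign hs k (k + 6) (by omega) ⟨?_, ?_, ?_, ?_⟩ <;> intros <;> (try subst_vars) <;>
        simp only [add_assoc, Nat.reduceAdd, *] <;> first | omega | linarith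
  · have := hB s hs hl
    rcases (by omega : j = k + 4 ∨ k + 5 ≤ j) with rfl | hj2
    · refine Sep.of_sign hs (k + 1) (k + 4) (by omega) ⟨?_, ?_, ?_, ?_⟩ <;> intros <;> (try subst_vars) <;>
        simp only [add_assoc, Nat.reduceAdd, *] <;> omega
    · refine Sep.of_sign hs (k + 1) (k + 7) (by omega) ⟨?_, ?_, ?_, ?_⟩ <;> intros <;> (try subst_vars) <;>
        simp only [add_assoc, Nat.reduceAdd, *] <;> omega

theorem sep_zero (h : Inserted n ε Y k A B C D Z) (g : Gap n ε Y) (hk : k + 1 < 3 * n)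
    {j : ℕ} (hj : k + 4 ≤ j) (hj' : j ≤ k + 5) : Sep Z k j := by
  have hε := g.pos
  have z0 := h.low k (by omega)
  have z1 := h.low (k + 1) (by omega)
  have zA := h.eqA
  have zB := h.eqB
  have zC := h.eqC
  have zD := h.eqD
  have zh := h.high (k + 3) (by omega)
  have zh' := h.high (k + 4) (by omega)
  have zh'' := h.high (k + 5) (by omega)
  have zh''' := h.high (k + 6) (by omega)
  have zh'''' := h.high (k + 7) (by omega)
  have hA := h.hA
  have hD := h.hD
  have hB := h.hB
  have hB0 := h.hB0
  have hC := h.hC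
  have hC0 := h.hC0
  have hAD := h.hAD
  simp only [add_assoc, Nat.reduceAdd] at *
  rcases zero_or_sign (Y (k + 3) - Y k) with h0 | ⟨s, hs, hl⟩
  · have h5 := hB0 h0
    rcases Nat.eq_zero_or_pos k with rfl | hk0
    · have := g.first_long (i := 0) (by omega)
      linarith
    obtain ⟨i, rfl⟩ : ∃ i, k = i + 1 := ⟨k - 1, by omega⟩
    simp only [add_assoc, Nat.reduceAdd, Nat.add_sub_cancel] at *
    rcases g.trichotomy (i := i) (by omega) with ⟨s, hs, hl⟩ | ⟨s, hs, hl⟩ | ⟨-, -, s, hs, h1, h2⟩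
    · rw [h0] at hl; linarith
    · have e1 := hC s hs (by linarith)
      have e2 := e1.2.2 h0
      rcases (by omega : j = i + 5 ∨ j = i + 6) with rfl | rfl
      · refine Sep.of_sign hs (i + 2) (i + 5) (by omega) ⟨?_, ?_, ?_, ?_⟩ <;> intros <;> (try subst_vars) <;>
          simp only [add_assoc, Nat.reduceAdd, *] <;> first | omega | linarith
      · refine Sep.of_sign hs (i + 2) (i + 8) (by omega) ⟨?_, ?_, ?_, ?_⟩ <;> intros <;> (try subst_vars) <;>
          simp only [add_assoc, Nat.reduceAdd, *] <;> first | omega | linarith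
    · have e1 := sign_mul_bounds hs hA
      have e2 := sign_mul_bounds hs hD
      have e3 := hAD s hs h0 (by linarith) (by linarith)
      refine Sep.of_sign hs (i + 3) (i + 6) (by omega) ⟨?_, ?_, ?_, ?_⟩ <;> intros <;> (try subst_vars) <;>
        simp only [add_assoc, Nat.reduceAdd, *] <;> first | omega | linarith
  · have := hB s hs hl
    refine Sep.of_sign hs k (k + 6) (by omega) ⟨?_, ?_, ?_, ?_⟩ <;> intros <;> (try subst_vars) <;>
      simp only [add_assoc, Nat.reduceAdd, *] <;> omega

theorem sep_zero_six (h : Inserted n ε Y k A B C D Z) (g : Gap n ε Y) (hk : k + 2 < 3 * n) :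
    Sep Z k (k + 6) := by
  have hε := g.pos
  have z0 := h.low k (by omega)
  have z1 := h.low (k + 1) (by omega)
  have zA := h.eqA
  have zB := h.eqB
  have zC := h.eqC
  have zD := h.eqD
  have zh := h.high (k + 3) (by omega)
  have zh' := h.high (k + 4) (by omega)
  have zh'' := h.high (k + 5) (by omega)
  have zh''' := h.high (k + 6) (by omega)
  have zh'''' := h.high (k + 7) (by omega)
  have hA := h.hA
  have hD := h.hD
  have hB := h.hB
  have hB0 := h.hB0
  have hC := h.hC
  have hC0 := h.hC0
  have hAD := h.hAD
  simp only [add_assoc, Nat.reduceAdd] at *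
  rcases g.trichotomy (i := k) (by omega) with ⟨s, hs, hl⟩ | ⟨s, hs, hl⟩ | ⟨-, -, s, hs, h1, h2⟩
  · have := hC s hs (by linarith)
    refine Sep.of_sign hs (k + 1) (k + 7) (by omega) ⟨?_, ?_, ?_, ?_⟩ <;> intros <;> (try subst_vars) <;>
      simp only [add_assoc, Nat.reduceAdd, *] <;> first | omega | linarith
  · have := sign_mul_bounds hs hA
    refine Sep.of_sign hs (k + 2) (k + 8) (by omega) ⟨?_, ?_, ?_, ?_⟩ <;> intros <;> (try subst_vars) <;>
      simp only [add_assoc, Nat.reduceAdd, *] <;> first | omega | linarith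
  · have := hB s hs (by linarith)
    refine Sep.of_sign hs k (k + 6) (by omega) ⟨?_, ?_, ?_, ?_⟩ <;> intros <;> (try subst_vars) <;>
      simp only [add_assoc, Nat.reduceAdd, *] <;> first | omega | linarith

theorem sep_succ_five (h : Inserted n ε Y k A B C D Z) (g : Gap n ε Y) (hk : k + 1 < 3 * n) :
    Sep Z (k + 1) (k + 5) := by
  have hε := g.pos
  have z0 := h.low k (by omega)
  have z1 := h.low (k + 1) (by omega)
  have zA := h.eqA
  have zB := h.eqB
  have zC := h.eqC
  have zD := h.eqD
  have zh := h.high (k + 3) (by omega)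
  have zh' := h.high (k + 4) (by omega)
  have zh'' := h.high (k + 5) (by omega)
  have zh''' := h.high (k + 6) (by omega)
  have zh'''' := h.high (k + 7) (by omega)
  have hA := h.hA
  have hD := h.hD
  have hB := h.hB
  have hB0 := h.hB0
  have hC := h.hC
  have hC0 := h.hC0
  have hAD := h.hAD
  simp only [add_assoc, Nat.reduceAdd] at *
  rcases zero_or_sign (Y (k + 3) - Y k) with h0 | ⟨s, hs, hl⟩
  · have h5 := hB0 h0
    rcases Nat.eq_zero_or_pos k with rfl | hk0
    · have := g.first_long (i := 0) (by omega)
      linarith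
    obtain ⟨i, rfl⟩ : ∃ i, k = i + 1 := ⟨k - 1, by omega⟩
    simp only [add_assoc, Nat.reduceAdd, Nat.add_sub_cancel] at *
    rcases g.trichotomy (i := i) (by omega) with ⟨s, hs, hl⟩ | ⟨s, hs, hl⟩ | ⟨-, -, s, hs, h1, h2⟩
    · rw [h0] at hl; linarith
    · have e1 := hC s hs (by linarith)
      refine Sep.of_sign hs (i + 2) (i + 8) (by omega) ⟨?_, ?_, ?_, ?_⟩ <;> intros <;> (try subst_vars) <;>
        simp only [add_assoc, Nat.reduceAdd, *] <;> first | omega | linarith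
    · have e1 := sign_mul_bounds hs hA
      have e2 := sign_mul_bounds hs hD
      have e3 := hAD s hs h0 (by linarith) (by linarith)
      refine Sep.of_sign hs (i + 3) (i + 6) (by omega) ⟨?_, ?_, ?_, ?_⟩ <;> intros <;> (try subst_vars) <;>
        simp only [add_assoc, Nat.reduceAdd, *] <;> first | omega | linarith
  · have := hB s hs hl
    refine Sep.of_sign hs (k + 3) (k + 6) (by omega) ⟨?_, ?_, ?_, ?_⟩ <;> intros <;> (try subst_vars) <;>
      simp only [add_assoc, Nat.reduceAdd, *] <;> omega

theorem sep_succ_six (h : Inserted n ε Y k A B C D Z) (g : Gap n ε Y) (hk : k + 2 < 3 * n) :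
    Sep Z (k + 1) (k + 6) := by
  have hε := g.pos
  have z0 := h.low k (by omega)
  have z1 := h.low (k + 1) (by omega)
  have zA := h.eqA
  have zB := h.eqB
  have zC := h.eqC
  have zD := h.eqD
  have zh := h.high (k + 3) (by omega)
  have zh' := h.high (k + 4) (by omega)
  have zh'' := h.high (k + 5) (by omega)
  have zh''' := h.high (k + 6) (by omega)
  have zh'''' := h.high (k + 7) (by omega)
  have hA := h.hA
  have hD := h.hD
  have hB := h.hB
  have hB0 := h.hB0
  have hC := h.hC
  have hC0 := h.hC0
  have hAD := h.hAD
  simp only [add_assoc, Nat.reduceAdd] at *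
  rcases g.trichotomy (i := k) (by omega) with ⟨s, hs, hl⟩ | ⟨s, hs, hl⟩ | ⟨-, -, s, hs, h1, h2⟩
  · have := hC s hs (by linarith)
    refine Sep.of_sign hs (k + 1) (k + 7) (by omega) ⟨?_, ?_, ?_, ?_⟩ <;> intros <;> (try subst_vars) <;>
      simp only [add_assoc, Nat.reduceAdd, *] <;> first | omega | linarith
  · have := sign_mul_bounds hs hA
    refine Sep.of_sign hs (k + 2) (k + 8) (by omega) ⟨?_, ?_, ?_, ?_⟩ <;> intros <;> (try subst_vars) <;>
      simp only [add_assoc, Nat.reduceAdd, *] <;> first | omega | linarith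
  · have := hB s hs (by linarith)
    refine Sep.of_sign hs (k + 3) (k + 6) (by omega) ⟨?_, ?_, ?_, ?_⟩ <;> intros <;> (try subst_vars) <;>
      simp only [add_assoc, Nat.reduceAdd, *] <;> first | omega | linarith

/-- Pairs that end at k + 7 need separate treatment only in the second mode, in which the cluster at
pipe k + 1 reaches one index further. -/
theorem sep_succ_seven (h : Inserted n ε Y k A B C D Z) (g : Gap n ε Y) (hk : k + 3 < 3 * n)
    (hm : |B - Y (k + 3)| ≤ ε / 2) :
    Sep Z (k + 1) (k + 7) := by
  have hε := g.pos
  have z0 := h.low k (by omega)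
  have z1 := h.low (k + 1) (by omega)
  have zA := h.eqA
  have zB := h.eqB
  have zC := h.eqC
  have zD := h.eqD
  have zh := h.high (k + 3) (by omega)
  have zh' := h.high (k + 4) (by omega)
  have zh'' := h.high (k + 5) (by omega)
  have zh''' := h.high (k + 6) (by omega)
  have zh'''' := h.high (k + 7) (by omega)
  have hA := h.hA
  have hD := h.hD
  have hB := h.hB
  have hB0 := h.hB0
  have hC := h.hC
  have hC0 := h.hC0
  have hAD := h.hAD
  simp only [add_assoc, Nat.reduceAdd] at *
  rcases g.trichotomy (i := (k + 1)) (by omega) with ⟨s, hs, hl⟩ | ⟨s, hs, hl⟩ | ⟨-, -, s, hs, h1, h2⟩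
  · have := sign_mul_bounds hs hA
    refine Sep.of_sign hs (k + 2) (k + 8) (by omega) ⟨?_, ?_, ?_, ?_⟩ <;> intros <;> (try subst_vars) <;>
      simp only [add_assoc, Nat.reduceAdd, *] <;> first | omega | linarith
  · have := sign_mul_bounds hs hm
    refine Sep.of_sign hs (k + 3) (k + 9) (by omega) ⟨?_, ?_, ?_, ?_⟩ <;> intros <;> (try subst_vars) <;>
      simp only [add_assoc, Nat.reduceAdd, *] <;> first | omega | linarith
  · have := hC s hs (by linarith)
    refine Sep.of_sign hs (k + 1) (k + 7) (by omega) ⟨?_, ?_, ?_, ?_⟩ <;> intros <;> (try subst_vars) <;>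
      simp only [add_assoc, Nat.reduceAdd, *] <;> first | omega | linarith

theorem sep_add_two_six (h : Inserted n ε Y k A B C D Z) (g : Gap n ε Y) (hk : k + 2 < 3 * n) :
    Sep Z (k + 2) (k + 6) := by
  have hε := g.pos
  have z0 := h.low k (by omega)
  have z1 := h.low (k + 1) (by omega)
  have zA := h.eqA
  have zB := h.eqB
  have zC := h.eqC
  have zD := h.eqD
  have zh := h.high (k + 3) (by omega)
  have zh' := h.high (k + 4) (by omega)
  have zh'' := h.high (k + 5) (by omega)
  have zh''' := h.high (k + 6) (by omega)
  have zh'''' := h.high (k + 7) (by omega)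
  have hA := h.hA
  have hD := h.hD
  have hB := h.hB
  have hB0 := h.hB0
  have hC := h.hC
  have hC0 := h.hC0
  have hAD := h.hAD
  simp only [add_assoc, Nat.reduceAdd] at *
  rcases g.trichotomy (i := k) (by omega) with ⟨s, hs, hl⟩ | ⟨s, hs, hl⟩ | ⟨-, -, s, hs, h1, h2⟩
  · have := hC s hs (by linarith)
    refine Sep.of_sign hs (k + 4) (k + 7) (by omega) ⟨?_, ?_, ?_, ?_⟩ <;> intros <;> (try subst_vars) <;>
      simp only [add_assoc, Nat.reduceAdd, *] <;> omega
  · have := sign_mul_bounds hs hA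
    have := sign_mul_bounds hs hD
    refine Sep.of_sign hs (k + 2) (k + 8) (by omega) ⟨?_, ?_, ?_, ?_⟩ <;> intros <;> (try subst_vars) <;>
      simp only [add_assoc, Nat.reduceAdd, *] <;> first | omega | linarith
  · have := hB s hs (by linarith)
    refine Sep.of_sign hs (k + 3) (k + 6) (by omega) ⟨?_, ?_, ?_, ?_⟩ <;> intros <;> (try subst_vars) <;>
      simp only [add_assoc, Nat.reduceAdd, *] <;> first | omega | linarith

theorem sep_add_two_seven (h : Inserted n ε Y k A B C D Z) (g : Gap n ε Y) (hk : k + 3 < 3 * n)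
    (hm : |B - Y (k + 3)| ≤ ε / 2) :
    Sep Z (k + 2) (k + 7) := by
  have hε := g.pos
  have z0 := h.low k (by omega)
  have z1 := h.low (k + 1) (by omega)
  have zA := h.eqA
  have zB := h.eqB
  have zC := h.eqC
  have zD := h.eqD
  have zh := h.high (k + 3) (by omega)
  have zh' := h.high (k + 4) (by omega)
  have zh'' := h.high (k + 5) (by omega)
  have zh''' := h.high (k + 6) (by omega)
  have zh'''' := h.high (k + 7) (by omega)
  have hA := h.hA
  have hD := h.hD
  have hB := h.hB
  have hB0 := h.hB0
  have hC := h.hC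
  have hC0 := h.hC0
  have hAD := h.hAD
  simp only [add_assoc, Nat.reduceAdd] at *
  rcases g.trichotomy (i := (k + 1)) (by omega) with ⟨s, hs, hl⟩ | ⟨s, hs, hl⟩ | ⟨-, -, s, hs, h1, h2⟩
  · have := sign_mul_bounds hs hA
    have := sign_mul_bounds hs hD
    refine Sep.of_sign hs (k + 2) (k + 8) (by omega) ⟨?_, ?_, ?_, ?_⟩ <;> intros <;> (try subst_vars) <;>
      simp only [add_assoc, Nat.reduceAdd, *] <;> first | omega | linarith
  · have := sign_mul_bounds hs hm
    refine Sep.of_sign hs (k + 3) (k + 9) (by omega) ⟨?_, ?_, ?_, ?_⟩ <;> intros <;> (try subst_vars) <;>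
      simp only [add_assoc, Nat.reduceAdd, *] <;> first | omega | linarith
  · have := hC s hs (by linarith)
    refine Sep.of_sign hs (k + 4) (k + 7) (by omega) ⟨?_, ?_, ?_, ?_⟩ <;> intros <;> (try subst_vars) <;>
      simp only [add_assoc, Nat.reduceAdd, *] <;> first | omega | linarith

theorem sep_add_three_seven (h : Inserted n ε Y k A B C D Z) (g : Gap n ε Y) (hk : k + 3 < 3 * n)
    (hm : |B - Y (k + 3)| ≤ ε / 2) :
    Sep Z (k + 3) (k + 7) := by
  have hε := g.pos
  have z0 := h.low k (by omega)
  have z1 := h.low (k + 1) (by omega)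
  have zA := h.eqA
  have zB := h.eqB
  have zC := h.eqC
  have zD := h.eqD
  have zh := h.high (k + 3) (by omega)
  have zh' := h.high (k + 4) (by omega)
  have zh'' := h.high (k + 5) (by omega)
  have zh''' := h.high (k + 6) (by omega)
  have zh'''' := h.high (k + 7) (by omega)
  have hA := h.hA
  have hD := h.hD
  have hB := h.hB
  have hB0 := h.hB0
  have hC := h.hC
  have hC0 := h.hC0
  have hAD := h.hAD
  simp only [add_assoc, Nat.reduceAdd] at *
  rcases g.trichotomy (i := (k + 1)) (by omega) with ⟨s, hs, hl⟩ | ⟨s, hs, hl⟩ | ⟨-, -, s, hs, h1, h2⟩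
  · have := sign_mul_bounds hs hA
    have := sign_mul_bounds hs hD
    refine Sep.of_sign hs (k + 5) (k + 8) (by omega) ⟨?_, ?_, ?_, ?_⟩ <;> intros <;> (try subst_vars) <;>
      simp only [add_assoc, Nat.reduceAdd, *] <;> first | omega | linarith
  · have := sign_mul_bounds hs hm
    refine Sep.of_sign hs (k + 3) (k + 9) (by omega) ⟨?_, ?_, ?_, ?_⟩ <;> intros <;> (try subst_vars) <;>
      simp only [add_assoc, Nat.reduceAdd, *] <;> first | omega | linarith
  · have := hC s hs (by linarith)
    refine Sep.of_sign hs (k + 4) (k + 7) (by omega) ⟨?_, ?_, ?_, ?_⟩ <;> intros <;> (try subst_vars) <;>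
      simp only [add_assoc, Nat.reduceAdd, *] <;> first | omega | linarith

end Inserted

/-- All coordinates of the `i`-th pipe of `Z` lie within `r` of those of the `p`-th pipe of `Y`. -/
def NearPipe (r : ℝ) (Y Z : ℕ → ℝ) (i p : ℕ) : Prop :=
  ∀ m', i ≤ m' → m' ≤ i + 3 → ∃ m1 m2, p ≤ m1 ∧ m1 ≤ p + 3 ∧ m1 % 3 = m' % 3 ∧
      p ≤ m2 ∧ m2 ≤ p + 3 ∧ m2 % 3 = m' % 3 ∧ Y m1 - r ≤ Z m' ∧ Z m' ≤ Y m2 + r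

namespace Inserted

variable {n : ℕ} {ε : ℝ} {Y : ℕ → ℝ} {k : ℕ} {A B C D : ℝ} {Z : ℕ → ℝ}

theorem near_A (h : Inserted n ε Y k A B C D Z) (hε : 0 < ε) :
    Y (k + 2) - ε ≤ Z (k + 2) ∧ Z (k + 2) ≤ Y (k + 2) + ε := by
  have := abs_le.1 h.hA
  rw [h.eqA]; constructor <;> linarith

theorem near_D (h : Inserted n ε Y k A B C D Z) (hε : 0 < ε) :
    Y (k + 2) - ε ≤ Z (k + 5) ∧ Z (k + 5) ≤ Y (k + 2) + ε := by
  have := abs_le.1 h.hD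
  rw [h.eqD]; constructor <;> linarith

theorem near_B (h : Inserted n ε Y k A B C D Z) (hε : 0 < ε) :
    ∃ m1 m2, (m1 = k ∨ m1 = k + 3) ∧ (m2 = k ∨ m2 = k + 3) ∧
      Y m1 - ε ≤ Z (k + 3) ∧ Z (k + 3) ≤ Y m2 + ε := by
  rw [h.eqB]
  rcases zero_or_sign (Y (k + 3) - Y k) with h0 | ⟨s, rfl | rfl, hl⟩
  · rw [h.hB0 h0]
    exact ⟨k + 3, k + 3, Or.inr rfl, Or.inr rfl, by linarith, by linarith⟩
  · have := h.hB 1 (Or.inl rfl) hl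
    exact ⟨k, k + 3, Or.inl rfl, Or.inr rfl, by linarith, by linarith⟩
  · have := h.hB (-1) (Or.inr rfl) hl
    exact ⟨k + 3, k, Or.inr rfl, Or.inl rfl, by linarith, by linarith⟩

theorem near_C (h : Inserted n ε Y k A B C D Z) (hε : 0 < ε) :
    ∃ m1 m2, (m1 = k + 1 ∨ m1 = k + 4) ∧ (m2 = k + 1 ∨ m2 = k + 4) ∧
      Y m1 - ε ≤ Z (k + 4) ∧ Z (k + 4) ≤ Y m2 + ε := by
  rw [h.eqC]
  rcases zero_or_sign (Y (k + 4) - Y (k + 1)) with h0 | ⟨s, rfl | rfl, hl⟩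
  · rw [h.hC0 h0]
    exact ⟨k + 1, k + 1, Or.inl rfl, Or.inl rfl, by linarith, by linarith⟩
  · have := h.hC 1 (Or.inl rfl) hl
    exact ⟨k + 1, k + 4, Or.inl rfl, Or.inr rfl, by linarith, by linarith⟩
  · have := h.hC (-1) (Or.inr rfl) hl
    exact ⟨k + 4, k + 1, Or.inr rfl, Or.inl rfl, by linarith, by linarith⟩

/-- The pipe of `Y` (shifted by three behind the new vertex) near a pipe of `Z` away from the new
vertex. -/
theorem near_away (h : Inserted n ε Y k A B C D Z) (hε : 0 < ε) {i p : ℕ}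
    (hi : (i + 1 ≤ k ∧ p = i) ∨ (k + 5 ≤ i ∧ p + 3 = i)) : NearPipe ε Y Z i p := by
  intro m h1 h2
  rcases hi with ⟨hi, rfl⟩ | ⟨hi, rfl⟩
  · refine ⟨m, m, h1, h2, rfl, h1, h2, rfl, ?_⟩
    rcases (by omega : m ≤ k + 1 ∨ m = k + 2) with hm | rfl
    · rw [h.low m hm]; constructor <;> linarith
    · exact h.near_A hε
  · obtain ⟨m, rfl⟩ : ∃ q, m = q + 3 := ⟨m - 3, by omega⟩
    refine ⟨m, m, by omega, by omega, by omega, by omega, by omega, by omega, ?_⟩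
    rcases (by omega : m = k + 2 ∨ k + 3 ≤ m) with rfl | hm
    · exact h.near_D hε
    · rw [h.high m hm]; constructor <;> linarith

/-- With C close to its old value, the new pipes k, …, k + 3 never leave the vicinity of old pipe k;
behind them the indices are shifted by three. -/
theorem near_pipe_of_C (h : Inserted n ε Y k A B C D Z) (hε : 0 < ε)
    (hm : |C - Y (k + 1)| ≤ ε / 2) (i : ℕ) : ∃ p, NearPipe ε Y Z i p ∧
      ((i ≤ k ∧ p = i) ∨ (k ≤ i ∧ i ≤ k + 3 ∧ p = k) ∨ (k + 4 ≤ i ∧ p + 3 = i)) := by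
  rcases (by omega : i + 1 ≤ k ∨ (k ≤ i ∧ i ≤ k + 3) ∨ i = k + 4 ∨ k + 5 ≤ i)
    with hi | ⟨h1, h2⟩ | rfl | hi
  · exact ⟨i, h.near_away hε (Or.inl ⟨hi, rfl⟩), Or.inl ⟨by omega, rfl⟩⟩
  · refine ⟨k, fun m h3 h4 => ?_, Or.inr (Or.inl ⟨h1, h2, rfl⟩)⟩
    rcases (by omega : m ≤ k + 1 ∨ m = k + 2 ∨ m = k + 3 ∨ m = k + 4 ∨ m = k + 5 ∨ m = k + 6)
      with hm | rfl | rfl | rfl | rfl | rfl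
    · refine ⟨m, m, by omega, by omega, rfl, by omega, by omega, rfl, ?_⟩
      rw [h.low m hm]; constructor <;> linarith
    · exact ⟨k + 2, k + 2, by omega, by omega, rfl, by omega, by omega, rfl, h.near_A hε⟩
    · obtain ⟨m1, m2, e1, e2, e3⟩ := h.near_B hε
      exact ⟨m1, m2, by omega, by omega, by omega, by omega, by omega, by omega, e3⟩
    · refine ⟨k + 1, k + 1, by omega, by omega, by omega, by omega, by omega, by omega, ?_⟩
      have := abs_le.1 hm
      rw [h.eqC]; constructor <;> linarith
    · exact ⟨k + 2, k + 2, by omega, by omega, by omega, by omega, by omega, by omega,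
        h.near_D hε⟩
    · refine ⟨k + 3, k + 3, by omega, by omega, by omega, by omega, by omega, by omega, ?_⟩
      rw [h.high (k + 3) le_rfl]; constructor <;> linarith
  · refine ⟨k + 1, fun m h3 h4 => ?_, Or.inr (Or.inr ⟨by omega, by omega⟩)⟩
    rcases (by omega : m = k + 4 ∨ m = k + 5 ∨ m = k + 6 ∨ m = k + 7) with rfl | rfl | rfl | rfl
    · obtain ⟨m1, m2, e1, e2, e3⟩ := h.near_C hε
      exact ⟨m1, m2, by omega, by omega, by omega, by omega, by omega, by omega, e3⟩
    · exact ⟨k + 2, k + 2, by omega, by omega, by omega, by omega, by omega, by omega,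
        h.near_D hε⟩
    · refine ⟨k + 3, k + 3, by omega, by omega, by omega, by omega, by omega, by omega, ?_⟩
      rw [h.high (k + 3) le_rfl]; constructor <;> linarith
    · refine ⟨k + 4, k + 4, by omega, by omega, by omega, by omega, by omega, by omega, ?_⟩
      rw [h.high (k + 4) (by omega)]; constructor <;> linarith
  · exact ⟨i - 3, h.near_away hε (Or.inr ⟨hi, by omega⟩), Or.inr (Or.inr ⟨by omega, by omega⟩)⟩

theorem near_pipe_of_B (h : Inserted n ε Y k A B C D Z) (hε : 0 < ε)
    (hm : |B - Y (k + 3)| ≤ ε / 2) (i : ℕ) : ∃ p, NearPipe ε Y Z i p ∧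
      ((i ≤ k ∧ p = i) ∨ (k + 1 ≤ i ∧ i ≤ k + 4 ∧ p = k + 1) ∨ (k + 5 ≤ i ∧ p + 3 = i)) := by
  rcases (by omega : i + 1 ≤ k ∨ i = k ∨ (k + 1 ≤ i ∧ i ≤ k + 4) ∨ k + 5 ≤ i)
    with hi | rfl | ⟨h1, h2⟩ | hi
  · exact ⟨i, h.near_away hε (Or.inl ⟨hi, rfl⟩), Or.inl ⟨by omega, rfl⟩⟩
  · refine ⟨i, fun m h3 h4 => ?_, Or.inl ⟨le_rfl, rfl⟩⟩
    rcases (by omega : m ≤ i + 1 ∨ m = i + 2 ∨ m = i + 3) with hm | rfl | rfl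
    · refine ⟨m, m, by omega, by omega, rfl, by omega, by omega, rfl, ?_⟩
      rw [h.low m hm]; constructor <;> linarith
    · exact ⟨i + 2, i + 2, by omega, by omega, rfl, by omega, by omega, rfl, h.near_A hε⟩
    · obtain ⟨m1, m2, e1, e2, e3⟩ := h.near_B hε
      exact ⟨m1, m2, by omega, by omega, by omega, by omega, by omega, by omega, e3⟩
  · refine ⟨k + 1, fun m h3 h4 => ?_, Or.inr (Or.inl ⟨h1, h2, rfl⟩)⟩
    rcases (by omega : m = k + 1 ∨ m = k + 2 ∨ m = k + 3 ∨ m = k + 4 ∨ m = k + 5 ∨ m = k + 6 ∨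
      m = k + 7) with rfl | rfl | rfl | rfl | rfl | rfl | rfl
    · refine ⟨k + 1, k + 1, by omega, by omega, rfl, by omega, by omega, rfl, ?_⟩
      rw [h.low _ le_rfl]; constructor <;> linarith
    · exact ⟨k + 2, k + 2, by omega, by omega, rfl, by omega, by omega, rfl, h.near_A hε⟩
    · refine ⟨k + 3, k + 3, by omega, by omega, by omega, by omega, by omega, by omega, ?_⟩
      have := abs_le.1 hm
      rw [h.eqB]; constructor <;> linarith
    · obtain ⟨m1, m2, e1, e2, e3⟩ := h.near_C hε
      exact ⟨m1, m2, by omega, by omega, by omega, by omega, by omega, by omega, e3⟩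
    · exact ⟨k + 2, k + 2, by omega, by omega, by omega, by omega, by omega, by omega,
        h.near_D hε⟩
    · refine ⟨k + 3, k + 3, by omega, by omega, by omega, by omega, by omega, by omega, ?_⟩
      rw [h.high (k + 3) le_rfl]; constructor <;> linarith
    · refine ⟨k + 4, k + 4, by omega, by omega, by omega, by omega, by omega, by omega, ?_⟩
      rw [h.high (k + 4) (by omega)]; constructor <;> linarith
  · exact ⟨i - 3, h.near_away hε (Or.inr ⟨hi, by omega⟩), Or.inr (Or.inr ⟨by omega, by omega⟩)⟩

/-- Two new pipes whose models are distant inherit an old gap, since 2ε < 5ε. The remaining pairs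
form a finite list around the insertion. -/
theorem kSeq (h : Inserted n ε Y k A B C D Z) (g : Gap n ε Y) (hk : k + 1 < 3 * n)
    (hZ : PSeq (n + 1) Z) : KSeq (n + 1) Z := by
  have hε := g.pos
  refine ⟨hZ, fun i j hij hj => ?_⟩
  have far : ∀ {p q}, NearPipe ε Y Z i p → NearPipe ε Y Z j q → p + 4 ≤ q → q < 3 * n →
      Sep Z i j := fun hp hq h1 h2 => (g.gap _ _ h1 h2).sep_of_near (r := ε) (by linarith) hp hq
  have zero : i = k → j ≤ k + 6 → Sep Z i j := by
    rintro rfl h1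
    rcases (by omega : j ≤ i + 5 ∨ j = i + 6) with h2 | rfl
    · exact h.sep_zero g (by omega) hij h2
    · exact h.sep_zero_six g (by omega)
  have one : i + 1 = k → j ≤ k + 5 → Sep Z i j := by
    rintro rfl h1
    exact h.sep_one g (by omega) hij h1
  have two : i + 2 = k → j ≤ k + 4 → Sep Z i j := by
    rintro rfl h1
    exact h.sep_two g (by omega) hij h1
  have succ : i = k + 1 → j ≤ k + 6 → Sep Z i j := by
    rintro rfl h1
    rcases (by omega : j = k + 5 ∨ j = k + 6) with rfl | rfl
    · exact h.sep_succ_five g (by omega)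
    · exact h.sep_succ_six g (by omega)
  rcases h.mode with hm | hm
  · obtain ⟨p, hp, hp'⟩ := h.near_pipe_of_C hε hm i
    obtain ⟨q, hq, hq'⟩ := h.near_pipe_of_C hε hm j
    by_cases hpq : p + 4 ≤ q
    · exact far hp hq hpq (by omega)
    rcases (by omega : (i + 3 = k ∧ j ≤ k + 3) ∨ (i + 2 = k ∧ j ≤ k + 4) ∨
        (i + 1 = k ∧ j ≤ k + 5) ∨ (i = k ∧ j ≤ k + 6) ∨ (i = k + 1 ∧ j ≤ k + 6) ∨
        (i = k + 2 ∧ j = k + 6))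
      with ⟨rfl, h1⟩ | ⟨h0, h1⟩ | ⟨h0, h1⟩ | ⟨h0, h1⟩ | ⟨h0, h1⟩ | ⟨rfl, rfl⟩
    · exact h.sep_three g (by omega) hm hij h1
    · exact two h0 h1
    · exact one h0 h1
    · exact zero h0 h1
    · exact succ h0 h1
    · exact h.sep_add_two_six g (by omega)
  · obtain ⟨p, hp, hp'⟩ := h.near_pipe_of_B hε hm i
    obtain ⟨q, hq, hq'⟩ := h.near_pipe_of_B hε hm j
    by_cases hpq : p + 4 ≤ q
    · exact far hp hq hpq (by omega)
    rcases (by omega : (i + 2 = k ∧ j ≤ k + 4) ∨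
        (i + 1 = k ∧ j ≤ k + 5) ∨ (i = k ∧ j ≤ k + 6) ∨ (i = k + 1 ∧ j ≤ k + 6) ∨
        (i = k + 1 ∧ j = k + 7) ∨ (i = k + 2 ∧ j = k + 6) ∨ (i = k + 2 ∧ j = k + 7) ∨
        (i = k + 3 ∧ j = k + 7))
      with ⟨h0, h1⟩ | ⟨h0, h1⟩ | ⟨h0, h1⟩ | ⟨h0, h1⟩ | ⟨rfl, rfl⟩ | ⟨rfl, rfl⟩ | ⟨rfl, rfl⟩ |
        ⟨rfl, rfl⟩
    · exact two h0 h1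
    · exact one h0 h1
    · exact zero h0 h1
    · exact succ h0 h1
    · exact h.sep_succ_seven g (by omega) hm
    · exact h.sep_add_two_six g (by omega)
    · exact h.sep_add_two_seven g (by omega) hm
    · exact h.sep_add_three_seven g (by omega) hm

end Inserted

/-! ### The insertion with parameters -/

/-- The interleaved coordinates after the insertion of a vertex in the `k`-th pipe, which divides
this pipe in the ratio `b : 1 - b` and borrows the proportions `a`, `c`, `d` from the pipes `k - 1`,
`k + 1`, `k + 2`. -/
def insertPipe (k : ℕ) (a b c d : ℝ) (Y : ℕ → ℝ) : ℕ → ℝ := fun i =>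
  if i ≤ k + 1 then Y i
  else if i = k + 2 then Y (k + 2) - a * (Y (k + 2) - Y (k - 1))
  else if i = k + 3 then Y k + b * (Y (k + 3) - Y k)
  else if i = k + 4 then Y (k + 1) + c * (Y (k + 4) - Y (k + 1))
  else if i = k + 5 then Y (k + 2) + d * (Y (k + 5) - Y (k + 2))
  else Y (i - 3)

/-- Parameters of insertions that lead to plumbers' knots. -/
structure Admissible (n : ℕ) (ε : ℝ) (Y : ℕ → ℝ) (k : ℕ) (a b c d : ℝ) : Prop where
  lt : k + 1 < 3 * n
  a0 : 0 ≤ a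
  a1 : a ≤ ε / 2
  b0 : 0 < b
  b1 : b < 1
  c0 : 0 ≤ c
  c1 : c < 1
  d0 : 0 ≤ d
  d1 : d ≤ ε / 2
  mode : c ≤ ε / 2 ∨ 1 - ε / 2 ≤ b
  -- A pipe of length zero is not divided by b; only the borrowed steps keep its surroundings apart.
  degenerate : Y (k + 3) - Y k = 0 → 0 < c ∧ 0 < a + d
  -- At the two ends old values are 0 or 1, and these parameters must pull the new vertex off the
  -- boundary of the cube.
  first : k = 0 → 0 < c ∧ 0 < d
  second : k = 1 → 0 < c
  last : k + 2 = 3 * n → 0 < a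

theorem sign_mul_mul_pos {s x t : ℝ} (h : 0 < s * x) (ht : 0 < t) : 0 < s * (t * x) := by
  have := mul_pos ht h
  linarith

theorem Admissible.inserted {n : ℕ} {ε : ℝ} {Y : ℕ → ℝ} {k : ℕ} {a b c d : ℝ}
    (h : Admissible n ε Y k a b c d) (g : Gap n ε Y) :
    Inserted n ε Y k (Y (k + 2) - a * (Y (k + 2) - Y (k - 1))) (Y k + b * (Y (k + 3) - Y k))
      (Y (k + 1) + c * (Y (k + 4) - Y (k + 1))) (Y (k + 2) + d * (Y (k + 5) - Y (k + 2)))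
      (insertPipe k a b c d Y) := by
  have hε := g.pos
  have habs : ∀ i j, |Y i - Y j| ≤ 1 := fun i j => by
    rw [abs_le]
    constructor <;> linarith [g.nonneg i, g.nonneg j, g.le_one i, g.le_one j]
  have hmul : ∀ t i j, 0 ≤ t → t ≤ ε / 2 → |t * (Y i - Y j)| ≤ ε / 2 := fun t i j h0 h1 => by
    rw [abs_mul, abs_of_nonneg h0]
    nlinarith [habs i j, abs_nonneg (Y i - Y j)]
  refine ⟨?_, ?_, ?_, ?_, ?_, ?_, ?_, ?_, ?_, ?_, ?_, ?_, ?_, ?_⟩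
  · intro i hi
    simp [insertPipe, hi]
  · simp [insertPipe]
  · simp [insertPipe]
  · simp [insertPipe]
  · simp [insertPipe]
  · intro i hi
    rcases hi.lt_or_eq with hi | rfl
    · have h1 : ¬ (i + 3 ≤ k + 1) := by omega
      have h2 : i ≠ k := by omega
      have h3 : i + 3 ≠ k + 2 := by omega
      have h4 : i ≠ k + 1 := by omega
      have h5 : i ≠ k + 2 := by omega
      simp [insertPipe, h1, h2, h3, h4, h5]
    · simp [insertPipe]
  · rw [sub_sub_cancel_left, abs_neg]
    exact hmul _ _ _ h.a0 h.a1
  · rw [add_sub_cancel_left]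
    exact hmul _ _ _ h.d0 h.d1
  · intro h0
    rw [h0]
    linarith
  · intro s hs h0
    have h1 := sign_mul_mul_pos h0 h.b0
    have h2 := sign_mul_mul_pos h0 (sub_pos.2 h.b1)
    constructor <;> linarith
  · intro h0
    rw [h0]
    linarith
  · intro s hs h0
    have h2 := sign_mul_mul_pos h0 (sub_pos.2 h.c1)
    have h3 := mul_nonneg h.c0 h0.le
    refine ⟨by linarith, by linarith, fun hd => ?_⟩
    have h1 := sign_mul_mul_pos h0 (h.degenerate hd).1
    linarith
  · intro s hs h0 h1 h2
    have h3 := (h.degenerate h0).2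
    have h4 := mul_nonneg h.a0 h1.le
    have h5 := mul_nonneg h.d0 h2.le
    rcases h.a0.lt_or_eq with h6 | h6
    · have := sign_mul_mul_pos h1 h6
      linarith
    · have := sign_mul_mul_pos h2 (t := d) (by linarith)
      linarith
  · rcases h.mode with hm | hm
    · left
      rw [add_sub_cancel_left]
      exact hmul _ _ _ h.c0 hm
    · right
      have : Y k + b * (Y (k + 3) - Y k) - Y (k + 3) = -((1 - b) * (Y (k + 3) - Y k)) := by ring
      rw [this, abs_neg]
      exact hmul _ _ _ (by linarith [h.b1]) (by linarith)

theorem combination_mem {x y t : ℝ} (hx : 0 ≤ x ∧ x ≤ 1) (hy : 0 ≤ y ∧ y ≤ 1) (ht : 0 ≤ t ∧ t < 1)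
    (h0 : 0 < x ∨ (0 < y ∧ 0 < t)) (h1 : x < 1 ∨ (y < 1 ∧ 0 < t)) :
    0 < x + t * (y - x) ∧ x + t * (y - x) < 1 := by
  obtain ⟨hx0, hx1⟩ := hx
  obtain ⟨hy0, hy1⟩ := hy
  obtain ⟨ht0, ht1⟩ := ht
  constructor
  · rcases h0 with h | ⟨h, h'⟩
    · nlinarith [mul_nonneg ht0 hy0]
    · nlinarith [mul_pos h' h]
  · rcases h1 with h | ⟨h, h'⟩
    · nlinarith [mul_nonneg ht0 (sub_nonneg.2 hy1)]
    · nlinarith [mul_pos h' (sub_pos.2 h)]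

theorem Gap.pos_of {n : ℕ} {ε : ℝ} {Y : ℕ → ℝ} (g : Gap n ε Y) {m : ℕ} (hm : 3 ≤ m) : 0 < Y m := by
  rcases lt_or_ge m (3 * n) with h | h
  · exact (g.toPSeq.cube m hm h).1
  · rw [g.one m h]; norm_num

theorem Gap.lt_one_of {n : ℕ} {ε : ℝ} {Y : ℕ → ℝ} (g : Gap n ε Y) {m : ℕ} (hm : m < 3 * n) :
    Y m < 1 := by
  rcases lt_or_ge m 3 with h | h
  · rw [g.zero m h]; norm_num
  · exact (g.toPSeq.cube m h hm).2

theorem Admissible.pSeq {n : ℕ} {ε : ℝ} {Y : ℕ → ℝ} {k : ℕ} {a b c d : ℝ}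
    (h : Admissible n ε Y k a b c d) (g : Gap n ε Y) : PSeq (n + 1) (insertPipe k a b c d Y) := by
  have H := h.inserted g
  have hn := g.three_le
  have hlt := h.lt
  have hε := g.le
  have u : ∀ m, 0 ≤ Y m ∧ Y m ≤ 1 := fun m => ⟨g.nonneg m, g.le_one m⟩
  refine ⟨fun m hm => ?_, fun m hm => ?_, fun m hm hm' => ?_⟩
  · rcases (by omega : m ≤ k + 1 ∨ (m = k + 2 ∧ k = 0)) with h1 | ⟨rfl, rfl⟩
    · rw [H.low m h1, g.zero m hm]
    · rw [H.eqA, g.zero 2 (by norm_num), g.zero (0 - 1) (by norm_num)]; ring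
  · rcases (by omega : k + 6 ≤ m ∨ (m = k + 5 ∧ 3 * n ≤ k + 2)) with h1 | ⟨rfl, h2⟩
    · obtain ⟨q, rfl⟩ : ∃ q, m = q + 3 := ⟨m - 3, by omega⟩
      rw [H.high q (by omega), g.one q (by omega)]
    · rw [H.eqD, g.one (k + 2) h2, g.one (k + 5) (by omega)]; ring
  · rcases (by omega : m ≤ k + 1 ∨ m = k + 2 ∨ m = k + 3 ∨ m = k + 4 ∨ m = k + 5 ∨ k + 6 ≤ m)
      with h1 | rfl | rfl | rfl | rfl | h1
    · rw [H.low m h1]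
      exact ⟨g.pos_of hm, g.lt_one_of (by omega)⟩
    · rw [H.eqA]
      have := combination_mem (u (k + 2)) (u (k - 1)) (t := a) ⟨h.a0, by linarith [h.a1]⟩
        (Or.inl (g.pos_of hm)) (by
          rcases (by omega : k + 2 < 3 * n ∨ k + 2 = 3 * n) with h1 | h1
          · exact Or.inl (g.lt_one_of h1)
          · exact Or.inr ⟨g.lt_one_of (by omega), h.last h1⟩)
      constructor <;> linarith
    · rw [H.eqB]
      exact combination_mem (u k) (u (k + 3)) (t := b) ⟨h.b0.le, h.b1⟩
        (Or.inr ⟨g.pos_of (by omega), h.b0⟩) (Or.inl (g.lt_one_of (by omega)))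
    · rw [H.eqC]
      refine combination_mem (u (k + 1)) (u (k + 4)) (t := c) ⟨h.c0, h.c1⟩ ?_
        (Or.inl (g.lt_one_of (by omega)))
      rcases (by omega : 3 ≤ k + 1 ∨ k = 0 ∨ k = 1) with h1 | h1 | h1
      · exact Or.inl (g.pos_of h1)
      · exact Or.inr ⟨g.pos_of (by omega), (h.first h1).1⟩
      · exact Or.inr ⟨g.pos_of (by omega), h.second h1⟩
    · rw [H.eqD]
      refine combination_mem (u (k + 2)) (u (k + 5)) (t := d) ⟨h.d0, by linarith [h.d1]⟩ ?_
        (Or.inl (g.lt_one_of (by omega)))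
      rcases (by omega : 3 ≤ k + 2 ∨ k = 0) with h1 | h1
      · exact Or.inl (g.pos_of h1)
      · exact Or.inr ⟨g.pos_of (by omega), (h.first h1).2⟩
    · obtain ⟨q, rfl⟩ : ∃ q, m = q + 3 := ⟨m - 3, by omega⟩
      rw [H.high q (by omega)]
      exact ⟨g.pos_of (by omega), g.lt_one_of (by omega)⟩

theorem Admissible.kSeq {n : ℕ} {ε : ℝ} {Y : ℕ → ℝ} {k : ℕ} {a b c d : ℝ}
    (h : Admissible n ε Y k a b c d) (g : Gap n ε Y) : KSeq (n + 1) (insertPipe k a b c d Y) :=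
  (h.inserted g).kSeq g h.lt (h.pSeq g)

/-! ### The map `iota` -/

set_option linter.unusedSimpArgs false

theorem insertPipe_low {k : ℕ} {a b c d : ℝ} {Y : ℕ → ℝ} {m : ℕ} (h : m ≤ k + 1) :
    insertPipe k a b c d Y m = Y m := by simp [insertPipe, h]

theorem insertPipe_high {k : ℕ} {a b c d : ℝ} {Y : ℕ → ℝ} {m : ℕ} (h : k + 6 ≤ m) :
    insertPipe k a b c d Y m = Y (m - 3) := by
  simp only [insertPipe]
  repeat rw [if_neg (by omega)]

theorem insertPipe_add_two (k : ℕ) (a b c d : ℝ) (Y : ℕ → ℝ) :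
    insertPipe k a b c d Y (k + 2) = Y (k + 2) - a * (Y (k + 2) - Y (k - 1)) := by
  simp [insertPipe]

theorem insertPipe_add_three (k : ℕ) (a b c d : ℝ) (Y : ℕ → ℝ) :
    insertPipe k a b c d Y (k + 3) = Y k + b * (Y (k + 3) - Y k) := by
  simp [insertPipe]

theorem insertPipe_add_four (k : ℕ) (a b c d : ℝ) (Y : ℕ → ℝ) :
    insertPipe k a b c d Y (k + 4) = Y (k + 1) + c * (Y (k + 4) - Y (k + 1)) := by
  simp [insertPipe]

theorem insertPipe_add_five (k : ℕ) (a b c d : ℝ) (Y : ℕ → ℝ) :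
    insertPipe k a b c d Y (k + 5) = Y (k + 2) + d * (Y (k + 5) - Y (k + 2)) := by
  simp [insertPipe]

/-- The three cases of the definition merge into one formula, since the interleaved index 3a + r
absorbs the direction: the pipe is halved, the same proportion is borrowed on both sides, and
nothing from pipe k + 2. -/
theorem val_iota (α : ℕ → ℕ) (n : ℕ) (v : Seq) : val (iota α n v) =
    insertPipe (3 * (α n + 1) + n % 3) (borrow n v (3 * (α n + 1) + n % 3)) (1 / 2)
      (borrow n v (3 * (α n + 1) + n % 3)) 0 (val v) := by
  funext m
  obtain ⟨i, c, rfl⟩ : ∃ (i : ℕ) (c : Fin 3), m = 3 * i + c :=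
    ⟨m / 3, ⟨m % 3, Nat.mod_lt _ (by norm_num)⟩, (Nat.div_add_mod m 3).symm⟩
  rw [val_mul_add]
  have hr : n % 3 = 0 ∨ n % 3 = 1 ∨ n % 3 = 2 := by omega
  simp only [iota]
  generalize α n = p
  generalize borrow n v (3 * (p + 1) + n % 3) = b
  generalize n % 3 = r at hr
  obtain hi | hi : i < p + 1 ∨ p + 1 ≤ i := by omega
  · rw [if_pos hi, insertPipe_low (by omega), val_mul_add]
  rw [if_neg (by omega)]
  obtain hi' | hi' : p + 4 ≤ i ∨ i < p + 4 := by omega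
  · rw [if_neg (by omega), if_neg (by omega), if_neg (by omega), insertPipe_high (by omega),
      ← val_mul_add]
    congr 1; omega
  have hc : ∀ j (c : Fin 3), corner v (3 * p + j) c = val v (3 * p + (3 * ((j + 2 - c) / 3) + c)) :=
    fun j c => corner_apply v (by omega) (by omega) (by omega)
  have vv : ∀ j (c : Fin 3), v j c = val v (3 * j + c) := fun j c => (val_mul_add v j c).symm
  obtain rfl | rfl | rfl : i = p + 1 ∨ i = p + 2 ∨ i = p + 3 := by omega
  all_goals
    rcases hr with rfl | rfl | rfl <;> fin_cases c <;>
    simp only [mul_add, add_assoc, Nat.reduceMul, Nat.reduceAdd, insertPipe] <;>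
    simp [disp_apply, hc, vv, midpoint_eq_smul_add, mul_add, add_assoc, Nat.mul_add_mod] <;> try ring

theorem borrow_nonneg (n : ℕ) (v : Seq) (k : ℕ) : 0 ≤ borrow n v k :=
  div_nonneg (le_max_left _ _) (by norm_num)

theorem borrow_le {n : ℕ} {v : Seq} (h : 0 ≤ eps n v) (k : ℕ) : borrow n v k ≤ eps n v / 2 := by
  have := norm_nonneg (disp v k)
  rw [borrow]
  gcongr
  exact max_le h (by linarith)

theorem borrow_pos {n : ℕ} {v : Seq} {k : ℕ} (h : 0 < eps n v)
    (hk : val v (k + 3) - val v k = 0) : 0 < borrow n v k := by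
  rw [borrow, norm_disp, hk, abs_zero, sub_zero, max_eq_right h.le]
  linarith

theorem continuous_val (m : ℕ) : Continuous fun v : Seq => val v m :=
  (EuclideanSpace.proj _).continuous.comp (continuous_apply _)

theorem continuous_of_val {X : Type*} [TopologicalSpace X] {F : X → Seq}
    (h : ∀ m, Continuous fun x => val (F x) m) : Continuous F := by
  refine continuous_pi fun i => ?_
  have : (fun x => F x i) = fun x => WithLp.toLp 2 fun c : Fin 3 => val (F x) (3 * i + c) := by
    funext x; ext c; exact (val_mul_add (F x) i c).symm
  rw [this]
  exact (PiLp.continuous_toLp 2 _).comp (continuous_pi fun c => h _)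

theorem continuous_iota (α : ℕ → ℕ) {n : ℕ} (hn : 3 ≤ n) : Continuous (iota α n) := by
  refine continuous_of_val fun m => ?_
  have hb : Continuous fun v => borrow n v (3 * (α n + 1) + n % 3) :=
    (continuous_const.max ((continuous_eps hn).sub (continuous_disp _).norm)).div_const _
  have hv := continuous_val
  simp only [val_iota, insertPipe]
  split_ifs
  · exact hv _
  · exact (hv _).sub (hb.mul ((hv _).sub (hv _)))
  · exact (hv _).add (continuous_const.mul ((hv _).sub (hv _)))
  · exact (hv _).add (hb.mul ((hv _).sub (hv _)))
  · exact (hv _).add (continuous_const.mul ((hv _).sub (hv _)))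
  · exact hv _

theorem iota_injective (α : ℕ → ℕ) (n : ℕ) : Function.Injective (iota α n) := by
  intro v w h
  have h := congrArg val h
  rw [val_iota, val_iota] at h
  refine val_injective (funext fun m => ?_)
  generalize 3 * (α n + 1) + n % 3 = k at h
  rcases (by omega : m ≤ k + 1 ∨ m = k + 2 ∨ k + 3 ≤ m) with hm | rfl | hm
  · simpa [insertPipe_low hm] using congrFun h m
  -- The borrowed amount depends on the list, so position k + 2 does not determine this value; but
  -- as d = 0 it survives unchanged at position k + 5.
  · simpa [insertPipe_add_five] using congrFun h (k + 5)
  · simpa [insertPipe_high (show k + 6 ≤ m + 3 by omega)] using congrFun h (m + 3)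

/-! ### Components of direct limits -/

theorem joinedIn_of_line {S : Set Seq} {v w : Seq}
    (h : ∀ t ∈ Icc (0 : ℝ) 1, v + t • (w - v) ∈ S) : JoinedIn S v w := by
  refine JoinedIn.ofLine (f := fun t : ℝ => v + t • (w - v)) (by fun_prop) (by simp) (by simp) ?_
  rintro _ ⟨t, ht, rfl⟩
  exact h t ht

/-- The list `v ∈ S n` represents the component `c` of the direct limit. -/
def Represents (S : ℕ → Set Seq) (g : ℕ → Seq → Seq) (n : ℕ) (v : Seq)
    (c : ZerothHomotopy (Lim S g)) : Prop :=
  ∃ hn hv, comp S g n hn v hv = c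

section Represents

variable {S : ℕ → Set Seq} {g : ℕ → Seq → Seq} {n : ℕ} {v w : Seq}
  {c c' : ZerothHomotopy (Lim S g)}

theorem Represents.unique (h : Represents S g n v c) (h' : Represents S g n v c') : c = c' := by
  obtain ⟨_, _, rfl⟩ := h
  obtain ⟨_, _, rfl⟩ := h'
  rfl

theorem Represents.mem (h : Represents S g n v c) : v ∈ S n := by
  obtain ⟨_, h, _⟩ := h
  exact h

theorem Represents.three_le (h : Represents S g n v c) : 3 ≤ n := by
  obtain ⟨h, _, _⟩ := h
  exact h

theorem exists_represents (hn : 3 ≤ n) (hv : v ∈ S n) : ∃ c, Represents S g n v c :=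
  ⟨_, hn, hv, rfl⟩

theorem exists_rep (c : ZerothHomotopy (Lim S g)) : ∃ n v, Represents S g n v c := by
  induction c using Quotient.inductionOn with
  | h x =>
    induction x using Quot.inductionOn with
    | h x => exact ⟨x.1.1, x.2.1, x.1.2, x.2.2, rfl⟩

theorem continuous_mk_stage (hn : 3 ≤ n) :
    Continuous fun x : S n => (Quot.mk _ (⟨⟨n, hn⟩, x⟩ : Stages S) : Lim S g) :=
  continuous_quot_mk.comp continuous_sigmaMk

theorem Represents.of_joinedIn (h : Represents S g n v c) (hj : JoinedIn (S n) v w) :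
    Represents S g n w c := by
  obtain ⟨hn, hv, rfl⟩ := h
  refine ⟨hn, hj.target_mem, Quotient.sound ?_⟩
  exact ((joinedIn_iff_joined hj.source_mem hj.target_mem).1 hj).symm.map
    (continuous_mk_stage (g := g) hn)

theorem Represents.succ (h : Represents S g n v c) (hg : g n v ∈ S (n + 1)) :
    Represents S g (n + 1) (g n v) c := by
  obtain ⟨hn, hv, rfl⟩ := h
  exact ⟨by omega, hg, congrArg _ (Quot.sound ⟨rfl, rfl⟩).symm⟩

theorem Represents.of_succ (h : Represents S g (n + 1) (g n v) c) (hn : 3 ≤ n) (hv : v ∈ S n) :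
    Represents S g n v c := by
  obtain ⟨_, _, rfl⟩ := h
  exact ⟨hn, hv, congrArg _ (Quot.sound ⟨rfl, rfl⟩)⟩

/-- Functions on the stages that are constant on path components and compatible with the maps of the
system descend to the components of the direct limit. -/
theorem exists_lift {A : Type*} (φ : ℕ → Seq → A)
    (hS : ∀ n, 3 ≤ n → ∀ v ∈ S n, ∀ᶠ w in nhdsWithin v (S n), JoinedIn (S n) v w)
    (hφ : ∀ n, 3 ≤ n → ∀ v w, JoinedIn (S n) v w → φ n v = φ n w)
    (hg : ∀ n, 3 ≤ n → ∀ v ∈ S n, φ (n + 1) (g n v) = φ n v) :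
    ∃ Φ : ZerothHomotopy (Lim S g) → A, ∀ n v c, Represents S g n v c → Φ c = φ n v := by
  let Ψ : Lim S g → A := Quot.lift (fun x : Stages S => φ x.1.1 x.2.1) (by
    rintro ⟨⟨n, hn⟩, v, hv⟩ ⟨⟨m, hm⟩, w, hw⟩ ⟨h1, h2⟩
    simp only at h1 h2 ⊢
    subst h1 h2
    exact (hg n hn v hv).symm)
  -- It is not necessary to know that a path in the limit lies in a stage: the induced function is
  -- locally constant on each stage, hence on the quotient, and so it is constant along every path.
  have hΨ : IsLocallyConstant Ψ := by
    intro s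
    change IsOpen (Quot.mk _ ⁻¹' (Ψ ⁻¹' s))
    rw [isOpen_sigma_iff]
    rintro ⟨n, hn⟩
    rw [isOpen_iff_mem_nhds]
    rintro ⟨v, hv⟩ hvs
    have := hS n hn v hv
    rw [nhdsWithin_eq_map_subtype_coe hv, Filter.eventually_map] at this
    filter_upwards [this] with w hw
    change φ n w.1 ∈ s
    rw [← hφ n hn v w.1 hw]
    exact hvs
  refine ⟨Quotient.lift Ψ fun x y (h : Joined x y) => ?_, ?_⟩
  · obtain ⟨γ⟩ := h
    have := hΨ.apply_eq_of_isPreconnected (isPreconnected_range γ.continuous)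
      (mem_range_self 0) (mem_range_self 1)
    simpa using this
  · rintro n v c ⟨hn, hv, rfl⟩
    rfl

end Represents

/-! ### Paths of plumbers' knots -/

theorem val_line (v w : Seq) (t : ℝ) (m : ℕ) :
    val (v + t • (w - v)) m = val v m + t * (val w m - val v m) := rfl

theorem PSeq.line {n : ℕ} {Y Z : ℕ → ℝ} (hY : PSeq n Y) (hZ : PSeq n Z) {t : ℝ}
    (ht : t ∈ Icc (0 : ℝ) 1) : PSeq n fun m => Y m + t * (Z m - Y m) := by
  refine ⟨fun m hm => ?_, fun m hm => ?_, fun m hm hm' => ?_⟩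
  · simp [hY.zero m hm, hZ.zero m hm]
  · simp [hY.one m hm, hZ.one m hm]
  · have := (convex_Ioo (0 : ℝ) 1).add_smul_sub_mem (hY.cube m hm hm') (hZ.cube m hm hm') ht
    exact this

/-- Displacing every coordinate by at most ε uses up only 2ε of each gap 5ε. In particular nearby
knots are joined by straight segments. -/
theorem Gap.kSeq_of_near {n : ℕ} {ε : ℝ} {Y Z : ℕ → ℝ} (g : Gap n ε Y) (hZ : PSeq n Z)
    (h : ∀ m, |Z m - Y m| ≤ ε) : KSeq n Z := by
  refine ⟨hZ, fun j k h1 h2 => (g.gap j k h1 h2).sep_of_near (r := ε) (by linarith [g.pos]) ?_ ?_⟩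
  all_goals
    intro m h3 h4
    have := abs_le.1 (h m)
    exact ⟨m, m, h3, h4, rfl, h3, h4, rfl, by linarith, by linarith⟩

theorem Gap.joinedIn {n : ℕ} {ε : ℝ} {v w : Seq} (g : Gap n ε (val v)) (hw : PSeq n (val w))
    (h : ∀ m, |val w m - val v m| ≤ ε) : JoinedIn (K n) v w := by
  refine joinedIn_of_line fun t ht => KSeq.mem_K (g.kSeq_of_near (g.toPSeq.line hw ht) fun m => ?_)
  rw [val_line, add_sub_cancel_left, abs_mul, abs_of_nonneg ht.1]
  nlinarith [h m, abs_nonneg (val w m - val v m), ht.1, ht.2]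

theorem eventually_abs_val_sub_lt {n : ℕ} (v : Seq) {r : ℝ} (hr : 0 < r) :
    ∀ᶠ w in nhds v, ∀ m < n, |val w m - val v m| < r := by
  refine (Filter.eventually_all_finite (Set.finite_lt_nat n)).2 ?_
  intro m _
  have := (continuous_val m).tendsto v
  exact (Metric.tendsto_nhds.1 this r hr)

theorem eventually_joinedIn_K (n : ℕ) (hn : 3 ≤ n) (v : Seq) (hv : v ∈ K n) :
    ∀ᶠ w in nhdsWithin v (K n), JoinedIn (K n) v w := by
  have g := gap_of_mem_K hn hv
  have hw : ∀ᶠ w in nhdsWithin v (K n), w ∈ K n := self_mem_nhdsWithin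
  filter_upwards [hw, nhdsWithin_le_nhds (eventually_abs_val_sub_lt (n := 3 * n) v g.pos)]
    with w hw h
  refine g.joinedIn ((mem_P_iff w).1 hw.1) fun m => ?_
  rcases lt_or_ge m (3 * n) with hm | hm
  · exact (h m hm).le
  · rw [((mem_P_iff w).1 hw.1).one m hm, g.one m hm, sub_self, abs_zero]
    exact g.pos.le

/-- For a fixed pipe the new list is affine in the four parameters, so that paths of knots can be
sought among the parameters. -/
theorem ofVal_insertPipe_line (k : ℕ) (a b c d a' b' c' d' t : ℝ) (Y : ℕ → ℝ) :
    ofVal (insertPipe k a b c d Y) +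
        t • (ofVal (insertPipe k a' b' c' d' Y) - ofVal (insertPipe k a b c d Y)) =
      ofVal (insertPipe k (a + t * (a' - a)) (b + t * (b' - b)) (c + t * (c' - c))
        (d + t * (d' - d)) Y) := by
  refine val_injective (funext fun m => ?_)
  rw [val_line]
  simp only [val_ofVal, insertPipe]
  split_ifs <;> ring

namespace Admissible

variable {n k : ℕ} {ε a b c d a' b' c' d' : ℝ} {Y : ℕ → ℝ}

theorem mem_K (h : Admissible n ε Y k a b c d) (g : Gap n ε Y) :
    ofVal (insertPipe k a b c d Y) ∈ K (n + 1) :=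
  KSeq.mem_K (by rw [val_ofVal]; exact h.kSeq g)

/-- Apart from `mode`, which is a disjunction, all conditions are convex; so it suffices that both
ends satisfy the same alternative. -/
theorem line (h : Admissible n ε Y k a b c d) (h' : Admissible n ε Y k a' b' c' d')
    (hm : (c ≤ ε / 2 ∧ c' ≤ ε / 2) ∨ (1 - ε / 2 ≤ b ∧ 1 - ε / 2 ≤ b')) {t : ℝ}
    (ht : t ∈ Icc (0 : ℝ) 1) : Admissible n ε Y k (a + t * (a' - a)) (b + t * (b' - b))
      (c + t * (c' - c)) (d + t * (d' - d)) := by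
  have ge : ∀ {r x y : ℝ}, r ≤ x → r ≤ y → r ≤ x + t * (y - x) := fun {r _ _} hx hy =>
    (convex_Ici r).add_smul_sub_mem (mem_Ici.2 hx) (mem_Ici.2 hy) ht
  have gt : ∀ {r x y : ℝ}, r < x → r < y → r < x + t * (y - x) := fun {r _ _} hx hy =>
    (convex_Ioi r).add_smul_sub_mem (mem_Ioi.2 hx) (mem_Ioi.2 hy) ht
  have le : ∀ {r x y : ℝ}, x ≤ r → y ≤ r → x + t * (y - x) ≤ r := fun {r _ _} hx hy =>
    (convex_Iic r).add_smul_sub_mem (mem_Iic.2 hx) (mem_Iic.2 hy) ht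
  have lt : ∀ {r x y : ℝ}, x < r → y < r → x + t * (y - x) < r := fun {r _ _} hx hy =>
    (convex_Iio r).add_smul_sub_mem (mem_Iio.2 hx) (mem_Iio.2 hy) ht
  refine ⟨h.lt, ge h.a0 h'.a0, le h.a1 h'.a1, gt h.b0 h'.b0, lt h.b1 h'.b1, ge h.c0 h'.c0,
    lt h.c1 h'.c1, ge h.d0 h'.d0, le h.d1 h'.d1, ?_, fun h0 => ⟨?_, ?_⟩, fun h0 => ⟨?_, ?_⟩,
    fun h0 => ?_, fun h0 => ?_⟩
  · exact hm.imp (fun h => le h.1 h.2) fun h => ge h.1 h.2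
  · exact gt (h.degenerate h0).1 (h'.degenerate h0).1
  · have := gt (h.degenerate h0).2 (h'.degenerate h0).2
    linarith
  · exact gt (h.first h0).1 (h'.first h0).1
  · exact gt (h.first h0).2 (h'.first h0).2
  · exact gt (h.second h0) (h'.second h0)
  · exact gt (h.last h0) (h'.last h0)

theorem joinedIn_of_mode (g : Gap n ε Y) (h : Admissible n ε Y k a b c d)
    (h' : Admissible n ε Y k a' b' c' d')
    (hm : (c ≤ ε / 2 ∧ c' ≤ ε / 2) ∨ (1 - ε / 2 ≤ b ∧ 1 - ε / 2 ≤ b')) :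
    JoinedIn (K (n + 1)) (ofVal (insertPipe k a b c d Y)) (ofVal (insertPipe k a' b' c' d' Y)) := by
  refine joinedIn_of_line fun t ht => ?_
  rw [ofVal_insertPipe_line]
  exact (h.line h' hm ht).mem_K g

/-- These parameters satisfy both modes and can therefore serve as a base point for all insertions
in the pipe. -/
theorem standard (g : Gap n ε Y) (hk : k + 1 < 3 * n) :
    Admissible n ε Y k (ε / 2) (1 - ε / 2) (ε / 2) (ε / 2) := by
  have := g.pos
  have := g.le
  refine ⟨hk, by linarith, le_rfl, by linarith, by linarith, by linarith, by linarith,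
    by linarith, le_rfl, Or.inl le_rfl, fun _ => ⟨?_, ?_⟩, fun _ => ⟨?_, ?_⟩, fun _ => ?_,
    fun _ => ?_⟩ <;> linarith

theorem joinedIn_standard (g : Gap n ε Y) (h : Admissible n ε Y k a b c d) :
    JoinedIn (K (n + 1)) (ofVal (insertPipe k a b c d Y))
      (ofVal (insertPipe k (ε / 2) (1 - ε / 2) (ε / 2) (ε / 2) Y)) :=
  h.joinedIn_of_mode g (standard g h.lt)
    (h.mode.imp (fun h => ⟨h, le_rfl⟩) fun h => ⟨h, le_rfl⟩)

/-- Dividing pipe k near its end without borrowing from pipe k - 1 gives the same list as dividing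
pipe k + 1 near its start without borrowing from pipe k + 3. This lets an insertion slide into the
next pipe. -/
theorem joinedIn_standard_succ (g : Gap n ε Y) (hk : k + 2 < 3 * n) :
    JoinedIn (K (n + 1)) (ofVal (insertPipe k (ε / 2) (1 - ε / 2) (ε / 2) (ε / 2) Y))
      (ofVal (insertPipe (k + 1) (ε / 2) (1 - ε / 2) (ε / 2) (ε / 2) Y)) := by
  have h0 := g.pos
  have h1 := g.le
  have h : Admissible n ε Y k 0 (1 - ε / 2) (ε / 2) (ε / 2) := by
    refine ⟨by omega, le_rfl, by linarith, by linarith, by linarith, by linarith, by linarith,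
      by linarith, le_rfl, Or.inl le_rfl, fun _ => ⟨?_, ?_⟩, fun _ => ⟨?_, ?_⟩, fun _ => ?_,
      fun h => by omega⟩ <;> linarith
  have h' : Admissible n ε Y (k + 1) (ε / 2) (ε / 2) (ε / 2) 0 := by
    refine ⟨by omega, by linarith, le_rfl, by linarith, by linarith, by linarith, by linarith,
      le_rfl, by linarith, Or.inl le_rfl, fun _ => ⟨?_, ?_⟩, fun h => by omega, fun _ => ?_,
      fun h => ?_⟩ <;> linarith
  have e : insertPipe k 0 (1 - ε / 2) (ε / 2) (ε / 2) Y =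
      insertPipe (k + 1) (ε / 2) (ε / 2) (ε / 2) 0 Y := by
    funext m
    rcases (by omega : m ≤ k + 1 ∨ m = k + 2 ∨ m = k + 3 ∨ m = k + 4 ∨ m = k + 5 ∨ m = k + 6 ∨
      k + 7 ≤ m) with hm | rfl | rfl | rfl | rfl | rfl | hm
    · rw [insertPipe_low hm, insertPipe_low (by omega)]
    · rw [insertPipe_low (k := k + 1) (by omega), insertPipe_add_two]; ring
    · rw [insertPipe_add_three, insertPipe_add_two (k + 1)]
      simp only [add_assoc, Nat.reduceAdd, Nat.add_sub_cancel]; ring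
    · rw [insertPipe_add_four, insertPipe_add_three (k + 1)]
    · rw [insertPipe_add_five, insertPipe_add_four (k + 1)]
    · rw [insertPipe_high le_rfl, insertPipe_add_five (k + 1)]
      simp
    · rw [insertPipe_high (by omega), insertPipe_high (by omega)]
  refine (h.joinedIn_standard g).symm.trans ?_
  rw [e]
  exact h'.joinedIn_standard g

theorem joinedIn {k' : ℕ} (g : Gap n ε Y) (h : Admissible n ε Y k a b c d)
    (h' : Admissible n ε Y k' a' b' c' d') :
    JoinedIn (K (n + 1)) (ofVal (insertPipe k a b c d Y))
      (ofVal (insertPipe k' a' b' c' d' Y)) := by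
  have key : ∀ i, i + 1 < 3 * n → JoinedIn (K (n + 1))
      (ofVal (insertPipe 0 (ε / 2) (1 - ε / 2) (ε / 2) (ε / 2) Y))
      (ofVal (insertPipe i (ε / 2) (1 - ε / 2) (ε / 2) (ε / 2) Y)) := by
    intro i
    induction i with
    | zero => exact fun hi => JoinedIn.refl ((standard g hi).mem_K g)
    | succ i ih => exact fun hi => (ih (by omega)).trans (joinedIn_standard_succ g hi)
  exact (h.joinedIn_standard g).trans ((key k h.lt).symm.trans ((key k' h'.lt).trans
    (h'.joinedIn_standard g).symm))

end Admissible

/-- As 1 ≤ α(n) + 1 ≤ n - 2, the divided pipe belongs neither to the first nor to the last move and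
the conditions at the ends are void. If it has length zero, the borrowed proportion is positive. -/
theorem admissible_iota {α : ℕ → ℕ} (hα : ∀ n, 3 ≤ n → α n + 3 ≤ n) {n : ℕ} (hn : 3 ≤ n) {v : Seq}
    (hv : v ∈ K n) : Admissible n (eps n v) (val v) (3 * (α n + 1) + n % 3)
      (borrow n v (3 * (α n + 1) + n % 3)) (1 / 2) (borrow n v (3 * (α n + 1) + n % 3)) 0 := by
  have g := gap_of_mem_K hn hv
  have hε := eps_pos hn hv
  have := hα n hn
  have h0 := borrow_nonneg n v (3 * (α n + 1) + n % 3)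
  have h1 := borrow_le hε.le (3 * (α n + 1) + n % 3)
  have hle := g.le
  refine ⟨by omega, h0, h1, by norm_num, by norm_num, h0, by linarith, le_rfl,
    by linarith, Or.inl h1, fun hk => ?_, fun h => by omega, fun h => by omega,
    fun h => by omega⟩
  have := borrow_pos hε hk
  exact ⟨this, by linarith⟩

theorem iota_mem {α : ℕ → ℕ} (hα : ∀ n, 3 ≤ n → α n + 3 ≤ n) {n : ℕ} (hn : 3 ≤ n) {v : Seq}
    (hv : v ∈ K n) : iota α n v ∈ K (n + 1) :=
  KSeq.mem_K (by rw [val_iota]; exact (admissible_iota hα hn hv).kSeq (gap_of_mem_K hn hv))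

/-- All insertions of a vertex lead to the same component of the limit. -/
theorem Represents.insertPipe {α : ℕ → ℕ} (hα : ∀ n, 3 ≤ n → α n + 3 ≤ n) {n : ℕ} {v : Seq}
    {x : ZerothHomotopy (Lim K (iota α))} (hx : Represents K (iota α) n v x) {k : ℕ}
    {a b c d : ℝ} (h : Admissible n (eps n v) (val v) k a b c d) :
    Represents K (iota α) (n + 1) (ofVal (insertPipe k a b c d (val v))) x := by
  have hn := hx.three_le
  refine (hx.succ (iota_mem hα hn hx.mem)).of_joinedIn ?_
  rw [← ofVal_val (iota α n v), val_iota]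
  exact (admissible_iota hα hn hx.mem).joinedIn (gap_of_mem_K hn hx.mem) h

/-! ### Piecewise linear curves -/

section poly

variable {V : Type*} [AddCommGroup V] [Module ℝ V]

/-- The PL map that runs linearly from `w i` to `w (i + 1)` on `[i, i + 1]`. -/
def poly (w : ℕ → V) (u : ℝ) : V :=
  (⌊u⌋₊ + 1 - u) • w ⌊u⌋₊ + (u - ⌊u⌋₊) • w (⌊u⌋₊ + 1)

theorem poly_eq (w : ℕ → V) {u : ℝ} {i : ℕ} (h : i ≤ u) (h' : u ≤ i + 1) :
    poly w u = w i + (u - i) • (w (i + 1) - w i) := by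
  rcases h'.lt_or_eq with h' | rfl
  · rw [poly, (Nat.floor_eq_iff ((Nat.cast_nonneg i).trans h)).2 ⟨h, h'⟩]
    module
  · have : ⌊(i : ℝ) + 1⌋₊ = i + 1 := by exact_mod_cast Nat.floor_natCast (i + 1)
    rw [poly, this]
    push_cast
    module

theorem poly_natCast (w : ℕ → V) (i : ℕ) : poly w i = w i := by
  rw [poly_eq w le_rfl (by linarith)]
  simp

theorem map_poly {V' : Type*} [AddCommGroup V'] [Module ℝ V'] (ℓ : V →ₗ[ℝ] V') (w : ℕ → V)
    (u : ℝ) : ℓ (poly w u) = poly (fun i => ℓ (w i)) u := by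
  simp [poly]

theorem exists_segment {n : ℕ} (hn : 0 < n) {u : ℝ} (h : u ∈ Icc (0 : ℝ) n) :
    ∃ i < n, (i : ℝ) ≤ u ∧ u ≤ i + 1 := by
  rcases h.2.lt_or_eq with h' | rfl
  · exact ⟨⌊u⌋₊, (Nat.floor_lt h.1).2 h', Nat.floor_le h.1, (Nat.lt_floor_add_one u).le⟩
  · refine ⟨n - 1, by omega, ?_, ?_⟩ <;> rw [Nat.cast_sub (by omega)] <;> simp

end poly

theorem injOn_psi_iff {n : ℕ} (hn : 0 < n) (v : Seq) :
    InjOn (psi n v) (Icc 0 3) ↔ InjOn (poly v) (Icc 0 n) := by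
  have hn' : (0 : ℝ) < n := Nat.cast_pos.2 hn
  have e : (fun t : ℝ => n * t / 3) '' Icc 0 3 = Icc 0 (n : ℝ) := by
    ext u
    constructor
    · rintro ⟨t, ⟨h0, h1⟩, rfl⟩
      constructor
      · positivity
      · simp only; rw [div_le_iff₀ (by norm_num)]; nlinarith
    · rintro ⟨h0, h1⟩
      refine ⟨3 * u / n, ⟨by positivity, ?_⟩, by simp only; field_simp⟩
      rw [div_le_iff₀ hn']; linarith
  rw [← e]
  constructor
  · rintro h _ ⟨t, ht, rfl⟩ _ ⟨t', ht', rfl⟩ htt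
    rw [h ht ht' htt]
  · intro h t ht t' ht' htt
    have := h ⟨t, ht, rfl⟩ ⟨t', ht', rfl⟩ htt
    simp only at this
    field_simp at this
    exact this

theorem mem_L_iff {n : ℕ} (hn : 0 < n) (v : Seq) :
    v ∈ L n ↔ v ∈ P n ∧ InjOn (poly v) (Icc 0 n) := by
  rw [← injOn_psi_iff hn]; rfl

/-- A PL function increases strictly if its increments are nonnegative and one of them is
positive. -/
theorem poly_lt_poly {a : ℕ → ℝ} {x y : ℝ} {j k : ℕ} (hxy : x < y) (h1 : (j : ℝ) ≤ x)
    (h2 : x < j + 1) (h3 : (k : ℝ) < y) (h4 : y ≤ k + 1)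
    (h : ∀ i, j ≤ i → i ≤ k → a i ≤ a (i + 1)) (h' : ∃ i, j ≤ i ∧ i ≤ k ∧ a i < a (i + 1)) :
    poly a x < poly a y := by
  rw [poly_eq a h1 h2.le, poly_eq a h3.le h4]
  simp only [smul_eq_mul]
  have hjk : j ≤ k := by
    have : (j : ℝ) < k + 1 := by linarith
    exact Nat.lt_succ_iff.1 (by exact_mod_cast this)
  have mono : ∀ i m, j ≤ i → i + m ≤ k + 1 → a i ≤ a (i + m) := by
    intro i m hi
    induction m with
    | zero => intro _; exact le_rfl
    | succ m ih => intro hm; exact (ih (by omega)).trans (h _ (by omega) (by omega))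
  obtain ⟨i, hi, hi', hs⟩ := h'
  rcases hjk.lt_or_eq with hjk | rfl
  · have e1 : a j + (x - j) * (a (j + 1) - a j) ≤ a (j + 1) := by
      nlinarith [h j le_rfl hjk.le]
    have e2 : a k ≤ a k + (y - k) * (a (k + 1) - a k) := by
      nlinarith [h k hjk.le le_rfl]
    rcases (by omega : i = j ∨ i = k ∨ (j + 1 ≤ i ∧ i + 1 ≤ k)) with rfl | rfl | ⟨h5, h6⟩
    · have := mono (i + 1) (k - (i + 1)) (by omega) (by omega)
      rw [Nat.add_sub_of_le hjk] at this
      nlinarith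
    · have := mono (j + 1) (i - (j + 1)) (by omega) (by omega)
      rw [Nat.add_sub_of_le hjk] at this
      nlinarith
    · have m1 := mono (j + 1) (i - (j + 1)) (by omega) (by omega)
      rw [Nat.add_sub_of_le h5] at m1
      have m2 := mono (i + 1) (k - (i + 1)) (by omega) (by omega)
      rw [Nat.add_sub_of_le h6] at m2
      linarith
  · obtain rfl : i = j := le_antisymm hi' hi
    nlinarith

/-- The edge at x contains x without being finished there, and the edge at y has begun strictly
before y; thus a part of positive length of both edges lies between the two parameters, also if x or
y is an integer. -/
theorem exists_floor_ceil {n : ℕ} {x y : ℝ} (hx : 0 ≤ x) (hxy : x < y) (hy : y ≤ n) :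
    ∃ j k : ℕ, (j : ℝ) ≤ x ∧ x < j + 1 ∧ (k : ℝ) < y ∧ y ≤ k + 1 ∧ j ≤ k ∧ k < n := by
  have h0 : 0 < ⌈y⌉₊ := Nat.ceil_pos.2 (by linarith)
  have h1 : ⌈y⌉₊ ≤ n := Nat.ceil_le.2 hy
  have h2 : ((⌈y⌉₊ - 1 : ℕ) : ℝ) < y := Nat.lt_ceil.1 (by omega)
  have h3 : y ≤ (⌈y⌉₊ - 1 : ℕ) + 1 := by
    have := Nat.le_ceil y
    rwa [Nat.cast_sub h0, Nat.cast_one, sub_add_cancel]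
  refine ⟨⌊x⌋₊, ⌈y⌉₊ - 1, Nat.floor_le hx, Nat.lt_floor_add_one x, h2, h3, ?_, by omega⟩
  have : (⌊x⌋₊ : ℝ) < (⌈y⌉₊ - 1 : ℕ) + 1 := (Nat.floor_le hx).trans_lt (hxy.trans_le h3)
  exact Nat.lt_succ_iff.1 (by exact_mod_cast this)

theorem poly_mem_segment {V : Type*} [AddCommGroup V] [Module ℝ V] (w : ℕ → V) {u : ℝ} {i : ℕ}
    (h : i ≤ u) (h' : u ≤ i + 1) : poly w u ∈ segment ℝ (w i) (w (i + 1)) := by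
  rw [poly_eq w h h', segment_eq_image']
  exact ⟨u - i, ⟨by linarith, by linarith⟩, rfl⟩

/-- A criterion for the injectivity of a PL map. -/
theorem injOn_poly {n : ℕ} {w : Seq}
    (h : ∀ j k, j ≤ k → k < n →
      (∃ ℓ : E3 →ₗ[ℝ] ℝ, (∀ i, j ≤ i → i ≤ k → ℓ (w i) ≤ ℓ (w (i + 1))) ∧
        ∃ i, j ≤ i ∧ i ≤ k ∧ ℓ (w i) < ℓ (w (i + 1))) ∨
      Disjoint (segment ℝ (w j) (w (j + 1))) (segment ℝ (w k) (w (k + 1)))) :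
    InjOn (poly w) (Icc 0 n) := by
  have key : ∀ x y : ℝ, 0 ≤ x → y ≤ n → x < y → poly w x ≠ poly w y := by
    intro x y hx hy hxy heq
    obtain ⟨j, k, h1, h2, h3, h4, hjk, hk⟩ := exists_floor_ceil hx hxy hy
    rcases h j k hjk hk with ⟨ℓ, h5, h6⟩ | hd
    · have := poly_lt_poly hxy h1 h2 h3 h4 h5 h6
      rw [← map_poly, ← map_poly, heq] at this
      exact lt_irrefl _ this
    · exact Set.disjoint_left.1 hd (poly_mem_segment w h1 h2.le)
        (heq ▸ poly_mem_segment w h3.le h4)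
  intro x hx y hy hxy
  rcases lt_trichotomy x y with hlt | rfl | hlt
  · exact (key x y hx.1 hy.2 hlt hxy).elim
  · rfl
  · exact (key y x hy.1 hx.2 hlt hxy.symm).elim

/-! ### Lists of vertices adapted to a curve -/

/-- The coordinates of three-space and their negatives. -/
def coords : Set (E3 →ₗ[ℝ] ℝ) :=
  {ℓ | ∃ (c : Fin 3) (s : ℝ), (s = 1 ∨ s = -1) ∧ ∀ x, ℓ x = s * x c}

/-- Quantitative injectivity of a curve `γ` in the cube: near each point a functional in `C`
increases strictly along `γ`. -/
structure Tame (C : Set (E3 →ₗ[ℝ] ℝ)) (η ρ μ : ℝ) (γ : ℝ → E3) : Prop where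
  zero : γ 0 = 0
  one : γ 1 = ones
  cube : ∀ t ∈ Ioo (0 : ℝ) 1, ∀ c, γ t c ∈ Ioo (0 : ℝ) 1
  chart : ∀ s ∈ Icc (0 : ℝ) 1, ∃ ℓ ∈ C, StrictMonoOn (fun t => ℓ (γ t)) (Icc (s - η) (s + η))
  far : ∀ s ∈ Icc (0 : ℝ) 1, ∀ s' ∈ Icc (0 : ℝ) 1, η / 8 ≤ |s - s'| → ρ < ‖γ s - γ s'‖
  near : ∀ s ∈ Icc (0 : ℝ) 1, ∀ s' ∈ Icc (0 : ℝ) 1, |s - s'| ≤ 4 * μ → ‖γ s - γ s'‖ ≤ ρ / 64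
  pos : 0 < η
  rho_pos : 0 < ρ
  mesh_pos : 0 < μ
  -- Seven sampling steps fit into η/4, so that the window from i - 6 to i + 7 in `Adapted` stays
  -- inside a chart.
  mesh_le : 32 * μ ≤ η

/-- Strictly increasing times `0 = t₀ < … < tₙ = 1` with steps at most `μ`. -/
structure FineTimes (n : ℕ) (μ : ℝ) (t : ℕ → ℝ) : Prop where
  zero : t 0 = 0
  one : ∀ i, n ≤ i → t i = 1
  lt : ∀ i, i < n → t i < t (i + 1)
  step : ∀ i, t (i + 1) ≤ t i + μ

/-- The times `t` with `x` inserted between `t p` and `t (p + 1)`. -/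
def insertTime (p : ℕ) (x : ℝ) (t : ℕ → ℝ) (i : ℕ) : ℝ :=
  if i ≤ p then t i else if i = p + 1 then x else t (i - 1)

/-- The list `w` is close to `γ` at the times `t`, and functionals in `C` that increase along `γ`
do not decrease along `w`. -/
structure WeaklyAdapted (C : Set (E3 →ₗ[ℝ] ℝ)) (r : ℝ) (γ : ℝ → E3) (n : ℕ) (t : ℕ → ℝ)
    (w : Seq) : Prop where
  near : ∀ i ≤ n, ‖w i - γ (t i)‖ ≤ r
  -- The window is wider than the edge because the lists to be treated take their vertices from
  -- neighbouring samples, shifted by an insertion or combined in threes by f.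
  inc : ∀ i < n, ∀ ℓ ∈ C, StrictMonoOn (fun s => ℓ (γ s)) (Icc (t (i - 6)) (t (i + 7))) →
    ℓ (w i) ≤ ℓ (w (i + 1))

/-- The list `w` is close to `γ` at the times `t`, and functionals in `C` that increase along `γ`
increase along `w`. -/
structure Adapted (C : Set (E3 →ₗ[ℝ] ℝ)) (r : ℝ) (γ : ℝ → E3) (n : ℕ) (t : ℕ → ℝ)
    (w : Seq) : Prop where
  near : ∀ i ≤ n, ‖w i - γ (t i)‖ ≤ r
  inc : ∀ i < n, ∀ ℓ ∈ C, StrictMonoOn (fun s => ℓ (γ s)) (Icc (t (i - 6)) (t (i + 7))) →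
    ℓ (w i) < ℓ (w (i + 1))

namespace FineTimes

variable {n : ℕ} {μ : ℝ} {t t' : ℕ → ℝ}

theorem monotone (h : FineTimes n μ t) : Monotone t := by
  refine monotone_nat_of_le_succ fun i => ?_
  rcases lt_or_ge i n with hi | hi
  · exact (h.lt i hi).le
  · rw [h.one i hi, h.one (i + 1) (by omega)]

theorem mem (h : FineTimes n μ t) (i : ℕ) : t i ∈ Icc (0 : ℝ) 1 := by
  constructor
  · rw [← h.zero]; exact h.monotone (Nat.zero_le i)
  · rcases le_total n i with hi | hi
    · rw [h.one i hi]
    · rw [← h.one n le_rfl]; exact h.monotone hi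

theorem add_le (h : FineTimes n μ t) (i m : ℕ) : t (i + m) ≤ t i + m * μ := by
  induction m with
  | zero => simp
  | succ m ih =>
    have := h.step (i + m)
    rw [← add_assoc]
    push_cast
    linarith

theorem le_add_of_le (h : FineTimes n μ t) (hμ : 0 ≤ μ) {i j m : ℕ} (hj : j ≤ i + m) :
    t j ≤ t i + m * μ := by
  rcases le_total j i with hij | hij
  · have := h.monotone hij
    have : 0 ≤ m * μ := by positivity
    linarith
  · exact (h.monotone hj).trans (h.add_le i m)

theorem abs_sub_le (h : FineTimes n μ t) (hμ : 0 ≤ μ) {i j m : ℕ} (hj : j ≤ i + m)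
    (hi : i ≤ j + m) : |t i - t j| ≤ m * μ := by
  have := h.le_add_of_le hμ hj
  have := h.le_add_of_le hμ hi
  rw [abs_le]
  constructor <;> linarith

theorem mem_Ioo (h : FineTimes n μ t) {i : ℕ} (h0 : 0 < i) (hi : i < n) :
    t i ∈ Ioo (0 : ℝ) 1 := by
  constructor
  · have h1 := h.lt 0 (by omega)
    rw [h.zero] at h1
    exact h1.trans_le (h.monotone h0)
  · exact (h.lt i hi).trans_le (h.mem _).2

theorem line (h : FineTimes n μ t) (h' : FineTimes n μ t') {s : ℝ} (hs : s ∈ Icc (0 : ℝ) 1) :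
    FineTimes n μ fun i => t i + s * (t' i - t i) := by
  obtain ⟨h0, h1⟩ := hs
  refine ⟨by simp [h.zero, h'.zero], fun i hi => by simp [h.one i hi, h'.one i hi],
    fun i hi => ?_, fun i => ?_⟩
  · have := h.lt i hi
    have := h'.lt i hi
    rcases h0.eq_or_lt with rfl | h0
    · linarith
    · nlinarith
  · have := h.step i
    have := h'.step i
    nlinarith

theorem uniform (hn : 0 < n) (hμ : 1 / n ≤ μ) : FineTimes n μ fun i => min ((i : ℝ) / n) 1 := by
  have hn' : (0 : ℝ) < n := Nat.cast_pos.2 hn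
  refine ⟨by simp, fun i hi => ?_, fun i hi => ?_, fun i => ?_⟩
  · rw [min_eq_right]
    rw [le_div_iff₀ hn', one_mul]
    exact_mod_cast hi
  · have h1 : ((i : ℝ) + 1) / n ≤ 1 := by
      rw [div_le_one hn']; exact_mod_cast hi
    have h2 : (i : ℝ) / n < (i + 1) / n := by gcongr; linarith
    push_cast
    rw [min_eq_left h1, min_eq_left (by linarith)]
    exact h2
  · push_cast
    rw [add_div, ← min_add_add_right]
    have : 0 < 1 / (n : ℝ) := by positivity
    refine min_le_min ?_ ?_ <;> linarith

theorem insert (h : FineTimes n μ t) {p : ℕ} (hp : p < n) {x : ℝ}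
    (hx : x ∈ Ioo (t p) (t (p + 1))) : FineTimes (n + 1) μ (insertTime p x t) := by
  have h0 := h.step p
  have h1 := h.step (p + 1)
  obtain ⟨hx1, hx2⟩ := hx
  refine ⟨by simp [insertTime, h.zero], fun i hi => ?_, fun i hi => ?_, fun i => ?_⟩
  · rw [insertTime, if_neg (by omega), if_neg (by omega), h.one _ (by omega)]
  · rw [insertTime, insertTime]
    rcases (by omega : i < p ∨ i = p ∨ i = p + 1 ∨ p + 2 ≤ i) with h1 | rfl | rfl | h1
    · rw [if_pos h1.le, if_pos (by omega)]
      exact h.lt i (by omega)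
    · simpa using hx1
    · simpa using hx2
    · obtain ⟨j, rfl⟩ : ∃ j, i = j + 1 := ⟨i - 1, by omega⟩
      rw [if_neg (by omega), if_neg (by omega), if_neg (by omega), if_neg (by omega)]
      exact h.lt j (by omega)
  · rw [insertTime, insertTime]
    rcases (by omega : i < p ∨ i = p ∨ i = p + 1 ∨ p + 2 ≤ i) with h1 | rfl | rfl | h1
    · rw [if_pos h1.le, if_pos (by omega)]
      exact h.step i
    · simp; linarith
    · simp; linarith
    · obtain ⟨j, rfl⟩ : ∃ j, i = j + 1 := ⟨i - 1, by omega⟩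
      rw [if_neg (by omega), if_neg (by omega), if_neg (by omega), if_neg (by omega)]
      exact h.step j

theorem insert_le (h : FineTimes n μ t) {p : ℕ} {x : ℝ} (hx : x ∈ Ioo (t p) (t (p + 1))) (i : ℕ) :
    t (i - 1) ≤ insertTime p x t i ∧ insertTime p x t i ≤ t i := by
  rw [insertTime]
  split_ifs with h1 h2
  · exact ⟨h.monotone (by omega), le_rfl⟩
  · subst h2
    exact ⟨hx.1.le, hx.2.le⟩
  · exact ⟨le_rfl, h.monotone (by omega)⟩

theorem half_mem (h : FineTimes n μ t) {p : ℕ} (hp : p < n) :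
    (t p + t (p + 1)) / 2 ∈ Ioo (t p) (t (p + 1)) := by
  have := h.lt p hp
  constructor <;> linarith

end FineTimes

section Adapted

variable {C : Set (E3 →ₗ[ℝ] ℝ)} {r η ρ μ : ℝ} {γ : ℝ → E3} {n : ℕ} {t : ℕ → ℝ} {w w' : Seq}

theorem FineTimes.adapted (ht : FineTimes n μ t) (hr : 0 ≤ r) :
    Adapted C r γ n t fun i => γ (t i) := by
  refine ⟨fun i _ => by simpa using hr, fun i hi ℓ _ hm => ?_⟩
  exact hm ⟨ht.monotone (by omega), ht.monotone (by omega)⟩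
    ⟨ht.monotone (by omega), ht.monotone (by omega)⟩ (ht.lt i hi)

theorem Tame.mem_P {μ' : ℝ} (h : Tame C η ρ μ γ) (ht : FineTimes n μ' t) : (fun i => γ (t i)) ∈ P n :=
  ⟨by simp only [ht.zero, h.zero], fun i hi => by simp only [ht.one i hi, h.one],
    fun i h0 hi c => h.cube _ (ht.mem_Ioo h0 hi) c⟩

theorem P_line {v w : Seq} (hv : v ∈ P n) (hw : w ∈ P n) {s : ℝ} (hs : s ∈ Icc (0 : ℝ) 1) :
    v + s • (w - v) ∈ P n := by
  rw [mem_P_iff] at *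
  exact hv.line hw hs

/-- Closeness is convex, and a weak inequality becomes strict once a positive share of a strict one
is mixed in. -/
theorem WeaklyAdapted.line (h : WeaklyAdapted C r γ n t w) (h' : Adapted C r γ n t w') {s : ℝ}
    (hs : s ∈ Ioc (0 : ℝ) 1) : Adapted C r γ n t (w + s • (w' - w)) := by
  obtain ⟨h0, h1⟩ := hs
  refine ⟨fun i hi => ?_, fun i hi ℓ hℓ hm => ?_⟩
  · have e : (w + s • (w' - w)) i - γ (t i) =
        (1 - s) • (w i - γ (t i)) + s • (w' i - γ (t i)) := by
      change w i + s • (w' i - w i) - γ (t i) = _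
      module
    have h2 := h.near i hi
    have h3 := h'.near i hi
    rw [e]
    refine (norm_add_le _ _).trans ?_
    rw [norm_smul, norm_smul, Real.norm_of_nonneg h0.le, Real.norm_of_nonneg (by linarith)]
    nlinarith
  · have h2 := h.inc i hi ℓ hℓ hm
    have h3 := h'.inc i hi ℓ hℓ hm
    change ℓ (w i + s • (w' i - w i)) < ℓ (w (i + 1) + s • (w' (i + 1) - w (i + 1)))
    simp only [map_add, map_smul, map_sub, smul_eq_mul]
    nlinarith

/-- A criterion for PL knots: the list `w` follows the curve `γ`. -/
theorem Tame.mem_L (h : Tame C η ρ μ γ) (hn : 0 < n) (hw : w ∈ P n) (t0 : t 0 = 0)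
    (t1 : t n = 1) (hm : ∀ i < n, t i ≤ t (i + 1))
    (near : ∀ i < n, ∀ s ∈ Icc (0 : ℝ) 1,
      ‖w i + s • (w (i + 1) - w i) - γ (t i + s * (t (i + 1) - t i))‖ ≤ ρ / 2)
    (inc : ∀ ℓ ∈ C, ∀ a b : ℝ, a < b → StrictMonoOn (fun s => ℓ (γ s)) (Icc a b) → ∀ i < n,
      t i ≤ b - η / 4 → a + η / 4 ≤ t (i + 1) → ℓ (w i) < ℓ (w (i + 1))) : w ∈ L n := by
  refine (mem_L_iff hn w).2 ⟨hw, ?_⟩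
  have mono : ∀ i j, i ≤ j → j ≤ n → t i ≤ t j := by
    intro i j hij
    induction j, hij using Nat.le_induction with
    | base => exact fun _ => le_rfl
    | succ j _ ih => exact fun hj => (ih (by omega)).trans (hm j (by omega))
  have bd : ∀ {u : ℝ} {i : ℕ}, i < n → (i : ℝ) ≤ u → u ≤ i + 1 →
      t i ≤ poly t u ∧ poly t u ≤ t (i + 1) ∧ ‖poly w u - γ (poly t u)‖ ≤ ρ / 2 := by
    intro u i hi h1 h2
    rw [poly_eq t h1 h2, poly_eq w h1 h2, smul_eq_mul]
    refine ⟨?_, ?_, near i hi _ ⟨by linarith, by linarith⟩⟩ <;> nlinarith [hm i hi]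
  have key : ∀ x y : ℝ, 0 ≤ x → y ≤ n → x < y → poly w x ≠ poly w y := by
    intro x y hx hy hxy heq
    obtain ⟨j, k, h1, h2, h3, h4, hjk, hk⟩ := exists_floor_ceil hx hxy hy
    obtain ⟨b1, b2, b3⟩ := bd (by omega) h1 h2.le
    obtain ⟨c1, c2, c3⟩ := bd hk h3.le h4
    have tm : ∀ i, i ≤ n → t i ∈ Icc (0 : ℝ) 1 := fun i hi =>
      ⟨t0 ▸ mono 0 i (Nat.zero_le _) hi, t1 ▸ mono i n hi le_rfl⟩
    have x0 : poly t x ∈ Icc (0 : ℝ) 1 :=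
      ⟨(tm j (by omega)).1.trans b1, b2.trans (tm (j + 1) (by omega)).2⟩
    have y0 : poly t y ∈ Icc (0 : ℝ) 1 :=
      ⟨(tm k (by omega)).1.trans c1, c2.trans (tm (k + 1) (by omega)).2⟩
    -- The polygon stays within ρ/2 of γ, so a double point at times η/8 apart would contradict
    -- `far`. The two times therefore lie in a common chart, along which all edges in between
    -- increase.
    have hd : |poly t x - poly t y| < η / 8 := by
      by_contra! hc
      have := h.far _ x0 _ y0 hc
      have e : γ (poly t x) - γ (poly t y) =
          (poly w y - γ (poly t y)) - (poly w x - γ (poly t x)) := by rw [heq]; abel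
      rw [e] at this
      linarith [norm_sub_le (poly w y - γ (poly t y)) (poly w x - γ (poly t x))]
    rw [abs_lt] at hd
    obtain ⟨ℓ, hC, hℓ⟩ := h.chart _ x0
    have hη := h.pos
    have hi : ∀ i, j ≤ i → i ≤ k → ℓ (w i) < ℓ (w (i + 1)) := fun i h5 h6 =>
      inc ℓ hC _ _ (by linarith) hℓ i (by omega) (by linarith [mono i k h6 (by omega)])
        (by linarith [mono (j + 1) (i + 1) (by omega) (by omega)])
    have := poly_lt_poly hxy h1 h2 h3 h4 (fun i h5 h6 => (hi i h5 h6).le)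
      ⟨j, le_rfl, hjk, hi j le_rfl hjk⟩
    rw [← map_poly, ← map_poly, heq] at this
    exact lt_irrefl _ this
  intro x hx y hy hxy
  rcases lt_trichotomy x y with hlt | rfl | hlt
  · exact (key x y hx.1 hy.2 hlt hxy).elim
  · rfl
  · exact (key y x hy.1 hx.2 hlt hxy.symm).elim

theorem Tame.norm_sub_le_of_adapted (h : Tame C η ρ μ γ) (ht : FineTimes n μ t)
    {i j : ℕ} (hw : ‖w j - γ (t j)‖ ≤ r) (h1 : i ≤ j + 4) (h2 : j ≤ i + 4) :
    ‖w j - γ (t i)‖ ≤ r + ρ / 64 := by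
  have e : w j - γ (t i) = (w j - γ (t j)) + (γ (t j) - γ (t i)) := by abel
  rw [e]
  refine (norm_add_le _ _).trans (add_le_add hw (h.near _ (ht.mem j) _ (ht.mem i) ?_))
  exact_mod_cast ht.abs_sub_le h.mesh_pos.le h1 h2

theorem Adapted.mem_L (h : Tame C η ρ μ γ) (hn : 0 < n) (hw : w ∈ P n) (ht : FineTimes n μ t)
    (ha : Adapted C (ρ / 8) γ n t w) : w ∈ L n := by
  have hρ := h.rho_pos
  have hμ := h.mesh_pos
  have hle := h.mesh_le
  refine h.mem_L hn hw ht.zero (ht.one n le_rfl) (fun i hi => (ht.lt i hi).le) ?_ ?_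
  · rintro i hi s ⟨hs0, hs1⟩
    have hlt := ht.lt i hi
    have hst := ht.step i
    have e1 := ha.near i hi.le
    have e2 : ‖w (i + 1) - γ (t i)‖ ≤ ρ / 8 + ρ / 64 :=
      h.norm_sub_le_of_adapted ht (ha.near (i + 1) (by omega)) (by omega) (by omega)
    have m0 := ht.mem i
    have m1 := ht.mem (i + 1)
    have e3 : ‖γ (t i) - γ (t i + s * (t (i + 1) - t i))‖ ≤ ρ / 64 := by
      refine h.near _ m0 _ ⟨?_, ?_⟩ ?_
      · nlinarith [m0.1]
      · nlinarith [m1.2]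
      · rw [sub_add_cancel_left, abs_neg, abs_of_nonneg (by nlinarith)]
        nlinarith
    have e : w i + s • (w (i + 1) - w i) - γ (t i + s * (t (i + 1) - t i)) =
        ((1 - s) • (w i - γ (t i)) + s • (w (i + 1) - γ (t i))) +
          (γ (t i) - γ (t i + s * (t (i + 1) - t i))) := by module
    rw [e]
    refine (norm_add_le _ _).trans ?_
    have e4 := norm_add_le ((1 - s) • (w i - γ (t i))) (s • (w (i + 1) - γ (t i)))
    rw [norm_smul, norm_smul, Real.norm_of_nonneg hs0, Real.norm_of_nonneg (by linarith)] at e4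
    nlinarith
  · intro ℓ hC a b _ hm i hi h1 h2
    refine ha.inc i hi ℓ hC (hm.mono (Icc_subset_Icc ?_ ?_))
    · have := ht.le_add_of_le hμ.le (i := i - 6) (j := i + 1) (m := 7) (by omega)
      push_cast at this
      linarith
    · have := ht.add_le i 7
      push_cast at this
      linarith

/-- Pipes of a list close to `γ` that belong to distant times do not meet. -/
theorem Tame.sep_of_far (h : Tame C η ρ μ γ) (ht : FineTimes n μ t)
    (near : ∀ i ≤ n, ‖w i - γ (t i)‖ ≤ ρ / 8) {j k : ℕ} (hjk : j + 4 ≤ k) (hk : k < 3 * n)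
    (hd : η / 8 ≤ |t (j / 3) - t (k / 3)|) : Sep (val w) j k := by
  have hρ := h.rho_pos
  have hfar := h.far _ (ht.mem (j / 3)) _ (ht.mem (k / 3)) hd
  obtain ⟨c, hc⟩ : ∃ c, ρ / 2 < |(γ (t (j / 3)) - γ (t (k / 3))) c| := by
    by_contra! hc
    linarith [norm_le_two_mul hc]
  rw [PiLp.sub_apply] at hc
  have cl : ∀ i m : ℕ, i ≤ m → m ≤ i + 3 → m % 3 = c → i < 3 * n →
      |val w m - γ (t (i / 3)) c| ≤ ρ / 8 + ρ / 64 := by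
    intro i m h1 h2 h3 h4
    have e1 : ‖w (m / 3) - γ (t (i / 3))‖ ≤ ρ / 8 + ρ / 64 :=
      h.norm_sub_le_of_adapted ht (near (m / 3) (by omega)) (by omega) (by omega)
    have e2 := (abs_apply_le_norm _ c).trans e1
    rw [PiLp.sub_apply, ← val_mul_add,
      show 3 * (m / 3) + (c : ℕ) = m by omega] at e2
    exact e2
  have hc' : (c : ℕ) % 3 = c := Nat.mod_eq_of_lt c.2
  rcases lt_abs.1 hc with hc | hc
  · refine ⟨c, Or.inr fun m m' h1 h2 h3 h4 h5 h6 => ?_⟩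
    have e1 := abs_le.1 (cl j m h1 h2 (by omega) (by omega))
    have e2 := abs_le.1 (cl k m' h3 h4 (by omega) (by omega))
    linarith
  · refine ⟨c, Or.inl fun m m' h1 h2 h3 h4 h5 h6 => ?_⟩
    have e1 := abs_le.1 (cl j m h1 h2 (by omega) (by omega))
    have e2 := abs_le.1 (cl k m' h3 h4 (by omega) (by omega))
    linarith

/-- For pipes close in time the chart is a signed coordinate that increases from sample to sample;
two pipes at least four indices apart are then separated by it. Pipes far apart in time are
separated because γ is. This is the point at which charts by coordinates are indispensable. -/
theorem Adapted.mem_K (h : Tame coords η ρ μ γ) (hw : w ∈ P n) (ht : FineTimes n μ t)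
    (ha : Adapted coords (ρ / 8) γ n t w) : w ∈ K n := by
  have hρ := h.rho_pos
  have hμ := h.mesh_pos
  have hle := h.mesh_le
  refine KSeq.mem_K ⟨(mem_P_iff w).1 hw, fun j k hjk hk => ?_⟩
  rcases lt_or_ge |t (j / 3) - t (k / 3)| (η / 8) with hd | hd
  · obtain ⟨ℓ, hℓ, hm⟩ := h.chart _ (ht.mem (j / 3))
    obtain ⟨c, s, hs, hℓc⟩ := id hℓ
    have step : ∀ m, j ≤ m → m ≤ k → m % 3 = c → s * val w m < s * val w (m + 3) := by
      intro m h1 h2 h3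
      rw [abs_lt] at hd
      have := ha.inc (m / 3) (by omega) ℓ hℓ (hm.mono (Icc_subset_Icc ?_ ?_))
      · rw [hℓc, hℓc, ← val_mul_add, ← val_mul_add] at this
        convert this using 3 <;> omega
      · have := ht.le_add_of_le hμ.le (i := m / 3 - 6) (j := j / 3) (m := 7) (by omega)
        push_cast at this
        linarith
      · have := ht.le_add_of_le hμ.le (i := k / 3) (j := m / 3 + 7) (m := 7) (by omega)
        push_cast at this
        linarith
    have mono : ∀ q m, j ≤ m → m + 3 * q ≤ k → m % 3 = c →
        s * val w m < s * val w (m + 3 * q + 3) := by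
      intro q
      induction q with
      | zero => exact fun m h1 h2 h3 => step m h1 (by omega) h3
      | succ q ih =>
        intro m h1 h2 h3
        exact (ih m h1 (by omega) h3).trans (step (m + 3 * q + 3) (by omega) (by omega) (by omega))
    have lt : ∀ m m', j ≤ m → m ≤ j + 3 → k ≤ m' → m' ≤ k + 3 → m % 3 = c → m' % 3 = c →
        s * val w m < s * val w m' := by
      intro m m' h1 h2 h3 h4 h5 h6
      have := mono ((m' - m) / 3 - 1) m h1 (by omega) h5
      rwa [show m + 3 * ((m' - m) / 3 - 1) + 3 = m' by omega] at this
    have hc : (c : ℕ) % 3 = c := Nat.mod_eq_of_lt c.2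
    rcases hs with rfl | rfl
    · exact ⟨c, Or.inl fun m m' h1 h2 h3 h4 h5 h6 => by
        have := lt m m' h1 h2 h3 h4 (by omega) (by omega); linarith⟩
    · exact ⟨c, Or.inr fun m m' h1 h2 h3 h4 h5 h6 => by
        have := lt m m' h1 h2 h3 h4 (by omega) (by omega); linarith⟩
  · exact h.sep_of_far ht ha.near hjk hk hd

end Adapted

/-! ### The component represented by a curve -/

/-- A directed system of spaces of lists that contains the lists adapted to tame curves. -/
structure System (S : ℕ → Set Seq) (g : ℕ → Seq → Seq) (C : Set (E3 →ₗ[ℝ] ℝ)) : Prop where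
  subset : ∀ n, S n ⊆ P n
  map : ∀ n, 3 ≤ n → ∀ v ∈ S n, g n v ∈ S (n + 1)
  mem : ∀ {η ρ μ : ℝ} {γ : ℝ → E3} {n : ℕ} {t : ℕ → ℝ} {w : Seq}, Tame C η ρ μ γ → 3 ≤ n →
    w ∈ P n → FineTimes n μ t → Adapted C (ρ / 8) γ n t w → w ∈ S n
  step : ∀ {η ρ μ : ℝ} {γ : ℝ → E3} {n : ℕ} {t : ℕ → ℝ}, Tame C η ρ μ γ → 3 ≤ n →
    FineTimes n μ t → (fun i => γ (t i)) ∈ S n → ∃ t', FineTimes (n + 1) μ t' ∧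
      WeaklyAdapted C (ρ / 8) γ (n + 1) t' (g n fun i => γ (t i))

section System

variable {S : ℕ → Set Seq} {g : ℕ → Seq → Seq} {C : Set (E3 →ₗ[ℝ] ℝ)} {η ρ μ : ℝ} {γ : ℝ → E3}
  {n : ℕ} {t t' : ℕ → ℝ}

theorem System.curve_mem (h : System S g C) (hγ : Tame C η ρ μ γ) (hn : 3 ≤ n)
    (ht : FineTimes n μ t) : (fun i => γ (t i)) ∈ S n :=
  h.mem hγ hn (hγ.mem_P ht) ht (ht.adapted (by linarith [hγ.rho_pos]))

/-- On the segment every list except `w` itself is adapted to γ, hence belongs to the stage; `w`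
does so by assumption. -/
theorem System.joinedIn (h : System S g C) (hγ : Tame C η ρ μ γ) (hn : 3 ≤ n)
    (ht : FineTimes n μ t) {w : Seq} (hw : w ∈ S n) (ha : WeaklyAdapted C (ρ / 8) γ n t w) :
    JoinedIn (S n) w fun i => γ (t i) := by
  refine joinedIn_of_line fun s hs => ?_
  rcases hs.1.eq_or_lt with rfl | h0
  · simpa using hw
  · exact h.mem hγ hn (P_line (h.subset n hw) (hγ.mem_P ht) hs) ht
      (ha.line (ht.adapted (by linarith [hγ.rho_pos])) ⟨h0, hs.2⟩)

theorem System.joinedIn_times (h : System S g C) (hγ : Tame C η ρ μ γ) (hc : Continuous γ)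
    (hn : 3 ≤ n) (ht : FineTimes n μ t) (ht' : FineTimes n μ t') :
    JoinedIn (S n) (fun i => γ (t i)) fun i => γ (t' i) := by
  refine JoinedIn.ofLine (f := fun s i => γ (t i + s * (t' i - t i))) ?_ ?_ ?_ ?_
  · exact Continuous.continuousOn (by fun_prop)
  · simp
  · simp
  · rintro _ ⟨s, hs, rfl⟩
    exact h.curve_mem hγ hn (ht.line ht' hs)

/-- All lists of points at fine times on a tame curve represent the same component. -/
theorem System.exists_class (h : System S g C) (hγ : Tame C η ρ μ γ) (hc : Continuous γ) :
    ∃ c, ∀ n t, 3 ≤ n → FineTimes n μ t → Represents S g n (fun i => γ (t i)) c := by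
  obtain ⟨N, hN3, hN⟩ : ∃ N : ℕ, 3 ≤ N ∧ 1 / (N : ℝ) ≤ μ := by
    obtain ⟨m, hm⟩ := exists_nat_one_div_lt hγ.mesh_pos
    refine ⟨m + 3, by omega, le_trans ?_ hm.le⟩
    push_cast
    gcongr
    norm_num
  have uni : ∀ n, N ≤ n → FineTimes n μ fun i => min ((i : ℝ) / n) 1 := fun n hn =>
    FineTimes.uniform (by omega) (le_trans (by gcongr) hN)
  -- A map of the system changes the stage but not the component in the limit, so samples of
  -- consecutive lengths can be compared in both directions.
  have up : ∀ {n t t' c}, 3 ≤ n → FineTimes n μ t → FineTimes (n + 1) μ t' →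
      (Represents S g n (fun i => γ (t i)) c ↔ Represents S g (n + 1) (fun i => γ (t' i)) c) := by
    intro n t t' c hn ht ht'
    have hS := h.curve_mem hγ hn ht
    obtain ⟨t'', ht'', hw⟩ := h.step hγ hn ht hS
    have hj := (h.joinedIn hγ (by omega) ht'' (h.map n hn _ hS) hw).trans
      (h.joinedIn_times hγ hc (by omega) ht'' ht')
    exact ⟨fun hr => (hr.succ (h.map n hn _ hS)).of_joinedIn hj,
      fun hr => (hr.of_joinedIn hj.symm).of_succ hn hS⟩
  obtain ⟨c, hcN⟩ := exists_represents (g := g) hN3 (h.curve_mem hγ hN3 (uni N le_rfl))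
  have unic : ∀ n, N ≤ n → Represents S g n (fun i => γ (min ((i : ℝ) / n) 1)) c := by
    intro n hn
    induction n, hn using Nat.le_induction with
    | base => exact hcN
    | succ n hn ih => exact (up (by omega) (uni n hn) (uni (n + 1) (by omega))).1 ih
  -- Fewer than N fine samples cannot be compared with uniform ones of the same length, which may be
  -- too coarse; inserting times raises the length to N first.
  have down : ∀ m n t, 3 ≤ n → FineTimes n μ t → N ≤ n + m →
      Represents S g n (fun i => γ (t i)) c := by
    intro m
    induction m with
    | zero =>
      intro n t hn ht hN
      exact (unic n hN).of_joinedIn (h.joinedIn_times hγ hc hn (uni n hN) ht)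
    | succ m ih =>
      intro n t hn ht hN
      have hi := ht.insert (p := 0) (by omega) (ht.half_mem (by omega))
      exact (up hn ht hi).2 (ih (n + 1) _ (by omega) hi (by omega))
  exact ⟨c, fun n t hn ht => down N n t hn ht (by omega)⟩

end System

/-- Each increment of the new values is a nonnegative combination of neighbouring old increments in
the same direction. -/
theorem insertPipe_le {k m : ℕ} {a b c d : ℝ} {Y : ℕ → ℝ} {s : ℝ} (hk : 0 < k)
    (ha : a ∈ Icc (0 : ℝ) 1)
    (hb : b ∈ Icc (0 : ℝ) 1) (hc : c ∈ Icc (0 : ℝ) 1) (hd : d ∈ Icc (0 : ℝ) 1)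
    (h : ∀ i, m ≤ i + 3 → i ≤ m + 3 → i % 3 = m % 3 → s * Y i ≤ s * Y (i + 3)) :
    s * insertPipe k a b c d Y m ≤ s * insertPipe k a b c d Y (m + 3) := by
  obtain ⟨a0, a1⟩ := ha
  obtain ⟨b0, b1⟩ := hb
  obtain ⟨c0, c1⟩ := hc
  obtain ⟨d0, d1⟩ := hd
  rcases (by omega : m + 3 ≤ k + 1 ∨ m + 1 = k ∨ m = k ∨ m = k + 1 ∨ m = k + 2 ∨ m = k + 3 ∨
    m = k + 4 ∨ m = k + 5 ∨ k + 6 ≤ m) with h1 | rfl | rfl | rfl | rfl | rfl | rfl | rfl | h1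
  · rw [insertPipe_low (by omega), insertPipe_low h1]
    exact h m (by omega) (by omega) rfl
  · rw [insertPipe_low (by omega), show m + 3 = m + 1 + 2 by rfl, insertPipe_add_two]
    have := h m (by omega) (by omega) rfl
    simp only [Nat.add_sub_cancel]
    nlinarith
  · rw [insertPipe_low (by omega), insertPipe_add_three]
    have := h m (by omega) (by omega) rfl
    nlinarith
  · rw [insertPipe_low (by omega), insertPipe_add_four]
    have := h (k + 1) (by omega) (by omega) rfl
    nlinarith
  · rw [insertPipe_add_two, insertPipe_add_five]
    have h1 := h (k + 2) (by omega) (by omega) rfl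
    have h2 := h (k - 1) (by omega) (by omega) (by omega)
    rw [show k - 1 + 3 = k + 2 by omega] at h2
    nlinarith
  · rw [insertPipe_add_three, insertPipe_high (by omega)]
    have := h k (by omega) (by omega) (by omega)
    have e : k + 3 + 3 - 3 = k + 3 := by omega
    rw [e]
    nlinarith
  · rw [insertPipe_add_four, insertPipe_high (by omega)]
    have := h (k + 1) (by omega) (by omega) (by omega)
    have e : k + 4 + 3 - 3 = k + 4 := by omega
    rw [e]
    nlinarith
  · rw [insertPipe_add_five, insertPipe_high (by omega)]
    have := h (k + 2) (by omega) (by omega) (by omega)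
    have e : k + 5 + 3 - 3 = k + 5 := by omega
    rw [e]
    nlinarith
  · rw [insertPipe_high h1, insertPipe_high (by omega)]
    have := h (m - 3) (by omega) (by omega) (by omega)
    rwa [show m + 3 - 3 = m by omega, ← show m - 3 + 3 = m by omega]

/-- Every new value lies between the old value at its position and the one three positions earlier,
hence near γ at the refined times. -/
theorem exists_insertPipe_eq {k : ℕ} {a b c d : ℝ} {Y : ℕ → ℝ} (ha : a ∈ Icc (0 : ℝ) 1)
    (hb : b ∈ Icc (0 : ℝ) 1) (hc : c ∈ Icc (0 : ℝ) 1) (hd : d ∈ Icc (0 : ℝ) 1) (m : ℕ) :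
    ∃ s ∈ Icc (0 : ℝ) 1, insertPipe k a b c d Y m = Y m + s * (Y (m - 3) - Y m) := by
  have h1 : ∀ {x : ℝ}, x ∈ Icc (0 : ℝ) 1 → 1 - x ∈ Icc (0 : ℝ) 1 := fun h =>
    ⟨by linarith [h.2], by linarith [h.1]⟩
  rcases (by omega : m ≤ k + 1 ∨ m = k + 2 ∨ m = k + 3 ∨ m = k + 4 ∨ m = k + 5 ∨ k + 6 ≤ m)
    with hm | rfl | rfl | rfl | rfl | hm
  · exact ⟨0, by simp, by rw [insertPipe_low hm]; ring⟩
  · refine ⟨a, ha, ?_⟩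
    rw [insertPipe_add_two, show k + 2 - 3 = k - 1 by omega]; ring
  · refine ⟨1 - b, h1 hb, ?_⟩
    rw [insertPipe_add_three, show k + 3 - 3 = k by omega]; ring
  · refine ⟨1 - c, h1 hc, ?_⟩
    rw [insertPipe_add_four, show k + 4 - 3 = k + 1 by omega]; ring
  · refine ⟨1 - d, h1 hd, ?_⟩
    rw [insertPipe_add_five, show k + 5 - 3 = k + 2 by omega]; ring
  · exact ⟨1, by simp, by rw [insertPipe_high hm]; ring⟩

theorem Tame.abs_apply_le {C : Set (E3 →ₗ[ℝ] ℝ)} {η ρ μ : ℝ} {γ : ℝ → E3} (h : Tame C η ρ μ γ)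
    {x s : ℝ} (hx : x ∈ Icc (0 : ℝ) 1) (hs : s ∈ Icc (0 : ℝ) 1) (hxs : |x - s| ≤ 4 * μ)
    (c : Fin 3) : |γ x c - γ s c| ≤ ρ / 64 :=
  (abs_apply_le_norm (γ x - γ s) c).trans (h.near x hx s hs hxs)

theorem abs_line_sub_le {x y z r s : ℝ} (hx : |x - z| ≤ r) (hy : |y - z| ≤ r)
    (hs : s ∈ Icc (0 : ℝ) 1) : |x + s * (y - x) - z| ≤ r := by
  obtain ⟨h0, h1⟩ := hs
  rw [abs_le] at *
  constructor <;> nlinarith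

/-- The insertion replaces values by convex combinations of neighbouring samples, so the result
follows γ at the times with the middle of step α(n) + 1 inserted. Borrowed steps may vanish, which
is why the inequalities obtained are only weak. -/
theorem system_K {α : ℕ → ℕ} (hα : ∀ n, 3 ≤ n → α n + 3 ≤ n) : System K (iota α) coords := by
  refine ⟨fun n v hv => hv.1, fun n hn v hv => iota_mem hα hn hv,
    fun hγ _ hw ht ha => ha.mem_K hγ hw ht, ?_⟩
  intro η ρ μ γ n t hγ hn ht hw
  have hαn := hα n hn
  have hμ := hγ.mesh_pos
  have g := gap_of_mem_K hn hw
  have hx := ht.half_mem (p := α n + 1) (by omega)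
  have ht' := ht.insert (by omega) hx
  refine ⟨_, ht', ?_⟩
  have tle := ht.insert_le hx
  generalize insertTime (α n + 1) _ t = t' at ht' tle ⊢
  set w : Seq := fun i => γ (t i) with hwdef
  have hb : borrow n w (3 * (α n + 1) + n % 3) ∈ Icc (0 : ℝ) 1 :=
    ⟨borrow_nonneg _ _ _, (borrow_le g.pos.le _).trans (by linarith [g.le])⟩
  have hval := val_iota α n w
  have hd : ∀ i j, i - 1 ≤ j → j ≤ i → |t j - t' i| ≤ 4 * μ := by
    intro i j h1 h2
    have h3 := tle i
    have h4 := ht.le_add_of_le hμ.le (i := i - 1) (j := i) (m := 1) (by omega)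
    have h5 := ht.monotone h1
    have h6 := ht.monotone h2
    rw [Nat.cast_one] at h4
    rw [abs_le]
    constructor <;> linarith
  constructor
  · intro i hi
    have hcoord : ∀ c, |(iota α n w i - γ (t' i)) c| ≤ ρ / 64 := by
      intro c
      rw [PiLp.sub_apply, ← val_mul_add (iota α n w), hval]
      have e1 : |w i c - γ (t' i) c| ≤ ρ / 64 := by
        refine hγ.abs_apply_le (ht.mem i) (ht'.mem i) ?_ c
        exact hd i i (by omega) le_rfl
      obtain ⟨s, ⟨s0, s1⟩, hs⟩ := exists_insertPipe_eq (k := 3 * (α n + 1) + n % 3) (Y := val w) hb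
        (b := 1 / 2) (by norm_num) hb (d := 0) (by norm_num) (3 * i + c)
      rcases Nat.eq_zero_or_pos i with rfl | h0
      · rw [insertPipe_low (by omega), val_mul_add]
        exact e1
      · have e2 : |w (i - 1) c - γ (t' i) c| ≤ ρ / 64 := by
          refine hγ.abs_apply_le (ht.mem (i - 1)) (ht'.mem i) ?_ c
          exact hd i (i - 1) (by omega) (by omega)
        rw [hs, val_mul_add, show 3 * i + (c : ℕ) - 3 = 3 * (i - 1) + c by omega, val_mul_add]
        exact abs_line_sub_le e1 e2 ⟨s0, s1⟩
    have := norm_le_two_mul hcoord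
    linarith [hγ.rho_pos]
  · rintro i hi ℓ ⟨c, s, hs, hℓ⟩ hm
    rw [hℓ, hℓ, ← val_mul_add, ← val_mul_add, hval,
      show 3 * (i + 1) + (c : ℕ) = 3 * i + c + 3 by omega]
    refine insertPipe_le (by omega) hb (by norm_num) hb (by norm_num) fun m h1 h2 h3 => ?_
    have h4 : t' (i - 6) ≤ t (m / 3) := ((tle (i - 6)).2).trans (ht.monotone (by omega))
    have h5 : t (m / 3 + 1) ≤ t' (i + 7) := (ht.monotone (by omega)).trans ((tle (i + 7)).1)
    have h6 := ht.monotone (Nat.le_succ (m / 3))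
    have := hm.monotoneOn ⟨h4, h6.trans h5⟩ ⟨h4.trans h6, h5⟩ h6
    simp only [hℓ] at this
    change s * w (m / 3) c ≤ s * w (m / 3 + 1) c at this
    rw [← val_mul_add w, ← val_mul_add w] at this
    convert this using 3 <;> omega

theorem insertMid_apply (α : ℕ → ℕ) (n : ℕ) (v : Seq) (i : ℕ) : insertMid α n v i =
    if i ≤ α n then v i
    else if i = α n + 1 then midpoint ℝ (v (α n)) (v (α n + 1)) else v (i - 1) := by
  rw [insertMid]
  split_ifs <;> first | rfl | omega | skip
  next h1 _ => subst h1; rfl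

theorem weaklyAdapted_insertMid {α : ℕ → ℕ} {C : Set (E3 →ₗ[ℝ] ℝ)} {η ρ μ : ℝ} {γ : ℝ → E3}
    (hγ : Tame C η ρ μ γ) {n : ℕ} (hn : α n < n) {t : ℕ → ℝ} (ht : FineTimes n μ t) :
    ∃ t', FineTimes (n + 1) μ t' ∧
      WeaklyAdapted C (ρ / 8) γ (n + 1) t' (insertMid α n fun i => γ (t i)) := by
  have hμ := hγ.mesh_pos
  have hρ := hγ.rho_pos
  have hx := ht.half_mem hn
  have ht' := ht.insert hn hx
  refine ⟨_, ht', ?_⟩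
  have tle := ht.insert_le hx
  constructor
  · intro i hi
    rw [insertMid_apply]
    simp only [insertTime]
    split_ifs with h1 h2
    · rw [sub_self, norm_zero]; linarith
    · have m0 := ht.mem (α n)
      have m1 := ht.mem (α n + 1)
      have hl := ht.lt _ hn
      have hs := ht.step (α n)
      have mm : (t (α n) + t (α n + 1)) / 2 ∈ Icc (0 : ℝ) 1 :=
        ⟨by linarith [m0.1, m1.1], by linarith [m0.2, m1.2]⟩
      have e1 := hγ.near _ m0 _ mm (by rw [abs_le]; constructor <;> linarith)
      have e2 := hγ.near _ m1 _ mm (by rw [abs_le]; constructor <;> linarith)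
      have e : midpoint ℝ (γ (t (α n))) (γ (t (α n + 1))) - γ ((t (α n) + t (α n + 1)) / 2) =
          (1 / 2 : ℝ) • ((γ (t (α n)) - γ ((t (α n) + t (α n + 1)) / 2)) +
            (γ (t (α n + 1)) - γ ((t (α n) + t (α n + 1)) / 2))) := by
        rw [midpoint_eq_smul_add, invOf_eq_inv]; module
      rw [e, norm_smul, Real.norm_of_nonneg (by norm_num)]
      have := norm_add_le (γ (t (α n)) - γ ((t (α n) + t (α n + 1)) / 2))
        (γ (t (α n + 1)) - γ ((t (α n) + t (α n + 1)) / 2))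
      linarith
    · rw [sub_self, norm_zero]; linarith
  · intro i hi ℓ hℓ hm
    have key : ∀ m, m ≤ i + 3 → i ≤ m + 3 → ℓ (γ (t m)) ≤ ℓ (γ (t (m + 1))) := by
      intro m h1 h2
      have h4 := ((tle (i - 6)).2).trans (ht.monotone (show i - 6 ≤ m by omega))
      have h5 := (ht.monotone (show m + 1 ≤ i + 7 - 1 by omega)).trans ((tle (i + 7)).1)
      have h6 := ht.monotone (Nat.le_succ m)
      exact hm.monotoneOn ⟨h4, h6.trans h5⟩ ⟨h4.trans h6, h5⟩ h6
    rw [insertMid_apply, insertMid_apply]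
    rcases (by omega : i < α n ∨ i = α n ∨ i = α n + 1 ∨ α n + 2 ≤ i) with h1 | rfl | rfl | h1
    · rw [if_pos h1.le, if_pos (by omega)]
      exact key i (by omega) (by omega)
    · have := key (α n) (by omega) (by omega)
      simp [midpoint_eq_smul_add]
      linarith
    · have := key (α n) (by omega) (by omega)
      simp [midpoint_eq_smul_add]
      linarith
    · obtain ⟨m, rfl⟩ : ∃ m, i = m + 1 := ⟨i - 1, by omega⟩
      rw [if_neg (by omega), if_neg (by omega), if_neg (by omega), if_neg (by omega)]
      exact key m (by omega) (by omega)

/-! ### Tame families of curves -/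

open Filter Topology in
/-- A family of curves is tame, uniformly in the parameter, near a parameter at which it is
injective, provided that it has local charts. -/
theorem exists_tame_le {X : Type*} [TopologicalSpace X] {C : Set (E3 →ₗ[ℝ] ℝ)} {Γ : X → ℝ → E3}
    {x₀ : X} (hc : Continuous fun p : X × ℝ => Γ p.1 p.2) (h0 : ∀ᶠ x in 𝓝 x₀, Γ x 0 = 0)
    (h1 : ∀ᶠ x in 𝓝 x₀, Γ x 1 = ones)
    (hcube : ∀ᶠ x in 𝓝 x₀, ∀ t ∈ Ioo (0 : ℝ) 1, ∀ c, Γ x t c ∈ Ioo (0 : ℝ) 1)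
    (hinj : InjOn (Γ x₀) (Icc 0 1))
    (hchart : ∀ s ∈ Icc (0 : ℝ) 1, ∃ ℓ ∈ C, ∃ r > 0, ∀ᶠ x in 𝓝 x₀,
      StrictMonoOn (fun t => ℓ (Γ x t)) (Icc (s - r) (s + r))) {r₀ : ℝ} (hr₀ : 0 < r₀) :
    ∃ η ρ μ, η ≤ r₀ ∧ ∀ᶠ x in 𝓝 x₀, Tame C η ρ μ (Γ x) := by
  -- Compactness of the interval makes the radius of the charts uniform in the time, and on a
  -- neighbourhood of x₀. The same induction gives uniform continuity below.
  have A : ∃ η > 0, η ≤ r₀ ∧ ∀ᶠ x in 𝓝 x₀, ∀ s ∈ Icc (0 : ℝ) 1, ∃ ℓ ∈ C,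
      StrictMonoOn (fun t => ℓ (Γ x t)) (Icc (s - η) (s + η)) := by
    refine isCompact_Icc.induction_on (p := fun A => ∃ η > 0, η ≤ r₀ ∧ ∀ᶠ x in 𝓝 x₀, ∀ s ∈ A,
      ∃ ℓ ∈ C, StrictMonoOn (fun t => ℓ (Γ x t)) (Icc (s - η) (s + η)))
      ⟨r₀, hr₀, le_rfl, by simp⟩ ?_ ?_ ?_
    · rintro A B hAB ⟨η, hη, hle, h⟩
      exact ⟨η, hη, hle, h.mono fun x hx s hs => hx s (hAB hs)⟩
    · rintro A B ⟨η, hη, hle, h⟩ ⟨η', hη', -, h'⟩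
      refine ⟨min η η', lt_min hη hη', (min_le_left _ _).trans hle, ?_⟩
      filter_upwards [h, h'] with x hx hx' s hs
      have e1 := min_le_left η η'
      have e2 := min_le_right η η'
      rcases hs with hs | hs
      · obtain ⟨ℓ, hℓ, hm⟩ := hx s hs
        exact ⟨ℓ, hℓ, hm.mono (Icc_subset_Icc (by linarith) (by linarith))⟩
      · obtain ⟨ℓ, hℓ, hm⟩ := hx' s hs
        exact ⟨ℓ, hℓ, hm.mono (Icc_subset_Icc (by linarith) (by linarith))⟩
    · intro s hs
      obtain ⟨ℓ, hℓ, r, hr, h⟩ := hchart s hs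
      have e1 := min_le_left (r / 2) r₀
      refine ⟨Ioo (s - r / 2) (s + r / 2), nhdsWithin_le_nhds (Ioo_mem_nhds (by linarith)
        (by linarith)), min (r / 2) r₀, lt_min (by linarith) hr₀, min_le_right _ _,
        h.mono fun x hx s' hs' => ⟨ℓ, hℓ, hx.mono ?_⟩⟩
      exact Icc_subset_Icc (by linarith [hs'.1]) (by linarith [hs'.2])
  obtain ⟨η, hη, hle, hA⟩ := A
  let D : Set (ℝ × ℝ) := (Icc (0 : ℝ) 1 ×ˢ Icc (0 : ℝ) 1) ∩ {p | η / 8 ≤ |p.1 - p.2|}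
  have hD : IsCompact D := by
    refine (isCompact_Icc.prod isCompact_Icc).inter_right (isClosed_le continuous_const ?_)
    fun_prop
  have hcd : Continuous fun q : X × ℝ × ℝ => ‖Γ q.1 q.2.1 - Γ q.1 q.2.2‖ :=
    ((hc.comp (continuous_fst.prodMk (continuous_fst.comp continuous_snd))).sub
      (hc.comp (continuous_fst.prodMk (continuous_snd.comp continuous_snd)))).norm
  have B : ∃ ρ > 0, ∀ᶠ x in 𝓝 x₀, ∀ p ∈ D, ρ < ‖Γ x p.1 - Γ x p.2‖ := by
    have hρ : ∃ ρ > 0, ∀ p ∈ D, ρ < ‖Γ x₀ p.1 - Γ x₀ p.2‖ := by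
      rcases D.eq_empty_or_nonempty with he | hne
      · exact ⟨1, by norm_num, by simp [he]⟩
      · obtain ⟨p, hp, hmin⟩ := hD.exists_isMinOn hne
          (hcd.comp (Continuous.prodMk_right x₀)).continuousOn
        have hpos : 0 < ‖Γ x₀ p.1 - Γ x₀ p.2‖ := by
          rw [norm_pos_iff, sub_ne_zero]
          intro he
          have this : η / 8 ≤ |p.1 - p.2| := hp.2
          rw [hinj hp.1.1 hp.1.2 he, sub_self, abs_zero] at this
          linarith
        refine ⟨‖Γ x₀ p.1 - Γ x₀ p.2‖ / 2, by linarith, fun q hq => ?_⟩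
        have : ‖Γ x₀ p.1 - Γ x₀ p.2‖ ≤ ‖Γ x₀ q.1 - Γ x₀ q.2‖ := hmin hq
        linarith
    obtain ⟨ρ, hρ, h⟩ := hρ
    refine ⟨ρ, hρ, hD.eventually_forall_of_forall_eventually fun p hp => ?_⟩
    exact hcd.continuousAt.eventually (lt_mem_nhds (h p hp))
  obtain ⟨ρ, hρ, hB⟩ := B
  have E : ∃ μ > 0, ∀ᶠ x in 𝓝 x₀, ∀ s ∈ Icc (0 : ℝ) 1, ∀ s', |s - s'| ≤ 4 * μ →
      ‖Γ x s - Γ x s'‖ ≤ ρ / 64 := by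
    refine isCompact_Icc.induction_on (p := fun A => ∃ μ > 0, ∀ᶠ x in 𝓝 x₀, ∀ s ∈ A, ∀ s',
      |s - s'| ≤ 4 * μ → ‖Γ x s - Γ x s'‖ ≤ ρ / 64) ⟨1, by norm_num, by simp⟩ ?_ ?_ ?_
    · rintro A B hAB ⟨η, hη, h⟩
      exact ⟨η, hη, h.mono fun x hx s hs => hx s (hAB hs)⟩
    · rintro A B ⟨η, hη, h⟩ ⟨η', hη', h'⟩
      refine ⟨min η η', lt_min hη hη', ?_⟩
      filter_upwards [h, h'] with x hx hx' s hs s' hss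
      have e1 := min_le_left η η'
      have e2 := min_le_right η η'
      rcases hs with hs | hs
      · exact hx s hs s' (by linarith)
      · exact hx' s hs s' (by linarith)
    · intro s hs
      have : ∀ᶠ q : X × ℝ in 𝓝 (x₀, s), ‖Γ q.1 q.2 - Γ x₀ s‖ < ρ / 128 := by
        have := Metric.tendsto_nhds.1 (hc.tendsto (x₀, s)) (ρ / 128) (by positivity)
        simpa [dist_eq_norm] using this
      rw [nhds_prod_eq] at this
      obtain ⟨pa, ha, pb, hb, hab⟩ := eventually_prod_iff.1 this
      obtain ⟨r, hr, hball⟩ := Metric.eventually_nhds_iff.1 hb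
      refine ⟨Ioo (s - r / 2) (s + r / 2), nhdsWithin_le_nhds (Ioo_mem_nhds (by linarith)
        (by linarith)), r / 16, by linarith, ha.mono fun x hx s' hs' s'' h => ?_⟩
      rw [abs_le] at h
      have e1 := hab hx (hball (y := s') (by
        rw [Real.dist_eq, abs_lt]; constructor <;> linarith [hs'.1, hs'.2]))
      have e2 := hab hx (hball (y := s'') (by
        rw [Real.dist_eq, abs_lt]; constructor <;> linarith [hs'.1, hs'.2]))
      have e : Γ x s' - Γ x s'' = (Γ x s' - Γ x₀ s) - (Γ x s'' - Γ x₀ s) := by abel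
      rw [e]
      refine (norm_sub_le _ _).trans ?_
      simp only at e1 e2
      linarith
  obtain ⟨μ, hμ, hE⟩ := E
  refine ⟨η, ρ, min μ (η / 32), hle, ?_⟩
  have e1 := min_le_left μ (η / 32)
  have e2 := min_le_right μ (η / 32)
  filter_upwards [h0, h1, hcube, hA, hB, hE] with x h0 h1 hcube hA hB hE
  exact ⟨h0, h1, hcube, hA, fun s hs s' hs' h => hB (s, s') ⟨⟨hs, hs'⟩, h⟩,
    fun s hs s' _ h => hE s hs s' (by linarith), hη, hρ, lt_min hμ (by linarith), by linarith⟩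

open Filter Topology in
theorem exists_tame {X : Type*} [TopologicalSpace X] {C : Set (E3 →ₗ[ℝ] ℝ)} {Γ : X → ℝ → E3}
    {x₀ : X} (hc : Continuous fun p : X × ℝ => Γ p.1 p.2) (h0 : ∀ᶠ x in 𝓝 x₀, Γ x 0 = 0)
    (h1 : ∀ᶠ x in 𝓝 x₀, Γ x 1 = ones)
    (hcube : ∀ᶠ x in 𝓝 x₀, ∀ t ∈ Ioo (0 : ℝ) 1, ∀ c, Γ x t c ∈ Ioo (0 : ℝ) 1)
    (hinj : InjOn (Γ x₀) (Icc 0 1))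
    (hchart : ∀ s ∈ Icc (0 : ℝ) 1, ∃ ℓ ∈ C, ∃ r > 0, ∀ᶠ x in 𝓝 x₀,
      StrictMonoOn (fun t => ℓ (Γ x t)) (Icc (s - r) (s + r))) :
    ∃ η ρ μ, ∀ᶠ x in 𝓝 x₀, Tame C η ρ μ (Γ x) := by
  obtain ⟨η, ρ, μ, -, h⟩ := exists_tame_le hc h0 h1 hcube hinj hchart one_pos
  exact ⟨η, ρ, μ, h⟩

/-! ### Refinement of times -/

theorem FineTimes.of_step {n : ℕ} {μ μ' : ℝ} {t : ℕ → ℝ} (h : FineTimes n μ t)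
    (hs : ∀ i, i < n → t (i + 1) ≤ t i + μ') (hμ : 0 ≤ μ') : FineTimes n μ' t := by
  refine ⟨h.zero, h.one, h.lt, fun i => ?_⟩
  rcases lt_or_ge i n with hi | hi
  · exact hs i hi
  · rw [h.one i hi, h.one (i + 1) (by omega)]; linarith

theorem FineTimes.exists_step {n : ℕ} {μ : ℝ} {t : ℕ → ℝ} (h : FineTimes n μ t) {x : ℝ}
    (hx : x ∈ Ioo (0 : ℝ) 1) (hne : ∀ i, t i ≠ x) : ∃ p < n, x ∈ Ioo (t p) (t (p + 1)) := by
  by_contra! hc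
  have : ∀ i ≤ n, t i < x := by
    intro i
    induction i with
    | zero => intro _; rw [h.zero]; exact hx.1
    | succ i ih =>
      intro hi
      by_contra! hge
      exact hc i (by omega) ⟨ih (by omega), lt_of_le_of_ne hge (hne (i + 1)).symm⟩
  have := this n le_rfl
  rw [h.one n le_rfl] at this
  exact lt_irrefl _ (this.trans hx.2)

/-- A property of lists of times that is preserved by the insertion of times from a dense set holds
for arbitrarily fine lists of times. -/
theorem exists_refinement {Q : ℕ → (ℕ → ℝ) → Prop} {A : Set ℝ} {m : ℕ} {t : ℕ → ℝ}
    (ht : FineTimes m 1 t) (hQ : Q m t) (hA : ∀ a b : ℝ, a < b → ∃ x ∈ A, x ∈ Ioo a b)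
    (hins : ∀ m t, FineTimes m 1 t → Q m t → ∀ p < m, ∀ x ∈ A, x ∈ Ioo (t p) (t (p + 1)) →
      Q (m + 1) (insertTime p x t)) {μ : ℝ} (hμ : 0 < μ) :
    ∃ n t', m ≤ n ∧ FineTimes n μ t' ∧ Q n t' := by
  -- Once each of the N + 1 equal parts of the interval contains one of the times, consecutive times
  -- differ by less than two parts, that is, by less than μ.
  obtain ⟨N, hN⟩ := exists_nat_one_div_lt (show 0 < μ / 2 by linarith)
  have hN0 : (0 : ℝ) < N + 1 := by positivity
  have hx : ∀ j : ℕ, ∃ x ∈ A, x ∈ Ioo ((j : ℝ) / (N + 1)) ((j + 1 : ℝ) / (N + 1)) := fun j =>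
    hA _ _ (by gcongr; linarith)
  choose x hxA hxI using hx
  have key : ∀ k ≤ N + 1, ∃ n t', m ≤ n ∧ FineTimes n 1 t' ∧ Q n t' ∧
      ∀ j < k, ∃ i, t' i = x j := by
    intro k
    induction k with
    | zero => exact fun _ => ⟨m, t, le_rfl, ht, hQ, by simp⟩
    | succ k ih =>
      intro hk
      obtain ⟨n, t', hn, ht', hQ', hr⟩ := ih (by omega)
      by_cases hmem : ∃ i, t' i = x k
      · refine ⟨n, t', hn, ht', hQ', fun j hj => ?_⟩
        rcases (by omega : j < k ∨ j = k) with h | rfl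
        · exact hr j h
        · exact hmem
      · push Not at hmem
        have hk' : (k : ℝ) + 1 ≤ N + 1 := by exact_mod_cast hk
        obtain ⟨p, hp, hxp⟩ := ht'.exists_step (x := x k) ⟨lt_of_le_of_lt (by positivity) (hxI k).1,
          (hxI k).2.trans_le (by rw [div_le_one hN0]; exact hk')⟩ hmem
        refine ⟨n + 1, _, by omega, ht'.insert hp hxp, hins n t' ht' hQ' p hp _ (hxA k) hxp,
          fun j hj => ?_⟩
        rcases (by omega : j < k ∨ j = k) with h | rfl
        · obtain ⟨i, hi⟩ := hr j h
          rcases le_or_gt i p with hip | hip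
          · exact ⟨i, by rw [insertTime, if_pos hip, hi]⟩
          · exact ⟨i + 1, by
              rw [insertTime, if_neg (by omega), if_neg (by omega), Nat.add_sub_cancel, hi]⟩
        · exact ⟨p + 1, by simp [insertTime]⟩
  obtain ⟨n, t', hn, ht', hQ', hr⟩ := key (N + 1) le_rfl
  refine ⟨n, t', hn, ht'.of_step (fun i hi => ?_) hμ.le, hQ'⟩
  by_contra! hc
  have h0 := (ht'.mem i).1
  have h1 := (ht'.mem (i + 1)).2
  have f1 := Nat.lt_floor_add_one (t' i * (N + 1))
  have f0 : (⌊t' i * (N + 1)⌋₊ : ℝ) ≤ t' i * (N + 1) := Nat.floor_le (by positivity)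
  set q := ⌊t' i * (N + 1)⌋₊
  have h2 : 2 < μ * (N + 1) := by
    rw [div_lt_iff₀ hN0] at hN; linarith
  have h3 : t' i * (N + 1) + 2 < t' (i + 1) * (N + 1) := by nlinarith
  have h4 : (q : ℝ) + 2 < N + 1 := by nlinarith
  obtain ⟨l, hl⟩ := hr (q + 1) (by
    have : ((q + 1 : ℕ) : ℝ) < (N + 1 : ℕ) := by push_cast; linarith
    exact_mod_cast this)
  have hxq := hxI (q + 1)
  rw [← hl] at hxq
  obtain ⟨g1, g2⟩ := hxq
  push_cast at g1 g2
  rw [div_lt_iff₀ hN0] at g1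
  rw [lt_div_iff₀ hN0] at g2
  have g3 : t' i < t' l := by
    by_contra! h; nlinarith
  have g4 : t' l < t' (i + 1) := by
    by_contra! h; nlinarith
  have g5 := ht'.monotone.reflect_lt g3
  have g6 := ht'.monotone.reflect_lt g4
  omega

/-! ### The PL curve of a list of vertices -/

/-- The PL map through `w 0, …, w n`, extended linearly beyond `[0, n]`. -/
def hinge (n : ℕ) (w : Seq) (u : ℝ) : E3 :=
  w 0 + u • (w 1 - w 0) +
    ∑ j ∈ Finset.range (n - 1), max (u - (j + 1)) 0 • (w (j + 2) - (2 : ℝ) • w (j + 1) + w j)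

/-- Each summand vanishes before its kink and is linear after it, and its coefficient is a second
difference, so the partial sums telescope. In exchange for this formula, joint continuity in list
and parameter is immediate. -/
theorem hinge_eq {n i : ℕ} (hi : i < n) (w : Seq) {u : ℝ} (h : i = 0 ∨ (i : ℝ) ≤ u)
    (h' : i + 1 = n ∨ u ≤ i + 1) : hinge n w u = w i + (u - i) • (w (i + 1) - w i) := by
  have e1 : ∑ j ∈ Finset.range (n - 1), max (u - (j + 1)) 0 •
      (w (j + 2) - (2 : ℝ) • w (j + 1) + w j) =
      ∑ j ∈ Finset.range i, (u - (j + 1)) • (w (j + 2) - (2 : ℝ) • w (j + 1) + w j) := by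
    rw [← Finset.sum_range_add_sum_Ico _ (show i ≤ n - 1 by omega)]
    have z : ∑ j ∈ Finset.Ico i (n - 1), max (u - (j + 1)) 0 •
        (w (j + 2) - (2 : ℝ) • w (j + 1) + w j) = 0 := by
      refine Finset.sum_eq_zero fun j hj => ?_
      rw [Finset.mem_Ico] at hj
      have : u ≤ i + 1 := by
        rcases h' with h' | h'
        · omega
        · exact h'
      have hj' : (i : ℝ) ≤ j := by exact_mod_cast hj.1
      rw [max_eq_right (by linarith), zero_smul]
    rw [z, add_zero]
    refine Finset.sum_congr rfl fun j hj => ?_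
    rw [Finset.mem_range] at hj
    have : (i : ℝ) ≤ u := by
      rcases h with h | h
      · omega
      · exact h
    have hj' : (j : ℝ) + 1 ≤ i := by exact_mod_cast hj
    rw [max_eq_left (by linarith)]
  have e2 : ∀ i : ℕ, w 0 + u • (w 1 - w 0) +
      ∑ j ∈ Finset.range i, (u - (j + 1)) • (w (j + 2) - (2 : ℝ) • w (j + 1) + w j) =
      w i + (u - i) • (w (i + 1) - w i) := by
    intro i
    induction i with
    | zero => simp
    | succ i ih =>
      rw [Finset.sum_range_succ, ← add_assoc, ih]
      push_cast
      module
  rw [hinge, e1, e2]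

theorem hinge_eq_poly {n : ℕ} (hn : 0 < n) (w : Seq) {u : ℝ} (hu : u ∈ Icc (0 : ℝ) n) :
    hinge n w u = poly w u := by
  obtain ⟨i, hi, h1, h2⟩ := exists_segment hn hu
  rw [hinge_eq hi w (Or.inr h1) (Or.inr h2), poly_eq w h1 h2]

/-- The list `w` with the endpoints of a list in `P n`. -/
def pin (n : ℕ) (w : Seq) (i : ℕ) : E3 := if i = 0 then 0 else if n ≤ i then ones else w i

theorem pin_eq_self {n : ℕ} {w : Seq} (hw : w ∈ P n) : pin n w = w := by
  funext i
  rw [pin]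
  split_ifs with h1 h2
  · rw [h1, hw.1]
  · rw [hw.2.1 i h2]
  · rfl

/-- The PL curve through the vertices of `w ∈ P n`, with the parameter interval `[0, 1]`. -/
def curve (n : ℕ) (w : Seq) (t : ℝ) : E3 := hinge n (pin n w) (n * t)

theorem continuous_pin (n i : ℕ) : Continuous fun w : Seq => pin n w i := by
  simp only [pin]
  split_ifs
  · exact continuous_const
  · exact continuous_const
  · exact continuous_apply i

theorem continuous_hinge_pin (n : ℕ) :
    Continuous fun p : Seq × ℝ => hinge n (pin n p.1) p.2 := by
  have hp : ∀ i, Continuous fun p : Seq × ℝ => pin n p.1 i := fun i =>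
    (continuous_pin n i).comp continuous_fst
  refine ((hp 0).add (continuous_snd.smul ((hp 1).sub (hp 0)))).add
    (continuous_finsetSum _ fun j _ => ?_)
  refine ((continuous_snd.sub continuous_const).max continuous_const).smul ?_
  exact ((hp _).sub ((hp _).const_smul (2 : ℝ))).add (hp _)

theorem continuous_curve (n : ℕ) : Continuous fun p : Seq × ℝ => curve n p.1 p.2 :=
  (continuous_hinge_pin n).comp
    (continuous_fst.prodMk (continuous_const.mul continuous_snd))

theorem pin_mem_P {n : ℕ} (hn : 0 < n) {w : Seq}
    (h : ∀ i, 0 < i → i < n → ∀ c, w i c ∈ Ioo (0 : ℝ) 1) : pin n w ∈ P n := by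
  refine ⟨by simp [pin], fun i hi => ?_, fun i h0 hi c => ?_⟩
  · rw [pin, if_neg (by omega), if_pos hi]
  · rw [pin, if_neg (by omega), if_neg (by omega)]
    exact h i h0 hi c

/-- Fixing the ends allows all lists in an open neighbourhood to be used as parameters, not only
those in `P n`; tameness can then be stated with `𝓝 w`. -/
theorem eventually_pin_mem_P {n : ℕ} (hn : 0 < n) {w : Seq} (hw : w ∈ P n) :
    ∀ᶠ w' in nhds w, pin n w' ∈ P n := by
  have : ∀ᶠ w' : Seq in nhds w, ∀ i < n, 0 < i → ∀ c, w' i c ∈ Ioo (0 : ℝ) 1 := by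
    refine (Filter.eventually_all_finite (Set.finite_lt_nat n)).2 fun i hi => ?_
    by_cases h0 : 0 < i
    · simp only [h0, forall_true_left]
      refine Filter.eventually_all.2 fun c => ?_
      have hc : Continuous fun w' : Seq => w' i c :=
        (EuclideanSpace.proj c).continuous.comp (continuous_apply i)
      exact hc.continuousAt.eventually (isOpen_Ioo.mem_nhds (hw.2.2 i h0 hi c))
    · exact Filter.Eventually.of_forall fun _ h => (h0 h).elim
  filter_upwards [this] with w' h
  exact pin_mem_P hn fun i h0 hi => h i hi h0

theorem hinge_mem_cube {n : ℕ} (hn : 2 ≤ n) {w : Seq} (hw : w ∈ P n) {u : ℝ}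
    (hu : u ∈ Ioo (0 : ℝ) n) (c : Fin 3) : hinge n w u c ∈ Ioo (0 : ℝ) 1 := by
  have hle : ∀ i, w i c ∈ Icc (0 : ℝ) 1 := by
    intro i
    rcases Nat.eq_zero_or_pos i with rfl | h0
    · rw [hw.1]; simp
    · rcases lt_or_ge i n with hi | hi
      · exact Ioo_subset_Icc_self (hw.2.2 i h0 hi c)
      · rw [hw.2.1 i hi]; simp [ones]
  obtain ⟨i, hi, h1, h2⟩ := exists_segment (n := n) (by omega) ⟨hu.1.le, hu.2.le⟩
  rw [hinge_eq hi w (Or.inr h1) (Or.inr h2)]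
  change w i c + (u - i) * (w (i + 1) c - w i c) ∈ _
  have a0 := hle i
  have a1 := hle (i + 1)
  by_cases hi0 : 0 < i
  · have b := hw.2.2 i hi0 hi c
    rcases h2.lt_or_eq with h2 | h2
    · constructor <;> nlinarith [a1.1, a1.2, b.1, b.2]
    · have : i + 1 < n := by
        have := hu.2
        rw [h2] at this
        exact_mod_cast this
      have b' := hw.2.2 (i + 1) (by omega) this c
      rw [h2]
      convert b' using 1
      ring
  · obtain rfl : i = 0 := by omega
    have b := hw.2.2 1 (by norm_num) (by omega) c
    have := hu.1
    have e : w 0 c = 0 := by rw [hw.1]; rfl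
    push_cast at h2 ⊢
    rw [e]
    constructor <;> nlinarith [b.1, b.2]

/-- The inner product with the bisector ‖q‖p + ‖p‖q is positive on both vectors, by the equality
case of the Cauchy–Schwarz inequality, unless they point in opposite directions. -/
theorem exists_pos_functional {p q : E3} (hp : p ≠ 0) (hq : q ≠ 0) (h : ‖q‖ • p ≠ -(‖p‖ • q)) :
    ∃ ℓ : E3 →ₗ[ℝ] ℝ, 0 < ℓ p ∧ 0 < ℓ q := by
  have hp' := norm_pos_iff.2 hp
  have hq' := norm_pos_iff.2 hq
  have hi : -(‖p‖ * ‖q‖) < inner ℝ p q := by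
    have h1 := real_inner_le_norm p (-q)
    rw [inner_neg_right, norm_neg] at h1
    refine lt_of_le_of_ne (by linarith) fun he => h ?_
    have := (inner_eq_norm_mul_iff_real (x := p) (y := -q)).1
      (by rw [inner_neg_right, norm_neg]; linarith)
    rwa [norm_neg, smul_neg] at this
  refine ⟨(innerSL ℝ (‖q‖ • p + ‖p‖ • q)).toLinearMap, ?_, ?_⟩
  · simp only [ContinuousLinearMap.coe_coe, innerSL_apply_apply, inner_add_left, inner_smul_left,
      real_inner_self_eq_norm_sq, real_inner_comm, conj_trivial]
    nlinarith
  · simp only [ContinuousLinearMap.coe_coe, innerSL_apply_apply, inner_add_left, inner_smul_left,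
      real_inner_self_eq_norm_sq, conj_trivial]
    nlinarith

theorem exists_functional {n : ℕ} {w : Seq} (hw : w ∈ L n) {i : ℕ} (hi : i + 1 < n) :
    ∃ ℓ : E3 →ₗ[ℝ] ℝ, 0 < ℓ (w (i + 1) - w i) ∧ 0 < ℓ (w (i + 2) - w (i + 1)) := by
  have hinj := ((mem_L_iff (by omega) w).1 hw).2
  have hn : (i : ℝ) + 2 ≤ n := by exact_mod_cast hi
  have hi0 : (0 : ℝ) ≤ i := Nat.cast_nonneg i
  have e0 := poly_natCast w i
  have e1 := poly_natCast w (i + 1)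
  have e2 := poly_natCast w (i + 2)
  push_cast at e1 e2
  have hp : w (i + 1) - w i ≠ 0 := by
    rw [← e0, ← e1, sub_ne_zero]
    intro h
    have := hinj ⟨by linarith, by linarith⟩ ⟨by linarith, by linarith⟩ h
    linarith
  have hq : w (i + 2) - w (i + 1) ≠ 0 := by
    rw [← e2, ← e1, sub_ne_zero]
    intro h
    have := hinj ⟨by linarith, by linarith⟩ ⟨by linarith, by linarith⟩ h
    linarith
  -- If the next edge pointed backwards, the points at distance ‖p‖‖q‖/(‖p‖ + ‖q‖) before and after
  -- the common vertex would coincide; this distance fits on both edges.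
  refine exists_pos_functional hp hq fun h => ?_
  have hp' := norm_pos_iff.2 hp
  have hq' := norm_pos_iff.2 hq
  set p := w (i + 1) - w i with hpdef
  set q := w (i + 2) - w (i + 1) with hqdef
  set d := ‖p‖ + ‖q‖ with hd
  have hd0 : 0 < d := by linarith
  have a1 : ‖q‖ / d ≤ 1 := by rw [div_le_one hd0]; linarith
  have b1 : ‖p‖ / d ≤ 1 := by rw [div_le_one hd0]; linarith
  have a0 : 0 < ‖q‖ / d := by positivity
  have b0 : 0 < ‖p‖ / d := by positivity
  have f1 : poly w (i + 1 - ‖q‖ / d) = w (i + 1) - (‖q‖ / d) • p := by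
    rw [poly_eq w (i := i) (by linarith) (by linarith), ← hpdef,
      show w i = w (i + 1) - p by rw [hpdef]; abel]
    module
  have f2 : poly w (i + 1 + ‖p‖ / d) = w (i + 1) + (‖p‖ / d) • q := by
    rw [poly_eq w (i := i + 1) (by push_cast; linarith) (by push_cast; linarith)]
    push_cast
    rw [show i + 1 + 1 = i + 2 by rfl, ← hqdef]
    module
  have : poly w (i + 1 - ‖q‖ / d) = poly w (i + 1 + ‖p‖ / d) := by
    rw [f1, f2, div_eq_inv_mul, div_eq_inv_mul, mul_smul, mul_smul, h]
    module
  have := hinj ⟨by linarith, by linarith⟩ ⟨by linarith, by linarith⟩ this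
  linarith

/-- Near each point a functional increases strictly along the curve of a PL knot, and also along the
curves of the lists nearby. -/
theorem eventually_strictMonoOn_hinge {n : ℕ} (hn : 2 ≤ n) {w : Seq} (hw : w ∈ L n) (u₀ : ℝ) :
    ∃ ℓ : E3 →ₗ[ℝ] ℝ, ∀ᶠ w' in nhds w,
      StrictMonoOn (fun u => ℓ (hinge n (pin n w') u)) (Icc (u₀ - 1 / 2) (u₀ + 1 / 2)) := by
  -- A window of length 1 meets at most two consecutive edges. At the ends of the list the first and
  -- the last edge are prolonged, so that side of the condition is dropped.
  obtain ⟨i, hi, h1, h2⟩ : ∃ i, i + 1 < n ∧ (i = 0 ∨ (i : ℝ) ≤ u₀ - 1 / 2) ∧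
      (i + 2 = n ∨ u₀ + 1 / 2 ≤ i + 2) := by
    rcases le_or_gt u₀ (3 / 2) with h | h
    · exact ⟨0, by omega, Or.inl rfl, Or.inr (by push_cast; linarith)⟩
    · have f0 : (⌊u₀ - 1 / 2⌋₊ : ℝ) ≤ u₀ - 1 / 2 := Nat.floor_le (by linarith)
      have f1 := Nat.lt_floor_add_one (u₀ - 1 / 2)
      rcases lt_or_ge (⌊u₀ - 1 / 2⌋₊ + 1) n with h' | h'
      · exact ⟨_, h', Or.inr f0, Or.inr (by linarith)⟩
      · refine ⟨n - 2, by omega, Or.inr ?_, Or.inl (by omega)⟩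
        refine le_trans ?_ f0
        exact_mod_cast (by omega : n - 2 ≤ ⌊u₀ - 1 / 2⌋₊)
  obtain ⟨ℓ, hp, hq⟩ := exists_functional hw hi
  refine ⟨ℓ, ?_⟩
  have hℓ : Continuous ℓ := ℓ.continuous_of_finiteDimensional
  have cont : ∀ j, Continuous fun w' => ℓ (pin n w' (j + 1) - pin n w' j) := fun j =>
    hℓ.comp ((continuous_pin n _).sub (continuous_pin n _))
  rw [← pin_eq_self hw.1] at hp hq
  filter_upwards [(cont i).continuousAt.eventually (lt_mem_nhds hp),
    (cont (i + 1)).continuousAt.eventually (lt_mem_nhds hq)] with w' hp' hq'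
  intro x hx y hy hxy
  have low : ∀ u ∈ Icc (u₀ - 1 / 2) (u₀ + 1 / 2), u ≤ i + 1 → ℓ (hinge n (pin n w') u) =
      ℓ (pin n w' (i + 1)) + (u - (i + 1)) * ℓ (pin n w' (i + 1) - pin n w' i) := by
    intro u hu hui
    rw [hinge_eq (i := i) (by omega) _ (h1.imp_right fun h => h.trans hu.1) (Or.inr hui)]
    simp only [map_add, map_sub, map_smul, smul_eq_mul]
    ring
  have high : ∀ u ∈ Icc (u₀ - 1 / 2) (u₀ + 1 / 2), i + 1 ≤ u → ℓ (hinge n (pin n w') u) =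
      ℓ (pin n w' (i + 1)) + (u - (i + 1)) * ℓ (pin n w' (i + 2) - pin n w' (i + 1)) := by
    intro u hu hui
    rw [hinge_eq (i := i + 1) (by omega) _ (Or.inr (by push_cast; exact hui))
      (h2.imp (fun h => by omega) fun h => by push_cast; linarith [hu.2])]
    simp only [map_add, map_sub, map_smul, smul_eq_mul]
    push_cast
    ring
  simp only
  rcases le_total x (i + 1) with hx1 | hx1
  · rcases le_total y (i + 1) with hy1 | hy1
    · rw [low x hx hx1, low y hy hy1]; nlinarith
    · rw [low x hx hx1, high y hy hy1]
      rcases hx1.lt_or_eq with hx2 | hx2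
      · nlinarith [mul_nonneg (sub_nonneg.2 hy1) hq'.le, mul_pos (sub_pos.2 hx2) hp']
      · subst hx2; nlinarith
  · rw [high x hx hx1, high y hy (by linarith)]; nlinarith

/-! ### PL knots -/

open Filter Topology

theorem curve_eq_poly {n : ℕ} (hn : 0 < n) {w : Seq} (hw : w ∈ P n) {t : ℝ}
    (ht : t ∈ Icc (0 : ℝ) 1) : curve n w t = poly w (n * t) := by
  have : (0 : ℝ) < n := Nat.cast_pos.2 hn
  rw [curve, pin_eq_self hw, hinge_eq_poly hn]
  constructor <;> nlinarith [ht.1, ht.2]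

theorem injOn_curve_iff {n : ℕ} (hn : 0 < n) {w : Seq} (hw : w ∈ P n) :
    InjOn (curve n w) (Icc 0 1) ↔ w ∈ L n := by
  have hn' : (0 : ℝ) < n := Nat.cast_pos.2 hn
  rw [mem_L_iff hn]
  constructor
  · refine fun h => ⟨hw, fun x hx y hy hxy => ?_⟩
    have key : ∀ x ∈ Icc (0 : ℝ) n, x / n ∈ Icc (0 : ℝ) 1 ∧ curve n w (x / n) = poly w x := by
      intro x hx
      have : x / n ∈ Icc (0 : ℝ) 1 := ⟨div_nonneg hx.1 hn'.le, (div_le_one hn').2 hx.2⟩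
      refine ⟨this, ?_⟩
      rw [curve_eq_poly hn hw this, mul_div_cancel₀ _ hn'.ne']
    have := h (key x hx).1 (key y hy).1 (by rw [(key x hx).2, (key y hy).2, hxy])
    field_simp at this
    exact this
  · rintro ⟨_, h⟩ x hx y hy hxy
    rw [curve_eq_poly hn hw hx, curve_eq_poly hn hw hy] at hxy
    have := h ⟨by have := hx.1; positivity, by nlinarith [hx.2]⟩
      ⟨by have := hy.1; positivity, by nlinarith [hy.2]⟩ hxy
    exact mul_left_cancel₀ hn'.ne' this

theorem curve_zero {n : ℕ} (hn : 0 < n) (w : Seq) : curve n w 0 = 0 := by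
  rw [curve, mul_zero, hinge_eq hn _ (Or.inl rfl) (Or.inr (by norm_num))]
  simp [pin]

theorem curve_one {n : ℕ} (hn : 0 < n) (w : Seq) : curve n w 1 = ones := by
  rw [curve, mul_one, hinge_eq (i := n - 1) (by omega) _ (Or.inr (by simp))
    (Or.inl (by omega)), Nat.sub_add_cancel hn]
  have : ((n - 1 : ℕ) : ℝ) = n - 1 := by rw [Nat.cast_sub hn]; simp
  rw [this, sub_sub_cancel, one_smul, add_sub_cancel]
  simp [pin]; omega

theorem exists_tame_curve {n : ℕ} (hn : 2 ≤ n) {w : Seq} (hw : w ∈ L n) :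
    ∃ η ρ μ, ∀ᶠ w' in 𝓝 w, Tame univ η ρ μ (curve n w') := by
  have hn' : (0 : ℝ) < n := by exact_mod_cast (by omega : 0 < n)
  refine exists_tame (Γ := curve n) (continuous_curve n)
    (Eventually.of_forall fun _ => curve_zero (by omega) _)
    (Eventually.of_forall fun _ => curve_one (by omega) _) ?_
    ((injOn_curve_iff (by omega) hw.1).2 hw) fun s hs => ?_
  · filter_upwards [eventually_pin_mem_P (by omega) hw.1] with w' hw' t ht c
    exact hinge_mem_cube hn hw' ⟨by have := ht.1; positivity, by nlinarith [ht.2]⟩ c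
  · obtain ⟨ℓ, hℓ⟩ := eventually_strictMonoOn_hinge hn hw (n * s)
    refine ⟨ℓ, mem_univ _, 1 / (2 * n), by positivity, hℓ.mono fun w' h x hx y hy hxy => ?_⟩
    have e : (n : ℝ) * (1 / (2 * n)) = 1 / 2 := by field_simp
    exact h ⟨by nlinarith [hx.1], by nlinarith [hx.2]⟩ ⟨by nlinarith [hy.1], by nlinarith [hy.2]⟩
      (mul_lt_mul_of_pos_left hxy hn')

theorem Tame.injOn {C : Set (E3 →ₗ[ℝ] ℝ)} {η ρ μ : ℝ} {γ : ℝ → E3} (h : Tame C η ρ μ γ) :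
    InjOn γ (Icc 0 1) := by
  intro x hx y hy hxy
  have hη := h.pos
  rcases lt_or_ge |x - y| (η / 8) with hd | hd
  · obtain ⟨ℓ, -, hm⟩ := h.chart x hx
    rw [abs_lt] at hd
    exact hm.injOn ⟨by linarith, by linarith⟩ ⟨by linarith, by linarith⟩ (congrArg ℓ hxy)
  · have := h.far x hx y hy hd
    rw [hxy, sub_self, norm_zero] at this
    exact (lt_asymm this h.rho_pos).elim

theorem eventually_line {w : Seq} {p : Seq → Prop} (h : ∀ᶠ w' in 𝓝 w, p w') :
    ∀ᶠ w' in 𝓝 w, ∀ s ∈ Icc (0 : ℝ) 1, p (w + s • (w' - w)) := by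
  refine isCompact_Icc.eventually_forall_of_forall_eventually fun s hs => ?_
  have hc : Continuous fun q : Seq × ℝ => w + q.2 • (q.1 - w) := by fun_prop
  have : Tendsto (fun q : Seq × ℝ => w + q.2 • (q.1 - w)) (𝓝 (w, s)) (𝓝 w) := by
    simpa using hc.tendsto (w, s)
  exact this.eventually h

/-- Tameness holds on a neighbourhood and hence along segments to nearby lists, and a tame curve is
injective. -/
theorem eventually_joinedIn_L (n : ℕ) (hn : 3 ≤ n) (w : Seq) (hw : w ∈ L n) :
    ∀ᶠ w' in nhdsWithin w (L n), JoinedIn (L n) w w' := by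
  obtain ⟨η, ρ, μ, h⟩ := exists_tame_curve (by omega) hw
  filter_upwards [self_mem_nhdsWithin, nhdsWithin_le_nhds (eventually_line h)] with w' hw' h
  exact joinedIn_of_line fun s hs =>
    (injOn_curve_iff (by omega) (P_line hw.1 hw'.1 hs)).1 (h s hs).injOn

/-- Points on the curve of a PL knot at times such that the curve is affine between consecutive
times, or the step is short. -/
theorem curve_comp_mem_L {n m : ℕ} {w : Seq} {η ρ μ : ℝ} (hn : 0 < n) (hw : w ∈ P n)
    (hγ : Tame univ η ρ μ (curve n w)) {t : ℕ → ℝ} (hm : 0 < m) (ht : FineTimes m 1 t)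
    (hgap : ∀ i < m, (∃ j < n, (j : ℝ) ≤ n * t i ∧ n * t (i + 1) ≤ j + 1) ∨ t (i + 1) - t i ≤ μ) :
    (fun i => curve n w (t i)) ∈ L m := by
  have hn' : (0 : ℝ) < n := Nat.cast_pos.2 hn
  have hρ := hγ.rho_pos
  have hη := hγ.pos
  have hμ := hγ.mesh_pos
  have hle := hγ.mesh_le
  have aff : ∀ i < m, (∃ j < n, (j : ℝ) ≤ n * t i ∧ n * t (i + 1) ≤ j + 1) →
      ∃ v : E3, ∀ x ∈ Icc (t i) (t (i + 1)), curve n w x = curve n w (t i) + (x - t i) • v := by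
    rintro i hi ⟨j, hj, h1, h2⟩
    refine ⟨(n : ℝ) • (w (j + 1) - w j), fun x hx => ?_⟩
    have := ht.lt i hi
    have e1 : (n : ℝ) * t i ≤ n * x := mul_le_mul_of_nonneg_left hx.1 hn'.le
    have e2 : (n : ℝ) * x ≤ n * t (i + 1) := mul_le_mul_of_nonneg_left hx.2 hn'.le
    rw [curve, curve, pin_eq_self hw, hinge_eq hj w (Or.inr (h1.trans e1)) (Or.inr (e2.trans h2)),
      hinge_eq hj w (Or.inr h1) (Or.inr ((e1.trans e2).trans h2))]
    module
  have hmono : ∀ i < m, t i ≤ t (i + 1) := fun i hi => (ht.lt i hi).le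
  refine hγ.mem_L hm (hγ.mem_P ht) ht.zero (ht.one m le_rfl) hmono ?_ ?_
  · rintro i hi s ⟨s0, s1⟩
    have hlt := ht.lt i hi
    have m0 := ht.mem i
    have m1 := ht.mem (i + 1)
    have hx : t i + s * (t (i + 1) - t i) ∈ Icc (t i) (t (i + 1)) :=
      ⟨by nlinarith, by nlinarith⟩
    rcases hgap i hi with hg | hg
    · obtain ⟨v, hv⟩ := aff i hi hg
      rw [hv _ ⟨hlt.le, le_rfl⟩, hv _ hx, add_sub_cancel_left, add_sub_cancel_left, mul_smul,
        sub_self, norm_zero]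
      linarith
    · have mx : t i + s * (t (i + 1) - t i) ∈ Icc (0 : ℝ) 1 :=
        ⟨m0.1.trans hx.1, hx.2.trans m1.2⟩
      have e1 := hγ.near _ m0 _ mx (by
        rw [abs_le]; constructor <;> linarith [hx.1, hx.2])
      have e2 := hγ.near _ m1 _ mx (by
        rw [abs_le]; constructor <;> linarith [hx.1, hx.2])
      have e : curve n w (t i) + s • (curve n w (t (i + 1)) - curve n w (t i)) -
          curve n w (t i + s * (t (i + 1) - t i)) =
          (1 - s) • (curve n w (t i) - curve n w (t i + s * (t (i + 1) - t i))) +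
            s • (curve n w (t (i + 1)) - curve n w (t i + s * (t (i + 1) - t i))) := by module
      rw [e]
      refine (norm_add_le _ _).trans ?_
      rw [norm_smul, norm_smul, Real.norm_of_nonneg s0, Real.norm_of_nonneg (by linarith)]
      nlinarith
  · intro ℓ _ a b hab hℓ i hi h1 h2
    have hlt := ht.lt i hi
    rcases hgap i hi with hg | hg
    · obtain ⟨v, hv⟩ := aff i hi hg
      -- The edge may leave the chart. On the overlap the functional increases, so it is positive on
      -- the direction of the edge, and by affinity it increases along the whole edge.
      have hpq : max (t i) a < min (t (i + 1)) b :=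
        max_lt (lt_min hlt (by linarith)) (lt_min (by linarith) hab)
      have p0 := le_max_left (t i) a
      have p1 := le_max_right (t i) a
      have q0 := min_le_left (t (i + 1)) b
      have q1 := min_le_right (t (i + 1)) b
      generalize max (t i) a = p at *
      generalize min (t (i + 1)) b = q at *
      have := hℓ ⟨p1, by linarith⟩ ⟨by linarith, q1⟩ hpq
      simp only at this
      rw [hv p ⟨p0, by linarith⟩, hv q ⟨by linarith, q0⟩] at this
      rw [hv _ ⟨hlt.le, le_rfl⟩]
      simp only [map_add, map_smul, smul_eq_mul] at this ⊢
      have : 0 < (q - p) * ℓ v := by linarith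
      have := pos_of_mul_pos_right this (by linarith)
      nlinarith
    · exact hℓ ⟨by linarith, by linarith⟩ ⟨by linarith, by linarith⟩ hlt

theorem joinedIn_L_of_times {n m : ℕ} {w : Seq} {η ρ μ : ℝ} (hn : 0 < n) (hw : w ∈ P n)
    (hγ : Tame univ η ρ μ (curve n w)) {t t' : ℕ → ℝ} (hm : 0 < m) (ht : FineTimes m 1 t)
    (ht' : FineTimes m 1 t')
    (hgap : ∀ i < m, (∃ j < n, (j : ℝ) ≤ n * t i ∧ n * t (i + 1) ≤ j + 1 ∧ (j : ℝ) ≤ n * t' i ∧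
      n * t' (i + 1) ≤ j + 1) ∨ (t (i + 1) - t i ≤ μ ∧ t' (i + 1) - t' i ≤ μ)) :
    JoinedIn (L m) (fun i => curve n w (t i)) fun i => curve n w (t' i) := by
  have hc : Continuous (curve n w) := (continuous_curve n).comp (Continuous.prodMk_right w)
  refine JoinedIn.ofLine (f := fun s i => curve n w (t i + s * (t' i - t i))) ?_ ?_ ?_ ?_
  · exact Continuous.continuousOn (by fun_prop)
  · simp
  · simp
  · rintro _ ⟨s, ⟨s0, s1⟩, rfl⟩
    refine curve_comp_mem_L hn hw hγ hm (ht.line ht' ⟨s0, s1⟩) fun i hi => ?_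
    rcases hgap i hi with ⟨j, hj, h1, h2, h3, h4⟩ | ⟨h1, h2⟩
    · exact Or.inl ⟨j, hj, by nlinarith, by nlinarith⟩
    · exact Or.inr (by nlinarith)

/-- The curve of `w` is affine between consecutive times. -/
def AffineTimes (n m : ℕ) (t : ℕ → ℝ) : Prop :=
  ∀ i < m, ∃ j < n, (j : ℝ) ≤ n * t i ∧ n * t (i + 1) ≤ j + 1

theorem AffineTimes.insert {n m : ℕ} {t : ℕ → ℝ} (h : AffineTimes n m t) {p : ℕ}
    (hp : p < m) {x : ℝ} (hx : x ∈ Ioo (t p) (t (p + 1))) :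
    AffineTimes n (m + 1) (insertTime p x t) := by
  intro i hi
  have hn' : (0 : ℝ) ≤ n := Nat.cast_nonneg n
  rw [insertTime, insertTime]
  rcases (by omega : i < p ∨ i = p ∨ i = p + 1 ∨ p + 2 ≤ i) with h1 | rfl | rfl | h1
  · rw [if_pos h1.le, if_pos (by omega)]
    exact h i (by omega)
  · obtain ⟨j, hj, h1, h2⟩ := h i hp
    refine ⟨j, hj, by simpa using h1, ?_⟩
    simp only [Nat.not_succ_le_self, if_false, if_true]
    nlinarith [hx.2]
  · obtain ⟨j, hj, h1, h2⟩ := h p hp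
    refine ⟨j, hj, ?_, by simpa using h2⟩
    simp only [Nat.not_succ_le_self, if_false, if_true]
    nlinarith [hx.1]
  · obtain ⟨q, rfl⟩ : ∃ q, i = q + 1 := ⟨i - 1, by omega⟩
    rw [if_neg (by omega), if_neg (by omega), if_neg (by omega), if_neg (by omega)]
    exact h q (by omega)

section insert

variable {n m : ℕ} {w : Seq} {η ρ μ : ℝ} {t : ℕ → ℝ}

theorem joinedIn_insertTime (hn : 0 < n) (hw : w ∈ P n) (hγ : Tame univ η ρ μ (curve n w))
    (ht : FineTimes m 1 t) (ha : AffineTimes n m t) {p : ℕ} (hp : p < m) {x y : ℝ}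
    (hx : x ∈ Ioo (t p) (t (p + 1))) (hy : y ∈ Ioo (t p) (t (p + 1))) :
    JoinedIn (L (m + 1)) (fun i => curve n w (insertTime p x t i))
      fun i => curve n w (insertTime p y t i) := by
  refine joinedIn_L_of_times hn hw hγ (by omega) (ht.insert hp hx) (ht.insert hp hy) fun i hi => ?_
  left
  have hn' : (0 : ℝ) ≤ n := Nat.cast_nonneg n
  simp only [insertTime]
  rcases (by omega : i < p ∨ i = p ∨ i = p + 1 ∨ p + 2 ≤ i) with h1 | rfl | rfl | h1
  · obtain ⟨j, hj, h2, h3⟩ := ha i (by omega)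
    exact ⟨j, hj, by simp [h1.le, h2], by simp [Nat.succ_le_of_lt h1, h3], by simp [h1.le, h2],
      by simp [Nat.succ_le_of_lt h1, h3]⟩
  · obtain ⟨j, hj, h1, h2⟩ := ha i hp
    refine ⟨j, hj, ?_, ?_, ?_, ?_⟩ <;> simp only [Nat.not_succ_le_self, le_refl, if_false, if_true] <;>
      nlinarith [hx.1, hx.2, hy.1, hy.2]
  · obtain ⟨j, hj, h1, h2⟩ := ha p hp
    refine ⟨j, hj, ?_, ?_, ?_, ?_⟩ <;> simp <;> nlinarith [hx.1, hx.2, hy.1, hy.2]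
  · obtain ⟨q, rfl⟩ : ∃ q, i = q + 1 := ⟨i - 1, by omega⟩
    obtain ⟨j, hj, h2, h3⟩ := ha q (by omega)
    rw [if_neg (by omega), if_neg (by omega), if_neg (by omega), if_neg (by omega),
      if_neg (by omega), if_neg (by omega), if_neg (by omega), if_neg (by omega)]
    exact ⟨j, hj, h2, h3, h2, h3⟩

/-- To push an inserted time past an old one, bring it within κ ≤ μ of it. In the transition the
only edge that is not on the polygon cuts a corner during a time of at most μ, which tameness
permits. -/
theorem exists_joinedIn_insertTime_succ (hn : 0 < n) (hw : w ∈ P n)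
    (hγ : Tame univ η ρ μ (curve n w)) (ht : FineTimes m 1 t) (ha : AffineTimes n m t) {p : ℕ}
    (hp : p + 1 < m) : ∃ x ∈ Ioo (t p) (t (p + 1)), ∃ y ∈ Ioo (t (p + 1)) (t (p + 2)),
      JoinedIn (L (m + 1)) (fun i => curve n w (insertTime p x t i))
        fun i => curve n w (insertTime (p + 1) y t i) := by
  have hn' : (0 : ℝ) ≤ n := Nat.cast_nonneg n
  have l0 := ht.lt p (by omega)
  have l1 := ht.lt (p + 1) hp
  have hμ := hγ.mesh_pos
  obtain ⟨κ, k0, k1, k2, k3⟩ : ∃ κ, 0 < κ ∧ κ < t (p + 1) - t p ∧ κ < t (p + 2) - t (p + 1) ∧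
      κ ≤ μ := by
    refine ⟨min ((t (p + 1) - t p) / 2) (min ((t (p + 2) - t (p + 1)) / 2) μ), ?_, ?_, ?_, ?_⟩
    · exact lt_min (by linarith) (lt_min (by linarith) hμ)
    · exact (min_le_left _ _).trans_lt (by linarith)
    · exact ((min_le_right _ _).trans (min_le_left _ _)).trans_lt (by linarith)
    · exact (min_le_right _ _).trans (min_le_right _ _)
  have hx : t (p + 1) - κ ∈ Ioo (t p) (t (p + 1)) := ⟨by linarith, by linarith⟩
  have hy : t (p + 1) + κ ∈ Ioo (t (p + 1)) (t (p + 2)) := ⟨by linarith, by linarith⟩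
  refine ⟨_, hx, _, hy, ?_⟩
  refine joinedIn_L_of_times hn hw hγ (by omega) (ht.insert (by omega) hx) (ht.insert hp hy)
    fun i hi => ?_
  simp only [insertTime]
  rcases (by omega : i < p ∨ i = p ∨ i = p + 1 ∨ i = p + 2 ∨ p + 3 ≤ i)
    with h1 | rfl | rfl | rfl | h1
  · left
    obtain ⟨j, hj, h2, h3⟩ := ha i (by omega)
    rw [if_pos (by omega), if_pos (by omega), if_pos (by omega), if_pos (by omega)]
    exact ⟨j, hj, h2, h3, h2, h3⟩
  · left
    obtain ⟨j, hj, h2, h3⟩ := ha i (by omega)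
    refine ⟨j, hj, ?_, ?_, ?_, ?_⟩ <;> simp <;> nlinarith
  · right
    simp [k3]
  · left
    obtain ⟨j, hj, h2, h3⟩ := ha (p + 1) (by omega)
    refine ⟨j, hj, ?_, ?_, ?_, ?_⟩ <;> simp <;> nlinarith
  · left
    obtain ⟨q, rfl⟩ : ∃ q, i = q + 1 := ⟨i - 1, by omega⟩
    obtain ⟨j, hj, h2, h3⟩ := ha q (by omega)
    rw [if_neg (by omega), if_neg (by omega), if_neg (by omega), if_neg (by omega),
      if_neg (by omega), if_neg (by omega), if_neg (by omega), if_neg (by omega)]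
    exact ⟨j, hj, h2, h3, h2, h3⟩

theorem joinedIn_insertTime' (hn : 0 < n) (hw : w ∈ P n) (hγ : Tame univ η ρ μ (curve n w))
    (ht : FineTimes m 1 t) (ha : AffineTimes n m t) {p q : ℕ} (hp : p < m) (hq : q < m) {x y : ℝ}
    (hx : x ∈ Ioo (t p) (t (p + 1))) (hy : y ∈ Ioo (t q) (t (q + 1))) :
    JoinedIn (L (m + 1)) (fun i => curve n w (insertTime p x t i))
      fun i => curve n w (insertTime q y t i) := by
  have key : ∀ p, p < m → ∀ x ∈ Ioo (t p) (t (p + 1)),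
      JoinedIn (L (m + 1)) (fun i => curve n w (insertTime 0 ((t 0 + t 1) / 2) t i))
        fun i => curve n w (insertTime p x t i) := by
    intro p
    induction p with
    | zero => exact fun hp x hx => joinedIn_insertTime hn hw hγ ht ha hp (ht.half_mem hp) hx
    | succ p ih =>
      intro hp x hx
      obtain ⟨x', hx', y', hy', hj⟩ := exists_joinedIn_insertTime_succ hn hw hγ ht ha hp
      exact (ih (by omega) x' hx').trans (hj.trans (joinedIn_insertTime hn hw hγ ht ha hp hy' hx))
  exact (key p hp x hx).symm.trans (key q hq y hy)

/-- The curve is affine between consecutive times, so the midpoint of two samples is the sample at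
the mean time. -/
theorem insertMid_curve_comp (α : ℕ → ℕ) (hw : w ∈ P n) (ht : FineTimes m 1 t)
    (ha : AffineTimes n m t) (hα : α m < m) : (insertMid α m fun i => curve n w (t i)) =
      fun i => curve n w (insertTime (α m) ((t (α m) + t (α m + 1)) / 2) t i) := by
  funext i
  rw [insertMid_apply, insertTime]
  split_ifs with h1 h2
  · rfl
  · obtain ⟨j, hj, h3, h4⟩ := ha _ hα
    have := ht.lt _ hα
    have hn' : (0 : ℝ) ≤ n := Nat.cast_nonneg n
    have key : ∀ x ∈ Icc (t (α m)) (t (α m + 1)), curve n w x =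
        w j + (n * x - j) • (w (j + 1) - w j) := by
      intro x hx
      rw [curve, pin_eq_self hw, hinge_eq hj w (Or.inr ?_) (Or.inr ?_)] <;> nlinarith [hx.1, hx.2]
    rw [key _ ⟨le_rfl, this.le⟩, key _ ⟨this.le, le_rfl⟩, key _ ⟨by linarith, by linarith⟩,
      midpoint_eq_smul_add, invOf_eq_inv]
    module
  · rfl

end insert

theorem affineTimes_uniform {n : ℕ} (hn : 0 < n) :
    AffineTimes n n fun i => min ((i : ℝ) / n) 1 := by
  intro i hi
  have hn' : (0 : ℝ) < n := Nat.cast_pos.2 hn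
  have h1 : ((i : ℝ) + 1) / n ≤ 1 := by rw [div_le_one hn']; exact_mod_cast hi
  have h2 : (i : ℝ) / n ≤ 1 := by rw [div_le_one hn']; exact_mod_cast hi.le
  refine ⟨i, hi, ?_, ?_⟩
  · simp only
    rw [min_eq_left h2, mul_div_cancel₀ _ hn'.ne']
  · push_cast
    rw [min_eq_left h1, mul_div_cancel₀ _ hn'.ne']

theorem uniform_one {n : ℕ} (hn : 0 < n) : FineTimes n 1 fun i => min ((i : ℝ) / n) 1 :=
  FineTimes.uniform hn (by
    rw [div_le_one (Nat.cast_pos.2 hn)]; exact_mod_cast hn)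

theorem curve_uniform {n : ℕ} (hn : 0 < n) {w : Seq} (hw : w ∈ P n) :
    (fun i : ℕ => curve n w (min ((i : ℝ) / n) 1)) = w := by
  funext i
  have hn' : (0 : ℝ) < n := Nat.cast_pos.2 hn
  rcases le_or_gt n i with hi | hi
  · rw [min_eq_right, curve_one hn, hw.2.1 i hi]
    rw [le_div_iff₀ hn', one_mul]
    exact_mod_cast hi
  · have h2 : (i : ℝ) / n ≤ 1 := by rw [div_le_one hn']; exact_mod_cast hi.le
    rw [min_eq_left h2, curve_eq_poly hn hw ⟨by positivity, h2⟩, mul_div_cancel₀ _ hn'.ne',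
      poly_natCast]

theorem insertMid_mem {α : ℕ → ℕ} (hα : ∀ n, 3 ≤ n → α n + 3 ≤ n) {n : ℕ} (hn : 3 ≤ n) {w : Seq}
    (hw : w ∈ L n) : insertMid α n w ∈ L (n + 1) := by
  have hαn := hα n hn
  obtain ⟨η, ρ, μ, h⟩ := exists_tame_curve (by omega) hw
  have ht := uniform_one (n := n) (by omega)
  have ha := affineTimes_uniform (n := n) (by omega)
  have e := insertMid_curve_comp α hw.1 ht ha (by omega)
  rw [curve_uniform (by omega) hw.1] at e
  rw [e]
  have hx := ht.half_mem (p := α n) (by omega)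
  exact curve_comp_mem_L (by omega) hw.1 h.self_of_nhds (by omega) (ht.insert (by omega) hx)
    fun i hi => Or.inl (ha.insert (by omega) hx i hi)

theorem system_L {α : ℕ → ℕ} (hα : ∀ n, 3 ≤ n → α n + 3 ≤ n) (C : Set (E3 →ₗ[ℝ] ℝ)) :
    System L (insertMid α) C := by
  refine ⟨fun n v hv => hv.1, fun n hn v hv => insertMid_mem hα hn hv,
    fun hγ hn hw ht ha => ha.mem_L hγ (by omega) hw ht, fun hγ hn ht _ => ?_⟩
  have := hα _ hn
  exact weaklyAdapted_insertMid hγ (by omega) ht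

/-- The insertion of vertices on the segments does not change the component of a PL knot. -/
theorem Represents.insertTime {α : ℕ → ℕ} (hα : ∀ n, 3 ≤ n → α n + 3 ≤ n) {n m : ℕ} {w : Seq}
    {η ρ μ : ℝ} {t : ℕ → ℝ} {c : ZerothHomotopy (Lim L (insertMid α))} (hn : 0 < n) (hw : w ∈ P n)
    (hγ : Tame univ η ρ μ (curve n w)) (ht : FineTimes m 1 t) (ha : AffineTimes n m t)
    (hc : Represents L (insertMid α) m (fun i => curve n w (t i)) c) {p : ℕ} (hp : p < m) {x : ℝ}
    (hx : x ∈ Ioo (t p) (t (p + 1))) :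
    Represents L (insertMid α) (m + 1) (fun i => curve n w (Plumbers.insertTime p x t i)) c := by
  have hm := hc.three_le
  have hαm := hα m hm
  have h := hc.succ (insertMid_mem hα hm hc.mem)
  rw [insertMid_curve_comp α hw ht ha (by omega)] at h
  exact h.of_joinedIn (joinedIn_insertTime' hn hw hγ ht ha (by omega) hp
    (ht.half_mem (by omega)) hx)

/-- The component of a PL knot is represented by the lists of points on its curve. -/
theorem Represents.curve_comp {α : ℕ → ℕ} (hα : ∀ n, 3 ≤ n → α n + 3 ≤ n) {n : ℕ} {w : Seq}
    {c : ZerothHomotopy (Lim L (insertMid α))} (hc : Represents L (insertMid α) n w c)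
    {η ρ μ : ℝ} (hγ : Tame univ η ρ μ (curve n w)) {m : ℕ} {t : ℕ → ℝ} (hm : 3 ≤ m)
    (ht : FineTimes m μ t) : Represents L (insertMid α) m (fun i => curve n w (t i)) c := by
  have hn := hc.three_le
  have hw := hc.mem
  have hcont : Continuous (curve n w) := (continuous_curve n).comp (Continuous.prodMk_right w)
  obtain ⟨c', hc'⟩ := (system_L hα univ).exists_class hγ hcont
  -- The uniform times give back `w`, and between them the curve is affine; inserting further times
  -- keeps the component and ends with fine times, to which the class of the curve applies.
  obtain ⟨m', t', hm', ht', -, hr⟩ := exists_refinement (A := univ)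
    (Q := fun m t => AffineTimes n m t ∧ Represents L (insertMid α) m (fun i => curve n w (t i)) c)
    (uniform_one (n := n) (by omega))
    ⟨affineTimes_uniform (by omega), by rwa [curve_uniform (by omega) hw.1]⟩
    (fun a b hab => ⟨(a + b) / 2, mem_univ _, by constructor <;> linarith⟩)
    (fun m t ht hQ p hp x _ hx => ⟨hQ.1.insert hp hx,
      hQ.2.insertTime hα (by omega) hw.1 hγ ht hQ.1 hp hx⟩) hγ.mesh_pos
  rw [hr.unique (hc' m' t' (by omega) ht')]
  exact hc' m t hm ht

theorem continuous_insertMid (α : ℕ → ℕ) (n : ℕ) : Continuous (insertMid α n) := by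
  refine continuous_pi fun i => ?_
  simp only [insertMid_apply, midpoint_eq_smul_add]
  split_ifs <;> fun_prop

theorem insertMid_injective (α : ℕ → ℕ) (n : ℕ) : Function.Injective (insertMid α n) := by
  intro v w h
  funext i
  rcases le_or_gt i (α n) with hi | hi
  · have := congrFun h i
    rwa [insertMid_apply, insertMid_apply, if_pos hi, if_pos hi] at this
  · have := congrFun h (i + 1)
    rwa [insertMid_apply, insertMid_apply, if_neg (by omega), if_neg (by omega),
      if_neg (by omega), if_neg (by omega)] at this

/-! ### Polygons along plumbers' curves -/

/-- The coordinate that belongs to an index of the interleaved list. -/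
def cls (m : ℕ) : Fin 3 := ⟨m % 3, Nat.mod_lt _ (by norm_num)⟩

@[simp] theorem cls_add_three (m : ℕ) : cls (m + 3) = cls m := by
  simp [cls]

theorem corner_cls (v : Seq) {k m : ℕ} (h1 : k ≤ m) (h2 : m < k + 3) :
    corner v k (cls m) = val v m := corner_apply v h1 h2 rfl

theorem exists_cls (k : ℕ) (c : Fin 3) : ∃ m, k ≤ m ∧ m < k + 3 ∧ cls m = c := by
  obtain ⟨m, h1, h2, h3⟩ := exists_class k c
  exact ⟨m, h1, h2, Fin.ext h3⟩

/-- A signed coordinate increases along the edges `j, …, k`, or separates the edges `j` and `k`. -/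
def Apart (Z : Seq) (j k : ℕ) : Prop :=
  ∃ (c : Fin 3) (s : ℝ), ((∀ i, j ≤ i → i ≤ k → 0 ≤ s * (Z (i + 1) c - Z i c)) ∧
      ∃ i, j ≤ i ∧ i ≤ k ∧ 0 < s * (Z (i + 1) c - Z i c)) ∨
    (0 < s * (Z k c - Z j c) ∧ 0 < s * (Z (k + 1) c - Z j c) ∧ 0 < s * (Z k c - Z (j + 1) c) ∧
      0 < s * (Z (k + 1) c - Z (j + 1) c))

theorem injOn_of_apart {n : ℕ} {Z : Seq} (h : ∀ j k, j ≤ k → k < n → Apart Z j k) :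
    InjOn (poly Z) (Icc 0 n) := by
  refine injOn_poly fun j k hjk hk => ?_
  obtain ⟨c, s, ⟨h1, i, hi1, hi2, hi⟩ | ⟨h1, h2, h3, h4⟩⟩ := h j k hjk hk
  · refine Or.inl ⟨s • (EuclideanSpace.proj c : E3 →L[ℝ] ℝ).toLinearMap, fun i hi1 hi2 => ?_,
      i, hi1, hi2, ?_⟩
    · have := h1 i hi1 hi2
      simp only [LinearMap.smul_apply, ContinuousLinearMap.coe_coe, PiLp.proj_apply, smul_eq_mul]
      linarith
    · simp only [LinearMap.smul_apply, ContinuousLinearMap.coe_coe, PiLp.proj_apply, smul_eq_mul]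
      linarith
  · right
    rw [Set.disjoint_left]
    rintro x ⟨a, b, ha, hb, hab, rfl⟩ ⟨a', b', ha', hb', hab', he⟩
    have := congrArg (fun x : E3 => s * x c) he
    simp only [PiLp.add_apply, PiLp.smul_apply, smul_eq_mul] at this
    have ea : a = 1 - b := by linarith
    have ea' : a' = 1 - b' := by linarith
    have key : 0 < a * a' * (s * (Z k c - Z j c)) + a * b' * (s * (Z (k + 1) c - Z j c)) +
        b * a' * (s * (Z k c - Z (j + 1) c)) + b * b' * (s * (Z (k + 1) c - Z (j + 1) c)) := by
      have t1 := mul_nonneg (mul_nonneg ha ha') h1.le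
      have t2 := mul_nonneg (mul_nonneg ha hb') h2.le
      have t3 := mul_nonneg (mul_nonneg hb ha') h3.le
      have t4 := mul_nonneg (mul_nonneg hb hb') h4.le
      rcases ha.lt_or_eq with ha | ha <;> rcases ha'.lt_or_eq with ha' | ha'
      · have := mul_pos (mul_pos ha ha') h1; linarith
      · have := mul_pos (mul_pos ha (show 0 < b' by linarith)) h2; linarith
      · have := mul_pos (mul_pos (show 0 < b by linarith) ha') h3; linarith
      · have := mul_pos (mul_pos (show 0 < b by linarith) (show 0 < b' by linarith)) h4; linarith
    rw [ea, ea'] at key this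
    nlinarith [key, this]

/-- Conditions on the vertices `Z 0, …, Z (3 n)` under which they span an embedded polygon close
to the plumbers' curve with interleaved coordinates `Y`. -/
structure Follows (n : ℕ) (ε : ℝ) (Y : ℕ → ℝ) (Z : Seq) : Prop where
  near : ∀ k m, k ≤ 3 * n → k ≤ m → m < k + 3 → |Z k (cls m) - Y m| ≤ 3 / 2 * ε
  strict : ∀ i s, i < 3 * n → 0 < s * (Y (i + 3) - Y i) → 0 < s * (Z (i + 1) (cls i) - Z i (cls i))
  prev : ∀ i s, i + 1 < 3 * n → 0 < s * (Y (i + 3) - Y i) →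
    0 ≤ s * (Z (i + 2) (cls i) - Z (i + 1) (cls i))
  next : ∀ i s, i + 1 < 3 * n → 0 < s * (Y (i + 4) - Y (i + 1)) →
    0 ≤ s * (Z (i + 1) (cls (i + 1)) - Z i (cls (i + 1)))
  prev_zero : ∀ i s, i + 1 < 3 * n → Y (i + 4) - Y (i + 1) = 0 → 0 < s * (Y (i + 3) - Y i) →
    0 < s * (Z (i + 2) (cls i) - Z (i + 1) (cls i))
  next_zero : ∀ i s, i + 1 < 3 * n → Y (i + 3) - Y i = 0 → 0 < s * (Y (i + 4) - Y (i + 1)) →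
    0 < s * (Z (i + 1) (cls (i + 1)) - Z i (cls (i + 1)))
  flat : ∀ i, i + 2 < 3 * n → Y (i + 3) - Y i = 0 → ε ≤ |Y (i + 4) - Y (i + 1)| →
    Z (i + 2) (cls (i + 2)) = Z (i + 1) (cls (i + 2))

/-- Conditions on a nondegenerate plumbers' curve are convex. -/
theorem Follows.line {n : ℕ} {ε : ℝ} {Y : ℕ → ℝ} {Z Z' : Seq} (h : Follows n ε Y Z)
    (h' : Follows n ε Y Z') (hY : ∀ i, i < 3 * n → Y (i + 3) - Y i ≠ 0) {t : ℝ}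
    (ht : t ∈ Icc (0 : ℝ) 1) : Follows n ε Y (Z + t • (Z' - Z)) := by
  have e : ∀ k c, (Z + t • (Z' - Z)) k c = (1 - t) * Z k c + t * Z' k c := fun k c => by
    simp only [Pi.add_apply, Pi.smul_apply, Pi.sub_apply, PiLp.add_apply, PiLp.smul_apply,
      PiLp.sub_apply, smul_eq_mul]
    ring
  have h0 := ht.1
  have h1 : 0 ≤ 1 - t := by linarith [ht.2]
  refine ⟨fun k m h2 h3 h4 => ?_, fun i s h2 h3 => ?_, fun i s h2 h3 => ?_, fun i s h2 h3 => ?_,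
    fun i s h2 h3 => ?_, fun i s h2 h3 => ?_, fun i h2 h3 => ?_⟩
  · have a := h.near k m h2 h3 h4
    have b := h'.near k m h2 h3 h4
    rw [e]
    rw [abs_le] at a b ⊢
    constructor <;> nlinarith
  · have a := h.strict i s h2 h3
    have b := h'.strict i s h2 h3
    rw [e, e]
    rcases h0.lt_or_eq with h0 | h0
    · nlinarith [mul_pos h0 b, mul_nonneg h1 a.le]
    · rw [← h0]; linarith
  · have a := h.prev i s h2 h3
    have b := h'.prev i s h2 h3
    rw [e, e]
    nlinarith [mul_nonneg h0 b, mul_nonneg h1 a]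
  · have a := h.next i s h2 h3
    have b := h'.next i s h2 h3
    rw [e, e]
    nlinarith [mul_nonneg h0 b, mul_nonneg h1 a]
  · exact absurd h3 (hY (i + 1) h2)
  · exact absurd h3 (hY i (by omega))
  · exact absurd h3 (hY i (by omega))

theorem abs_two_sub {a b x y r : ℝ} (ha : |a - x| ≤ r) (hb : |b - y| ≤ r) {s : ℝ}
    (hs : s = 1 ∨ s = -1) : s * (y - x) - 2 * r ≤ s * (b - a) := by
  rw [abs_le] at ha hb
  rcases hs with rfl | rfl <;> linarith

/-- For edges at most three indices apart, the signs of the edges yield a coordinate that is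
monotone from the first to the last edge and increases somewhere; otherwise, and for distant edges,
a gap 5ε of the plumbers' curve exceeds the two errors 3ε/2. -/
theorem Follows.apart {n : ℕ} {ε : ℝ} {Y : ℕ → ℝ} {Z : Seq} (h : Follows n ε Y Z)
    (g : Gap n ε Y) {j k : ℕ} (hjk : j ≤ k) (hk : k < 3 * n) : Apart Z j k := by
  have hε := g.pos
  have long : ∀ i, i < 3 → Y (i + 3) - Y i ≠ 0 := fun i hi => by
    have := g.first_long hi; intro h0; linarith
  have long' : ∀ i, i < 3 * n → 3 * n ≤ i + 3 → Y (i + 3) - Y i ≠ 0 := fun i hi hi' => by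
    have := g.last_long hi' hi; intro h0; linarith
  have pos : ∀ i, Y (i + 3) - Y i ≠ 0 → ∃ s : ℝ, (s = 1 ∨ s = -1) ∧ 0 < s * (Y (i + 3) - Y i) :=
    fun i hi => (zero_or_sign _).resolve_left hi
  have same : ∀ i, i + 2 < 3 * n → |Y (i + 4) - Y (i + 1)| < 5 * ε →
      |Y (i + 5) - Y (i + 2)| < 5 * ε → ∃ s : ℝ, 0 < s * (Y (i + 3) - Y i) ∧
        0 < s * (Y (i + 6) - Y (i + 3)) := fun i hi h1 h2 => by
    rcases g.same_direction hi h1 h2 with t | t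
    · exact ⟨1, by linarith, by linarith⟩
    · exact ⟨-1, by linarith, by linarith⟩
  rcases (by omega : k = j ∨ k = j + 1 ∨ k = j + 2 ∨ k = j + 3 ∨ j + 4 ≤ k) with
    rfl | rfl | rfl | rfl | hjk
  · -- a single edge
    have one : ∀ c s, 0 < s * (Z (k + 1) c - Z k c) → Apart Z k k := fun c s hs =>
      ⟨c, s, Or.inl ⟨fun i h1 h2 => by obtain rfl : i = k := by omega
                                       exact hs.le, k, le_rfl, le_rfl, hs⟩⟩
    by_cases h0 : Y (k + 3) - Y k = 0
    · have k1 : 3 ≤ k := by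
        by_contra hc; exact long k (by omega) h0
      have k2 : k + 3 < 3 * n := by
        by_contra hc; exact long' k (by omega) (by omega) h0
      obtain ⟨i, rfl⟩ : ∃ i, k = i + 1 := ⟨k - 1, by omega⟩
      by_cases h1 : Y (i + 3) - Y i = 0
      · have h2 : Y (i + 5) - Y (i + 2) ≠ 0 := fun h2 => by
          have := g.one_long (i := i) (by omega)
          rw [h1, show Y (i + 4) - Y (i + 1) = 0 from h0, h2, abs_zero] at this
          rcases this with t | t | t <;> linarith
        obtain ⟨s, -, hs⟩ := pos (i + 2) h2
        exact one _ s (h.next_zero (i + 1) s (by omega) h0 hs)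
      · obtain ⟨s, -, hs⟩ := pos i h1
        exact one _ s (h.prev_zero i s (by omega) h0 hs)
    · obtain ⟨s, -, hs⟩ := pos k h0
      exact one _ s (h.strict k s hk hs)
  · -- two edges
    have two : ∀ c s, 0 ≤ s * (Z (j + 1) c - Z j c) → 0 ≤ s * (Z (j + 2) c - Z (j + 1) c) →
        (0 < s * (Z (j + 1) c - Z j c) ∨ 0 < s * (Z (j + 2) c - Z (j + 1) c)) →
        Apart Z j (j + 1) := fun c s h1 h2 h3 =>
      ⟨c, s, Or.inl ⟨fun i i1 i2 => by
        rcases (by omega : i = j ∨ i = j + 1) with rfl | rfl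
        exacts [h1, h2], h3.elim (fun h3 => ⟨j, by omega, by omega, h3⟩)
          fun h3 => ⟨j + 1, by omega, by omega, h3⟩⟩⟩
    by_cases h1 : Y (j + 4) - Y (j + 1) = 0
    · by_cases h0 : Y (j + 3) - Y j = 0
      · have j1 : 3 ≤ j := by
          by_contra hc; exact long j (by omega) h0
        have j2 : j + 4 < 3 * n := by
          by_contra hc; exact long' (j + 1) (by omega) (by omega) h1
        obtain ⟨i, rfl⟩ : ∃ i, j = i + 1 := ⟨j - 1, by omega⟩
        obtain ⟨s, hs, hs'⟩ := same i (by omega)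
          (by rw [show Y (i + 4) - Y (i + 1) = 0 from h0, abs_zero]; linarith)
          (by rw [show Y (i + 5) - Y (i + 2) = 0 from h1, abs_zero]; linarith)
        have t1 := h.prev i s (by omega) hs
        have t2 := h.next_zero (i + 2) s (by omega) h1 hs'
        rw [show i + 2 + 1 = i + 3 from rfl, cls_add_three] at t2
        exact two _ s t1 t2.le (Or.inr t2)
      · obtain ⟨s, -, hs⟩ := pos j h0
        have t := h.strict j s (by omega) hs
        exact two _ s t.le (h.prev j s hk hs) (Or.inl t)
    · obtain ⟨s, -, hs⟩ := pos (j + 1) h1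
      have t := h.strict (j + 1) s (by omega) hs
      exact two _ s (h.next j s hk hs) t.le (Or.inr t)
  · -- three edges
    have three : ∀ c s, 0 ≤ s * (Z (j + 1) c - Z j c) → 0 ≤ s * (Z (j + 2) c - Z (j + 1) c) →
        0 ≤ s * (Z (j + 3) c - Z (j + 2) c) →
        (0 < s * (Z (j + 1) c - Z j c) ∨ 0 < s * (Z (j + 2) c - Z (j + 1) c) ∨
          0 < s * (Z (j + 3) c - Z (j + 2) c)) →
        Apart Z j (j + 2) := fun c s h1 h2 h3 h4 =>
      ⟨c, s, Or.inl ⟨fun i i1 i2 => by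
        rcases (by omega : i = j ∨ i = j + 1 ∨ i = j + 2) with rfl | rfl | rfl
        exacts [h1, h2, h3], h4.elim (fun h4 => ⟨j, by omega, by omega, h4⟩)
          fun h4 => h4.elim (fun h4 => ⟨j + 1, by omega, by omega, h4⟩)
            fun h4 => ⟨j + 2, by omega, by omega, h4⟩⟩⟩
    by_cases h1 : Y (j + 4) - Y (j + 1) = 0
    · have j2 : j + 4 < 3 * n := by
        by_contra hc; exact long' (j + 1) (by omega) (by omega) h1
      rcases lt_or_ge |Y (j + 5) - Y (j + 2)| ε with h2 | h2
      · obtain ⟨s, hs, hs'⟩ := same j (by omega) (by rw [h1, abs_zero]; linarith) (by linarith)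
        have t1 := h.strict j s (by omega) hs
        have t2 := h.prev j s (by omega) hs
        have t3 := h.next (j + 2) s (by
          by_contra hc
          have := g.last_long (i := j + 2) (by omega) (by omega)
          rw [abs_lt] at h2
          have e : Y (j + 2 + 3) = Y (j + 5) := rfl
          linarith) hs'
        rw [show j + 2 + 1 = j + 3 from rfl, cls_add_three] at t3
        exact three _ s t1.le t2 t3 (Or.inl t1)
      · have h2' : Y (j + 5) - Y (j + 2) ≠ 0 := fun h0 => by
          rw [h0, abs_zero] at h2; linarith
        by_cases h0 : Y (j + 3) - Y j = 0
        · have j1 : 3 ≤ j := by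
            by_contra hc; exact long j (by omega) h0
          obtain ⟨i, rfl⟩ : ∃ i, j = i + 1 := ⟨j - 1, by omega⟩
          obtain ⟨s, hs, hs'⟩ := same i (by omega)
            (by rw [show Y (i + 4) - Y (i + 1) = 0 from h0, abs_zero]; linarith)
            (by rw [show Y (i + 5) - Y (i + 2) = 0 from h1, abs_zero]; linarith)
          have t1 := h.prev i s (by omega) hs
          have t2 := h.next (i + 2) s (by omega) hs'
          have t3 := h.strict (i + 3) s (by omega) hs'
          rw [show i + 2 + 1 = i + 3 from rfl, cls_add_three] at t2
          rw [cls_add_three] at t3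
          exact three _ s t1 t2 t3.le (Or.inr (Or.inr t3))
        · obtain ⟨s, -, hs⟩ := pos j h0
          have t1 := h.strict j s (by omega) hs
          have t2 := h.prev j s (by omega) hs
          -- The middle pipe has length zero and the one after it is long, hence not buckled
          -- against; the third edge therefore does not change the coordinate of pipe j at all.
          have t3 := h.flat (j + 1) (by
            by_contra hc
            exact long' (j + 1) (by omega) (by omega) h1) h1 h2
          rw [show j + 1 + 2 = j + 3 from rfl, cls_add_three] at t3
          exact three _ s t1.le t2 (by rw [t3, sub_self, mul_zero]) (Or.inl t1)
    · obtain ⟨s, -, hs⟩ := pos (j + 1) h1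
      have t := h.strict (j + 1) s (by omega) hs
      exact three _ s (h.next j s (by omega) hs) t.le (h.prev (j + 1) s (by omega) hs)
        (Or.inr (Or.inl t))
  · -- four edges
    -- The pipe i itself provides the separation: its length 5ε exceeds the errors at the vertices
    -- of the outer two edges.
    have gap : ∀ i, j + 1 ≤ i → i ≤ j + 2 → 5 * ε ≤ |Y (i + 3) - Y i| → Apart Z j (j + 3) := by
      intro i h1 h2 h3
      obtain ⟨s, hs, h4⟩ := (long_or_short (Y (i + 3) - Y i) (5 * ε)).resolve_left (by
        intro h0; linarith)
      refine ⟨cls i, s, Or.inr ?_⟩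
      have n1 := h.near j i (by omega) (by omega) (by omega)
      have n2 := h.near (j + 1) i (by omega) (by omega) (by omega)
      have n3 := h.near (j + 3) (i + 3) (by omega) (by omega) (by omega)
      have n4 := h.near (j + 3 + 1) (i + 3) (by omega) (by omega) (by omega)
      rw [cls_add_three] at n3 n4
      have t1 := abs_two_sub n1 n3 hs
      have t2 := abs_two_sub n1 n4 hs
      have t3 := abs_two_sub n2 n3 hs
      have t4 := abs_two_sub n2 n4 hs
      refine ⟨?_, ?_, ?_, ?_⟩ <;> linarith
    rcases lt_or_ge |Y (j + 4) - Y (j + 1)| (5 * ε) with h1 | h1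
    · rcases lt_or_ge |Y (j + 5) - Y (j + 2)| (5 * ε) with h2 | h2
      · obtain ⟨s, hs, hs'⟩ := same j (by omega) h1 h2
        have t1 := h.strict j s (by omega) hs
        have t2 := h.prev j s (by omega) hs
        have t3 := h.next (j + 2) s (by omega) hs'
        have t4 := h.strict (j + 3) s (by omega) hs'
        rw [show j + 2 + 1 = j + 3 from rfl, cls_add_three] at t3
        rw [cls_add_three] at t4
        refine ⟨cls j, s, Or.inl ⟨fun i i1 i2 => ?_, j, by omega, by omega, t1⟩⟩
        rcases (by omega : i = j ∨ i = j + 1 ∨ i = j + 2 ∨ i = j + 3) with rfl | rfl | rfl | rfl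
        exacts [t1.le, t2, t3, t4.le]
      · exact gap (j + 2) (by omega) le_rfl h2
    · exact gap (j + 1) le_rfl (by omega) h1
  · -- distant edges
    obtain ⟨a, ha⟩ := g.gap j k hjk hk
    obtain ⟨m1, a1, a2, a3⟩ := exists_cls j (cls a)
    obtain ⟨m2, b1, b2, b3⟩ := exists_cls (j + 1) (cls a)
    obtain ⟨m3, c1, c2, c3⟩ := exists_cls k (cls a)
    obtain ⟨m4, d1, d2, d3⟩ := exists_cls (k + 1) (cls a)
    have n1 := h.near j m1 (by omega) a1 a2
    have n2 := h.near (j + 1) m2 (by omega) b1 b2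
    have n3 := h.near k m3 (by omega) c1 c2
    have n4 := h.near (k + 1) m4 (by omega) d1 d2
    rw [a3] at n1
    rw [b3] at n2
    rw [c3] at n3
    rw [d3] at n4
    have a3 := Fin.ext_iff.1 a3
    have b3 := Fin.ext_iff.1 b3
    have c3 := Fin.ext_iff.1 c3
    have d3 := Fin.ext_iff.1 d3
    simp only [cls] at a3 b3 c3 d3
    obtain ⟨s, hs, e1, e2, e3, e4⟩ : ∃ s : ℝ, (s = 1 ∨ s = -1) ∧ 5 * ε ≤ s * (Y m3 - Y m1) ∧
        5 * ε ≤ s * (Y m4 - Y m1) ∧ 5 * ε ≤ s * (Y m3 - Y m2) ∧ 5 * ε ≤ s * (Y m4 - Y m2) := by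
      rcases ha with ha | ha
      · have t1 := ha m1 m3 (by omega) (by omega) (by omega) (by omega) a3 c3
        have t2 := ha m1 m4 (by omega) (by omega) (by omega) (by omega) a3 d3
        have t3 := ha m2 m3 (by omega) (by omega) (by omega) (by omega) b3 c3
        have t4 := ha m2 m4 (by omega) (by omega) (by omega) (by omega) b3 d3
        exact ⟨1, Or.inl rfl, by linarith, by linarith, by linarith, by linarith⟩
      · have t1 := ha m1 m3 (by omega) (by omega) (by omega) (by omega) a3 c3
        have t2 := ha m1 m4 (by omega) (by omega) (by omega) (by omega) a3 d3
        have t3 := ha m2 m3 (by omega) (by omega) (by omega) (by omega) b3 c3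
        have t4 := ha m2 m4 (by omega) (by omega) (by omega) (by omega) b3 d3
        exact ⟨-1, Or.inr rfl, by linarith, by linarith, by linarith, by linarith⟩
    have t1 := abs_two_sub n1 n3 hs
    have t2 := abs_two_sub n1 n4 hs
    have t3 := abs_two_sub n2 n3 hs
    have t4 := abs_two_sub n2 n4 hs
    exact ⟨cls a, s, Or.inr ⟨by linarith, by linarith, by linarith, by linarith⟩⟩

/-! ### Embeddedness of the buckled polygon -/

section buckling

variable {n : ℕ} {v : Seq} {j : ℕ}

theorem buckling_nonneg (n : ℕ) (v : Seq) (k : ℕ) : 0 ≤ buckling n v k := by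
  rw [buckling]
  split_ifs
  exacts [Real.sqrt_nonneg _, le_rfl]

/-- The real square root vanishes on negative arguments, so a single formula covers both cases and
continuity follows. -/
theorem buckling_eq_sqrt (h : 0 ≤ eps n v) (k : ℕ) :
    buckling n v k = √((eps n v ^ 2 - ‖disp v k‖ ^ 2) / 2) := by
  rw [buckling]
  split_ifs with h1
  · rfl
  · rw [Real.sqrt_eq_zero_of_nonpos]
    have := pow_le_pow_left₀ h (not_lt.1 h1) 2
    linarith

/-- The constant is an upper bound for √(1/2). -/
theorem buckling_le (h : 0 ≤ eps n v) (k : ℕ) : buckling n v k ≤ 3 / 4 * eps n v := by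
  rw [buckling_eq_sqrt h]
  refine Real.sqrt_le_iff.2 ⟨by linarith, ?_⟩
  nlinarith [sq_nonneg ‖disp v k‖, sq_nonneg (eps n v)]

theorem buckling_pos (h : 0 < eps n v) {k : ℕ} (hk : val v (k + 3) - val v k = 0) :
    0 < buckling n v k := by
  rw [buckling_eq_sqrt h.le, norm_disp, hk]
  apply Real.sqrt_pos.2
  have := sq_pos_of_pos h
  simp only [abs_zero]
  linarith

theorem buckling_eq_zero {k : ℕ} (hk : eps n v ≤ |val v (k + 3) - val v k|) :
    buckling n v k = 0 := by
  rw [buckling, if_neg]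
  rw [norm_disp]
  exact not_lt.2 hk

theorem disp_cls_self (v : Seq) (k : ℕ) : disp v k (cls k) = val v (k + 3) - val v k := by
  rw [disp_apply]
  exact if_pos rfl

theorem disp_cls_ne (v : Seq) {k m : ℕ} (h : m % 3 ≠ k % 3) : disp v k (cls m) = 0 := by
  rw [disp_apply, if_neg]
  exact fun h' => h h'.symm

theorem f_apply (n : ℕ) (v : Seq) (hj : j + 1 < 3 * n) (c : Fin 3) : f n v (j + 1) c =
    (1 - eps n v) * (corner v (j + 1) c + buckling n v j * disp v (j + 1) c -
      buckling n v (j + 1) * disp v j c) + eps n v / 2 := by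
  rw [f, if_neg (by omega), if_pos hj]
  simp [buckled, ones]

theorem f_apply_first (n : ℕ) (v : Seq) (hj : j + 1 < 3 * n) : f n v (j + 1) (cls (j + 1)) =
    (1 - eps n v) * (val v (j + 1) + buckling n v j * (val v (j + 4) - val v (j + 1))) +
      eps n v / 2 := by
  rw [f_apply n v hj, corner_cls v le_rfl (by omega), disp_cls_self, disp_cls_ne v (by omega)]
  ring

theorem f_apply_second (n : ℕ) (v : Seq) (hj : j + 1 < 3 * n) : f n v (j + 1) (cls (j + 2)) =
    (1 - eps n v) * val v (j + 2) + eps n v / 2 := by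
  rw [f_apply n v hj, corner_cls v (by omega) (by omega), disp_cls_ne v (by omega),
    disp_cls_ne v (by omega)]
  ring

theorem f_apply_third (n : ℕ) (v : Seq) (hj : j + 1 < 3 * n) : f n v (j + 1) (cls j) =
    (1 - eps n v) * (val v (j + 3) - buckling n v (j + 1) * (val v (j + 3) - val v j)) +
      eps n v / 2 := by
  rw [f_apply n v hj, disp_cls_self, disp_cls_ne v (by omega), ← cls_add_three,
    corner_cls v (by omega) (by omega)]
  ring

theorem convex_mem {x y t : ℝ} (hx : 0 ≤ x ∧ x ≤ 1) (hy : 0 ≤ y ∧ y ≤ 1) (ht : 0 ≤ t ∧ t < 1) :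
    0 ≤ x + t * (y - x) ∧ x + t * (y - x) ≤ 1 := by
  constructor <;> nlinarith [mul_nonneg ht.1 hy.1, mul_nonneg ht.1 (sub_nonneg.2 hy.2)]

theorem contract_mem {e b : ℝ} (he' : e < 1) (hb : 0 ≤ b) (hb' : b ≤ 1) :
    (1 - e) * b + e / 2 ∈ Icc (e / 2) (1 - e / 2) := by
  constructor <;> nlinarith

theorem abs_contract_sub_le {e b y d β : ℝ} (he : 0 < e) (he' : e < 1)
    (hb : 0 ≤ y) (hb' : y ≤ 1) (h : b - y = β * d) (hβ : 0 ≤ β) (hβ' : β ≤ 3 / 4 * e)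
    (hd : |d| ≤ 1) : |(1 - e) * b + e / 2 - y| ≤ 3 / 2 * e := by
  have h1 : |β * d| ≤ 3 / 4 * e := by
    rw [abs_mul, abs_of_nonneg hβ]
    nlinarith [abs_nonneg d]
  have h2 : (1 - e) * b + e / 2 - y = (1 - e) * (β * d) + e * (1 / 2 - y) := by rw [← h]; ring
  rw [h2]
  rw [abs_le] at h1 ⊢
  constructor <;> nlinarith

/-- The vertices of the polygon `f n v` satisfy the conditions for embeddedness. -/
theorem f_follows_and_mem (hn : 3 ≤ n) (hv : v ∈ K n) :
    Follows n (eps n v) (val v) (f n v) ∧ f n v ∈ P (3 * n) ∧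
      ∀ k, 0 < k → k < 3 * n → ∀ c, f n v k c ∈ Icc (eps n v / 2) (1 - eps n v / 2) := by
  have g := gap_of_mem_K hn hv
  have he := g.pos
  have he1 := g.le
  have b0 := buckling_nonneg n v
  have b1 := buckling_le (v := v) he.le
  have f0 : ∀ c, f n v 0 c = 0 := fun c => by rw [f, if_pos rfl]; rfl
  have f1 : ∀ k, 3 * n ≤ k → f n v k = ones := fun k hk => by
    rw [f, if_neg (by omega), if_neg (by omega)]
  have hd : ∀ i, |val v (i + 3) - val v i| ≤ 1 := fun i => by
    have := g.nonneg i; have := g.nonneg (i + 3); have := g.le_one i; have := g.le_one (i + 3)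
    rw [abs_le]; constructor <;> linarith
  have cube' : ∀ k, 0 < k → k < 3 * n → ∀ c,
      f n v k c ∈ Icc (eps n v / 2) (1 - eps n v / 2) := by
    intro k h1 h2 c
    obtain ⟨j, rfl⟩ : ∃ j, k = j + 1 := ⟨k - 1, by omega⟩
    have c1 := fun i => (⟨g.nonneg i, g.le_one i⟩ : 0 ≤ val v i ∧ val v i ≤ 1)
    have b2 : ∀ i, 0 ≤ buckling n v i ∧ buckling n v i < 1 := fun i =>
      ⟨b0 i, by linarith [b1 i]⟩
    obtain ⟨m, m1, m2, rfl⟩ := exists_cls j c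
    rcases (by omega : m = j ∨ m = j + 1 ∨ m = j + 2) with rfl | rfl | rfl
    · rw [f_apply_third n v h2]
      have := convex_mem (c1 (m + 3)) (c1 m) (b2 (m + 1))
      apply contract_mem (by linarith) <;> linarith
    · rw [f_apply_first n v h2]
      have := convex_mem (c1 (j + 1)) (c1 (j + 4)) (b2 j)
      apply contract_mem (by linarith) <;> linarith
    · rw [f_apply_second n v h2]
      exact contract_mem (by linarith) (c1 _).1 (c1 _).2
  have cube : ∀ k, 0 < k → k < 3 * n → ∀ c, f n v k c ∈ Ioo (0 : ℝ) 1 := fun k h1 h2 c =>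
    ⟨by linarith [(cube' k h1 h2 c).1], by linarith [(cube' k h1 h2 c).2]⟩
  have start : ∀ c, 0 < f n v 1 c - f n v 0 c := fun c => by
    rw [f0, sub_zero]; exact (cube 1 one_pos (by omega) c).1
  have stop_pos : ∀ c, 0 < f n v (3 * n) c - f n v (3 * n - 1) c := fun c => by
    rw [f1 _ le_rfl, sub_pos]; exact (cube (3 * n - 1) (by omega) (by omega) c).2
  have sign : ∀ i s, i < 3 ∨ 3 * n ≤ i + 3 → i < 3 * n → 0 < s * (val v (i + 3) - val v i) →
      0 < s := fun i s h1 h2 h3 => by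
    have : val v i + 10 * eps n v ≤ val v (i + 3) := by
      rcases h1 with h1 | h1
      exacts [g.first_long h1, g.last_long h1 h2]
    exact pos_of_mul_pos_left h3 (by linarith)
  -- In each direction an inner edge is a multiple of the pipe of that direction among the three
  -- around it. The factors are nonnegative; for the middle pipe the factor is positive since β ≤
  -- 3ε/4, and for an outer one it is positive if the middle pipe has length zero. All sign
  -- conditions follow from this.
  have m1 : ∀ i, i + 2 < 3 * n → f n v (i + 2) (cls (i + 1)) - f n v (i + 1) (cls (i + 1)) =
      (1 - eps n v) * (1 - buckling n v (i + 2) - buckling n v i) *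
        (val v (i + 4) - val v (i + 1)) := fun i hi => by
    rw [f_apply_third n v hi, f_apply_first n v (by omega)]; ring
  have m2 : ∀ i, i + 2 < 3 * n → f n v (i + 2) (cls (i + 2)) - f n v (i + 1) (cls (i + 2)) =
      (1 - eps n v) * buckling n v (i + 1) * (val v (i + 5) - val v (i + 2)) := fun i hi => by
    rw [f_apply_first n v hi, f_apply_second n v (by omega)]; ring
  have m3 : ∀ i, i + 2 < 3 * n → f n v (i + 2) (cls i) - f n v (i + 1) (cls i) =
      (1 - eps n v) * buckling n v (i + 1) * (val v (i + 3) - val v i) := fun i hi => by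
    rw [f_apply_third n v (by omega), ← cls_add_three, f_apply_second n v hi]; ring
  have smul : ∀ {s a d : ℝ}, 0 < a → 0 < s * d → 0 < s * (a * d) := fun ha h => by
    have := mul_pos ha h; linarith
  have smul' : ∀ {s a d : ℝ}, 0 ≤ a → 0 < s * d → 0 ≤ s * (a * d) := fun ha h => by
    have := mul_nonneg ha h.le; linarith
  have e1 : 0 < 1 - eps n v := by linarith
  refine ⟨⟨fun k m h1 h2 h3 => ?_, fun i s h1 h2 => ?_, fun i s h1 h2 => ?_, fun i s h1 h2 => ?_,
    fun i s h1 h2 h3 => ?_, fun i s h1 h2 h3 => ?_, fun i h1 h2 h3 => ?_⟩, ⟨?_, f1, cube⟩, cube'⟩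
  · rcases Nat.eq_zero_or_pos k with rfl | hk
    · rw [f0, g.zero m h3, sub_zero, abs_zero]; linarith
    rcases h1.eq_or_lt with rfl | h1
    · rw [f1 _ le_rfl, g.one m h2]
      simp only [ones, sub_self, abs_zero]; linarith
    obtain ⟨j, rfl⟩ : ∃ j, k = j + 1 := ⟨k - 1, by omega⟩
    rcases (by omega : m = j + 1 ∨ m = j + 2 ∨ m = j + 3) with rfl | rfl | rfl
    · rw [f_apply_first n v h1]
      exact abs_contract_sub_le he (by linarith) (g.nonneg _) (g.le_one _) (add_sub_cancel_left _ _)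
        (b0 _) (b1 _) (hd _)
    · rw [f_apply_second n v h1]
      exact abs_contract_sub_le he (by linarith) (g.nonneg _) (g.le_one _)
        (show _ = 0 * (0 : ℝ) by ring) le_rfl (by linarith) (by simp)
    · rw [cls_add_three, f_apply_third n v h1]
      refine abs_contract_sub_le he (by linarith) (g.nonneg _) (g.le_one _)
        (show _ = buckling n v (j + 1) * -(val v (j + 3) - val v j) by ring) (b0 _) (b1 _) ?_
      rw [abs_neg]; exact hd _
  · rcases Nat.eq_zero_or_pos i with rfl | hi
    · exact mul_pos (sign 0 s (Or.inl (by norm_num)) h1 h2) (start _)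
    obtain ⟨i, rfl⟩ : ∃ j, i = j + 1 := ⟨i - 1, by omega⟩
    rcases (by omega : i + 2 < 3 * n ∨ i + 2 = 3 * n) with h3 | h3
    · rw [show i + 1 + 1 = i + 2 from rfl, m1 i h3]
      exact smul (mul_pos e1 (by linarith [b1 i, b1 (i + 2)])) h2
    · have := stop_pos (cls (i + 1))
      rw [← h3] at this
      exact mul_pos (sign _ s (Or.inr (by omega)) h1 h2) this
  · rcases (by omega : i + 2 < 3 * n ∨ i + 2 = 3 * n) with h3 | h3
    · rw [m3 i h3]
      exact smul' (mul_nonneg e1.le (b0 _)) h2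
    · have := stop_pos (cls i)
      rw [← h3] at this
      exact (mul_pos (sign _ s (Or.inr (by omega)) (by omega) h2) this).le
  · rcases Nat.eq_zero_or_pos i with rfl | hi
    · exact (mul_pos (sign 1 s (Or.inl (by norm_num)) h1 h2) (start _)).le
    obtain ⟨i, rfl⟩ : ∃ j, i = j + 1 := ⟨i - 1, by omega⟩
    rw [show i + 1 + 1 = i + 2 from rfl, m2 i h1]
    exact smul' (mul_nonneg e1.le (b0 _)) h2
  · rcases (by omega : i + 2 < 3 * n ∨ i + 2 = 3 * n) with h4 | h4
    · rw [m3 i h4]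
      exact smul (mul_pos e1 (buckling_pos he h2)) h3
    · have := stop_pos (cls i)
      rw [← h4] at this
      exact mul_pos (sign _ s (Or.inr (by omega)) (by omega) h3) this
  · rcases Nat.eq_zero_or_pos i with rfl | hi
    · exact mul_pos (sign 1 s (Or.inl (by norm_num)) h1 h3) (start _)
    obtain ⟨i, rfl⟩ : ∃ j, i = j + 1 := ⟨i - 1, by omega⟩
    rw [show i + 1 + 1 = i + 2 from rfl, m2 i h1]
    exact smul (mul_pos e1 (buckling_pos he h2)) h3
  · have := m2 i h1
    rw [buckling_eq_zero (k := i + 1) h3] at this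
    linarith
  · ext c; exact f0 c

theorem f_mem (hn : 3 ≤ n) (hv : v ∈ K n) : f n v ∈ L (3 * n) := by
  obtain ⟨h1, h2, -⟩ := f_follows_and_mem hn hv
  refine (mem_L_iff (by omega) _).2 ⟨h2, ?_⟩
  exact injOn_of_apart fun j k hjk hk => h1.apart (gap_of_mem_K hn hv) hjk hk

theorem continuousOn_f (hn : 3 ≤ n) : ContinuousOn (f n) (K n) := by
  have he := continuous_eps hn
  have hb : ∀ k, ContinuousOn (fun v => buckling n v k) (K n) := fun k => by
    have : Continuous fun v => √((eps n v ^ 2 - ‖disp v k‖ ^ 2) / 2) :=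
      (((he.pow 2).sub ((continuous_disp k).norm.pow 2)).div_const _).sqrt
    exact this.continuousOn.congr fun v hv => buckling_eq_sqrt (eps_pos hn hv).le k
  refine continuousOn_pi.2 fun k => ?_
  unfold f buckled
  split_ifs
  · exact continuousOn_const
  · exact ((continuous_const.sub he).continuousOn.smul
      (((continuous_corner k).continuousOn.add
        ((hb _).smul (continuous_disp k).continuousOn)).sub
        ((hb _).smul (continuous_disp _).continuousOn))).add
      ((he.div_const _).smul continuous_const).continuousOn
  · exact continuousOn_const

end buckling

/-! ### The polygon along the plumbers' curve -/

/-- The list `w` with the point `x` inserted between `w p` and `w (p + 1)`. -/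
def insertVertex (p : ℕ) (x : E3) (w : Seq) : Seq := fun i =>
  if i ≤ p then w i else if i = p + 1 then x else w (i - 1)

/-- The new vertex is the point of the curve at the time (p + τ)/n, so this is the insertion of a
time among the uniform ones. -/
theorem Represents.insertVertex {α : ℕ → ℕ} (hα : ∀ n, 3 ≤ n → α n + 3 ≤ n) {n : ℕ} {w : Seq}
    {c : ZerothHomotopy (Lim L (insertMid α))} (hc : Represents L (insertMid α) n w c) {p : ℕ}
    (hp : p < n) {τ : ℝ} (hτ : τ ∈ Ioo (0 : ℝ) 1) :
    Represents L (insertMid α) (n + 1)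
      (Plumbers.insertVertex p (w p + τ • (w (p + 1) - w p)) w) c := by
  have hn := hc.three_le
  have hw := hc.mem
  have hn' : (0 : ℝ) < n := Nat.cast_pos.2 (by omega)
  have hpn : (p : ℝ) + 1 ≤ n := by exact_mod_cast hp
  obtain ⟨η, ρ, μ, h⟩ := exists_tame_curve (by omega) hw
  have hc' := hc
  rw [← curve_uniform (by omega) hw.1] at hc'
  have e1 : min ((p : ℝ) / n) 1 = p / n := min_eq_left (by rw [div_le_one hn']; linarith)
  have e2 : min (((p + 1 : ℕ) : ℝ) / n) 1 = (p + 1) / n := by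
    push_cast; exact min_eq_left (by rw [div_le_one hn']; linarith)
  have := Represents.insertTime hα (by omega) hw.1 h.self_of_nhds (uniform_one (by omega))
    (affineTimes_uniform (by omega)) hc' hp (x := (p + τ) / n) (by
      rw [e1, e2]
      constructor <;> (apply div_lt_div_of_pos_right _ hn'; linarith [hτ.1, hτ.2]))
  convert this using 1
  funext i
  rw [Plumbers.insertVertex, Plumbers.insertTime]
  have hu := congrFun (curve_uniform (by omega) hw.1)
  split_ifs with h1 h2
  · exact (hu i).symm
  · have hx : (n : ℝ) * ((p + τ) / n) = p + τ := mul_div_cancel₀ _ hn'.ne'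
    rw [curve_eq_poly (by omega) hw.1 ⟨by have := hτ.1; positivity, by
      rw [div_le_one hn']; linarith [hτ.2]⟩, hx,
      poly_eq w (i := p) (by linarith [hτ.1]) (by linarith [hτ.2]), add_sub_cancel_left]
  · exact (hu (i - 1)).symm

theorem Apart.shift {X : Seq} {j k : ℕ} (h : Apart (fun k => X (k + 1)) j k) :
    Apart X (j + 1) (k + 1) := by
  obtain ⟨c, s, ⟨h1, i, hi1, hi2, hi⟩ | h⟩ := h
  · refine ⟨c, s, Or.inl ⟨fun i h2 h3 => ?_, i + 1, by omega, by omega, hi⟩⟩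
    obtain ⟨i, rfl⟩ : ∃ m, i = m + 1 := ⟨i - 1, by omega⟩
    exact h1 i (by omega) (by omega)
  · exact ⟨c, s, Or.inr h⟩

/-- Conditions on a polygon with `3 n + 2` edges of which all but the first and the last follow a
plumbers' curve with `n` moves. -/
structure BoxedFollows (n : ℕ) (ε : ℝ) (Y : ℕ → ℝ) (X : Seq) : Prop where
  zero : X 0 = 0
  one : ∀ i, 3 * n + 2 ≤ i → X i = ones
  follows : Follows n ε Y fun k => X (k + 1)
  cube : ∀ k c, 0 < k → k < 3 * n + 2 → X k c ∈ Ioo (0 : ℝ) 1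
  first : ∀ k c, 1 ≤ k → k < 3 * n + 2 → X 1 c ≤ X k c
  first_lt : ∀ k, 2 ≤ k → k < 3 * n + 2 → X 1 0 < X k 0
  last : ∀ k c, 1 ≤ k → k < 3 * n + 2 → X k c ≤ X (3 * n + 1) c
  last_lt : ∀ k, 1 ≤ k → k < 3 * n + 1 → X k 2 < X (3 * n + 1) 2

theorem convex_lt {a b a' b' t : ℝ} (h : a < b) (h' : a' < b') (ht : t ∈ Icc (0 : ℝ) 1) :
    (1 - t) * a + t * a' < (1 - t) * b + t * b' := by
  rcases ht.1.lt_or_eq with h0 | h0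
  · nlinarith [mul_pos h0 (sub_pos.2 h'), mul_nonneg (sub_nonneg.2 ht.2) (sub_pos.2 h).le]
  · rw [← h0]; linarith

theorem convex_le {a b a' b' t : ℝ} (h : a ≤ b) (h' : a' ≤ b') (ht : t ∈ Icc (0 : ℝ) 1) :
    (1 - t) * a + t * a' ≤ (1 - t) * b + t * b' := by
  nlinarith [mul_nonneg ht.1 (sub_nonneg.2 h'), mul_nonneg (sub_nonneg.2 ht.2) (sub_nonneg.2 h)]

theorem BoxedFollows.line {n : ℕ} {ε : ℝ} {Y : ℕ → ℝ} {X X' : Seq} (h : BoxedFollows n ε Y X)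
    (h' : BoxedFollows n ε Y X') (hY : ∀ i, i < 3 * n → Y (i + 3) - Y i ≠ 0) {t : ℝ}
    (ht : t ∈ Icc (0 : ℝ) 1) : BoxedFollows n ε Y (X + t • (X' - X)) := by
  have e : ∀ k c, (X + t • (X' - X)) k c = (1 - t) * X k c + t * X' k c := fun k c => by
    simp only [Pi.add_apply, Pi.smul_apply, Pi.sub_apply, PiLp.add_apply, PiLp.smul_apply,
      PiLp.sub_apply, smul_eq_mul]
    ring
  refine ⟨?_, fun i hi => ?_, h.follows.line h'.follows hY ht, fun k c h1 h2 => ?_,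
    fun k c h1 h2 => ?_, fun k h1 h2 => ?_, fun k c h1 h2 => ?_, fun k h1 h2 => ?_⟩
  · simp [h.zero, h'.zero]
  · simp [h.one i hi, h'.one i hi]
  · rw [e]
    have a := h.cube k c h1 h2
    have b := h'.cube k c h1 h2
    have t1 := convex_lt a.1 b.1 ht
    have t2 := convex_lt a.2 b.2 ht
    constructor <;> linarith
  · rw [e, e]; exact convex_le (h.first k c h1 h2) (h'.first k c h1 h2) ht
  · rw [e, e]; exact convex_lt (h.first_lt k h1 h2) (h'.first_lt k h1 h2) ht
  · rw [e, e]; exact convex_le (h.last k c h1 h2) (h'.last k c h1 h2) ht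
  · rw [e, e]; exact convex_lt (h.last_lt k h1 h2) (h'.last_lt k h1 h2) ht

/-- Among the inner vertices the first is lowest, strictly so in x, and the last is highest,
strictly so in z. Thus x separates the first edge from the others and z the last one, with
monotonicity in place of separation for adjacent edges; the inner edges are covered by
`Follows.apart`. -/
theorem BoxedFollows.mem_L {n : ℕ} {ε : ℝ} {Y : ℕ → ℝ} {X : Seq} (h : BoxedFollows n ε Y X)
    (g : Gap n ε Y) : X ∈ L (3 * n + 2) := by
  have hn := g.three_le
  refine (mem_L_iff (by omega) _).2 ⟨⟨h.zero, h.one, fun i h1 h2 c => h.cube i c h1 h2⟩, ?_⟩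
  have z : ∀ c, X 0 c = 0 := fun c => by rw [h.zero]; rfl
  have o : ∀ c, X (3 * n + 2) c = 1 := fun c => by rw [h.one _ le_rfl]; rfl
  have s1 : 0 < X 1 0 := (h.cube 1 0 (by omega) (by omega)).1
  have s2 : X (3 * n + 1) 2 < 1 := (h.cube (3 * n + 1) 2 (by omega) (by omega)).2
  refine injOn_of_apart fun j k hjk hk => ?_
  rcases Nat.eq_zero_or_pos j with rfl | hj
  · rcases (by omega : k = 0 ∨ k = 1 ∨ 2 ≤ k) with rfl | rfl | hk2
    · exact ⟨0, 1, Or.inl ⟨fun i h1 h2 => by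
        obtain rfl : i = 0 := by omega
        rw [z]; linarith, 0, le_rfl, le_rfl, by rw [z]; linarith⟩⟩
    · have s3 := h.first_lt 2 le_rfl (by omega)
      refine ⟨0, 1, Or.inl ⟨fun i h1 h2 => ?_, 0, le_rfl, by omega, by rw [z]; linarith⟩⟩
      rcases (by omega : i = 0 ∨ i = 1) with rfl | rfl
      · rw [z]; linarith
      · linarith
    · have s3 := h.first_lt k hk2 hk
      have s4 : X 1 0 < X (k + 1) 0 := by
        rcases (by omega : k + 1 < 3 * n + 2 ∨ k + 1 = 3 * n + 2) with h1 | h1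
        · exact h.first_lt _ (by omega) h1
        · rw [h1, o]; exact (h.cube 1 0 (by omega) (by omega)).2
      refine ⟨0, 1, Or.inr ?_⟩
      rw [z]
      refine ⟨?_, ?_, ?_, ?_⟩ <;> linarith
  obtain ⟨j, rfl⟩ : ∃ m, j = m + 1 := ⟨j - 1, by omega⟩
  rcases (by omega : k = 3 * n + 1 ∨ k ≤ 3 * n) with rfl | hk2
  · rcases (by omega : j = 3 * n ∨ j + 1 = 3 * n ∨ j + 1 < 3 * n) with rfl | h1 | h1
    · exact ⟨2, 1, Or.inl ⟨fun i h1 h2 => by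
        obtain rfl : i = 3 * n + 1 := by omega
        rw [o]; linarith, 3 * n + 1, le_rfl, le_rfl, by rw [o]; linarith⟩⟩
    · have s3 := h.last_lt (3 * n) (by omega) (by omega)
      refine ⟨2, 1, Or.inl ⟨fun i h2 h3 => ?_, 3 * n + 1, by omega, by omega, by rw [o]; linarith⟩⟩
      rcases (by omega : i = 3 * n + 1 ∨ i = 3 * n) with rfl | rfl
      · rw [o]; linarith
      · linarith
    · have s3 := h.last_lt (j + 1) (by omega) (by omega)
      have s4 := h.last_lt (j + 1 + 1) (by omega) (by omega)
      refine ⟨2, 1, Or.inr ?_⟩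
      rw [o]
      refine ⟨?_, ?_, ?_, ?_⟩ <;> linarith
  · obtain ⟨k, rfl⟩ : ∃ m, k = m + 1 := ⟨k - 1, by omega⟩
    exact (h.follows.apart g (by omega) (by omega)).shift

/-- `V` arises from `Y` by the insertion of vertices close to the ends. -/
structure Extends (n : ℕ) (ε : ℝ) (Y V : ℕ → ℝ) : Prop where
  low : ∀ i, i < 3 → 0 < V (i + 3) ∧ V (i + 3) ≤ ε
  mid : ∀ i, 3 ≤ i → i < 3 * n → V (i + 3) = Y i
  high : ∀ i, 3 * n ≤ i → i < 3 * n + 3 → 1 - ε ≤ V (i + 3) ∧ V (i + 3) < 1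

/-- The polygon with the vertices `0`, the corners of `v` between its first and last inner vertex,
and `(1, 1, 1)`. -/
def spine (n : ℕ) (v : Seq) : Seq := fun k =>
  if k = 0 then 0 else if k < 3 * n + 2 then corner v (k + 2) else ones

/-- Without its outer edges, the spine has corners that agree with those of the curve of Y except
for values within ε of 0 or 1 near the ends; and each of its edges changes one coordinate only, so
most conditions hold with equality. -/
theorem spine_boxedFollows {n : ℕ} {ε : ℝ} {Y : ℕ → ℝ} {v : Seq} (g : Gap n ε Y)
    (hY : ∀ i, i < 3 * n → Y (i + 3) - Y i ≠ 0) (h : Extends n ε Y (val v)) :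
    BoxedFollows n ε Y (spine n v) := by
  have hε := g.pos
  have hε1 := g.le
  have hn := g.three_le
  have s1 : ∀ k, 0 < k → k < 3 * n + 2 → spine n v k = corner v (k + 2) := fun k h1 h2 => by
    rw [spine, if_neg (by omega), if_pos h2]
  have s2 : ∀ k m, k ≤ 3 * n → k ≤ m → m < k + 3 → spine n v (k + 1) (cls m) = val v (m + 3) :=
    fun k m h1 h2 h3 => by
      rw [s1 (k + 1) (by omega) (by omega), ← cls_add_three, corner_cls v (by omega) (by omega)]
  have c0 : (0 : Fin 3) = cls 0 := rfl
  have c2 : (2 : Fin 3) = cls 2 := rfl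
  have e0 : cls (3 * n) = cls 0 := by simp [cls]
  have mid : ∀ i, 3 ≤ i → i < 3 * n → 10 * ε ≤ val v (i + 3) ∧ val v (i + 3) ≤ 1 - 10 * ε :=
    fun i h1 h2 => by rw [h.mid i h1 h2]; exact g.cube i h1 h2
  have upper : ∀ i, 3 ≤ i → i < 3 * n + 3 → 10 * ε ≤ val v (i + 3) := fun i h1 h2 => by
    rcases lt_or_ge i (3 * n) with h3 | h3
    · exact (mid i h1 h3).1
    · linarith [(h.high i h3 h2).1]
  have lower : ∀ i, i < 3 * n → val v (i + 3) ≤ 1 - 10 * ε := fun i h1 => by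
    rcases lt_or_ge i 3 with h3 | h3
    · linarith [(h.low i h3).2]
    · exact (mid i h3 h1).2
  have first : ∀ k m, k ≤ 3 * n → k ≤ m → m < k + 3 → 3 ≤ m →
      spine n v 1 (cls m) < spine n v (k + 1) (cls m) := fun k m h1 h2 h3 h4 => by
    rw [s2 k m h1 h2 h3, show cls m = cls (m % 3) by simp [cls],
      show (1 : ℕ) = 0 + 1 from rfl, s2 0 (m % 3) (by omega) (by omega) (by omega)]
    linarith [upper m h4 (by omega), (h.low (m % 3) (by omega)).2]
  have last : ∀ k m, k ≤ 3 * n → k ≤ m → m < k + 3 → m < 3 * n →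
      spine n v (k + 1) (cls m) < spine n v (3 * n + 1) (cls m) := fun k m h1 h2 h3 h4 => by
    rw [s2 k m h1 h2 h3, show cls m = cls (3 * n + m % 3) by simp [cls],
      s2 (3 * n) (3 * n + m % 3) (by omega) (by omega) (by omega)]
    linarith [lower m h4, (h.high (3 * n + m % 3) (by omega) (by omega)).1]
  refine ⟨by rw [spine, if_pos rfl], fun i hi => by rw [spine, if_neg (by omega), if_neg (by omega)],
    ⟨fun k m h1 h2 h3 => ?_, fun i s h1 h2 => ?_, fun i s h1 h2 => ?_, fun i s h1 h2 => ?_,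
      fun i s h1 h2 => absurd h2 (hY (i + 1) h1), fun i s h1 h2 => absurd h2 (hY i (by omega)),
      fun i h1 h2 => absurd h2 (hY i (by omega))⟩,
    fun k c h1 h2 => ?_, fun k c h1 h2 => ?_, fun k h1 h2 => ?_, fun k c h1 h2 => ?_,
    fun k h1 h2 => ?_⟩
  · rw [s2 k m h1 h2 h3]
    rcases (by omega : m < 3 ∨ 3 ≤ m ∧ m < 3 * n ∨ 3 * n ≤ m ∧ m < 3 * n + 3) with h4 | h4 | h4
    · rw [g.zero m h4, sub_zero, abs_of_pos (h.low m h4).1]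
      linarith [(h.low m h4).2]
    · rw [h.mid m h4.1 h4.2, sub_self, abs_zero]; linarith
    · have := h.high m h4.1 h4.2
      rw [g.one m h4.1, abs_le]
      constructor <;> linarith
  · rw [← cls_add_three, s2 (i + 1) (i + 3) (by omega) (by omega) (by omega), cls_add_three,
      s2 i i (by omega) le_rfl (by omega)]
    rcases (by omega : i < 3 ∨ 3 ≤ i ∧ i + 3 < 3 * n ∨ 3 * n ≤ i + 3) with h4 | h4 | h4
    · have t := g.first_long h4
      have := h.low i h4
      have := upper (i + 3) (by omega) (by omega)
      exact mul_pos (pos_of_mul_pos_left h2 (by linarith)) (by linarith)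
    · rwa [h.mid i h4.1 (by omega), h.mid (i + 3) (by omega) h4.2]
    · have t := g.last_long h4 h1
      have := lower i h1
      have := h.high (i + 3) h4 (by omega)
      exact mul_pos (pos_of_mul_pos_left h2 (by linarith)) (by linarith)
  · rw [← cls_add_three, s2 (i + 2) (i + 3) (by omega) (by omega) (by omega),
      s2 (i + 1) (i + 3) (by omega) (by omega) (by omega), sub_self, mul_zero]
  · rw [s2 (i + 1) (i + 1) (by omega) (by omega) (by omega),
      s2 i (i + 1) (by omega) (by omega) (by omega), sub_self, mul_zero]
  · obtain ⟨k, rfl⟩ : ∃ m, k = m + 1 := ⟨k - 1, by omega⟩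
    obtain ⟨m, h3, h4, rfl⟩ := exists_cls k c
    rw [s2 k m (by omega) h3 h4]
    constructor
    · rcases lt_or_ge m 3 with h5 | h5
      · exact (h.low m h5).1
      · linarith [upper m h5 (by omega)]
    · rcases lt_or_ge m (3 * n) with h5 | h5
      · linarith [lower m h5]
      · exact (h.high m h5 (by omega)).2
  · obtain ⟨k, rfl⟩ : ∃ m, k = m + 1 := ⟨k - 1, by omega⟩
    obtain ⟨m, h3, h4, rfl⟩ := exists_cls k c
    rcases lt_or_ge m 3 with h5 | h5
    · rw [s2 k m (by omega) h3 h4, show (1 : ℕ) = 0 + 1 from rfl,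
        s2 0 m (by omega) (by omega) (by omega)]
    · exact (first k m (by omega) h3 h4 h5).le
  · obtain ⟨k, rfl⟩ : ∃ m, k = m + 1 := ⟨k - 1, by omega⟩
    obtain ⟨m, h3, h4, h5⟩ := exists_cls k 0
    rw [← h5]
    refine first k m (by omega) h3 h4 ?_
    have := Fin.ext_iff.1 h5
    simp only [cls, Fin.val_zero] at this
    omega
  · obtain ⟨k, rfl⟩ : ∃ m, k = m + 1 := ⟨k - 1, by omega⟩
    obtain ⟨m, h3, h4, rfl⟩ := exists_cls k c
    rcases lt_or_ge m (3 * n) with h5 | h5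
    · exact (last k m (by omega) h3 h4 h5).le
    · rw [s2 k m (by omega) h3 h4, s2 (3 * n) m le_rfl (by omega) (by omega)]
  · obtain ⟨k, rfl⟩ : ∃ m, k = m + 1 := ⟨k - 1, by omega⟩
    obtain ⟨m, h3, h4, h5⟩ := exists_cls k 2
    rw [← h5]
    refine last k m (by omega) h3 h4 ?_
    have := Fin.ext_iff.1 h5
    simp only [cls, Fin.val_two] at this
    omega

/-- All conditions except closeness concern signs of edges, which a positive factor on each edge
does not affect. -/
theorem Follows.rescale {n : ℕ} {ε : ℝ} {Y : ℕ → ℝ} {W Z : Seq} (h : Follows n ε Y W)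
    (near : ∀ k m, k ≤ 3 * n → k ≤ m → m < k + 3 → |Z k (cls m) - Y m| ≤ 3 / 2 * ε)
    (hZ : ∀ i < 3 * n, ∃ κ : ℝ, 0 < κ ∧ ∀ c, Z (i + 1) c - Z i c = κ * (W (i + 1) c - W i c)) :
    Follows n ε Y Z := by
  have pos : ∀ i s c, i < 3 * n → 0 < s * (W (i + 1) c - W i c) →
      0 < s * (Z (i + 1) c - Z i c) := fun i s c hi h0 => by
    obtain ⟨κ, h1, h2⟩ := hZ i hi
    rw [h2]
    have := mul_pos h1 h0
    linarith
  have nonneg : ∀ i s c, i < 3 * n → 0 ≤ s * (W (i + 1) c - W i c) →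
      0 ≤ s * (Z (i + 1) c - Z i c) := fun i s c hi h0 => by
    obtain ⟨κ, h1, h2⟩ := hZ i hi
    rw [h2]
    have := mul_nonneg h1.le h0
    linarith
  refine ⟨near, fun i s h1 h2 => pos i s _ h1 (h.strict i s h1 h2),
    fun i s h1 h2 => nonneg (i + 1) s _ h1 (h.prev i s h1 h2),
    fun i s h1 h2 => nonneg i s _ (by omega) (h.next i s h1 h2),
    fun i s h1 h2 h3 => pos (i + 1) s _ h1 (h.prev_zero i s h1 h2 h3),
    fun i s h1 h2 h3 => pos i s _ (by omega) (h.next_zero i s h1 h2 h3), fun i h1 h2 h3 => ?_⟩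
  obtain ⟨κ, -, h4⟩ := hZ (i + 1) (by omega)
  have := h4 (cls (i + 2))
  rw [h.flat i h1 h2 h3, sub_self, mul_zero] at this
  linarith

/-- Placing one vertex on the first edge and one on the last gives the polygon `f n v` as many
vertices, in the same arrangement, as the spine of an extension of `v` has. -/
theorem f_boxedFollows {n : ℕ} {v : Seq} (hn : 3 ≤ n) (hv : v ∈ K n) :
    ∃ τ ∈ Ioo (0 : ℝ) 1, ∃ τ' ∈ Ioo (0 : ℝ) 1, ∀ w, w = insertVertex 0 (τ • f n v 1) (f n v) →
      BoxedFollows n (eps n v) (val v)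
        (insertVertex (3 * n) (w (3 * n) + τ' • (w (3 * n + 1) - w (3 * n))) w) := by
  obtain ⟨h1, h2, h3⟩ := f_follows_and_mem hn hv
  have g := gap_of_mem_K hn hv
  have he := g.pos
  have he1 := g.le
  set e := eps n v
  -- The vertices of `f n v` stay e/2 away from the boundary of the cube, so the factor e/4 places
  -- the new vertices strictly outside their range in every coordinate.
  refine ⟨e / 4, ⟨by linarith, by linarith⟩, 1 - e / 4, ⟨by linarith, by linarith⟩, ?_⟩
  rintro w rfl
  set X := insertVertex (3 * n) _ _ with hX
  have f0 : ∀ c, f n v 0 c = 0 := fun c => by rw [h2.1]; rfl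
  have f1 : f n v (3 * n) = ones := h2.2.1 _ le_rfl
  have o : ∀ c, ones c = 1 := fun c => rfl
  have X0 : X 0 = 0 := by
    rw [hX, insertVertex, if_pos (by omega), insertVertex, if_pos le_rfl, h2.1]
  have X1 : ∀ c, X 1 c = e / 4 * f n v 1 c := fun c => by
    rw [hX, insertVertex, if_pos (by omega), insertVertex, if_neg (by omega), if_pos (by omega)]
    rfl
  have Xm : ∀ k, 1 ≤ k → k < 3 * n → X (k + 1) = f n v k := fun k k1 k2 => by
    rw [hX, insertVertex, if_pos (by omega), insertVertex, if_neg (by omega), if_neg (by omega)]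
    rfl
  have Xl : ∀ c, X (3 * n + 1) c = 1 - e / 4 * (1 - f n v (3 * n - 1) c) := fun c => by
    rw [hX, insertVertex, if_neg (by omega), if_pos rfl, insertVertex, if_neg (by omega),
      if_neg (by omega), insertVertex, if_neg (by omega), if_neg (by omega), Nat.add_sub_cancel, f1]
    simp only [PiLp.add_apply, PiLp.smul_apply, PiLp.sub_apply, smul_eq_mul, o]
    ring
  have X2 : ∀ i, 3 * n + 2 ≤ i → X i = ones := fun i hi => by
    rw [hX, insertVertex, if_neg (by omega), if_neg (by omega), insertVertex, if_neg (by omega),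
      if_neg (by omega)]
    exact h2.2.1 _ (by omega)
  have b1 := h3 1 (by omega) (by omega)
  have b2 := h3 (3 * n - 1) (by omega) (by omega)
  have lo : ∀ c, 0 < X 1 c ∧ X 1 c < e / 2 := fun c => by
    have := b1 c
    rw [X1]
    constructor <;> nlinarith [this.1, this.2]
  have hi : ∀ c, 1 - e / 2 < X (3 * n + 1) c ∧ X (3 * n + 1) c < 1 := fun c => by
    have := b2 c
    rw [Xl]
    constructor <;> nlinarith [this.1, this.2]
  have mid : ∀ k c, 2 ≤ k → k < 3 * n + 1 → e / 2 ≤ X k c ∧ X k c ≤ 1 - e / 2 := by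
    intro k c k1 k2
    obtain ⟨k, rfl⟩ : ∃ m, k = m + 1 := ⟨k - 1, by omega⟩
    rw [Xm k (by omega) (by omega)]
    exact h3 k (by omega) (by omega) c
  have first : ∀ k c, 2 ≤ k → k < 3 * n + 2 → X 1 c < X k c := fun k c k1 k2 => by
    rcases (by omega : k = 3 * n + 1 ∨ k < 3 * n + 1) with rfl | k3
    · linarith [(lo c).2, (hi c).1]
    · linarith [(lo c).2, (mid k c k1 k3).1]
  have last : ∀ k c, 1 ≤ k → k < 3 * n + 1 → X k c < X (3 * n + 1) c := fun k c k1 k2 => by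
    rcases (by omega : k = 1 ∨ 2 ≤ k) with rfl | k3
    · linarith [(lo c).2, (hi c).1]
    · linarith [(hi c).1, (mid k c k3 k2).2]
  refine ⟨X0, X2, h1.rescale (fun k m k1 k2 k3 => ?_) (fun i i1 => ?_), fun k c k1 k2 => ?_,
    fun k c k1 k2 => ?_, fun k k1 k2 => first k 0 k1 k2, fun k c k1 k2 => ?_,
    fun k k1 k2 => last k 2 k1 k2⟩
  · rcases (by omega : k = 0 ∨ k = 3 * n ∨ 1 ≤ k ∧ k < 3 * n) with rfl | rfl | k4
    · rw [g.zero m (by omega), sub_zero, abs_of_pos (lo _).1]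
      linarith [(lo (cls m)).2]
    · rw [g.one m (by omega), abs_le]
      constructor <;> linarith [(hi (cls m)).1, (hi (cls m)).2]
    · rw [Xm k k4.1 k4.2]
      exact h1.near k m k1 k2 k3
  · rcases (by omega : i = 0 ∨ i + 1 = 3 * n ∨ 1 ≤ i ∧ i + 1 < 3 * n) with rfl | i2 | i2
    · refine ⟨1 - e / 4, by linarith, fun c => ?_⟩
      rw [show (0 : ℕ) + 1 = 1 from rfl, X1, Xm 1 le_rfl (by omega), f0]
      ring
    · refine ⟨1 - e / 4, by linarith, fun c => ?_⟩
      rw [Xm i (by omega) (by omega), i2, Xl, f1, o, ← i2, Nat.add_sub_cancel]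
      ring
    · refine ⟨1, one_pos, fun c => ?_⟩
      rw [Xm i i2.1 (by omega), Xm (i + 1) (by omega) i2.2, one_mul]
  · rcases (by omega : k = 1 ∨ k = 3 * n + 1 ∨ 2 ≤ k ∧ k < 3 * n + 1) with rfl | rfl | k3
    · exact ⟨(lo c).1, by linarith [(lo c).2]⟩
    · exact ⟨by linarith [(hi c).1], (hi c).2⟩
    · have := mid k c k3.1 k3.2
      constructor <;> linarith
  · rcases k1.eq_or_lt with rfl | k1
    exacts [le_rfl, (first k c k1 k2).le]
  · rcases (by omega : k = 3 * n + 1 ∨ k < 3 * n + 1) with rfl | k3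
    exacts [le_rfl, (last k c k1 k3).le]

/-- For a nondegenerate plumbers' knot `v` the polygon `f n v` lies in the component of the polygon
along an extension of `v`. -/
theorem Represents.spine {α : ℕ → ℕ} (hα : ∀ n, 3 ≤ n → α n + 3 ≤ n) {n : ℕ} {v u : Seq}
    {c : ZerothHomotopy (Lim L (insertMid α))} (hn : 3 ≤ n) (hv : v ∈ K n)
    (hY : ∀ i, i < 3 * n → val v (i + 3) - val v i ≠ 0) (hu : Extends n (eps n v) (val v) (val u))
    (hc : Represents L (insertMid α) (3 * n) (f n v) c) :
    Represents L (insertMid α) (3 * n + 2) (Plumbers.spine n u) c := by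
  obtain ⟨τ, hτ, τ', hτ', h⟩ := f_boxedFollows hn hv
  have g := gap_of_mem_K hn hv
  have h0 : f n v 0 = 0 := if_pos rfl
  have h1 := hc.insertVertex hα (p := 0) (by omega) hτ
  rw [h0, zero_add, zero_add, sub_zero] at h1
  have h2 := h1.insertVertex hα (p := 3 * n) (by omega) hτ'
  refine h2.of_joinedIn (joinedIn_of_line fun t ht => ?_)
  -- Without pipes of length zero the conditions of both polygons are convex, hence hold along the
  -- segment.
  exact ((h _ rfl).line (spine_boxedFollows g hY hu) hY ht).mem_L g

/-- Every plumbers' knot is connected to one without pipes of length zero. -/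
theorem exists_nondegenerate {n : ℕ} {v : Seq} (hn : 3 ≤ n) (hv : v ∈ K n) :
    ∃ w, JoinedIn (K n) v w ∧ ∀ i, i < 3 * n → val w (i + 3) - val w i ≠ 0 := by
  have g := gap_of_mem_K hn hv
  have hε := g.pos
  have hN : (0 : ℝ) < 3 * n := by positivity
  set e := eps n v
  -- Adding τm to the inner value at m changes the signed length of every inner pipe by 3τ, so only
  -- finitely many τ produce a pipe of length zero there. The bound on τ keeps the displacement
  -- below ε.
  obtain ⟨τ, ⟨h0, h1⟩, hτ⟩ : ∃ τ ∈ Ioo (0 : ℝ) (e / (3 * n)),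
      τ ∉ (fun i => -(val v (i + 3) - val v i) / 3) '' {i | i < 3 * n} :=
    ((Ioo_infinite (by positivity)).sdiff ((finite_lt_nat _).image _)).nonempty
  rw [lt_div_iff₀ hN] at h1
  let Z : ℕ → ℝ := fun m => if 3 ≤ m ∧ m < 3 * n then val v m + τ * m else val v m
  have hZ : ∀ m, val v m ≤ Z m ∧ Z m ≤ val v m + e := fun m => by
    simp only [Z]
    split_ifs with h
    · have : (m : ℝ) ≤ 3 * n := by exact_mod_cast h.2.le
      constructor <;> nlinarith
    · constructor <;> linarith
  have Z0 : ∀ m, m < 3 → Z m = 0 := fun m hm => by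
    simp only [Z]; rw [if_neg (by omega), g.zero m hm]
  have Z1 : ∀ m, 3 * n ≤ m → Z m = 1 := fun m hm => by
    simp only [Z]; rw [if_neg (by omega), g.one m hm]
  refine ⟨ofVal Z, g.joinedIn ?_ fun m => ?_, fun i hi => ?_⟩
  · rw [val_ofVal]
    refine ⟨Z0, Z1, fun m h2 h3 => ?_⟩
    have := g.cube m h2 h3
    have := hZ m
    constructor <;> linarith
  · rw [val_ofVal, abs_le]
    have := hZ m
    constructor <;> linarith
  · rw [val_ofVal]
    rcases lt_or_ge i 3 with h2 | h2
    · rw [Z0 i h2]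
      have := g.cube (i + 3) (by omega) (by omega)
      have := hZ (i + 3)
      linarith
    rcases lt_or_ge (i + 3) (3 * n) with h3 | h3
    · simp only [Z]
      rw [if_pos ⟨by omega, h3⟩, if_pos ⟨h2, hi⟩]
      intro h4
      refine hτ ⟨i, hi, ?_⟩
      push_cast at h4 ⊢
      linarith
    · rw [Z1 _ h3]
      have := g.cube i h2 hi
      have := hZ i
      linarith

/-- Every component of plumbers' knots contains an extension of a given representative. -/
theorem Represents.exists_extends {α : ℕ → ℕ} (hα : ∀ n, 3 ≤ n → α n + 3 ≤ n) {n : ℕ} {v : Seq}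
    {x : ZerothHomotopy (Lim K (iota α))} (hx : Represents K (iota α) n v x) :
    ∃ u, Represents K (iota α) (n + 2) u x ∧ Extends n (eps n v) (val v) (val u) := by
  have hn := hx.three_le
  have g := gap_of_mem_K hn hx.mem
  have hε := g.pos
  have hε1 := g.le
  set e := eps n v with he
  -- In pipe 0 the parameters b, c, d determine the three coordinates of the new first vertex, which
  -- comes to lie near the origin.
  have h1 : Admissible n e (val v) 0 0 e (e / 2) (e / 2) := by
    refine ⟨by omega, le_rfl, by linarith, hε, by linarith, by linarith, by linarith, by linarith,
      le_rfl, Or.inl le_rfl, fun _ => ⟨by linarith, by linarith⟩, fun _ => ⟨by linarith, by linarith⟩,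
      by omega, by omega⟩
  have hx' := hx.insertPipe hα h1
  set v' := ofVal (Plumbers.insertPipe 0 0 e (e / 2) (e / 2) (val v)) with hv'
  have g' := gap_of_mem_K (by omega) hx'.mem
  have hε' := g'.pos
  have hε1' := g'.le
  set e' := eps (n + 1) v'
  have V0 : ∀ i, i < 3 → val v' (i + 3) = (if i = 0 then e else e / 2) * val v (i + 3) :=
    fun i hi => by
      rw [hv', val_ofVal]
      rcases (by omega : i = 0 ∨ i = 1 ∨ i = 2) with rfl | rfl | rfl
      · rw [show 0 + 3 = 0 + 3 from rfl, insertPipe_add_three, g.zero 0 (by norm_num)]; simp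
      · rw [show 1 + 3 = 0 + 4 from rfl, insertPipe_add_four, g.zero (0 + 1) (by norm_num)]; simp
      · rw [show 2 + 3 = 0 + 5 from rfl, insertPipe_add_five, g.zero (0 + 2) (by norm_num)]; simp
  have V1 : ∀ i, 3 ≤ i → val v' (i + 3) = val v i := fun i hi => by
    rw [hv', val_ofVal, insertPipe_high (by omega)]; simp
  obtain ⟨θ, θ0, θ1, θ2⟩ : ∃ θ, 0 < θ ∧ θ ≤ e' / 2 ∧ θ ≤ e :=
    ⟨min (e' / 2) e, lt_min (by linarith) hε, min_le_left _ _, min_le_right _ _⟩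
  have c1 : ∀ i, 3 * n ≤ i → i < 3 * n + 3 → val v' i ≤ 1 - 10 * e ∧ 0 < val v' i := fun i h2 h3 => by
    obtain ⟨i, rfl⟩ : ∃ m, i = m + 3 := ⟨i - 3, by omega⟩
    have := g.cube i (by omega) (by omega)
    rw [V1 i (by omega)]
    exact ⟨this.2, by linarith⟩
  have o1 : ∀ i, 3 * n + 3 ≤ i → val v' i = 1 := fun i hi => g'.one i (by omega)
  -- The new last vertex occupies the positions 3n + 3, 3n + 4, 3n + 5, which are governed by a, b,
  -- c if the pipe 3n + 1 is divided. This insertion has c close to 1, so it uses the second mode.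
  have h2 : Admissible (n + 1) e' (val v') (3 * n + 1) θ (1 - θ) (1 - θ) 0 := by
    refine ⟨by omega, θ0.le, θ1, by linarith, by linarith, by linarith, by linarith, le_rfl,
      by linarith, Or.inr (by linarith), fun h0 => ?_, by omega, by omega, fun _ => θ0⟩
    have := c1 (3 * n + 1) (by omega) (by omega)
    rw [o1 _ (by omega)] at h0
    linarith
  have hx2 := hx'.insertPipe hα h2
  refine ⟨_, hx2, ⟨fun i hi => ?_, fun i h3 h4 => ?_, fun i h3 h4 => ?_⟩⟩
  · rw [val_ofVal, insertPipe_low (by omega), V0 i hi]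
    have := g.cube (i + 3) (by omega) (by omega)
    split_ifs <;> constructor <;> nlinarith
  · rw [val_ofVal, insertPipe_low (by omega), V1 i h3]
  · rw [val_ofVal]
    rcases (by omega : i = 3 * n ∨ i = 3 * n + 1 ∨ i = 3 * n + 2) with rfl | rfl | rfl
    · rw [show 3 * n + 3 = 3 * n + 1 + 2 from rfl, insertPipe_add_two, o1 (3 * n + 1 + 2) (by omega),
        show 3 * n + 1 - 1 = 3 * n by omega]
      have := c1 (3 * n) (by omega) (by omega)
      constructor <;> nlinarith
    · rw [show 3 * n + 1 + 3 = 3 * n + 1 + 3 from rfl, insertPipe_add_three,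
        o1 (3 * n + 1 + 3) (by omega)]
      have := c1 (3 * n + 1) (by omega) (by omega)
      constructor <;> nlinarith
    · rw [show 3 * n + 2 + 3 = 3 * n + 1 + 4 from rfl, insertPipe_add_four,
        o1 (3 * n + 1 + 4) (by omega)]
      have := c1 (3 * n + 1 + 1) (by omega) (by omega)
      constructor <;> nlinarith

/-! ### Smoothing of curves -/

section smooth

open Filter Topology MeasureTheory

/-- The average of the curve `γ` over intervals of radius `δ`. -/
def smooth (δ : ℝ) (γ : ℝ → E3) (t : ℝ) : E3 := (1 / 2 : ℝ) • ∫ x in (-1 : ℝ)..1, γ (t + δ * x)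

variable {γ : ℝ → E3} {δ t t' r : ℝ}

theorem map_smooth (ℓ : E3 →ₗ[ℝ] ℝ) (hγ : Continuous γ) (δ t : ℝ) :
    ℓ (smooth δ γ t) = 1 / 2 * ∫ x in (-1 : ℝ)..1, ℓ (γ (t + δ * x)) := by
  have hc : Continuous fun x => γ (t + δ * x) := by fun_prop
  have := (LinearMap.toContinuousLinearMap ℓ).intervalIntegral_comp_comm
    (hc.intervalIntegrable (μ := volume) (-1) 1)
  simp only [LinearMap.coe_toContinuousLinearMap'] at this
  rw [smooth, map_smul, this, smul_eq_mul]

/-- A mean over a symmetric interval reproduces affine curves; so straight ends are left unchanged.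
-/
theorem smooth_affine {p q : E3} (h : ∀ x ∈ Icc (-1 : ℝ) 1, γ (t + δ * x) = p + (t + δ * x) • q) :
    smooth δ γ t = p + t • q := by
  have e : ∫ x in (-1 : ℝ)..1, γ (t + δ * x) = ∫ x in (-1 : ℝ)..1, ((p + t • q) + x • (δ • q)) := by
    refine intervalIntegral.integral_congr fun x hx => ?_
    rw [uIcc_of_le (by norm_num)] at hx
    rw [h x hx]
    module
  have h1 : Continuous fun x : ℝ => x • (δ • q) := by fun_prop
  rw [smooth, e, intervalIntegral.integral_add (by simp) (h1.intervalIntegrable _ _),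
    intervalIntegral.integral_const, intervalIntegral.integral_smul_const, integral_id]
  norm_num
  module

/-- With δ = 0 admitted as a parameter, the smoothings form an isotopy that starts at the curve
itself. -/
theorem smooth_zero (γ : ℝ → E3) : smooth 0 γ = γ := by
  funext t
  rw [smooth]
  simp only [zero_mul, add_zero, intervalIntegral.integral_const, smul_smul]
  norm_num

theorem continuous_comp_line (ℓ : E3 →ₗ[ℝ] ℝ) (hγ : Continuous γ) (δ t : ℝ) :
    Continuous fun x => ℓ (γ (t + δ * x)) :=
  (LinearMap.continuous_of_finiteDimensional ℓ).comp (hγ.comp (by fun_prop))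

theorem smooth_le {ℓ : E3 →ₗ[ℝ] ℝ} (hγ : Continuous γ)
    (h : ∀ x ∈ Icc (-1 : ℝ) 1, ℓ (γ (t + δ * x)) ≤ ℓ (γ (t' + δ * x))) :
    ℓ (smooth δ γ t) ≤ ℓ (smooth δ γ t') := by
  rw [map_smooth ℓ hγ, map_smooth ℓ hγ]
  have := intervalIntegral.integral_mono_on (μ := volume) (by norm_num)
    ((continuous_comp_line ℓ hγ δ t).intervalIntegrable _ _)
    ((continuous_comp_line ℓ hγ δ t').intervalIntegrable _ _) h
  linarith

theorem integral_lt_integral {f g : ℝ → ℝ} (hf : Continuous f) (hg : Continuous g) {a b : ℝ}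
    (hab : a < b) (h : ∀ x ∈ Ioo a b, f x < g x) : ∫ x in a..b, f x < ∫ x in a..b, g x := by
  have := intervalIntegral.intervalIntegral_pos_of_pos_on
    ((hg.sub hf).intervalIntegrable (μ := volume) a b)
    (fun x hx => sub_pos.2 (h x hx)) hab
  rw [← sub_pos, ← intervalIntegral.integral_sub (hg.intervalIntegrable _ _)
    (hf.intervalIntegrable _ _)]
  exact this

theorem smooth_lt {ℓ : E3 →ₗ[ℝ] ℝ} (hγ : Continuous γ)
    (h : ∀ x ∈ Icc (-1 : ℝ) 1, ℓ (γ (t + δ * x)) < ℓ (γ (t' + δ * x))) :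
    ℓ (smooth δ γ t) < ℓ (smooth δ γ t') := by
  rw [map_smooth ℓ hγ, map_smooth ℓ hγ]
  have := integral_lt_integral (continuous_comp_line ℓ hγ δ t) (continuous_comp_line ℓ hγ δ t')
    (show (-1 : ℝ) < 1 by norm_num) fun x hx => h x (Ioo_subset_Icc_self hx)
  linarith

theorem window_mem {x : ℝ} (hx : x ∈ Icc (-1 : ℝ) 1) (hδ : |δ| ≤ r) : δ * x ∈ Icc (-r) r := by
  have : |δ * x| ≤ r := by
    rw [abs_mul]
    have := abs_le.2 ⟨hx.1, hx.2⟩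
    nlinarith [abs_nonneg δ, abs_nonneg x]
  exact abs_le.1 this

/-- Averaging preserves strict monotonicity as long as the averaging interval stays in the larger
window; so every chart of the curve is a chart of the smoothing. -/
theorem strictMonoOn_smooth {ℓ : E3 →ₗ[ℝ] ℝ} (hγ : Continuous γ) {s : ℝ}
    (h : StrictMonoOn (fun t => ℓ (γ t)) (Icc (s - 2 * r) (s + 2 * r))) (hδ : |δ| ≤ r) :
    StrictMonoOn (fun t => ℓ (smooth δ γ t)) (Icc (s - r) (s + r)) := by
  intro a ha b hb hab
  refine smooth_lt hγ fun x hx => h ?_ ?_ (by linarith)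
  all_goals
    have := window_mem hx hδ
    constructor <;> linarith [ha.1, ha.2, hb.1, hb.2, this.1, this.2]

theorem smooth_mem_Ioo (hγ : Continuous γ) (c : Fin 3)
    (h : ∀ x ∈ Icc (-1 : ℝ) 1, γ (t + δ * x) c ∈ Ioo (0 : ℝ) 1) :
    smooth δ γ t c ∈ Ioo (0 : ℝ) 1 := by
  have e := map_smooth (EuclideanSpace.proj c : E3 →L[ℝ] ℝ).toLinearMap hγ δ t
  have hc := continuous_comp_line (EuclideanSpace.proj c : E3 →L[ℝ] ℝ).toLinearMap hγ δ t
  simp only [ContinuousLinearMap.coe_coe, PiLp.proj_apply] at e hc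
  have h1 := integral_lt_integral continuous_const hc (show (-1 : ℝ) < 1 by norm_num)
    fun x hx => (h x (Ioo_subset_Icc_self hx)).1
  have h2 := integral_lt_integral hc continuous_const (show (-1 : ℝ) < 1 by norm_num)
    fun x hx => (h x (Ioo_subset_Icc_self hx)).2
  rw [intervalIntegral.integral_const, smul_eq_mul] at h1 h2
  rw [e]
  constructor <;> linarith

/-- The derivative of the smoothing of a curve. -/
theorem hasDerivAt_smooth (hγ : Continuous γ) (hδ : 0 < δ) (c : Fin 3) (t : ℝ) :
    HasDerivAt (fun t => smooth δ γ t c) ((γ (t + δ) c - γ (t - δ) c) / (2 * δ)) t := by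
  have hc : Continuous fun t => γ t c := (EuclideanSpace.proj c).continuous.comp hγ
  have e : ∀ t, smooth δ γ t c = ((∫ x in (0 : ℝ)..(t + δ), γ x c) -
      ∫ x in (0 : ℝ)..(t - δ), γ x c) / (2 * δ) := fun t => by
    have e := map_smooth (EuclideanSpace.proj c : E3 →L[ℝ] ℝ).toLinearMap hγ δ t
    simp only [ContinuousLinearMap.coe_coe, PiLp.proj_apply] at e
    rw [e, intervalIntegral.integral_comp_add_mul (fun x => γ x c) hδ.ne',
      intervalIntegral.integral_interval_sub_left (hc.intervalIntegrable _ _)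
        (hc.intervalIntegrable _ _), smul_eq_mul, mul_neg, mul_one,
      ← sub_eq_add_neg]
    field_simp
  have d : ∀ u, HasDerivAt (fun u => ∫ x in (0 : ℝ)..u, γ x c) (γ u c) u := fun u =>
    intervalIntegral.integral_hasDerivAt_right (hc.intervalIntegrable _ _)
      hc.aestronglyMeasurable.stronglyMeasurableAtFilter hc.continuousAt
  have h1 := (d (t + δ)).comp_add_const t δ
  have h2 := (d (t - δ)).comp_sub_const t δ
  exact ((h1.sub h2).div_const (2 * δ)).congr_of_eventuallyEq (Eventually.of_forall e)

/-- The sign of the derivative of the smoothing is that of a chord of the curve. -/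
theorem strictMonoOn_smooth_apply (hγ : Continuous γ) (hδ : 0 < δ) {c : Fin 3} {s a b : ℝ}
    (h : ∀ t ∈ Icc a b, 0 < s * (γ (t + δ) c - γ (t - δ) c)) :
    StrictMonoOn (fun t => s * smooth δ γ t c) (Icc a b) := by
  have hd := fun t => (hasDerivAt_smooth hγ hδ c t).const_mul s
  refine strictMonoOn_of_hasDerivWithinAt_pos (convex_Icc a b)
    (fun t _ => (hd t).continuousAt.continuousWithinAt) (fun t _ => (hd t).hasDerivWithinAt)
    fun t ht => ?_
  rw [← mul_div_assoc]
  exact div_pos (h t (interior_subset ht)) (by linarith)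

/-- A family of injective curves with local charts that are linear near the ends. -/
structure Regular {X : Type*} [TopologicalSpace X] (Γ : X → ℝ → E3) (x₀ : X) : Prop where
  cont : Continuous fun p : X × ℝ => Γ p.1 p.2
  cube : ∀ᶠ x in 𝓝 x₀, ∀ t ∈ Ioo (0 : ℝ) 1, ∀ c, Γ x t c ∈ Ioo (0 : ℝ) 1
  inj : InjOn (Γ x₀) (Icc 0 1)
  chart : ∀ s ∈ Icc (0 : ℝ) 1, ∃ ℓ : E3 →ₗ[ℝ] ℝ, ∃ r > 0, ∀ᶠ x in 𝓝 x₀,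
    StrictMonoOn (fun t => ℓ (Γ x t)) (Icc (s - r) (s + r))
  linear : ∃ r > 0, ∀ᶠ x in 𝓝 x₀, ∃ a b : E3, (∀ t ≤ r, Γ x t = t • a) ∧
    ∀ t, 1 - r ≤ t → Γ x t = ones + (t - 1) • b

variable {X : Type*} [TopologicalSpace X] {Γ : X → ℝ → E3} {x₀ : X}

theorem Regular.comp (h : Regular Γ x₀) {Z : Type*} [TopologicalSpace Z] {φ : Z → X} {z₀ : Z}
    (hφ : Continuous φ) (h0 : φ z₀ = x₀) : Regular (fun z => Γ (φ z)) z₀ := by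
  have ht : Tendsto φ (𝓝 z₀) (𝓝 x₀) := h0 ▸ hφ.tendsto z₀
  refine ⟨h.cont.comp ((hφ.comp continuous_fst).prodMk continuous_snd), ht.eventually h.cube,
    h0 ▸ h.inj, fun s hs => ?_, ?_⟩
  · obtain ⟨ℓ, r, hr, h1⟩ := h.chart s hs
    exact ⟨ℓ, r, hr, ht.eventually h1⟩
  · obtain ⟨r, hr, h1⟩ := h.linear
    exact ⟨r, hr, ht.eventually h1⟩

theorem Regular.continuous_curve (h : Regular Γ x₀) (x : X) : Continuous (Γ x) :=
  h.cont.comp (Continuous.prodMk_right x)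

theorem Regular.exists_tame (h : Regular Γ x₀) :
    ∃ η ρ μ, ∀ᶠ x in 𝓝 x₀, Tame univ η ρ μ (Γ x) := by
  obtain ⟨r, hr, hlin⟩ := h.linear
  refine Plumbers.exists_tame h.cont ?_ ?_ h.cube h.inj fun s hs => ?_
  · filter_upwards [hlin] with x ⟨a, b, h1, _⟩
    rw [h1 0 hr.le, zero_smul]
  · filter_upwards [hlin] with x ⟨a, b, _, h1⟩
    rw [h1 1 (by linarith), sub_self, zero_smul, add_zero]
  · obtain ⟨ℓ, h1⟩ := h.chart s hs
    exact ⟨ℓ, mem_univ _, h1⟩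

theorem Regular.continuous_smooth (h : Regular Γ x₀) :
    Continuous fun p : (ℝ × X) × ℝ => smooth p.1.1 (Γ p.1.2) p.2 := by
  have hc : Continuous (Function.uncurry fun (p : (ℝ × X) × ℝ) (x : ℝ) =>
      Γ p.1.2 (p.2 + p.1.1 * x)) :=
    h.cont.comp (f := fun q : ((ℝ × X) × ℝ) × ℝ => (q.1.1.2, q.1.2 + q.1.1.1 * q.2)) (by fun_prop)
  exact (intervalIntegral.continuous_parametric_intervalIntegral_of_continuous' hc (-1)
    1).const_smul (1 / 2 : ℝ)

/-- Near the ends the curve is linear and equals its smoothing; elsewhere the averaging interval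
lies in (0, 1), where the curve is inside the open cube. -/
theorem smooth_mem_cube (hγ : Continuous γ) (hcube : ∀ t ∈ Ioo (0 : ℝ) 1, ∀ c, γ t c ∈ Ioo (0 : ℝ) 1)
    {a b : E3} (h0 : ∀ t ≤ r, γ t = t • a) (h1 : ∀ t, 1 - r ≤ t → γ t = ones + (t - 1) • b)
    (hδ : |δ| < r / 2) :
    smooth δ γ 0 = 0 ∧ smooth δ γ 1 = ones ∧
      ∀ t ∈ Ioo (0 : ℝ) 1, ∀ c, smooth δ γ t c ∈ Ioo (0 : ℝ) 1 := by
  have hδ0 := abs_nonneg δ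
  have A : ∀ t, t + |δ| ≤ r → smooth δ γ t = γ t := fun t ht => by
    rw [h0 t (by linarith), ← zero_add (t • a)]
    refine smooth_affine fun x hx => ?_
    rw [h0 _ (by linarith [(window_mem (δ := δ) hx le_rfl).2]), zero_add]
  have B : ∀ t, 1 - r ≤ t - |δ| → smooth δ γ t = γ t := fun t ht => by
    rw [h1 t (by linarith), show ones + (t - 1) • b = (ones - b) + t • b by module]
    refine smooth_affine fun x hx => ?_
    rw [h1 _ (by linarith [(window_mem (δ := δ) hx le_rfl).1])]
    module
  refine ⟨?_, ?_, fun t ht c => ?_⟩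
  · rw [A 0 (by linarith), h0 0 (by linarith), zero_smul]
  · rw [B 1 (by linarith), h1 1 (by linarith), sub_self, zero_smul, add_zero]
  · rcases le_or_gt (t + |δ|) r with h2 | h2
    · rw [A t h2]; exact hcube t ht c
    rcases le_or_gt (1 - r) (t - |δ|) with h3 | h3
    · rw [B t h3]; exact hcube t ht c
    · refine smooth_mem_Ioo hγ c fun x hx => hcube _ ?_ c
      have := window_mem (δ := δ) hx le_rfl
      constructor <;> linarith [this.1, this.2]

theorem Regular.eventually_ends (h : Regular Γ x₀) : ∀ᶠ p : ℝ × X in 𝓝 (0, x₀),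
    smooth p.1 (Γ p.2) 0 = 0 ∧ smooth p.1 (Γ p.2) 1 = ones ∧
      ∀ t ∈ Ioo (0 : ℝ) 1, ∀ c, smooth p.1 (Γ p.2) t c ∈ Ioo (0 : ℝ) 1 := by
  obtain ⟨r, hr, hlin⟩ := h.linear
  have hδ : ∀ᶠ δ : ℝ in 𝓝 0, |δ| < r / 2 :=
    continuous_abs.tendsto' _ _ abs_zero |>.eventually_lt_const (by linarith)
  filter_upwards [hδ.prod_nhds (h.cube.and hlin)] with p ⟨h1, h2, a, b, h3, h4⟩
  exact smooth_mem_cube (h.continuous_curve _) h2 h3 h4 h1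

/-- At δ = 0 the smoothing is the given curve, and charts survive on half their window; so
compactness applies with the pair (δ, x) as the parameter. -/
theorem Regular.smooth_tame (h : Regular Γ x₀) :
    ∃ η ρ μ, ∀ᶠ p : ℝ × X in 𝓝 (0, x₀), Tame univ η ρ μ (smooth p.1 (Γ p.2)) := by
  have he := h.eventually_ends
  refine Plumbers.exists_tame (Γ := fun p : ℝ × X => smooth p.1 (Γ p.2)) h.continuous_smooth
    (he.mono fun p hp => hp.1) (he.mono fun p hp => hp.2.1) (he.mono fun p hp => hp.2.2) ?_
    fun s hs => ?_
  · simpa only [smooth_zero] using h.inj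
  · obtain ⟨ℓ, r, hr, h1⟩ := h.chart s hs
    refine ⟨ℓ, mem_univ _, r / 2, by linarith, ?_⟩
    have hδ : ∀ᶠ δ : ℝ in 𝓝 0, |δ| < r / 2 :=
      continuous_abs.tendsto' _ _ abs_zero |>.eventually_lt_const (by linarith)
    filter_upwards [hδ.prod_nhds h1] with p ⟨h2, h3⟩
    refine strictMonoOn_smooth (h.continuous_curve _) ?_ h2.le
    rwa [mul_div_cancel₀ _ two_ne_zero]

/-- The smoothings of regular curves have charts given by coordinates. -/
theorem Regular.smooth_tame_coords (h : Regular Γ x₀) : ∃ δ₀ > 0, ∀ᶠ x₁ in 𝓝 x₀,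
    ∀ δ₁ ∈ Ioo (0 : ℝ) δ₀, ∃ η ρ μ, ∀ᶠ p : ℝ × X in 𝓝 (δ₁, x₁),
      Tame coords η ρ μ (smooth p.1 (Γ p.2)) := by
  obtain ⟨η, ρ, μ, h1⟩ := h.exists_tame
  obtain ⟨η', ρ', μ', h2⟩ := h.smooth_tame
  obtain ⟨x, hx⟩ := h1.exists
  have hη := hx.pos
  obtain ⟨pδ, hδ, pX, hX, h3⟩ := eventually_prod_iff.1 (nhds_prod_eq (X := ℝ) (Y := X) ▸ h2)
  obtain ⟨δ₀, hδ₀, hball⟩ := Metric.eventually_nhds_iff.1 hδ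
  refine ⟨min δ₀ η, lt_min hδ₀ hη, ?_⟩
  filter_upwards [h1, hX.eventually_nhds] with x₁ h4 h5 δ₁ hδ₁
  have d1 : δ₁ < δ₀ := hδ₁.2.trans_le (min_le_left _ _)
  have d2 : δ₁ < η := hδ₁.2.trans_le (min_le_right _ _)
  have near : ∀ᶠ δ in 𝓝 δ₁, 0 < δ ∧ pδ δ := by
    filter_upwards [Ioo_mem_nhds hδ₁.1 d1] with δ hδ
    exact ⟨hδ.1, hball (by rw [Real.dist_eq, sub_zero, abs_of_pos hδ.1]; exact hδ.2)⟩
  have htame : ∀ᶠ p : ℝ × X in 𝓝 (δ₁, x₁), 0 < p.1 ∧ Tame univ η' ρ' μ' (smooth p.1 (Γ p.2)) := by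
    filter_upwards [near.prod_nhds h5] with p ⟨⟨a, b⟩, c⟩
    exact ⟨a, h3 b c⟩
  refine Plumbers.exists_tame (Γ := fun p : ℝ × X => smooth p.1 (Γ p.2)) h.continuous_smooth
    (htame.mono fun p hp => hp.2.zero) (htame.mono fun p hp => hp.2.one)
    (htame.mono fun p hp => hp.2.cube) htame.self_of_nhds.2.injOn fun s hs => ?_
  -- Since δ₁ < η, a functional of the tame curve increases across the chord, which is thus nonzero
  -- in some coordinate. By continuity that coordinate keeps its sign for nearby times and
  -- parameters and provides the chart. Injectivity comes from tameness for general functionals.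
  have hne : Γ x₁ (s + δ₁) - Γ x₁ (s - δ₁) ≠ 0 := by
    obtain ⟨ℓ, -, hm⟩ := h4.chart s hs
    have := hm (a := s - δ₁) (b := s + δ₁) ⟨by linarith, by linarith [hδ₁.1]⟩
      ⟨by linarith [hδ₁.1], by linarith⟩ (by linarith [hδ₁.1])
    intro h0
    simp only [sub_eq_zero.1 h0] at this
    exact lt_irrefl _ this
  obtain ⟨c, hc⟩ : ∃ c, (Γ x₁ (s + δ₁) - Γ x₁ (s - δ₁)) c ≠ 0 := by
    by_contra! hc
    exact hne (PiLp.ext hc)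
  obtain ⟨σ, hσ, hpos⟩ := (zero_or_sign _).resolve_left hc
  have hcont : Continuous fun q : (ℝ × X) × ℝ =>
      σ * (Γ q.1.2 (q.2 + q.1.1) c - Γ q.1.2 (q.2 - q.1.1) c) := by
    have c1 : Continuous fun q : (ℝ × X) × ℝ => Γ q.1.2 (q.2 + q.1.1) :=
      h.cont.comp (f := fun q : (ℝ × X) × ℝ => (q.1.2, q.2 + q.1.1)) (by fun_prop)
    have c2 : Continuous fun q : (ℝ × X) × ℝ => Γ q.1.2 (q.2 - q.1.1) :=
      h.cont.comp (f := fun q : (ℝ × X) × ℝ => (q.1.2, q.2 - q.1.1)) (by fun_prop)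
    exact continuous_const.mul (((EuclideanSpace.proj c).continuous.comp c1).sub
      ((EuclideanSpace.proj c).continuous.comp c2))
  have hev : ∀ᶠ q : (ℝ × X) × ℝ in 𝓝 ((δ₁, x₁), s),
      0 < σ * (Γ q.1.2 (q.2 + q.1.1) c - Γ q.1.2 (q.2 - q.1.1) c) :=
    hcont.continuousAt.eventually_const_lt hpos
  obtain ⟨pp, hpp, ps, hps, h6⟩ :=
    eventually_prod_iff.1 (nhds_prod_eq (X := ℝ × X) (Y := ℝ) ▸ hev)
  obtain ⟨r, hr, hball'⟩ := Metric.eventually_nhds_iff.1 hps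
  refine ⟨σ • (EuclideanSpace.proj c : E3 →L[ℝ] ℝ).toLinearMap, ⟨c, σ, hσ, fun x => rfl⟩, r / 2,
    by linarith, ?_⟩
  filter_upwards [hpp, htame] with p h7 h8
  refine strictMonoOn_smooth_apply (h.continuous_curve _) h8.1 fun t ht => h6 h7 (hball' ?_)
  rw [Real.dist_eq, abs_lt]
  constructor <;> linarith [ht.1, ht.2]

end smooth

/-! ### Components traced by curves and by their smoothings -/

open Filter Topology

/-- The fine samples of the curve `γ` lie in the component `c`. -/
def Traces (S : ℕ → Set Seq) (g : ℕ → Seq → Seq) (γ : ℝ → E3) (c : ZerothHomotopy (Lim S g)) :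
    Prop :=
  ∃ μ > 0, ∀ n t, 3 ≤ n → FineTimes n μ t → Represents S g n (fun i => γ (t i)) c

section Traces

variable {S : ℕ → Set Seq} {g : ℕ → Seq → Seq} {C : Set (E3 →ₗ[ℝ] ℝ)}
  {c c' : ZerothHomotopy (Lim S g)}

theorem exists_fineTimes {μ : ℝ} (hμ : 0 < μ) : ∃ N, 3 ≤ N ∧ ∀ n, N ≤ n →
    FineTimes n μ fun i => min ((i : ℝ) / n) 1 := by
  obtain ⟨m, hm⟩ := exists_nat_one_div_lt hμ
  refine ⟨m + 3, by omega, fun n hn => FineTimes.uniform (by omega) (le_trans ?_ hm.le)⟩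
  gcongr
  exact_mod_cast (by omega : m + 1 ≤ n)

theorem Traces.unique {γ : ℝ → E3} (h : Traces S g γ c) (h' : Traces S g γ c') : c = c' := by
  obtain ⟨μ, hμ, h⟩ := h
  obtain ⟨μ', hμ', h'⟩ := h'
  obtain ⟨N, hN, ht⟩ := exists_fineTimes hμ
  obtain ⟨N', hN', ht'⟩ := exists_fineTimes hμ'
  exact (h _ _ (by omega) (ht (max N N') (le_max_left _ _))).unique
    (h' _ _ (by omega) (ht' (max N N') (le_max_right _ _)))

theorem System.exists_traces (h : System S g C) {η ρ μ : ℝ} {γ : ℝ → E3} (hγ : Tame C η ρ μ γ)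
    (hc : Continuous γ) : ∃ c, Traces S g γ c :=
  (h.exists_class hγ hc).imp fun _ hc => ⟨μ, hγ.mesh_pos, hc⟩

/-- Near each parameter the curves are tame with common constants, so one list of times samples all
of them and moving the curve gives a path in a single stage. Connectedness of the interval does the
rest. -/
theorem Traces.isotopy (h : System S g C) {Λ : ℝ → ℝ → E3}
    (hΛ : Continuous fun p : ℝ × ℝ => Λ p.1 p.2) {a b : ℝ} (hab : a ≤ b)
    (ht : ∀ s ∈ Icc a b, ∃ η ρ μ, ∀ᶠ x in 𝓝 s, Tame C η ρ μ (Λ x)) :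
    Traces S g (Λ a) c ↔ Traces S g (Λ b) c := by
  have cont : ∀ s, Continuous (Λ s) := fun s => hΛ.comp (Continuous.prodMk_right s)
  refine isPreconnected_Icc.induction₂ (s := Icc a b)
    (fun s s' => Traces S g (Λ s) c ↔ Traces S g (Λ s') c) (fun s hs => ?_)
    (fun x y z _ _ _ h1 h2 => h1.trans h2) (fun x y _ _ h1 => h1.symm)
    (left_mem_Icc.2 hab) (right_mem_Icc.2 hab)
  obtain ⟨η, ρ, μ, h1⟩ := ht s hs
  obtain ⟨r, hr, hball⟩ := Metric.eventually_nhds_iff_ball.1 h1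
  refine nhdsWithin_le_nhds ?_
  filter_upwards [Metric.ball_mem_nhds s hr] with s' hs'
  have hs0 := Metric.mem_ball_self (x := s) hr
  obtain ⟨c1, h2⟩ := h.exists_class (hball s hs0) (cont s)
  obtain ⟨c2, h3⟩ := h.exists_class (hball s' hs') (cont s')
  have hμ := (hball s hs0).mesh_pos
  have e : c1 = c2 := by
    obtain ⟨N, hN, ht⟩ := exists_fineTimes hμ
    have hN' := ht N le_rfl
    refine (h2 N _ hN hN').unique (.of_joinedIn (h3 N _ hN hN') ?_)
    refine JoinedIn.symm (JoinedIn.ofLine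
      (f := fun x (i : ℕ) => Λ (s + x * (s' - s)) (min ((i : ℝ) / N) 1)) ?_ ?_ ?_ ?_)
    · refine (continuous_pi fun i => ?_).continuousOn
      exact hΛ.comp (f := fun x : ℝ => (s + x * (s' - s), min ((i : ℝ) / N) 1)) (by fun_prop)
    · simp
    · simp
    · rintro _ ⟨x, hx, rfl⟩
      refine h.curve_mem (hball _ ?_) hN hN'
      rw [Metric.mem_ball, Real.dist_eq] at hs' ⊢
      rw [add_sub_cancel_left, abs_mul, abs_of_nonneg hx.1]
      nlinarith [hx.2, abs_nonneg (s' - s)]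
  subst e
  have t1 : Traces S g (Λ s) c1 := ⟨μ, hμ, h2⟩
  have t2 : Traces S g (Λ s') c1 := ⟨μ, hμ, h3⟩
  exact ⟨fun h => h.unique t1 ▸ t2, fun h => h.unique t2 ▸ t1⟩

end Traces

/-- The component of the plumbers' knots along the smoothings of a curve. -/
def SmoothClass (α : ℕ → ℕ) (γ : ℝ → E3) (c : ZerothHomotopy (Lim K (iota α))) : Prop :=
  ∃ δ₀ > 0, ∀ δ ∈ Ioo (0 : ℝ) δ₀, Traces K (iota α) (smooth δ γ) c

section SmoothClass

variable {α : ℕ → ℕ} {c c' : ZerothHomotopy (Lim K (iota α))}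

/-- Changing δ within (0, δ₀) is an isotopy of curves with coordinate charts, so a single δ decides
the class. It matters that δ₀ is uniform in x. -/
theorem Regular.eventually_smoothClass (hα : ∀ n, 3 ≤ n → α n + 3 ≤ n) {X : Type*}
    [TopologicalSpace X] {Γ : X → ℝ → E3} {x₀ : X} (h : Regular Γ x₀) :
    ∃ δ₀ > 0, ∀ᶠ x in 𝓝 x₀, ∀ δ ∈ Ioo (0 : ℝ) δ₀, (∃ η ρ μ, ∀ᶠ p : ℝ × X in 𝓝 (δ, x),
      Tame coords η ρ μ (smooth p.1 (Γ p.2))) ∧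
      ∀ c, SmoothClass α (Γ x) c ↔ Traces K (iota α) (smooth δ (Γ x)) c := by
  obtain ⟨δ₀, hδ₀, h1⟩ := h.smooth_tame_coords
  refine ⟨δ₀, hδ₀, h1.mono fun x hx δ hδ => ⟨hx δ hδ, fun c => ?_⟩⟩
  have iso : ∀ δ₁ δ₂, δ₁ ∈ Ioo 0 δ₀ → δ₂ ∈ Ioo 0 δ₀ → δ₁ ≤ δ₂ → ∀ c,
      (Traces K (iota α) (smooth δ₁ (Γ x)) c ↔ Traces K (iota α) (smooth δ₂ (Γ x)) c) := by
    intro δ₁ δ₂ h2 h3 hle c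
    refine Traces.isotopy (system_K hα) (Λ := fun δ => smooth δ (Γ x)) ?_ hle fun s hs => ?_
    · exact h.continuous_smooth.comp (f := fun p : ℝ × ℝ => ((p.1, x), p.2)) (by fun_prop)
    · obtain ⟨η, ρ, μ, h4⟩ := hx s ⟨h2.1.trans_le hs.1, hs.2.trans_lt h3.2⟩
      exact ⟨η, ρ, μ, (Continuous.prodMk_left x).continuousAt.eventually h4⟩
  constructor
  · rintro ⟨δ₁, hδ₁, h2⟩
    have h3 : 0 < min δ₁ δ := lt_min hδ₁ hδ.1
    have h4 := min_le_left δ₁ δ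
    have h5 := min_le_right δ₁ δ
    exact (iso (min δ₁ δ / 2) δ ⟨by linarith, by linarith [hδ.2]⟩ hδ (by linarith) c).1
      (h2 _ ⟨by linarith, by linarith⟩)
  · refine fun h2 => ⟨δ₀, hδ₀, fun δ' hδ' => ?_⟩
    rcases le_total δ δ' with h3 | h3
    · exact (iso δ δ' hδ hδ' h3 c).1 h2
    · exact (iso δ' δ hδ' hδ h3 c).2 h2

theorem Regular.exists_smoothClass (hα : ∀ n, 3 ≤ n → α n + 3 ≤ n) {X : Type*}
    [TopologicalSpace X] {Γ : X → ℝ → E3} {x₀ : X} (h : Regular Γ x₀) :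
    ∃ c, SmoothClass α (Γ x₀) c := by
  obtain ⟨δ₀, hδ₀, h1⟩ := h.eventually_smoothClass hα
  obtain ⟨⟨η, ρ, μ, h2⟩, h3⟩ := h1.self_of_nhds (δ₀ / 2) ⟨by linarith, by linarith⟩
  obtain ⟨c, hc⟩ := (system_K hα).exists_traces h2.self_of_nhds
    (h.continuous_smooth.comp (Continuous.prodMk_right (δ₀ / 2, x₀)))
  exact ⟨c, (h3 c).2 hc⟩

/-- Near each parameter one radius, δ₀/2, serves all curves, and their smoothings by this radius
form an isotopy of tame curves. -/
theorem SmoothClass.isotopy (hα : ∀ n, 3 ≤ n → α n + 3 ≤ n) {Γ : ℝ → ℝ → E3}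
    (h : ∀ s ∈ Icc (0 : ℝ) 1, Regular Γ s) : SmoothClass α (Γ 0) c ↔ SmoothClass α (Γ 1) c := by
  refine isPreconnected_Icc.induction₂ (s := Icc (0 : ℝ) 1)
    (fun s s' => SmoothClass α (Γ s) c ↔ SmoothClass α (Γ s') c) (fun s hs => ?_)
    (fun x y z _ _ _ h1 h2 => h1.trans h2) (fun x y _ _ h1 => h1.symm)
    (left_mem_Icc.2 zero_le_one) (right_mem_Icc.2 zero_le_one)
  obtain ⟨δ₀, hδ₀, h1⟩ := (h s hs).eventually_smoothClass hα
  obtain ⟨r, hr, hball⟩ := Metric.eventually_nhds_iff_ball.1 h1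
  refine nhdsWithin_le_nhds ?_
  filter_upwards [Metric.ball_mem_nhds s hr] with s' hs'
  have hδ : δ₀ / 2 ∈ Ioo 0 δ₀ := ⟨by linarith, by linarith⟩
  have hs0 := Metric.mem_ball_self (x := s) hr
  rw [(hball s hs0 _ hδ).2 c, (hball s' hs' _ hδ).2 c]
  have hc : Continuous fun p : ℝ × ℝ => smooth (δ₀ / 2) (Γ p.1) p.2 :=
    (h s hs).continuous_smooth.comp (f := fun p : ℝ × ℝ => ((δ₀ / 2, p.1), p.2)) (by fun_prop)
  have iso : ∀ a b, a ≤ b → a ∈ Metric.ball s r → b ∈ Metric.ball s r →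
      (Traces K (iota α) (smooth (δ₀ / 2) (Γ a)) c ↔
        Traces K (iota α) (smooth (δ₀ / 2) (Γ b)) c) := by
    intro a b hab ha hb
    refine Traces.isotopy (system_K hα) (Λ := fun x => smooth (δ₀ / 2) (Γ x)) hc hab fun x hx => ?_
    have hx' : x ∈ Metric.ball s r := by
      rw [Real.ball_eq_Ioo] at ha hb ⊢
      exact ⟨ha.1.trans_le hx.1, hx.2.trans_lt hb.2⟩
    obtain ⟨⟨η, ρ, μ, h4⟩, -⟩ := hball x hx' _ hδ
    exact ⟨η, ρ, μ, (Continuous.prodMk_right (δ₀ / 2)).continuousAt.eventually h4⟩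
  rcases le_total s s' with hle | hle
  · exact iso s s' hle hs0 hs'
  · exact (iso s' s hle hs' hs0).symm

theorem regular_curve {n : ℕ} (hn : 2 ≤ n) {w : Seq} (hw : w ∈ L n) : Regular (curve n) w := by
  have hn' : (0 : ℝ) < n := Nat.cast_pos.2 (by omega)
  refine ⟨continuous_curve n, ?_, (injOn_curve_iff (by omega) hw.1).2 hw, fun s _ => ?_, ?_⟩
  · filter_upwards [eventually_pin_mem_P (by omega) hw.1] with w' hw' t ht c
    exact hinge_mem_cube hn hw' ⟨by have := ht.1; positivity, by nlinarith [ht.2]⟩ c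
  · obtain ⟨ℓ, hℓ⟩ := eventually_strictMonoOn_hinge hn hw (n * s)
    refine ⟨ℓ, 1 / (2 * n), by positivity, hℓ.mono fun w' h x hx y hy hxy => ?_⟩
    have e : (n : ℝ) * (1 / (2 * n)) = 1 / 2 := by field_simp
    exact h ⟨by nlinarith [hx.1], by nlinarith [hx.2]⟩ ⟨by nlinarith [hy.1], by nlinarith [hy.2]⟩
      (mul_lt_mul_of_pos_left hxy hn')
  · have e : (n : ℝ) * (1 / n) = 1 := by field_simp
    refine ⟨1 / n, by positivity, Eventually.of_forall fun w' => ⟨(n : ℝ) • pin n w' 1,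
      (n : ℝ) • (ones - pin n w' (n - 1)), fun t ht => ?_, fun t ht => ?_⟩⟩
    · rw [curve, hinge_eq (i := 0) (by omega) _ (Or.inl rfl) (Or.inr (by push_cast; nlinarith))]
      have : pin n w' 0 = 0 := if_pos rfl
      rw [this]
      push_cast
      module
    · have c1 : ((n - 1 : ℕ) : ℝ) = n - 1 := by rw [Nat.cast_sub (by omega)]; simp
      rw [curve, hinge_eq (i := n - 1) (by omega) _ (Or.inr (by rw [c1]; nlinarith))
        (Or.inl (by omega)), show n - 1 + 1 = n by omega, c1]
      have : pin n w' n = ones := by rw [pin, if_neg (by omega), if_pos le_rfl]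
      rw [this]
      module

theorem smoothClass_iff_of_joinedIn (hα : ∀ n, 3 ≤ n → α n + 3 ≤ n) {n : ℕ} (hn : 2 ≤ n)
    {w w' : Seq} (h : JoinedIn (L n) w w') :
    SmoothClass α (curve n w) c ↔ SmoothClass α (curve n w') c := by
  obtain ⟨p, hp⟩ := h
  have := SmoothClass.isotopy (c := c) hα (Γ := fun s => curve n (p.extend s)) fun s _ => by
    refine (regular_curve hn ?_).comp (φ := p.extend) (x₀ := p.extend s) (by fun_prop) rfl
    exact hp (projIcc 0 1 zero_le_one s)
  simpa using this

end SmoothClass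

/-! ### Independence of the smoothing class from inserted vertices -/

open Filter Topology

/-- A reparametrization of the interval `[0, n]` that has slope `1 / 2` on `[1, 3]` and slope `1`
elsewhere. -/
def stretch (u : ℝ) : ℝ := min u (max ((u + 1) / 2) (u - 1))

theorem continuous_stretch : Continuous stretch := by
  unfold stretch
  fun_prop

theorem stretch_strictMono : StrictMono stretch := fun a b h =>
  lt_min (lt_of_le_of_lt (min_le_left _ _) h)
    (lt_of_le_of_lt (min_le_right _ _) (max_lt (lt_max_of_lt_left (by linarith))
      (lt_max_of_lt_right (by linarith))))

theorem stretch_of_le_one {u : ℝ} (h : u ≤ 1) : stretch u = u := by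
  rw [stretch, max_eq_left (by linarith), min_eq_left (by linarith)]

theorem stretch_of_mem {u : ℝ} (h : 1 ≤ u) (h' : u ≤ 3) : stretch u = (u + 1) / 2 := by
  rw [stretch, max_eq_left (by linarith), min_eq_right (by linarith)]

theorem stretch_of_three_le {u : ℝ} (h : 3 ≤ u) : stretch u = u - 1 := by
  rw [stretch, max_eq_right (by linarith), min_eq_right (by linarith)]

/-- Interpolation between two parametrizations of a polygon. -/
def shift (n : ℕ) (s t : ℝ) : ℝ :=
  (1 - projIcc (0 : ℝ) 1 zero_le_one s) * (n * t) +
    projIcc (0 : ℝ) 1 zero_le_one s * stretch ((n + 1) * t)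

theorem continuous_shift (n : ℕ) : Continuous fun p : ℝ × ℝ => shift n p.1 p.2 := by
  have h := continuous_stretch
  have h1 : Continuous fun s : ℝ => (projIcc (0 : ℝ) 1 zero_le_one s : ℝ) :=
    continuous_subtype_val.comp continuous_projIcc
  unfold shift
  fun_prop

theorem shift_strictMono {n : ℕ} (hn : 0 < n) (s : ℝ) : StrictMono (shift n s) := by
  intro a b hab
  obtain ⟨h0, h1⟩ := (projIcc (0 : ℝ) 1 zero_le_one s).2
  have hn' : (0 : ℝ) < n := Nat.cast_pos.2 hn
  have h2 := stretch_strictMono (show ((n : ℝ) + 1) * a < (n + 1) * b by nlinarith)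
  have h3 : (n : ℝ) * a < n * b := by nlinarith
  have := convex_lt h3 h2 ⟨h0, h1⟩
  exact this

/-- Increasing reparametrizations keep injectivity and charts, and near both ends this one is affine
in t, so the curves stay linear there. -/
theorem regular_shift {n : ℕ} (hn : 3 ≤ n) {w : Seq} (hw : w ∈ L n) (s : ℝ) :
    Regular (fun s t => hinge n w (shift n s t)) s := by
  have hn' : (3 : ℝ) ≤ n := by exact_mod_cast hn
  have hh : Continuous (hinge n w) := by
    have := (continuous_hinge_pin n).comp (Continuous.prodMk_right w)
    have e : (fun u => hinge n (pin n w) u) = hinge n w := by rw [pin_eq_self hw.1]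
    exact e ▸ this
  have z : ∀ s, shift n s 0 = 0 := fun s => by
    simp only [shift, mul_zero, stretch_of_le_one (zero_le_one' ℝ), add_zero]
  have o : ∀ s, shift n s 1 = n := fun s => by
    rw [shift, stretch_of_three_le (by linarith)]; ring
  refine ⟨hh.comp (continuous_shift n), Eventually.of_forall fun x t ht c => ?_, ?_,
    fun t _ => ?_, ?_⟩
  · refine hinge_mem_cube (by omega) hw.1 ⟨?_, ?_⟩ c
    · rw [← z x]; exact shift_strictMono (by omega) x ht.1
    · rw [← o x]; exact shift_strictMono (by omega) x ht.2
  · have hi := (injOn_curve_iff (by omega) hw.1).2 hw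
    intro a ha b hb hab
    have mem : ∀ t ∈ Icc (0 : ℝ) 1, shift n s t / n ∈ Icc (0 : ℝ) 1 := fun t ht => by
      have h0 := (shift_strictMono (show 0 < n by omega) s).monotone ht.1
      have h1 := (shift_strictMono (show 0 < n by omega) s).monotone ht.2
      rw [z] at h0
      rw [o] at h1
      exact ⟨div_nonneg h0 (by linarith), by rw [div_le_one (by linarith)]; exact h1⟩
    have e : ∀ t, curve n w (shift n s t / n) = hinge n w (shift n s t) := fun t => by
      rw [curve, pin_eq_self hw.1, mul_div_cancel₀ _ (by linarith)]
    have := hi (mem a ha) (mem b hb) (by rw [e, e]; exact hab)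
    refine (shift_strictMono (show 0 < n by omega) s).injective ?_
    rwa [div_left_inj' (by linarith)] at this
  · obtain ⟨ℓ, hℓ⟩ := eventually_strictMonoOn_hinge (by omega) hw (shift n s t)
    have hm := hℓ.self_of_nhds
    rw [pin_eq_self hw.1] at hm
    have hev : ∀ᶠ q : ℝ × ℝ in 𝓝 (s, t),
        shift n q.1 q.2 ∈ Icc (shift n s t - 1 / 2) (shift n s t + 1 / 2) :=
      (continuous_shift n).continuousAt.eventually (Icc_mem_nhds (by simp) (by simp))
    obtain ⟨ps, hps, pt, hpt, h1⟩ := eventually_prod_iff.1 (nhds_prod_eq (X := ℝ) (Y := ℝ) ▸ hev)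
    obtain ⟨r, hr, hball⟩ := Metric.eventually_nhds_iff.1 hpt
    refine ⟨ℓ, r / 2, by linarith, hps.mono fun x hx a ha b hb hab => ?_⟩
    have mem : ∀ y ∈ Icc (t - r / 2) (t + r / 2), pt y := fun y hy => hball (by
      rw [Real.dist_eq, abs_lt]; constructor <;> linarith [hy.1, hy.2])
    exact hm (h1 hx (mem a ha)) (h1 hx (mem b hb)) (shift_strictMono (by omega) x hab)
  · have e : ((n : ℝ) + 1) * (1 / (n + 1)) = 1 := by field_simp
    refine ⟨1 / (n + 1), by positivity, Eventually.of_forall fun x => ?_⟩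
    obtain ⟨h0, h1⟩ := (projIcc (0 : ℝ) 1 zero_le_one x).2
    set σ := (projIcc (0 : ℝ) 1 zero_le_one x : ℝ) with hσ
    refine ⟨((n : ℝ) + σ) • w 1, ((n : ℝ) + σ) • (ones - w (n - 1)), fun t ht => ?_,
      fun t ht => ?_⟩
    · have e1 : shift n x t = (n + σ) * t := by
        rw [shift, stretch_of_le_one (by nlinarith), ← hσ]; ring
      have e2 : (n + σ) * t ≤ 1 := by
        rcases le_total 0 t with h | h
        · nlinarith
        · nlinarith [mul_nonpos_of_nonneg_of_nonpos (show 0 ≤ n + σ by linarith) h]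
      simp only [e1]
      rw [hinge_eq (i := 0) (by omega) _ (Or.inl rfl) (Or.inr (by push_cast; linarith)), hw.1.1]
      push_cast
      module
    · have e1 : shift n x t = n + (n + σ) * (t - 1) := by
        rw [shift, stretch_of_three_le (by nlinarith), ← hσ]; ring
      have c1 : ((n - 1 : ℕ) : ℝ) = n - 1 := by rw [Nat.cast_sub (by omega)]; simp
      have e2 : n - 1 ≤ n + (n + σ) * (t - 1) := by
        rcases le_total t 1 with h | h
        · nlinarith
        · nlinarith [mul_nonneg (show 0 ≤ n + σ by linarith) (sub_nonneg.2 h)]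
      simp only [e1]
      rw [hinge_eq (i := n - 1) (by omega) _ (Or.inr (by rw [c1]; exact e2))
        (Or.inl (by omega)), show n - 1 + 1 = n by omega, c1, hw.1.2.1 n le_rfl]
      module

theorem hinge_insertVertex {n : ℕ} (hn : 3 ≤ n) (w : Seq) (u : ℝ) :
    hinge (n + 1) (insertVertex 1 (midpoint ℝ (w 1) (w 2)) w) u = hinge n w (stretch u) := by
  have v0 : insertVertex 1 (midpoint ℝ (w 1) (w 2)) w 0 = w 0 := if_pos (by norm_num)
  have v1 : insertVertex 1 (midpoint ℝ (w 1) (w 2)) w 1 = w 1 := if_pos le_rfl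
  have v2 : insertVertex 1 (midpoint ℝ (w 1) (w 2)) w 2 = midpoint ℝ (w 1) (w 2) := by
    rw [insertVertex, if_neg (by norm_num), if_pos rfl]
  have v3 : ∀ i, 2 ≤ i → insertVertex 1 (midpoint ℝ (w 1) (w 2)) w (i + 1) = w i := fun i hi => by
    rw [insertVertex, if_neg (by omega), if_neg (by omega)]; rfl
  have hm : midpoint ℝ (w 1) (w 2) = w 1 + (1 / 2 : ℝ) • (w 2 - w 1) := by
    rw [midpoint_eq_smul_add, invOf_eq_inv]; module
  rcases le_total u 1 with h1 | h1
  · rw [stretch_of_le_one h1, hinge_eq (i := 0) (by omega) _ (Or.inl rfl) (Or.inr (by simpa)),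
      hinge_eq (i := 0) (by omega) _ (Or.inl rfl) (Or.inr (by simpa)), v0, v1]
  rcases le_total u 2 with h2 | h2
  · rw [stretch_of_mem h1 (by linarith),
      hinge_eq (i := 1) (by omega) _ (Or.inr (by simpa)) (Or.inr (by push_cast; linarith)),
      hinge_eq (i := 1) (by omega) _ (Or.inr (by push_cast; linarith))
        (Or.inr (by push_cast; linarith)), v1, v2, hm]
    push_cast
    module
  rcases le_total u 3 with h3 | h3
  · rw [stretch_of_mem h1 h3,
      hinge_eq (i := 2) (by omega) _ (Or.inr (by simpa)) (Or.inr (by push_cast; linarith)),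
      hinge_eq (i := 1) (by omega) _ (Or.inr (by push_cast; linarith))
        (Or.inr (by push_cast; linarith)), v2, v3 2 le_rfl, hm]
    push_cast
    module
  · obtain ⟨i, i2, i3, i4, i5⟩ : ∃ i, 2 ≤ i ∧ i < n ∧ (i : ℝ) + 1 ≤ u ∧ (i + 1 = n ∨ u ≤ i + 2) := by
      have f0 : (⌊u⌋₊ : ℝ) ≤ u := Nat.floor_le (by linarith)
      have f1 := Nat.lt_floor_add_one u
      have f2 : 3 ≤ ⌊u⌋₊ := Nat.le_floor (by exact_mod_cast h3)
      rcases le_or_gt ⌊u⌋₊ n with h4 | h4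
      · refine ⟨⌊u⌋₊ - 1, by omega, by omega, ?_, Or.inr ?_⟩ <;>
          rw [Nat.cast_sub (by omega)] <;> push_cast <;> linarith
      · refine ⟨n - 1, by omega, by omega, ?_, Or.inl (by omega)⟩
        have : (n : ℝ) < ⌊u⌋₊ := by exact_mod_cast h4
        rw [Nat.cast_sub (by omega)]
        push_cast
        linarith
    rw [stretch_of_three_le h3,
      hinge_eq (i := i + 1) (by omega) _ (Or.inr (by push_cast; linarith)) (by
        rcases i5 with h | h
        · exact Or.inl (by omega)
        · exact Or.inr (by push_cast; linarith)),
      hinge_eq (i := i) i3 _ (Or.inr (by linarith)) (by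
        rcases i5 with h | h
        · exact Or.inl h
        · exact Or.inr (by linarith)), v3 i i2, v3 (i + 1) (by omega)]
    push_cast
    module

theorem smoothClass_insertMid {α : ℕ → ℕ} (hα : ∀ n, 3 ≤ n → α n + 3 ≤ n) {n : ℕ} (hn : 3 ≤ n)
    {w : Seq} (hw : w ∈ L n) {c : ZerothHomotopy (Lim K (iota α))} :
    SmoothClass α (curve (n + 1) (insertMid α n w)) c ↔ SmoothClass α (curve n w) c := by
  have hαn := hα n hn
  have hn' : (n : ℝ) ≠ 0 := by positivity
  obtain ⟨η, ρ, μ, h⟩ := exists_tame_curve (by omega) hw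
  have ht := uniform_one (n := n) (by omega)
  have ha := affineTimes_uniform (n := n) (by omega)
  have e := insertMid_curve_comp α hw.1 ht ha (by omega)
  -- The inserted vertex is first moved to segment 1, the one that `stretch` traverses at half
  -- speed; the first and the last segment remain undivided. What is left is the isotopy between two
  -- parametrizations.
  have hj := joinedIn_insertTime' (by omega) hw.1 h.self_of_nhds ht ha (p := α n) (q := 1)
    (by omega) (by omega) (ht.half_mem (by omega)) (ht.half_mem (by omega))
  have e2 : insertMid 1 n w = insertVertex 1 (midpoint ℝ (w 1) (w 2)) w := by
    funext i
    rw [insertMid_apply, insertVertex]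
    rfl
  have e3 := insertMid_curve_comp 1 hw.1 ht ha (by simp; omega)
  rw [curve_uniform (by omega) hw.1] at e e3
  simp only [Pi.one_apply] at e3
  rw [← e, ← e3, e2] at hj
  rw [smoothClass_iff_of_joinedIn hα (by omega) hj]
  have key := SmoothClass.isotopy (c := c) hα
    (Γ := fun s t => hinge n w (shift n s t)) fun s _ => regular_shift hn hw s
  have k0 : (fun t => hinge n w (shift n 0 t)) = curve n w := by
    funext t
    rw [curve, pin_eq_self hw.1]
    simp [shift]
  have k1 : (fun t => hinge n w (shift n 1 t)) =
      curve (n + 1) (insertVertex 1 (midpoint ℝ (w 1) (w 2)) w) := by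
    funext t
    rw [curve, pin_eq_self hj.target_mem.1, hinge_insertVertex hn]
    simp [shift]
  rw [k0, k1] at key
  exact key.symm

/-- The map from components of PL knots to components of plumbers' knots given by smoothing. -/
theorem exists_smoothing_map {α : ℕ → ℕ} (hα : ∀ n, 3 ≤ n → α n + 3 ≤ n) :
    ∃ G : ZerothHomotopy (Lim L (insertMid α)) → ZerothHomotopy (Lim K (iota α)),
      ∀ n w c, Represents L (insertMid α) n w c → SmoothClass α (curve n w) (G c) := by
  -- The value is the set of all classes of smoothings, so that an element needs to be chosen only
  -- after invariance is known.
  obtain ⟨Φ, hΦ⟩ := exists_lift (S := L) (g := insertMid α)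
    (fun n w => {c : ZerothHomotopy (Lim K (iota α)) | SmoothClass α (curve n w) c})
    (fun n hn w hw => eventually_joinedIn_L n hn w hw)
    (fun n hn v w h => Set.ext fun c => smoothClass_iff_of_joinedIn hα (by omega) h)
    (fun n hn v hv => Set.ext fun c => smoothClass_insertMid hα hn hv)
  have ex : ∀ c, ∃ d, d ∈ Φ c := fun c => by
    obtain ⟨n, w, h⟩ := exists_rep c
    rw [hΦ n w c h]
    exact (regular_curve (by have := h.three_le; omega) h.mem).exists_smoothClass hα
  choose G hG using ex
  refine ⟨G, fun n w c h => ?_⟩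
  have := hG c
  rwa [hΦ n w c h] at this

open Filter Topology

/-! ### Polygons of fine samples -/

section Composition

variable {α : ℕ → ℕ} {n : ℕ} {v : Seq} {η ρ μ : ℝ} {γ : ℝ → E3} {t t' : ℕ → ℝ}

/-- Each coordinate of a segment of `f n v` is a nonnegative multiple of one of the three pipes
around it. -/
theorem f_sub_eq (hn : 3 ≤ n) (hv : v ∈ K n) {i : ℕ} (hi : i + 2 < 3 * n) (c : Fin 3) :
    ∃ m, i ≤ m ∧ m < i + 3 ∧ m % 3 = c ∧ ∃ b, 0 ≤ b ∧
      f n v (i + 2) c - f n v (i + 1) c = b * (val v (m + 3) - val v m) := by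
  have g := gap_of_mem_K hn hv
  have he := g.pos
  have he1 := g.le
  have b0 := buckling_nonneg n v
  have b1 := buckling_le (v := v) he.le
  have e1 : 0 ≤ 1 - eps n v := by linarith
  obtain ⟨m, m1, m2, rfl⟩ := exists_cls i c
  refine ⟨m, m1, m2, rfl, ?_⟩
  rcases (by omega : m = i ∨ m = i + 1 ∨ m = i + 2) with rfl | rfl | rfl
  · refine ⟨_, mul_nonneg e1 (b0 (m + 1)), ?_⟩
    rw [f_apply_third n v (by omega), ← cls_add_three, f_apply_second n v hi]
    ring
  · refine ⟨_, mul_nonneg e1 (show 0 ≤ 1 - buckling n v (i + 2) - buckling n v i by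
      linarith [b1 i, b1 (i + 2)]), ?_⟩
    rw [f_apply_third n v hi, f_apply_first n v (by omega)]
    ring
  · refine ⟨_, mul_nonneg e1 (b0 (i + 1)), ?_⟩
    rw [f_apply_first n v hi, f_apply_second n v (by omega)]
    ring

/-- The k-th vertex of the polygon is close to the k-th corner, whose coordinates come from the
samples k/3 and k/3 + 1; and along each edge every coordinate changes by a nonnegative multiple of
an increment between samples. -/
theorem weaklyAdapted_f (h : Tame coords η ρ μ γ) (hn : 3 ≤ n) (ht : FineTimes n μ t)
    (ht' : FineTimes (3 * n) μ t') (hle : ∀ k, t (k / 3) ≤ t' k ∧ t' k ≤ t (k / 3 + 1))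
    (hv : (fun i => γ (t i)) ∈ K n) :
    WeaklyAdapted coords (ρ / 8) γ (3 * n) t' (f n fun i => γ (t i)) := by
  set v : Seq := fun i => γ (t i) with hvd
  have g := gap_of_mem_K hn hv
  have hμ := h.mesh_pos
  have hρ := h.rho_pos
  obtain ⟨fol, fP, -⟩ := f_follows_and_mem hn hv
  have val_eq : ∀ m, val v m = γ (t (m / 3)) (cls m) := fun m => rfl
  have close : ∀ m k c, k ≤ m → m < k + 3 → |γ (t (m / 3)) c - γ (t' k) c| ≤ ρ / 64 := by
    intro m k c h1 h2
    have := h.near _ (ht.mem (m / 3)) _ (ht'.mem k) (by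
      have h3 := hle k
      have h4 := ht.monotone (show k / 3 ≤ m / 3 by omega)
      have h5 := ht.monotone (show m / 3 ≤ k / 3 + 1 by omega)
      have h6 := ht.step (k / 3)
      rw [abs_le]; constructor <;> linarith)
    exact (abs_apply_le_norm (γ (t (m / 3)) - γ (t' k)) c).trans this
  -- The first pipe is at least 10ε long, while a single step of γ is short; so ε is negligible
  -- against ρ.
  have heps : 10 * eps n v ≤ ρ / 64 := by
    have h1 := g.first_long (i := 0) (by norm_num)
    have h2 := close 3 1 (cls 3) (by norm_num) (by norm_num)
    have h3 := h.near _ (ht.mem 1) _ (ht.mem 0) (by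
      have := ht.step 0
      have := ht.monotone (Nat.zero_le 1)
      rw [abs_le]; constructor <;> linarith)
    have h4 := (abs_apply_le_norm _ (cls 3)).trans h3
    rw [g.zero 0 (by norm_num), val_eq] at h1
    rw [ht.zero, h.zero, sub_zero] at h4
    have := (abs_le.1 h4).2
    change γ (t 1) (cls 3) ≤ _ at this
    change 0 + 10 * eps n v ≤ γ (t 1) (cls 3) at h1
    linarith
  refine ⟨fun k hk => ?_, fun k hk ℓ hℓ hm => ?_⟩
  · have : ∀ c, |(f n v k - γ (t' k)) c| ≤ ρ / 16 := fun c => by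
      obtain ⟨m, m1, m2, rfl⟩ := exists_cls k c
      have h1 := fol.near k m hk m1 m2
      have h2 := close m k (cls m) m1 m2
      rw [val_eq] at h1
      rw [PiLp.sub_apply]
      rw [abs_le] at *
      constructor <;> linarith
    have := norm_le_two_mul this
    linarith
  · obtain ⟨c, s, -, hs⟩ := hℓ
    have mem : ∀ j, k - 6 ≤ j → j ≤ k + 7 → t' j ∈ Icc (t' (k - 6)) (t' (k + 7)) :=
      fun j h1 h2 => ⟨ht'.monotone h1, ht'.monotone h2⟩
    have key : ∀ x ∈ Icc (t' (k - 6)) (t' (k + 7)), ∀ y ∈ Icc (t' (k - 6)) (t' (k + 7)), x ≤ y →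
        s * γ x c ≤ s * γ y c := fun x hx y hy hxy => by
      have := hm.monotoneOn hx hy hxy
      simpa only [hs] using this
    rw [hs, hs]
    rcases Nat.eq_zero_or_pos k with rfl | h0
    · have h1 := key _ (mem 0 le_rfl (by omega)) _ (mem 1 (by omega) (by omega))
        (ht'.monotone zero_le_one)
      have h2 := h.cube _ (ht'.mem_Ioo (i := 1) one_pos (by omega)) c
      have h3 := fP.2.2 1 one_pos (by omega) c
      rw [fP.1]
      rw [ht'.zero, h.zero] at h1
      simp only [PiLp.zero_apply, mul_zero, zero_add] at h1 ⊢
      exact mul_nonneg (nonneg_of_mul_nonneg_left h1 h2.1) h3.1.le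
    rcases (by omega : k + 1 = 3 * n ∨ k + 1 < 3 * n) with h4 | h4
    · have h1 := key _ (mem k (by omega) (by omega)) _ (mem (k + 1) (by omega) (by omega))
        (ht'.monotone (by omega))
      have h2 := h.cube _ (ht'.mem_Ioo (i := k) h0 (by omega)) c
      have h3 := fP.2.2 k h0 (by omega) c
      rw [fP.2.1 (k + 1) h4.ge]
      rw [ht'.one (k + 1) h4.ge, h.one] at h1
      have h5 : 0 ≤ s := nonneg_of_mul_nonneg_left (b := ones c - γ (t' k) c)
        (by linarith) (sub_pos.2 h2.2)
      exact mul_le_mul_of_nonneg_left h3.2.le h5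
    · obtain ⟨i, rfl⟩ : ∃ i, k = i + 1 := ⟨k - 1, by omega⟩
      obtain ⟨m, m1, m2, m3, b, hb, e⟩ := f_sub_eq hn hv h4 c
      have c1 : cls m = c := Fin.ext m3
      have h1 := key (t (m / 3)) ⟨?_, ?_⟩ (t (m / 3 + 1)) ⟨?_, ?_⟩ (ht.monotone (by omega))
      · rw [val_eq, val_eq, cls_add_three, c1, show (m + 3) / 3 = m / 3 + 1 by omega] at e
        have e2 : s * f n v (i + 2) c - s * f n v (i + 1) c =
            b * (s * γ (t (m / 3 + 1)) c - s * γ (t (m / 3)) c) := by rw [← mul_sub, e]; ring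
        have := mul_nonneg hb (sub_nonneg.2 h1)
        exact sub_nonneg.1 (by rw [show i + 1 + 1 = i + 2 from rfl, e2]; exact this)
      all_goals
        have l1 := (hle (i + 1 - 6)).2
        have l0 := (hle (i + 1 + 7)).1
      · rcases (by omega : i + 1 ≤ 6 ∨ 6 < i + 1) with h6 | h6
        · rw [show i + 1 - 6 = 0 by omega, ht'.zero]
          exact (ht.mem _).1
        · exact l1.trans (ht.monotone (by omega))
      · exact (ht.monotone (by omega)).trans l0
      · rcases (by omega : i + 1 ≤ 6 ∨ 6 < i + 1) with h6 | h6
        · rw [show i + 1 - 6 = 0 by omega, ht'.zero]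
          exact (ht.mem _).1
        · exact l1.trans (ht.monotone (by omega))
      · exact (ht.monotone (by omega)).trans l0

/-- Uniform times. -/
abbrev ticks (n : ℕ) (i : ℕ) : ℝ := min ((i : ℝ) / n) 1

theorem ticks_three_mul (hn : 0 < n) (k : ℕ) :
    ticks n (k / 3) ≤ ticks (3 * n) k ∧ ticks (3 * n) k ≤ ticks n (k / 3 + 1) := by
  have hn' : (0 : ℝ) < n := Nat.cast_pos.2 hn
  have e : (k : ℝ) / ((3 * n : ℕ) : ℝ) = (k / 3) / n := by push_cast; field_simp
  have h1 : ((k / 3 : ℕ) : ℝ) ≤ k / 3 := by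
    rw [le_div_iff₀ (by norm_num)]; exact_mod_cast (by omega : k / 3 * 3 ≤ k)
  have h2 : (k : ℝ) / 3 ≤ ((k / 3 + 1 : ℕ) : ℝ) := by
    rw [div_le_iff₀ (by norm_num)]; exact_mod_cast (by omega : k ≤ (k / 3 + 1) * 3)
  unfold ticks
  rw [e]
  constructor <;> gcongr

/-- Fine samples of γ form plumbers' knots, and their polygons follow γ; a segment therefore joins
them to fine samples of γ that are PL knots. -/
theorem Traces.f_comp (hα : ∀ n, 3 ≤ n → α n + 3 ≤ n) (h : Tame coords η ρ μ γ)
    {c : ZerothHomotopy (Lim L (insertMid α))} (hc : Traces L (insertMid α) γ c) :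
    ∃ N, 3 ≤ N ∧ ∀ n, N ≤ n → Represents L (insertMid α) (3 * n) (f n fun i => γ (ticks n i)) c := by
  obtain ⟨ν, hν, hc⟩ := hc
  obtain ⟨N, hN, ht⟩ := exists_fineTimes (lt_min hν h.mesh_pos)
  refine ⟨N, hN, fun n hn => ?_⟩
  have weaken : ∀ {m : ℕ} {t : ℕ → ℝ} {a b : ℝ}, a ≤ b → FineTimes m a t → FineTimes m b t :=
    fun hab h => ⟨h.zero, h.one, h.lt, fun i => (h.step i).trans (by linarith)⟩
  have t1 := weaken (min_le_right _ _) (ht n hn)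
  have t3 := weaken (min_le_right _ _) (ht (3 * n) (by omega))
  have hv := (system_K hα).curve_mem h (by omega) t1
  have := (system_L hα coords).joinedIn h (by omega) t3 (f_mem (by omega) hv)
    (weaklyAdapted_f h (by omega) t1 t3 (ticks_three_mul (by omega)) hv)
  exact (hc (3 * n) _ (by omega) (weaken (min_le_left _ _) (ht (3 * n) (by omega)))).of_joinedIn
    this.symm

theorem Represents.traces_curve (hα : ∀ n, 3 ≤ n → α n + 3 ≤ n) {w : Seq}
    {c : ZerothHomotopy (Lim L (insertMid α))} (hc : Represents L (insertMid α) n w c) :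
    Traces L (insertMid α) (curve n w) c := by
  obtain ⟨η, ρ, μ, h⟩ := exists_tame_curve (by have := hc.three_le; omega) hc.mem
  exact ⟨μ, h.self_of_nhds.mesh_pos, fun m t hm ht => hc.curve_comp hα h.self_of_nhds hm ht⟩

/-- A sufficiently small smoothing serves both systems: it is isotopic to the PL curve through
curves with charts by functionals, and it has coordinate charts itself. -/
theorem exists_tame_smoothing (hα : ∀ n, 3 ≤ n → α n + 3 ≤ n) {w : Seq}
    {c : ZerothHomotopy (Lim L (insertMid α))} {d : ZerothHomotopy (Lim K (iota α))}
    (hc : Represents L (insertMid α) n w c) (hd : SmoothClass α (curve n w) d) :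
    ∃ γ η ρ μ, Tame coords η ρ μ γ ∧ Continuous γ ∧ Traces L (insertMid α) γ c ∧
      Traces K (iota α) γ d := by
  have hn := hc.three_le
  have hr := regular_curve (by omega) hc.mem
  obtain ⟨δ₁, hδ₁, h1⟩ := hd
  obtain ⟨δ₂, hδ₂, h2⟩ := hr.eventually_smoothClass hα
  obtain ⟨η, ρ, μ, h3⟩ := hr.smooth_tame
  have h4 : ∀ᶠ δ in 𝓝 (0 : ℝ), ∀ᶠ x in 𝓝 δ, Tame univ η ρ μ (smooth x (curve n w)) := by
    have : Tendsto (fun δ : ℝ => (δ, w)) (𝓝 0) (𝓝 (0, w)) := by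
      exact (show Continuous fun δ : ℝ => (δ, w) by fun_prop).tendsto 0
    exact (this.eventually h3).eventually_nhds
  obtain ⟨δ₃, hδ₃, h5⟩ := Metric.eventually_nhds_iff.1 h4
  obtain ⟨δ, hδ0, hδ⟩ := exists_between (lt_min (lt_min hδ₁ hδ₂) hδ₃)
  obtain ⟨⟨l1, l2⟩, l3⟩ : (δ < δ₁ ∧ δ < δ₂) ∧ δ < δ₃ := by simpa only [lt_min_iff] using hδ
  have cont : Continuous fun p : ℝ × ℝ => smooth p.1 (curve n w) p.2 :=
    hr.continuous_smooth.comp (f := fun p : ℝ × ℝ => ((p.1, w), p.2)) (by fun_prop)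
  obtain ⟨⟨η', ρ', μ', h6⟩, -⟩ := h2.self_of_nhds δ ⟨hδ0, l2⟩
  have iso := Traces.isotopy (c := c) (Λ := fun x => smooth x (curve n w)) (system_L hα univ)
    cont hδ0.le fun s hs =>
    ⟨η, ρ, μ, h5 (by rw [Real.dist_eq, sub_zero, abs_of_nonneg hs.1]; linarith [hs.2])⟩
  simp only [smooth_zero] at iso
  have h7 : Tame coords η' ρ' μ' (smooth δ (curve n w)) := h6.self_of_nhds
  have c7 : Continuous (smooth δ (curve n w)) := 
    cont.comp (f := fun t : ℝ => (δ, t)) (by fun_prop)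
  exact ⟨_, η', ρ', μ', h7, c7, iso.1 (hc.traces_curve hα), h1 δ ⟨hδ0, l1⟩⟩

end Composition

/-! ### Injectivity of the smoothing map -/

/-- The image of `v ∈ K n` in `K (n + k)`. -/
def iotaIter (α : ℕ → ℕ) (n : ℕ) (v : Seq) : ℕ → Seq
  | 0 => v
  | k + 1 => iota α (n + k) (iotaIter α n v k)

section Injectivity

variable {α : ℕ → ℕ} {n : ℕ} {v : Seq}

theorem iotaIter_iota (k : ℕ) : iotaIter α (n + 1) (iota α n v) k = iotaIter α n v (k + 1) := by
  induction k with
  | zero => rfl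
  | succ k ih => rw [iotaIter, ih, show n + 1 + k = n + (k + 1) by omega]; rfl

theorem joinedIn_iotaIter (hα : ∀ n, 3 ≤ n → α n + 3 ≤ n) (hn : 3 ≤ n) {w : Seq}
    (h : JoinedIn (K n) v w) (k : ℕ) :
    JoinedIn (K (n + k)) (iotaIter α n v k) (iotaIter α n w k) := by
  induction k with
  | zero => exact h
  | succ k ih =>
    refine (ih.map (continuous_iota α (show 3 ≤ n + k by omega))).mono ?_
    rintro _ ⟨x, hx, rfl⟩
    exact iota_mem hα (show 3 ≤ n + k by omega) hx

theorem joinedIn_f (hn : 3 ≤ n) {w : Seq} (h : JoinedIn (K n) v w) :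
    JoinedIn (L (3 * n)) (f n v) (f n w) := by
  refine (h.map_continuousOn (continuousOn_f hn)).mono ?_
  rintro _ ⟨x, hx, rfl⟩
  exact f_mem hn hx

/-- The component to which the polygons of the images of `v` belong eventually. -/
def LimitClass (α : ℕ → ℕ) (n : ℕ) (v : Seq) : Set (ZerothHomotopy (Lim L (insertMid α))) :=
  {c | ∃ k₀, ∀ k, k₀ ≤ k →
    Represents L (insertMid α) (3 * (n + k)) (f (n + k) (iotaIter α n v k)) c}

/-- Only large k matter in `LimitClass`, so it does not see the maps of the system, and continuity
of ι and f makes it constant on path components. Compatibility of f with the systems is not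
presupposed. -/
theorem exists_limitClass_map (hα : ∀ n, 3 ≤ n → α n + 3 ≤ n) :
    ∃ Φ : ZerothHomotopy (Lim K (iota α)) → Set (ZerothHomotopy (Lim L (insertMid α))),
      ∀ n v c, Represents K (iota α) n v c → Φ c = LimitClass α n v := by
  refine exists_lift (LimitClass α) eventually_joinedIn_K (fun n hn v w h => ?_) fun n hn v hv => ?_
  · have : ∀ {v w}, JoinedIn (K n) v w → LimitClass α n v ⊆ LimitClass α n w := by
      rintro v w h c ⟨k₀, hk⟩
      exact ⟨k₀, fun k h1 => (hk k h1).of_joinedIn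
        (joinedIn_f (by omega) (joinedIn_iotaIter hα hn h k))⟩
    exact (this h).antisymm (this h.symm)
  · ext c
    constructor
    · rintro ⟨k₀, hk⟩
      refine ⟨k₀ + 1, fun k h1 => ?_⟩
      obtain ⟨k, rfl⟩ : ∃ j, k = j + 1 := ⟨k - 1, by omega⟩
      have := hk k (by omega)
      rwa [iotaIter_iota, show n + 1 + k = n + (k + 1) by omega] at this
    · rintro ⟨k₀, hk⟩
      refine ⟨k₀, fun k h1 => ?_⟩
      have := hk (k + 1) (by omega)
      rwa [iotaIter_iota, show n + 1 + k = n + (k + 1) by omega]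

theorem limitClass_subsingleton {c c' : ZerothHomotopy (Lim L (insertMid α))}
    (h : c ∈ LimitClass α n v) (h' : c' ∈ LimitClass α n v) : c = c' := by
  obtain ⟨k, hk⟩ := h
  obtain ⟨k', hk'⟩ := h'
  exact (hk _ (le_max_left k k')).unique (hk' _ (le_max_right k k'))

variable {η ρ μ : ℝ} {γ : ℝ → E3}

theorem joinedIn_iotaIter_curve (hα : ∀ n, 3 ≤ n → α n + 3 ≤ n) (h : Tame coords η ρ μ γ)
    (hc : Continuous γ) (hn : 3 ≤ n) (ht : ∀ m, n ≤ m → FineTimes m μ (ticks m)) (k : ℕ) :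
    JoinedIn (K (n + k)) (iotaIter α n (fun i => γ (ticks n i)) k)
      fun i => γ (ticks (n + k) i) := by
  have hs := system_K hα
  induction k with
  | zero => exact JoinedIn.refl (hs.curve_mem h hn (ht n le_rfl))
  | succ k ih =>
    have hm := hs.curve_mem h (by omega) (ht (n + k) (by omega))
    obtain ⟨t', ht', ha⟩ := hs.step h (by omega) (ht (n + k) (by omega)) hm
    refine ((ih.map (continuous_iota α (show 3 ≤ n + k by omega))).mono ?_).trans
      ((hs.joinedIn h (by omega) ht' (iota_mem hα (by omega) hm) ha).trans
        (hs.joinedIn_times h hc (by omega) ht' (ht (n + k + 1) (by omega))))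
    rintro _ ⟨x, hx, rfl⟩
    exact iota_mem hα (show 3 ≤ n + k by omega) hx

/-- Start from very fine samples of γ: their images under the maps of the system remain joined to
longer lists of fine samples, whose polygons represent c. -/
theorem mem_limitClass (hα : ∀ n, 3 ≤ n → α n + 3 ≤ n) (h : Tame coords η ρ μ γ)
    (hc : Continuous γ) {c : ZerothHomotopy (Lim L (insertMid α))}
    {d : ZerothHomotopy (Lim K (iota α))} (hL : Traces L (insertMid α) γ c)
    (hK : Traces K (iota α) γ d) :
    ∃ n v, Represents K (iota α) n v d ∧ c ∈ LimitClass α n v := by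
  obtain ⟨ν, hν, hK⟩ := hK
  obtain ⟨N₁, hN₁, h1⟩ := Traces.f_comp hα h hL
  obtain ⟨N₂, hN₂, h2⟩ := exists_fineTimes h.mesh_pos
  obtain ⟨N₃, hN₃, h3⟩ := exists_fineTimes hν
  refine ⟨N₁ + N₂ + N₃, fun i => γ (ticks (N₁ + N₂ + N₃) i),
    hK _ _ (by omega) (h3 _ (by omega)), 0, fun k _ => ?_⟩
  exact (h1 _ (by omega)).of_joinedIn (joinedIn_f (by omega) (joinedIn_iotaIter_curve hα h hc
    (by omega) (fun m hm => h2 m (by omega)) k).symm)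

/-- The component c is an element of the limit class of G(c), and such a class has at most one
element. -/
theorem smoothing_injective (hα : ∀ n, 3 ≤ n → α n + 3 ≤ n)
    {G : ZerothHomotopy (Lim L (insertMid α)) → ZerothHomotopy (Lim K (iota α))}
    (hG : ∀ n w c, Represents L (insertMid α) n w c → SmoothClass α (curve n w) (G c)) :
    Function.Injective G := by
  obtain ⟨Φ, hΦ⟩ := exists_limitClass_map hα
  have key : ∀ c, c ∈ Φ (G c) := fun c => by
    obtain ⟨n, w, hw⟩ := exists_rep c
    obtain ⟨γ, η, ρ, μ, h1, h2, h3, h4⟩ := exists_tame_smoothing hα hw (hG n w c hw)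
    obtain ⟨m, v, hv, hc⟩ := mem_limitClass hα h1 h2 h3 h4
    rwa [hΦ m v _ hv]
  intro c c' h
  have h1 := key c
  have h2 := key c'
  obtain ⟨n, v, hv⟩ := exists_rep (G c')
  rw [h, hΦ n v _ hv] at h1
  rw [hΦ n v _ hv] at h2
  exact limitClass_subsingleton h1 h2

end Injectivity

/-! ### Coordinates along the spine of a boxed knot -/

/-- The piecewise linear function that increases from `0` to `1` on the unit interval. -/
def ramp (z : ℝ) : ℝ := max 0 (min z 1)

theorem ramp_of_nonpos {z : ℝ} (h : z ≤ 0) : ramp z = 0 :=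
  max_eq_left ((min_le_left _ _).trans h)

theorem ramp_of_one_le {z : ℝ} (h : 1 ≤ z) : ramp z = 1 := by
  rw [ramp, min_eq_right h, max_eq_right zero_le_one]

theorem ramp_of_mem {z : ℝ} (h : z ∈ Icc (0 : ℝ) 1) : ramp z = z := by
  rw [ramp, min_eq_left h.2, max_eq_right h.1]

theorem ramp_mem (z : ℝ) : ramp z ∈ Icc (0 : ℝ) 1 :=
  ⟨le_max_left _ _, max_le zero_le_one (min_le_right _ _)⟩

theorem ramp_pos {z : ℝ} (h : 0 < z) : 0 < ramp z := lt_max_of_lt_right (lt_min h one_pos)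

theorem ramp_lt_one {z : ℝ} (h : z < 1) : ramp z < 1 := max_lt one_pos ((min_le_left _ _).trans_lt h)

/-- Plumbers' knots with `n + 2` moves that have no pipes of length zero except possibly in the
first and the last move and whose other vertices lie in the box spanned by the first and the last
inner vertex. -/
structure Boxed (n : ℕ) (u : Seq) : Prop where
  pos : 0 < n
  mem : u ∈ K (n + 2)
  pipe : ∀ i, 3 ≤ i → i < 3 * n + 3 → val u (i + 3) - val u i ≠ 0
  first : ∀ r j, r < 3 → 2 ≤ j → val u (3 + r) < val u (3 * j + r)
  last : ∀ r j, r < 3 → j ≤ n → val u (3 * j + r) < val u (3 * n + 3 + r)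

theorem Extends.boxed {n : ℕ} {v u : Seq} (hn : 3 ≤ n) (hv : v ∈ K n) (hu : u ∈ K (n + 2))
    (hY : ∀ i, i < 3 * n → val v (i + 3) - val v i ≠ 0) (h : Extends n (eps n v) (val v) (val u)) :
    Boxed n u := by
  have g := gap_of_mem_K hn hv
  have hε := g.pos
  have hε1 := g.le
  have hp := (mem_P_iff u).1 hu.1
  have mid : ∀ i, 6 ≤ i → i < 3 * n + 3 → 10 * eps n v ≤ val u i ∧ val u i ≤ 1 - 10 * eps n v :=
    fun i h1 h2 => by
      obtain ⟨i, rfl⟩ : ∃ m, i = m + 3 := ⟨i - 3, by omega⟩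
      rw [h.mid i (by omega) (by omega)]
      exact g.cube i (by omega) (by omega)
  have high : ∀ i, 3 * n + 3 ≤ i → 1 - eps n v ≤ val u i := fun i h1 => by
    rcases lt_or_ge i (3 * n + 6) with h2 | h2
    · obtain ⟨i, rfl⟩ : ∃ m, i = m + 3 := ⟨i - 3, by omega⟩
      exact (h.high i (by omega) (by omega)).1
    · rw [hp.one i (by omega)]; linarith
  have low : ∀ i, i < 6 → val u i ≤ eps n v := fun i h1 => by
    rcases lt_or_ge i 3 with h2 | h2
    · rw [hp.zero i h2]; exact hε.le
    · obtain ⟨i, rfl⟩ : ∃ m, i = m + 3 := ⟨i - 3, by omega⟩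
      exact (h.low i (by omega)).2
  refine ⟨by omega, hu, fun i h1 h2 => ?_, fun r j h1 h2 => ?_, fun r j h1 h2 => ?_⟩
  · rcases (by omega : i < 6 ∨ (6 ≤ i ∧ i < 3 * n) ∨ 3 * n ≤ i) with h3 | h3 | h3
    · have := low i h3
      have := mid (i + 3) (by omega) (by omega)
      linarith
    · obtain ⟨i, rfl⟩ : ∃ m, i = m + 3 := ⟨i - 3, by omega⟩
      rw [h.mid i (by omega) (by omega), h.mid (i + 3) (by omega) (by omega)]
      exact hY i (by omega)
    · have := high (i + 3) (by omega)
      have := mid i (by omega) (by omega)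
      linarith
  · have := low (3 + r) (by omega)
    rcases lt_or_ge (3 * j + r) (3 * n + 3) with h3 | h3
    · linarith [(mid (3 * j + r) (by omega) h3).1]
    · linarith [high (3 * j + r) h3]
  · have := high (3 * n + 3 + r) (by omega)
    rcases lt_or_ge (3 * j + r) 6 with h3 | h3
    · linarith [low (3 * j + r) h3]
    · linarith [(mid (3 * j + r) h3 (by omega)).2]

/-- The parametrized spine. -/
def spineMap (n : ℕ) (u : Seq) (y : ℝ) : E3 := hinge (3 * n + 2) (spine n u) y

namespace Boxed

variable {n : ℕ} {u : Seq} {y y' : ℝ} {r j : ℕ}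

theorem pSeq (h : Boxed n u) : PSeq (n + 2) (val u) := (mem_P_iff u).1 h.mem.1

theorem spine_apply {k m : ℕ} (h0 : 0 < k) (h1 : k < 3 * n + 2) (h2 : k + 2 ≤ m) (h3 : m < k + 5) :
    spine n u k (cls m) = val u m := by
  rw [spine, if_neg (by omega), if_pos h1, corner_cls u h2 (by omega)]

theorem map_first (hr : r < 3) (hy : y ≤ 1) :
    spineMap n u y (cls r) = y * val u (3 + r) := by
  rw [spineMap, hinge_eq (i := 0) (by omega) _ (Or.inl rfl) (Or.inr (by simpa))]
  have e := spine_apply (u := u) (n := n) (k := 1) (m := r + 3) one_pos (by omega) (by omega)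
    (by omega)
  rw [cls_add_three] at e
  simp only [PiLp.add_apply, PiLp.smul_apply, PiLp.sub_apply, smul_eq_mul, zero_add, e]
  simp [spine, add_comm]

theorem map_last (hr : r < 3) (hy : 3 * n + 1 ≤ y) :
    spineMap n u y (cls r) =
      val u (3 * n + 3 + r) + (y - (3 * n + 1)) * (1 - val u (3 * n + 3 + r)) := by
  rw [spineMap, hinge_eq (i := 3 * n + 1) (by omega) _ (Or.inr (by push_cast; linarith))
    (Or.inl rfl)]
  have e := spine_apply (u := u) (n := n) (k := 3 * n + 1) (m := 3 * n + 3 + r) (by omega)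
    (by omega) (by omega) (by omega)
  have c : cls (3 * n + 3 + r) = cls r := Fin.ext (by simp [cls]; omega)
  rw [c] at e
  have e1 : spine n u (3 * n + 1 + 1) (cls r) = 1 := by
    rw [spine, if_neg (by omega), if_neg (by omega)]; simp [ones]
  simp only [PiLp.add_apply, PiLp.smul_apply, PiLp.sub_apply, smul_eq_mul, e, e1]
  push_cast
  ring

/-- In a move the directions take turns: coordinate r runs during the r-th unit of the parameter and
rests otherwise, which is what `ramp` expresses. -/
theorem map_mid (hj : 1 ≤ j) (hj' : j ≤ n) (hr : r < 3) (h1 : 3 * (j : ℝ) - 2 ≤ y)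
    (h2 : y ≤ 3 * (j : ℝ) + 1) : spineMap n u y (cls r) = val u (3 * j + r) +
      ramp (y - (3 * j - 2 + r)) * (val u (3 * (j + 1) + r) - val u (3 * j + r)) := by
  obtain ⟨q, hq, h3, h4⟩ : ∃ q : ℕ, q < 3 ∧ 3 * (j : ℝ) - 2 + q ≤ y ∧ y ≤ 3 * (j : ℝ) - 1 + q := by
    rcases le_total y (3 * j - 1) with h | h
    · exact ⟨0, by norm_num, by push_cast; linarith, by push_cast; linarith⟩
    rcases le_total y (3 * j) with h' | h'
    · exact ⟨1, by norm_num, by push_cast; linarith, by push_cast; linarith⟩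
    · exact ⟨2, by norm_num, by push_cast; linarith, by push_cast; linarith⟩
  have c0 : ((3 * j - 2 + q : ℕ) : ℝ) = 3 * j - 2 + q := by
    rw [Nat.cast_add, Nat.cast_sub (by omega)]; push_cast; ring
  have e : spineMap n u y (cls r) = spine n u (3 * j - 2 + q) (cls r) + (y - (3 * j - 2 + q)) *
      (spine n u (3 * j - 2 + q + 1) (cls r) - spine n u (3 * j - 2 + q) (cls r)) := by
    rw [spineMap, hinge_eq (i := 3 * j - 2 + q) (by omega) _ (Or.inr (by rw [c0]; exact h3))
      (Or.inr (by rw [c0]; linarith)), c0]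
    rfl
  have c1 : cls (3 * j + r) = cls r := Fin.ext (by simp [cls])
  have c2 : cls (3 * (j + 1) + r) = cls r := Fin.ext (by simp [cls])
  have hn : 3 * j ≤ 3 * n := by omega
  rcases lt_trichotomy r q with hrq | rfl | hrq
  · have hrq' : (r : ℝ) + 1 ≤ q := by exact_mod_cast hrq
    rw [ramp_of_one_le (by linarith), e, ← c2, spine_apply (by omega) (by omega) (by omega)
      (by omega), spine_apply (by omega) (by omega) (by omega) (by omega)]
    ring
  · rw [ramp_of_mem ⟨by linarith, by linarith⟩, e]
    have e1 := spine_apply (n := n) (u := u) (k := 3 * j - 2 + r) (m := 3 * j + r) (by omega)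
      (by omega) (by omega) (by omega)
    have e2 := spine_apply (n := n) (u := u) (k := 3 * j - 2 + r + 1) (m := 3 * (j + 1) + r)
      (by omega) (by omega) (by omega) (by omega)
    rw [c1] at e1
    rw [c2] at e2
    rw [e1, e2]
  · have hrq' : (q : ℝ) + 1 ≤ r := by exact_mod_cast hrq
    rw [ramp_of_nonpos (by linarith), e, ← c1, spine_apply (by omega) (by omega) (by omega)
      (by omega), spine_apply (by omega) (by omega) (by omega) (by omega)]
    ring

theorem exists_move (hn : 0 < n) (h1 : 1 ≤ y) (h2 : y ≤ 3 * n + 1) :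
    ∃ j : ℕ, 1 ≤ j ∧ j ≤ n ∧ 3 * (j : ℝ) - 2 ≤ y ∧ y ≤ 3 * (j : ℝ) + 1 := by
  obtain ⟨i, hi, h3, h4⟩ := exists_segment (u := (y - 1) / 3) hn
    ⟨by linarith, by linarith⟩
  exact ⟨i + 1, by omega, by omega, by push_cast; linarith, by push_cast; linarith⟩

theorem val_pos (h : Boxed n u) (hr : r < 3) : 0 < val u (3 + r) :=
  (h.pSeq.cube (3 + r) (by omega) (by omega)).1

theorem val_lt_one (h : Boxed n u) (hr : r < 3) : val u (3 * n + 3 + r) < 1 :=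
  (h.pSeq.cube (3 * n + 3 + r) (by omega) (by omega)).2

theorem first_lt_last (h : Boxed n u) (hr : r < 3) : val u (3 + r) < val u (3 * n + 3 + r) := by
  have := h.pos
  simpa using h.last r 1 hr h.pos

theorem le_map (h : Boxed n u) (hr : r < 3) (hy : 1 ≤ y) :
    val u (3 + r) ≤ spineMap n u y (cls r) ∧
      (r = 0 → 1 < y → val u (3 + r) < spineMap n u y (cls r)) := by
  have h0 := h.pos
  rcases le_total y (3 * n + 1) with h1 | h1
  · obtain ⟨j, j1, j2, j3, j4⟩ := exists_move h.pos hy h1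
    rw [map_mid j1 j2 hr j3 j4]
    have hb := h.first r (j + 1) hr (by omega)
    obtain ⟨r0, r1⟩ := ramp_mem (y - (3 * j - 2 + r))
    rcases j1.eq_or_lt with rfl | j1
    · rw [mul_one]
      have := mul_nonneg r0 (sub_nonneg.2 hb.le)
      refine ⟨by linarith, ?_⟩
      rintro rfl hy1
      have := mul_pos (ramp_pos (z := y - (3 * (1 : ℕ) - 2 + (0 : ℕ))) (by push_cast; linarith))
        (sub_pos.2 hb)
      linarith
    · have ha := h.first r j hr (by omega)
      have : val u (3 + r) < val u (3 * j + r) + ramp (y - (3 * j - 2 + r)) *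
          (val u (3 * (j + 1) + r) - val u (3 * j + r)) := by
        rcases r0.eq_or_lt with h2 | h2
        · rw [← h2]; linarith
        · nlinarith [mul_pos h2 (sub_pos.2 hb), mul_nonneg (sub_nonneg.2 r1) (sub_pos.2 ha).le]
      exact ⟨this.le, fun _ _ => this⟩
  · rw [map_last hr h1]
    have h2 := h.first_lt_last hr
    have := mul_nonneg (sub_nonneg.2 h1) (sub_pos.2 (h.val_lt_one hr)).le
    exact ⟨by linarith, fun _ _ => by linarith⟩

theorem map_le (h : Boxed n u) (hr : r < 3) (hy : y ≤ 3 * n + 1) :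
    spineMap n u y (cls r) ≤ val u (3 * n + 3 + r) ∧
      (r = 2 → y < 3 * n + 1 → spineMap n u y (cls r) < val u (3 * n + 3 + r)) := by
  have h0 := h.pos
  rcases le_total 1 y with h1 | h1
  · obtain ⟨j, j1, j2, j3, j4⟩ := exists_move h.pos h1 hy
    rw [map_mid j1 j2 hr j3 j4]
    have ha := h.last r j hr j2
    obtain ⟨r0, r1⟩ := ramp_mem (y - (3 * j - 2 + r))
    rcases j2.eq_or_lt with rfl | j2
    · rw [show 3 * (j + 1) + r = 3 * j + 3 + r by ring]
      refine ⟨by nlinarith [mul_nonneg (sub_nonneg.2 r1) (sub_pos.2 ha).le], ?_⟩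
      rintro rfl hy1
      have := ramp_lt_one (z := y - (3 * j - 2 + (2 : ℕ))) (by push_cast; linarith)
      nlinarith [mul_pos (sub_pos.2 this) (sub_pos.2 ha)]
    · have hb := h.last r (j + 1) hr (by omega)
      have : val u (3 * j + r) + ramp (y - (3 * j - 2 + r)) *
          (val u (3 * (j + 1) + r) - val u (3 * j + r)) < val u (3 * n + 3 + r) := by
        rcases r0.eq_or_lt with h2 | h2
        · rw [← h2]; linarith
        · nlinarith [mul_pos h2 (sub_pos.2 hb), mul_nonneg (sub_nonneg.2 r1) (sub_pos.2 ha).le]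
      exact ⟨this.le, fun _ _ => this⟩
  · rw [map_first hr h1]
    have h2 := h.first_lt_last hr
    have h3 := h.val_pos hr
    have : y * val u (3 + r) < val u (3 * n + 3 + r) := by nlinarith
    exact ⟨this.le, fun _ _ => this⟩

/-- On the first edge every coordinate increases, and the rest of the spine stays in the box above
the end of that edge. In x the curve leaves this corner at once, which gives the boundary case. -/
theorem map_lt_of_first (h : Boxed n u) (hr : r < 3) (hy : y < 1 ∨ y = 1 ∧ r = 0) (hyy : y < y') :
    spineMap n u y (cls r) < spineMap n u y' (cls r) := by
  have h0 := h.val_pos hr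
  have hy1 : y ≤ 1 := by rcases hy with h | h <;> linarith
  rw [map_first hr hy1]
  rcases le_total y' 1 with h1 | h1
  · rw [map_first hr h1]
    exact mul_lt_mul_of_pos_right hyy h0
  · obtain ⟨h2, h3⟩ := h.le_map hr h1
    rcases hy with hy | ⟨rfl, hr0⟩
    · nlinarith
    · linarith [h3 hr0 hyy]

theorem map_lt_of_last (h : Boxed n u) (hr : r < 3) (hy : 3 * n + 1 < y' ∨ y' = 3 * n + 1 ∧ r = 2)
    (hyy : y < y') : spineMap n u y (cls r) < spineMap n u y' (cls r) := by
  have h0 := h.val_lt_one hr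
  have hy1 : 3 * n + 1 ≤ y' := by rcases hy with h | h <;> linarith
  rw [map_last hr hy1]
  rcases le_total (3 * n + 1 : ℝ) y with h1 | h1
  · rw [map_last hr h1]
    have := mul_lt_mul_of_pos_right (sub_lt_sub_right hyy (3 * n + 1 : ℝ)) (sub_pos.2 h0)
    linarith
  · obtain ⟨h2, h3⟩ := h.map_le hr h1
    rcases hy with hy | ⟨rfl, hr0⟩
    · have := mul_pos (sub_pos.2 hy) (sub_pos.2 h0)
      linarith
    · linarith [h3 hr0 hyy]

end Boxed

/-! ### Sampling the spine by insertion of vertices -/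

theorem insertPipe_plain (k : ℕ) (b : ℝ) (Y : ℕ → ℝ) (m : ℕ) : insertPipe k 0 b 0 0 Y m =
    if m ≤ k + 2 then Y m else if m = k + 3 then Y k + b * (Y (k + 3) - Y k) else Y (m - 3) := by
  rcases (by omega : m ≤ k + 1 ∨ m = k + 2 ∨ m = k + 3 ∨ m = k + 4 ∨ m = k + 5 ∨ k + 6 ≤ m) with
    h | rfl | rfl | rfl | rfl | h
  · rw [insertPipe_low h, if_pos (by omega)]
  · rw [insertPipe_add_two, if_pos le_rfl]; ring
  · rw [insertPipe_add_three, if_neg (by omega), if_pos rfl]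
  · rw [insertPipe_add_four, if_neg (by omega), if_neg (by omega)]
    simp
  · rw [insertPipe_add_five, if_neg (by omega), if_neg (by omega)]
    simp
  · rw [insertPipe_high h, if_neg (by omega), if_neg (by omega)]

theorem curve_spine {n : ℕ} {u : Seq} (h : spine n u ∈ P (3 * n + 2)) (t : ℝ) :
    curve (3 * n + 2) (spine n u) t = spineMap n u ((3 * n + 2) * t) := by
  rw [curve, pin_eq_self h, spineMap]
  push_cast
  rfl

theorem FineTimes.lt_of_lt {n : ℕ} {μ : ℝ} {t : ℕ → ℝ} (h : FineTimes n μ t) {i j : ℕ}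
    (hij : i < j) (hi : i < n) : t i < t j :=
  (h.lt i hi).trans_le (h.monotone hij)

section Insertion

variable {n m q : ℕ} {u : Seq} {η ρ μ : ℝ} {t t' : ℕ → ℝ}

local notation "γ" => curve (3 * n + 2) (spine n u)

theorem val_curve_spine (hS : spine n u ∈ P (3 * n + 2)) (t : ℕ → ℝ) (k : ℕ) :
    val (fun i => γ (t i)) k = spineMap n u ((3 * n + 2) * t (k / 3)) (cls (k % 3)) := by
  change γ (t (k / 3)) (cls k) = _
  rw [curve_spine hS, show cls (k % 3) = cls k from Fin.ext (Nat.mod_mod _ _)]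

/-- Sample q is the first inner vertex of the spine. A pipe that starts before it is separated from
all distant later ones by the growth of the coordinates on the first edge; the remaining pairs do
not involve the changed times. -/
theorem Boxed.mem_K_of_first (hb : Boxed n u) (hS : spine n u ∈ P (3 * n + 2))
    (hγ : Tame univ η ρ μ γ) (hm : 3 ≤ m) (ht : FineTimes m 1 t) (hK : (fun i => γ (t i)) ∈ K m)
    (hq : (3 * n + 2) * t q = 1) (ht' : FineTimes m 1 t') (heq : ∀ i, q ≤ i → t' i = t i) :
    (fun i => γ (t' i)) ∈ K m := by
  have hp : (0 : ℝ) < 3 * n + 2 := by positivity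
  have hqm : q < m := by
    by_contra hc
    have := ht.one q (by omega)
    have := Nat.cast_nonneg (α := ℝ) n
    nlinarith
  refine KSeq.mem_K ⟨(mem_P_iff _).1 (hγ.mem_P ht'), fun j k hjk hk => ?_⟩
  rcases lt_or_ge j (3 * q) with h | h
  -- Among the values at j, …, j + 3 only the one at j + 1 has this residue. If it already belongs
  -- to sample q, the residue is 0, so the x-coordinate is the one compared.
  · refine ⟨j + 1, Or.inl fun i i' h1 h2 h3 h4 h5 h6 => ?_⟩
    obtain rfl : i = j + 1 := by omega
    rw [val_curve_spine hS, val_curve_spine hS, h6, h5]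
    refine hb.map_lt_of_first (Nat.mod_lt _ (by norm_num)) ?_
      (mul_lt_mul_of_pos_left (ht'.lt_of_lt (by omega) (by omega)) hp)
    rcases (by omega : (j + 1) / 3 < q ∨ (j + 1) / 3 = q ∧ (j + 1) % 3 = 0) with h7 | ⟨h7, h8⟩
    · left
      rw [← hq, ← heq q le_rfl]
      exact mul_lt_mul_of_pos_left (ht'.lt_of_lt h7 (by omega)) hp
    · right
      rw [h7, heq q le_rfl]
      exact ⟨hq, h8⟩
  · obtain ⟨a, ha⟩ := (gap_of_mem_K hm hK).toKSeq.sep j k hjk hk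
    have e : ∀ i, j ≤ i → val (fun i => γ (t' i)) i = val (fun i => γ (t i)) i := fun i hi => by
      rw [val_curve_spine hS, val_curve_spine hS, heq _ (by omega)]
    refine ⟨a, ha.imp (fun ha i i' h1 h2 h3 h4 h5 h6 => ?_) fun ha i i' h1 h2 h3 h4 h5 h6 => ?_⟩ <;>
    · rw [e i h1, e i' (by omega)]
      exact ha i i' h1 h2 h3 h4 h5 h6

theorem Boxed.mem_K_of_last (hb : Boxed n u) (hS : spine n u ∈ P (3 * n + 2))
    (hγ : Tame univ η ρ μ γ) (hm : 3 ≤ m) (hK : (fun i => γ (t i)) ∈ K m)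
    (hqm : q < m) (hq : (3 * n + 2) * t q = 3 * n + 1) (ht' : FineTimes m 1 t')
    (heq : ∀ i, i ≤ q → t' i = t i) : (fun i => γ (t' i)) ∈ K m := by
  have hp : (0 : ℝ) < 3 * n + 2 := by positivity
  refine KSeq.mem_K ⟨(mem_P_iff _).1 (hγ.mem_P ht'), fun j k hjk hk => ?_⟩
  rcases le_or_gt (3 * q) k with h | h
  · refine ⟨k + 2, Or.inl fun i i' h1 h2 h3 h4 h5 h6 => ?_⟩
    obtain rfl : i' = k + 2 := by omega
    rw [val_curve_spine hS, val_curve_spine hS, h6, h5]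
    refine hb.map_lt_of_last (Nat.mod_lt _ (by norm_num)) ?_
      (mul_lt_mul_of_pos_left (ht'.lt_of_lt (by omega) (by omega)) hp)
    rcases (by omega : q < (k + 2) / 3 ∨ (k + 2) / 3 = q ∧ (k + 2) % 3 = 2) with h7 | ⟨h7, h8⟩
    · left
      rw [← hq, ← heq q le_rfl]
      exact mul_lt_mul_of_pos_left (ht'.lt_of_lt h7 hqm) hp
    · right
      rw [h7, heq q le_rfl]
      exact ⟨hq, h8⟩
  · obtain ⟨a, ha⟩ := (gap_of_mem_K hm hK).toKSeq.sep j k hjk hk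
    have e : ∀ i, i ≤ k + 3 → val (fun i => γ (t' i)) i = val (fun i => γ (t i)) i :=
      fun i hi => by
        rw [val_curve_spine hS, val_curve_spine hS, heq _ (by omega)]
    refine ⟨a, ha.imp (fun ha i i' h1 h2 h3 h4 h5 h6 => ?_) fun ha i i' h1 h2 h3 h4 h5 h6 => ?_⟩ <;>
    · rw [e i (by omega), e i' h4]
      exact ha i i' h1 h2 h3 h4 h5 h6

theorem joinedIn_of_times {S : Set Seq} (ht : FineTimes m 1 t) (ht' : FineTimes m 1 t')
    {A : Set ℕ} (h : ∀ t'', FineTimes m 1 t'' → (∀ i ∈ A, t'' i = t i) → (fun i => γ (t'' i)) ∈ S)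
    (heq : ∀ i ∈ A, t' i = t i) : JoinedIn S (fun i => γ (t i)) fun i => γ (t' i) := by
  have hc : Continuous γ := (continuous_curve _).comp (Continuous.prodMk_right _)
  refine JoinedIn.ofLine (f := fun s i => γ (t i + s * (t' i - t i))) ?_ ?_ ?_ ?_
  · exact Continuous.continuousOn (by fun_prop)
  · simp
  · simp
  · rintro _ ⟨s, hs, rfl⟩
    exact h _ (ht.line ht' hs) fun i hi => by simp only [heq i hi]; ring

variable {α : ℕ → ℕ} {d : ZerothHomotopy (Lim K (iota α))} {p : ℕ} {x : ℝ}

/-- The first edge starts at the origin, so an admissible insertion in pipe 0 with b = c = d = σ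
adds exactly the sample at the time σt₁. All times before q may then be moved freely to those
wanted. -/
theorem Boxed.represents_insert_first (hα : ∀ n, 3 ≤ n → α n + 3 ≤ n) (hb : Boxed n u)
    (hS : spine n u ∈ P (3 * n + 2)) (hγ : Tame univ η ρ μ γ) (ht : FineTimes m 1 t)
    (hd : Represents K (iota α) m (fun i => γ (t i)) d) (hqm : q ≤ m)
    (hq : (3 * n + 2) * t q = 1) (hpq : p < q) (hx : x ∈ Ioo (t p) (t (p + 1))) :
    Represents K (iota α) (m + 1) (fun i => γ (insertTime p x t i)) d := by
  have hp : (0 : ℝ) < 3 * n + 2 := by positivity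
  have hm := hd.three_le
  have g := gap_of_mem_K hm hd.mem
  have hε := g.pos
  have hε1 := g.le
  obtain ⟨σ, hσ⟩ : ∃ σ, σ = eps m (fun i => γ (t i)) / 2 := ⟨_, rfl⟩
  have ha : Admissible m (eps m fun i => γ (t i)) (val fun i => γ (t i)) 0 0 σ σ σ :=
    ⟨by omega, le_rfl, by linarith, by linarith, by linarith, by linarith, by linarith, by linarith,
      by linarith, Or.inl (by linarith), fun _ => ⟨by linarith, by linarith⟩,
      fun _ => ⟨by linarith, by linarith⟩, by omega, by omega⟩
  have h1 := hd.insertPipe hα ha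
  have t01 := ht.lt 0 (by omega)
  have t0 := ht.zero
  have hx1 : σ * t 1 ∈ Ioo (t 0) (t (0 + 1)) := by
    rw [t0] at t01 ⊢
    constructor <;> nlinarith
  have e : ofVal (insertPipe 0 0 σ σ σ (val fun i => γ (t i))) =
      fun i => γ (insertTime 0 (σ * t 1) t i) := by
    apply val_injective
    rw [val_ofVal]
    funext k
    have first : ∀ r, r < 3 → spineMap n u ((3 * n + 2) * (σ * t 1)) (cls r) =
        σ * spineMap n u ((3 * n + 2) * t 1) (cls r) := fun r hr => by
      have h2 : (3 * n + 2) * t 1 ≤ 1 := by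
        rw [← hq]; exact mul_le_mul_of_nonneg_left (ht.monotone (by omega)) hp.le
      have h3 : (3 * n + 2) * (σ * t 1) ≤ (3 * n + 2) * t 1 :=
        mul_le_mul_of_nonneg_left hx1.2.le hp.le
      rw [Boxed.map_first hr h2, Boxed.map_first hr (h3.trans h2)]
      ring
    rcases (by omega : k ≤ 2 ∨ k = 3 ∨ k = 4 ∨ k = 5 ∨ 6 ≤ k) with h | rfl | rfl | rfl | h
    · have e1 : insertPipe 0 0 σ σ σ (val fun i => γ (t i)) k = val (fun i => γ (t i)) k := by
        rcases (by omega : k ≤ 1 ∨ k = 2) with h | rfl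
        · exact insertPipe_low (by omega)
        · rw [show 2 = 0 + 2 from rfl, insertPipe_add_two]; ring
      rw [e1, val_curve_spine hS, val_curve_spine hS, insertTime, if_pos (by omega)]
    · rw [show 3 = 0 + 3 from rfl, insertPipe_add_three, g.zero 0 (by norm_num),
        val_curve_spine hS, val_curve_spine hS]
      simp [insertTime, first 0 (by norm_num)]
    · rw [show 4 = 0 + 4 from rfl, insertPipe_add_four, g.zero (0 + 1) (by norm_num),
        val_curve_spine hS, val_curve_spine hS]
      simp [insertTime, first 1 (by norm_num)]
    · rw [show 5 = 0 + 5 from rfl, insertPipe_add_five, g.zero (0 + 2) (by norm_num),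
        val_curve_spine hS, val_curve_spine hS]
      simp [insertTime, first 2 (by norm_num)]
    · rw [insertPipe_high (by omega), val_curve_spine hS, val_curve_spine hS, insertTime,
        if_neg (by omega), if_neg (by omega), show (k - 3) / 3 = k / 3 - 1 by omega,
        show (k - 3) % 3 = k % 3 by omega]
  rw [e] at h1
  have f1 := ht.insert (by omega) hx1
  have q1 : insertTime 0 (σ * t 1) t (q + 1) = t q := by
    rw [insertTime, if_neg (by omega), if_neg (by omega)]; rfl
  refine h1.of_joinedIn (joinedIn_of_times (A := Ici (q + 1)) f1 (ht.insert (by omega) hx)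
    (fun t'' h2 h3 => hb.mem_K_of_first hS hγ (by omega) f1 h1.mem (by rw [q1]; exact hq) h2 h3)
    fun i hi => ?_)
  have hi' : q + 1 ≤ i := hi
  rw [insertTime, if_neg (by omega), if_neg (by omega), insertTime, if_neg (by omega),
    if_neg (by omega)]

/-- The mirror image of the insertion on the first edge: the last sample before the end is
contracted towards (1, 1, 1), by an insertion in the second mode. -/
theorem Boxed.represents_insert_last (hα : ∀ n, 3 ≤ n → α n + 3 ≤ n) (hb : Boxed n u)
    (hS : spine n u ∈ P (3 * n + 2)) (hγ : Tame univ η ρ μ γ) (ht : FineTimes m 1 t)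
    (hd : Represents K (iota α) m (fun i => γ (t i)) d) (hpm : p < m)
    (hq : (3 * n + 2) * t q = 3 * n + 1) (hpq : q ≤ p) (hx : x ∈ Ioo (t p) (t (p + 1))) :
    Represents K (iota α) (m + 1) (fun i => γ (insertTime p x t i)) d := by
  have hp : (0 : ℝ) < 3 * n + 2 := by positivity
  have hm := hd.three_le
  have g := gap_of_mem_K hm hd.mem
  have hε := g.pos
  have hε1 := g.le
  obtain ⟨m, rfl⟩ : ∃ k, m = k + 1 := ⟨m - 1, by omega⟩
  obtain ⟨σ, hσ⟩ : ∃ σ, σ = eps (m + 1) (fun i => γ (t i)) / 2 := ⟨_, rfl⟩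
  have ha : Admissible (m + 1) (eps (m + 1) fun i => γ (t i)) (val fun i => γ (t i))
      (3 * m + 1) σ (1 - σ) (1 - σ) 0 :=
    ⟨by omega, by linarith, by linarith, by linarith, by linarith, by linarith, by linarith, le_rfl,
      by linarith, Or.inr (by linarith), fun _ => ⟨by linarith, by linarith⟩, by omega, by omega,
      fun _ => by linarith⟩
  have h1 := hd.insertPipe hα ha
  have t01 := ht.lt m (by omega)
  have t0 := ht.one (m + 1) le_rfl
  have hx1 : 1 - σ * (1 - t m) ∈ Ioo (t m) (t (m + 1)) := by
    rw [t0] at t01 ⊢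
    constructor <;> nlinarith
  have e : ofVal (insertPipe (3 * m + 1) σ (1 - σ) (1 - σ) 0 (val fun i => γ (t i))) =
      fun i => γ (insertTime m (1 - σ * (1 - t m)) t i) := by
    apply val_injective
    rw [val_ofVal]
    funext k
    have last : ∀ r, r < 3 → spineMap n u ((3 * n + 2) * (1 - σ * (1 - t m))) (cls r) =
        1 - σ * (1 - spineMap n u ((3 * n + 2) * t m) (cls r)) := fun r hr => by
      have h2 : 3 * n + 1 ≤ (3 * n + 2) * t m := by
        rw [← hq]; exact mul_le_mul_of_nonneg_left (ht.monotone (by omega)) hp.le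
      have h3 := mul_le_mul_of_nonneg_left hx1.1.le hp.le
      rw [Boxed.map_last hr h2, Boxed.map_last hr (h2.trans h3)]
      ring
    have ins : insertTime m (1 - σ * (1 - t m)) t (m + 1) = 1 - σ * (1 - t m) := by
      rw [insertTime, if_neg (by omega), if_pos rfl]
    rcases (by omega : k ≤ 3 * m + 2 ∨ k = 3 * m + 3 ∨ k = 3 * m + 4 ∨ k = 3 * m + 5 ∨
      3 * m + 6 ≤ k) with h | rfl | rfl | rfl | h
    · rw [insertPipe_low (by omega), val_curve_spine hS, val_curve_spine hS, insertTime,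
        if_pos (by omega)]
    · rw [show 3 * m + 3 = 3 * m + 1 + 2 from rfl, insertPipe_add_two, g.one _ (by omega),
        val_curve_spine hS, val_curve_spine hS, show (3 * m + 1 + 2) / 3 = m + 1 by omega,
        show (3 * m + 1 + 2) % 3 = 0 by omega, show (3 * m + 1 - 1) / 3 = m by omega,
        show (3 * m + 1 - 1) % 3 = 0 by omega, ins, last 0 (by norm_num)]
    · rw [show 3 * m + 4 = 3 * m + 1 + 3 from rfl, insertPipe_add_three,
        g.one (3 * m + 1 + 3) (by omega), val_curve_spine hS, val_curve_spine hS, show (3 * m + 1 + 3) / 3 = m + 1 by omega,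
        show (3 * m + 1 + 3) % 3 = 1 by omega, show (3 * m + 1) / 3 = m by omega,
        show (3 * m + 1) % 3 = 1 by omega, ins, last 1 (by norm_num)]
      ring
    · rw [show 3 * m + 5 = 3 * m + 1 + 4 from rfl, insertPipe_add_four,
        g.one (3 * m + 1 + 4) (by omega),
        val_curve_spine hS, val_curve_spine hS, show (3 * m + 1 + 4) / 3 = m + 1 by omega,
        show (3 * m + 1 + 4) % 3 = 2 by omega, show (3 * m + 1 + 1) / 3 = m by omega,
        show (3 * m + 1 + 1) % 3 = 2 by omega, ins, last 2 (by norm_num)]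
      ring
    · have e1 : insertPipe (3 * m + 1) σ (1 - σ) (1 - σ) 0 (val fun i => γ (t i)) k =
          val (fun i => γ (t i)) (k - 3) := by
        rcases (by omega : k = 3 * m + 1 + 5 ∨ 3 * m + 1 + 6 ≤ k) with rfl | h
        · rw [insertPipe_add_five, zero_mul, add_zero]; rfl
        · exact insertPipe_high h
      rw [e1, val_curve_spine hS, val_curve_spine hS, insertTime,
        if_neg (by omega), if_neg (by omega), show (k - 3) / 3 = k / 3 - 1 by omega,
        show (k - 3) % 3 = k % 3 by omega]
  rw [e] at h1
  have f1 := ht.insert (by omega) hx1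
  have q1 : insertTime m (1 - σ * (1 - t m)) t q = t q := by
    rw [insertTime, if_pos (by omega)]
  refine h1.of_joinedIn (joinedIn_of_times (A := Iic q) f1 (ht.insert (by omega) hx)
    (fun t'' h2 h3 => hb.mem_K_of_last hS hγ (by omega) h1.mem (by omega) (by rw [q1]; exact hq)
      h2 h3) fun i hi => ?_)
  have hi' : i ≤ q := hi
  rw [insertTime, if_pos (by omega), insertTime, if_pos (by omega)]

/-- At the new time coordinate r is running, the coordinates before it have already reached their
values at the next sample, and those after it are still at their values of the previous one. Thus
the new list arises from dividing pipe 3p + r with no borrowing, and equality holds without any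
deformation. -/
theorem Boxed.represents_insert_mid (hα : ∀ n, 3 ≤ n → α n + 3 ≤ n) (hb : Boxed n u)
    (hS : spine n u ∈ P (3 * n + 2)) (ht : FineTimes m 1 t)
    (hd : Represents K (iota α) m (fun i => γ (t i)) d) (hpm : p < m) {j r : ℕ} (hj : 1 ≤ j)
    (hj' : j ≤ n) (hr : r < 3) (h1 : 3 * (j : ℝ) - 2 ≤ (3 * n + 2) * t p)
    (h2 : (3 * n + 2) * t (p + 1) ≤ 3 * (j : ℝ) + 1) (hx : x ∈ Ioo (t p) (t (p + 1)))
    (hxr : (3 * n + 2) * x ∈ Ioo (3 * (j : ℝ) - 2 + r) (3 * (j : ℝ) - 1 + r)) :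
    Represents K (iota α) (m + 1) (fun i => γ (insertTime p x t i)) d := by
  have hp : (0 : ℝ) < 3 * n + 2 := by positivity
  have hj1 : (1 : ℝ) ≤ j := by exact_mod_cast hj
  have hjn : (j : ℝ) ≤ n := by exact_mod_cast hj'
  have a1 := mul_lt_mul_of_pos_left hx.1 hp
  have a2 := mul_lt_mul_of_pos_left hx.2 hp
  have p0 : p ≠ 0 := by
    rintro rfl
    rw [ht.zero] at h1
    linarith
  have pm : p + 1 ≠ m := fun h => by
    rw [ht.one (p + 1) h.ge] at h2
    linarith
  have mid : ∀ {y c}, c < 3 → y ∈ Icc (t p) (t (p + 1)) → spineMap n u ((3 * n + 2) * y) (cls c) =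
      val u (3 * j + c) + ramp ((3 * n + 2) * y - (3 * j - 2 + c)) *
        (val u (3 * (j + 1) + c) - val u (3 * j + c)) := fun hc hy =>
    Boxed.map_mid hj hj' hc (h1.trans (mul_le_mul_of_nonneg_left hy.1 hp.le))
      ((mul_le_mul_of_nonneg_left hy.2 hp.le).trans h2)
  have tp := ht.lt p hpm
  have mp : t p ∈ Icc (t p) (t (p + 1)) := ⟨le_rfl, tp.le⟩
  have mq : t (p + 1) ∈ Icc (t p) (t (p + 1)) := ⟨tp.le, le_rfl⟩
  have mx : x ∈ Icc (t p) (t (p + 1)) := Ioo_subset_Icc_self hx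
  obtain ⟨z, hz⟩ : ∃ z, z = (3 * n + 2) * x - (3 * j - 2 + r) := ⟨_, rfl⟩
  have z0 : 0 < z := by linarith [hxr.1]
  have z1 : z < 1 := by linarith [hxr.2]
  obtain ⟨A, hA⟩ : ∃ A, A = ramp ((3 * n + 2) * t p - (3 * j - 2 + r)) := ⟨_, rfl⟩
  obtain ⟨B, hB⟩ : ∃ B, B = ramp ((3 * n + 2) * t (p + 1) - (3 * j - 2 + r)) := ⟨_, rfl⟩
  have hAz : A < z := by
    rw [hA]; exact max_lt z0 ((min_le_left _ _).trans_lt (by linarith))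
  have hzB : z < B := by
    rw [hB]; exact lt_max_of_lt_right (lt_min (by linarith) z1)
  have hD := hb.pipe (3 * j + r) (by omega) (by omega)
  rw [show 3 * j + r + 3 = 3 * (j + 1) + r by ring] at hD
  have Y0 : val (fun i => γ (t i)) (3 * p + r) =
      val u (3 * j + r) + A * (val u (3 * (j + 1) + r) - val u (3 * j + r)) := by
    rw [val_curve_spine hS, show (3 * p + r) / 3 = p by omega, show (3 * p + r) % 3 = r by omega,
      mid hr mp, hA]
  have Y1 : val (fun i => γ (t i)) (3 * p + r + 3) =
      val u (3 * j + r) + B * (val u (3 * (j + 1) + r) - val u (3 * j + r)) := by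
    rw [val_curve_spine hS, show (3 * p + r + 3) / 3 = p + 1 by omega,
      show (3 * p + r + 3) % 3 = r by omega, mid hr mq, hB]
  have hne : val (fun i => γ (t i)) (3 * p + r + 3) - val (fun i => γ (t i)) (3 * p + r) ≠ 0 := by
    rw [Y0, Y1]
    have := mul_ne_zero (sub_ne_zero.2 (hAz.trans hzB).ne') hD
    intro h
    exact this (by linarith)
  have hm := hd.three_le
  have hε := (gap_of_mem_K hm hd.mem).pos
  have ha : Admissible m (eps m fun i => γ (t i)) (val fun i => γ (t i)) (3 * p + r) 0
      ((z - A) / (B - A)) 0 0 := by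
    refine ⟨by omega, le_rfl, by linarith, div_pos (by linarith) (by linarith), ?_, le_rfl, one_pos,
      le_rfl, by linarith, Or.inl (by linarith), fun h => (hne h).elim, by omega, by omega, by omega⟩
    rw [div_lt_one (by linarith)]
    linarith
  have h3 := hd.insertPipe hα ha
  convert h3 using 1
  apply val_injective
  rw [val_ofVal]
  funext k
  rw [insertPipe_plain, val_curve_spine hS]
  rcases (by omega : k / 3 ≤ p ∨ k / 3 = p + 1 ∨ p + 2 ≤ k / 3) with h | h | h
  · rw [if_pos (by omega), val_curve_spine hS, insertTime, if_pos h]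
  · rw [insertTime, if_neg (by omega), if_pos h]
    have hk : k % 3 < 3 := Nat.mod_lt _ (by norm_num)
    rw [mid hk mx]
    rcases lt_trichotomy (k % 3) r with h4 | h4 | h4
    · have h5 : ((k % 3 : ℕ) : ℝ) + 1 ≤ r := by exact_mod_cast h4
      rw [if_pos (by omega), val_curve_spine hS, h, mid hk mq,
        ramp_of_one_le (by linarith), ramp_of_one_le (by linarith)]
    · rw [if_neg (by omega), if_pos (by omega), Y0, Y1, h4, ← hz, ramp_of_mem ⟨z0.le, z1.le⟩]
      have : B - A ≠ 0 := by linarith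
      field_simp
      ring
    · have h5 : (r : ℝ) + 1 ≤ (k % 3 : ℕ) := by exact_mod_cast h4
      rw [if_neg (by omega), if_neg (by omega), val_curve_spine hS,
        show (k - 3) / 3 = p by omega, show (k - 3) % 3 = k % 3 by omega, mid hk mp,
        ramp_of_nonpos (by linarith), ramp_of_nonpos (by linarith)]
  · rw [insertTime, if_neg (by omega), if_neg (by omega), if_neg (by omega), if_neg (by omega),
      val_curve_spine hS, show (k - 3) / 3 = k / 3 - 1 by omega, show (k - 3) % 3 = k % 3 by omega]

end Insertion

section Refinement

variable {n : ℕ} {u : Seq} {η ρ μ : ℝ}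

local notation "γ" => curve (3 * n + 2) (spine n u)

theorem Boxed.represents_insert {α : ℕ → ℕ} (hα : ∀ n, 3 ≤ n → α n + 3 ≤ n) (hb : Boxed n u)
    (hS : spine n u ∈ P (3 * n + 2)) (hγ : Tame univ η ρ μ γ) {m p : ℕ} {t : ℕ → ℝ} {x : ℝ}
    {d : ZerothHomotopy (Lim K (iota α))} (ht : FineTimes m 1 t)
    (hit : ∀ j, j ≤ n → ∃ q ≤ m, (3 * n + 2) * t q = 3 * j + 1)
    (hd : Represents K (iota α) m (fun i => γ (t i)) d) (hp : p < m)
    (hx : x ∈ Ioo (t p) (t (p + 1))) (hxk : ∀ k : ℕ, (3 * n + 2) * x ≠ k) :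
    Represents K (iota α) (m + 1) (fun i => γ (insertTime p x t i)) d := by
  have hN : (0 : ℝ) < 3 * n + 2 := by positivity
  have before : ∀ q, (3 * n + 2) * t q < (3 * n + 2) * x → q ≤ p := fun q h => by
    by_contra hc
    exact absurd (lt_of_mul_lt_mul_left h hN.le) (not_lt.2 (hx.2.le.trans
      (ht.monotone (by omega))))
  have after : ∀ q, (3 * n + 2) * x < (3 * n + 2) * t q → p < q := fun q h => by
    by_contra hc
    exact absurd (lt_of_mul_lt_mul_left h hN.le) (not_lt.2 ((ht.monotone (by omega)).trans hx.1.le))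
  rcases lt_or_ge ((3 * n + 2) * x) 1 with h1 | h1
  · obtain ⟨q, hq, e⟩ := hit 0 (by omega)
    simp only [Nat.cast_zero, mul_zero, zero_add] at e
    exact hb.represents_insert_first hα hS hγ ht hd hq e (after q (by rw [e]; exact h1)) hx
  rcases lt_or_ge (3 * n + 1 : ℝ) ((3 * n + 2) * x) with h2 | h2
  · obtain ⟨q, hq, e⟩ := hit n le_rfl
    exact hb.represents_insert_last hα hS hγ ht hd hp e (before q (by rw [e]; exact h2)) hx
  obtain ⟨k, hk, h3, h4⟩ := exists_segment (n := 3 * n + 1) (by omega)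
    (u := (3 * n + 2) * x) ⟨by linarith, by push_cast; linarith⟩
  have h3 := h3.lt_of_ne (hxk k).symm
  have h4 := h4.lt_of_ne (by exact_mod_cast hxk (k + 1))
  have hk1 : 1 ≤ k := by
    by_contra hc
    obtain rfl : k = 0 := by omega
    norm_num at h4
    linarith
  obtain ⟨i, r, hr, rfl⟩ : ∃ i r, r < 3 ∧ k = 3 * i + 1 + r :=
    ⟨(k - 1) / 3, (k - 1) % 3, Nat.mod_lt _ (by norm_num), by omega⟩
  have hr' : (r : ℝ) ≤ 2 := by exact_mod_cast (by omega : r ≤ 2)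
  have hr0 : (0 : ℝ) ≤ r := Nat.cast_nonneg r
  push_cast at h3 h4
  obtain ⟨q, -, e⟩ := hit i (by omega)
  obtain ⟨q', -, e'⟩ := hit (i + 1) (by omega)
  have l1 := mul_le_mul_of_nonneg_left
    (ht.monotone (before q (by rw [e]; linarith))) hN.le
  have l2 := mul_le_mul_of_nonneg_left
    (ht.monotone (after q' (by rw [e']; push_cast; linarith)).nat_succ_le) hN.le
  rw [e] at l1
  rw [e'] at l2
  refine hb.represents_insert_mid hα hS ht hd hp (j := i + 1) (by omega) (by omega) hr
    (le_trans (le_of_eq ?_) l1) (l2.trans (le_of_eq ?_)) hx ⟨?_, ?_⟩ <;> push_cast <;> linarith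

theorem Boxed.exists_fine {α : ℕ → ℕ} (hα : ∀ n, 3 ≤ n → α n + 3 ≤ n) (hb : Boxed n u)
    (hS : spine n u ∈ P (3 * n + 2)) (hγ : Tame univ η ρ μ γ)
    {d : ZerothHomotopy (Lim K (iota α))} (hd : Represents K (iota α) (n + 2) u d) {ν : ℝ}
    (hν : 0 < ν) : ∃ m t, FineTimes m ν t ∧ Represents K (iota α) m (fun i => γ (t i)) d := by
  have hN : (0 : ℝ) < 3 * n + 2 := by positivity
  have hp := hb.pos
  -- Vertex i of `u` is corner 3i, which is vertex 3i - 2 of the spine; sampling at these times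
  -- returns `u`.
  let t : ℕ → ℝ := fun i => max 0 (min ((3 * i - 2) / (3 * n + 2)) 1)
  have t_zero : t 0 = 0 := max_eq_left ((min_le_left _ _).trans (by
    rw [div_le_iff₀ hN]; norm_num))
  have t_one : ∀ i, n + 2 ≤ i → t i = 1 := fun i hi => by
    have : (n : ℝ) + 2 ≤ i := by exact_mod_cast hi
    have h1 : 1 ≤ (3 * (i : ℝ) - 2) / (3 * n + 2) := by rw [le_div_iff₀ hN]; linarith
    simp only [t]
    rw [min_eq_right h1, max_eq_right zero_le_one]
  have t_mid : ∀ i, 1 ≤ i → i ≤ n + 1 → t i = (3 * i - 2) / (3 * n + 2) := fun i h1 h2 => by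
    have h1' : (1 : ℝ) ≤ i := by exact_mod_cast h1
    have h2' : (i : ℝ) ≤ n + 1 := by exact_mod_cast h2
    simp only [t]
    rw [min_eq_left, max_eq_right]
    · exact div_nonneg (by linarith) hN.le
    · rw [div_le_one hN]; linarith
  have ht : FineTimes (n + 2) 1 t := by
    refine ⟨t_zero, t_one, fun i hi => ?_, fun i => ?_⟩
    · rcases Nat.eq_zero_or_pos i with rfl | h0
      · rw [t_zero, t_mid (0 + 1) le_rfl (by omega)]
        push_cast
        exact div_pos (by norm_num) hN
      · have h2 : (i : ℝ) ≤ n + 1 := by exact_mod_cast (by omega : i ≤ n + 1)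
        rw [t_mid i h0 (by omega)]
        rcases (by omega : i = n + 1 ∨ i + 1 ≤ n + 1) with rfl | h3
        · rw [t_one _ le_rfl, div_lt_one hN]
          push_cast
          linarith
        · rw [t_mid (i + 1) (by omega) h3]
          push_cast
          gcongr
          linarith
    · have h1 : t (i + 1) ≤ 1 := max_le zero_le_one (min_le_right _ _)
      have h2 : 0 ≤ t i := le_max_left _ _
      linarith
  have hu : (fun i => γ (t i)) = u := by
    apply val_injective
    funext k
    have hk : k % 3 < 3 := Nat.mod_lt _ (by norm_num)
    have e : 3 * (k / 3) + k % 3 = k := Nat.div_add_mod k 3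
    rcases (by omega : k / 3 = 0 ∨ (1 ≤ k / 3 ∧ k / 3 ≤ n) ∨ k / 3 = n + 1 ∨ n + 2 ≤ k / 3) with
      h | h | h | h
    · rw [val_curve_spine hS, h, t_zero, Boxed.map_first hk (by simp), hb.pSeq.zero k (by omega)]
      simp
    · rw [val_curve_spine hS, t_mid _ h.1 (by omega), mul_div_cancel₀ _ hN.ne',
        Boxed.map_mid h.1 h.2 hk le_rfl (by linarith), ramp_of_nonpos, zero_mul, add_zero, e]
      linarith [Nat.cast_nonneg (α := ℝ) (k % 3)]
    · rw [val_curve_spine hS, t_mid _ (by omega) h.le, mul_div_cancel₀ _ hN.ne', h,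
        Boxed.map_last hk (by push_cast; linarith), show 3 * n + 3 + k % 3 = k by omega]
      push_cast
      ring
    · have : val (fun i => γ (t i)) k = val (fun i => γ (t (n + 2))) k := by
        change γ (t (k / 3)) (cls k) = γ (t (n + 2)) (cls k)
        rw [t_one _ h, t_one _ le_rfl]
      rw [this, val_curve_spine hS, t_one _ le_rfl, Boxed.map_last hk (by linarith),
        hb.pSeq.one k (by omega)]
      ring
  -- Times at which the spine has a vertex are avoided, because there the sample would not divide a
  -- pipe properly; as they are countable, the others are dense.
  have hA : ∀ a b : ℝ, a < b → ∃ x ∈ {x : ℝ | ∀ k : ℕ, (3 * n + 2) * x ≠ k}, x ∈ Ioo a b := by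
    intro a b hab
    obtain ⟨x, hx, hxI⟩ := ((countable_range fun k : ℕ => (k : ℝ) / (3 * n + 2)).dense_compl
      ℝ).exists_between hab
    refine ⟨x, fun k hk => hx ⟨k, ?_⟩, hxI⟩
    simp only
    rw [← hk, mul_div_cancel_left₀ _ hN.ne']
  have hQ : (∀ j, j ≤ n → ∃ q ≤ n + 2, (3 * n + 2) * t q = 3 * j + 1) ∧
      Represents K (iota α) (n + 2) (fun i => γ (t i)) d := by
    refine ⟨fun j hj => ⟨j + 1, by omega, ?_⟩, by rwa [hu]⟩
    rw [t_mid _ (by omega) (by omega), mul_div_cancel₀ _ hN.ne']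
    push_cast
    ring
  obtain ⟨m, t', -, h1, -, h2⟩ := exists_refinement (Q := fun m t =>
    (∀ j, j ≤ n → ∃ q ≤ m, (3 * n + 2) * t q = 3 * j + 1) ∧
      Represents K (iota α) m (fun i => γ (t i)) d) ht hQ hA (fun m t ht h p hp x hxA hx => by
    refine ⟨fun j hj => ?_, hb.represents_insert hα hS hγ ht h.1 h.2 hp hx hxA⟩
    obtain ⟨q, hq, e⟩ := h.1 j hj
    rcases le_or_gt q p with h1 | h1
    · exact ⟨q, by omega, by rw [insertTime, if_pos h1, e]⟩
    · refine ⟨q + 1, by omega, ?_⟩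
      rw [insertTime, if_neg (by omega), if_neg (by omega), ← e]
      rfl) hν
  exact ⟨m, t', h1, h2⟩

end Refinement

/-! ### Smoothing the spine inside its component -/

theorem monotoneOn_hinge {n i : ℕ} (hi : i + 1 < n) {w : Seq} {ℓ : E3 →ₗ[ℝ] ℝ} {a b : ℝ}
    (ha : i = 0 ∨ (i : ℝ) ≤ a) (hb : i + 2 = n ∨ b ≤ i + 2) (h1 : ℓ (w i) ≤ ℓ (w (i + 1)))
    (h2 : ℓ (w (i + 1)) ≤ ℓ (w (i + 2))) : MonotoneOn (fun y => ℓ (hinge n w y)) (Icc a b) := by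
  have e1 : ∀ y : ℝ, a ≤ y → y ≤ i + 1 → ℓ (hinge n w y) =
      ℓ (w (i + 1)) + (y - (i + 1)) * (ℓ (w (i + 1)) - ℓ (w i)) := fun y hy hy' => by
    rw [hinge_eq (i := i) (by omega) w (ha.imp_right (·.trans hy)) (Or.inr hy')]
    simp only [map_add, map_smul, map_sub, smul_eq_mul]
    ring
  have e2 : ∀ y : ℝ, i + 1 ≤ y → y ≤ b → ℓ (hinge n w y) =
      ℓ (w (i + 1)) + (y - (i + 1)) * (ℓ (w (i + 2)) - ℓ (w (i + 1))) := fun y hy hy' => by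
    rw [hinge_eq (i := i + 1) hi w (Or.inr (by push_cast; exact hy))
      (hb.imp id fun h => by push_cast; linarith)]
    simp only [map_add, map_smul, map_sub, smul_eq_mul]
    push_cast
    ring
  intro x hx y hy hxy
  simp only
  have s1 := sub_nonneg.2 h1
  have s2 := sub_nonneg.2 h2
  rcases le_total x (i + 1) with h3 | h3
  · rw [e1 x hx.1 h3]
    rcases le_total y (i + 1) with h4 | h4
    · rw [e1 y hy.1 h4]
      nlinarith
    · rw [e2 y h4 hy.2]
      nlinarith [mul_nonneg (sub_nonneg.2 h3) s1, mul_nonneg (sub_nonneg.2 h4) s2]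
  · rw [e2 x h3 hx.2, e2 y (h3.trans hxy) hy.2]
    nlinarith

/-- The linear form `x ↦ s * x c`. -/
def signed (s : ℝ) (c : Fin 3) : E3 →ₗ[ℝ] ℝ :=
  s • (EuclideanSpace.proj c : E3 →L[ℝ] ℝ).toLinearMap

theorem exists_sign (d : ℝ) : ∃ s : ℝ, (s = 1 ∨ s = -1) ∧ 0 ≤ s * d := by
  rcases le_total 0 d with h | h
  · exact ⟨1, Or.inl rfl, by linarith⟩
  · exact ⟨-1, Or.inr rfl, by linarith⟩

/-- Of two consecutive inner edges at most one changes a given coordinate. The first and the last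
edge change all of them, but there the box condition fixes the direction of the neighbouring edge.
-/
theorem Boxed.exists_sign {n : ℕ} {u : Seq} (hb : Boxed n u) {i : ℕ} (hi : i + 1 < 3 * n + 2)
    (c : Fin 3) : ∃ s : ℝ, (s = 1 ∨ s = -1) ∧ s * spine n u i c ≤ s * spine n u (i + 1) c ∧
      s * spine n u (i + 1) c ≤ s * spine n u (i + 2) c := by
  have hn := hb.pos
  have same : ∀ k m, 0 < k → k + 1 < 3 * n + 2 → (m = k + 3 ∨ m = k + 4) →
      spine n u k (cls m) = spine n u (k + 1) (cls m) := fun k m h1 h2 h3 => by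
    rw [Boxed.spine_apply h1 (by omega) (by omega) (by omega),
      Boxed.spine_apply (by omega) h2 (by omega) (by omega)]
  have moved : ∀ k, 0 < k → k + 1 < 3 * n + 2 →
      val u (k + 2) < val u (k + 5) → spine n u k (cls (k + 2)) ≤ spine n u (k + 1) (cls (k + 2)) :=
    fun k h1 h2 h3 => by
      rw [Boxed.spine_apply h1 (by omega) (by omega) (by omega), ← cls_add_three,
        Boxed.spine_apply (by omega) h2 (by omega) (by omega)]
      exact h3.le
  obtain ⟨m, m1, m2, rfl⟩ := exists_cls (i + 3) c
  rcases Nat.eq_zero_or_pos i with rfl | h0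
  · refine ⟨1, Or.inl rfl, ?_, ?_⟩
    · have e0 : spine n u 0 (cls m) = 0 := by simp [spine]
      rw [one_mul, one_mul, e0, Boxed.spine_apply (by omega) hi (by omega) (by omega)]
      exact (hb.pSeq.cube m (by omega) (by omega)).1.le
    · rw [one_mul, one_mul]
      rcases (by omega : m = 3 ∨ m = 4 ∨ m = 5) with rfl | rfl | rfl
      · exact moved 1 one_pos (by omega) (by simpa using hb.first 0 2 (by norm_num) le_rfl)
      · exact (same 1 4 one_pos (by omega) (by omega)).le
      · exact (same 1 5 one_pos (by omega) (by omega)).le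
  rcases (by omega : i = 3 * n ∨ i < 3 * n) with rfl | h1
  · refine ⟨1, Or.inl rfl, ?_, ?_⟩
    · rw [one_mul, one_mul]
      rcases (by omega : m = 3 * n + 3 ∨ m = 3 * n + 4 ∨ m = 3 * n + 2 + 3) with rfl | rfl | rfl
      · exact (same _ _ h0 hi (by omega)).le
      · exact (same _ _ h0 hi (by omega)).le
      · rw [cls_add_three]
        exact moved _ h0 hi (hb.last 2 n (by norm_num) le_rfl)
    · have e0 : spine n u (3 * n + 2) (cls m) = 1 := by simp [spine, ones]
      rw [one_mul, one_mul, e0, Boxed.spine_apply (by omega) hi (by omega) (by omega)]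
      exact (hb.pSeq.cube m (by omega) (by omega)).2.le
  rcases (by omega : m = i + 3 ∨ m = i + 4 ∨ m = i + 2 + 3) with rfl | rfl | rfl
  · obtain ⟨s, hs, h2⟩ := Plumbers.exists_sign
      (spine n u (i + 2) (cls (i + 3)) - spine n u (i + 1) (cls (i + 3)))
    exact ⟨s, hs, by rw [same i _ h0 hi (by omega)], by linarith⟩
  · obtain ⟨s, hs, h2⟩ := Plumbers.exists_sign
      (spine n u (i + 2) (cls (i + 4)) - spine n u (i + 1) (cls (i + 4)))
    exact ⟨s, hs, by rw [same i _ h0 hi (by omega)], by linarith⟩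
  · obtain ⟨s, hs, h2⟩ := Plumbers.exists_sign
      (spine n u (i + 1) (cls (i + 2 + 3)) - spine n u i (cls (i + 2 + 3)))
    refine ⟨s, hs, by linarith, ?_⟩
    rw [same (i + 1) (i + 2 + 3) (by omega) (by omega) (by omega)]

open Filter Topology

section Smoothing

variable {n : ℕ} {u : Seq} {η ρ μ : ℝ}

local notation "γ" => curve (3 * n + 2) (spine n u)

/-- In a short window each coordinate is monotone along the spine and its smoothings. -/
theorem Boxed.exists_monotoneOn (hb : Boxed n u) (hS : spine n u ∈ P (3 * n + 2)) {δ a b : ℝ}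
    (hδ : 0 ≤ δ) (hab : (3 * n + 2) * (b - a + 2 * δ) ≤ 1) (c : Fin 3) :
    ∃ s : ℝ, (s = 1 ∨ s = -1) ∧ MonotoneOn (fun x => s * γ x c) (Icc a b) ∧
      MonotoneOn (fun x => s * smooth δ γ x c) (Icc a b) := by
  have hN : (0 : ℝ) < 3 * n + 2 := by positivity
  have hc : Continuous γ := (continuous_curve _).comp (Continuous.prodMk_right _)
  obtain ⟨A, hA⟩ : ∃ A, A = (3 * n + 2) * (a - δ) := ⟨_, rfl⟩
  obtain ⟨B, hB⟩ : ∃ B, B = (3 * n + 2) * (b + δ) := ⟨_, rfl⟩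
  have hAB : B ≤ A + 1 := by rw [hA, hB]; linarith
  -- Enlarged by δ on both sides, the window has length at most 1 in the parameter of the spine,
  -- hence meets at most two consecutive edges.
  obtain ⟨i, hi, h1, h2⟩ : ∃ i, i + 1 < 3 * n + 2 ∧ (i = 0 ∨ (i : ℝ) ≤ A) ∧
      (i + 2 = 3 * n + 2 ∨ B ≤ i + 2) := by
    rcases le_or_gt A 1 with h | h
    · exact ⟨0, by omega, Or.inl rfl, Or.inr (by push_cast; linarith)⟩
    · have f0 : (⌊A⌋₊ : ℝ) ≤ A := Nat.floor_le (by linarith)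
      have f1 := Nat.lt_floor_add_one A
      rcases lt_or_ge (⌊A⌋₊ + 1) (3 * n + 2) with h' | h'
      · exact ⟨_, h', Or.inr f0, Or.inr (by linarith)⟩
      · refine ⟨3 * n, by omega, Or.inr (le_trans ?_ f0), Or.inl rfl⟩
        exact_mod_cast (by omega : 3 * n ≤ ⌊A⌋₊)
  obtain ⟨s, hs, h3, h4⟩ := hb.exists_sign hi c
  have key := monotoneOn_hinge hi (ℓ := signed s c) h1 h2 h3 h4
  have key' : ∀ x y, a - δ ≤ x → x ≤ y → y ≤ b + δ → s * γ x c ≤ s * γ y c :=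
    fun x y hx hxy hy => by
      rw [curve_spine hS, curve_spine hS]
      have l1 := mul_le_mul_of_nonneg_left hx hN.le
      have l2 := mul_le_mul_of_nonneg_left hxy hN.le
      have l3 := mul_le_mul_of_nonneg_left hy hN.le
      rw [← hA] at l1
      rw [← hB] at l3
      exact key ⟨l1, l2.trans l3⟩ ⟨l1.trans l2, l3⟩ l2
  refine ⟨s, hs, fun x hx y hy hxy => key' x y (by linarith [hx.1]) hxy (by linarith [hy.2]),
    fun x hx y hy hxy => ?_⟩
  refine smooth_le (ℓ := signed s c) hc fun z hz => ?_
  have := window_mem (r := δ) hz (abs_of_nonneg hδ).le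
  exact key' _ _ (by linarith [hx.1, this.1]) (by linarith) (by linarith [hy.2, this.2])

/-- Lists of points on the spine are joined to lists of points on its smoothing. -/
theorem Boxed.joinedIn_smooth (hb : Boxed n u) (hS : spine n u ∈ P (3 * n + 2))
    (hγ : Tame univ η ρ μ γ) (hη : η ≤ 1 / (4 * (3 * n + 2))) {δ : ℝ} (hδ : 0 ≤ δ)
    (hδ' : δ ≤ 1 / (4 * (3 * n + 2))) (near : ∀ x ∈ Icc (0 : ℝ) 1, ‖smooth δ γ x - γ x‖ ≤ ρ / 8)
    {m : ℕ} {t : ℕ → ℝ} (hm : 3 ≤ m) (ht : FineTimes m μ t) (hK : (fun i => γ (t i)) ∈ K m)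
    (hK' : (fun i => smooth δ γ (t i)) ∈ K m) :
    JoinedIn (K m) (fun i => γ (t i)) fun i => smooth δ γ (t i) := by
  have hN : (0 : ℝ) < 3 * n + 2 := by positivity
  have hη0 := hγ.pos
  have hμ := hγ.mesh_le
  refine joinedIn_of_line fun s hs => ?_
  rcases hs.2.eq_or_lt with rfl | hs1
  · simpa using hK'
  refine KSeq.mem_K ⟨(mem_P_iff _).1 (P_line hK.1 hK'.1 hs), fun j k hjk hk => ?_⟩
  by_cases far : η / 8 ≤ |t (j / 3) - t (k / 3)|
  · refine hγ.sep_of_far ht (fun i _ => ?_) hjk hk far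
    have e : ((fun i => γ (t i)) + s • ((fun i => smooth δ γ (t i)) - fun i => γ (t i)) : Seq) i -
        γ (t i) = s • (smooth δ γ (t i) - γ (t i)) := by
      simp
    rw [e, norm_smul, Real.norm_of_nonneg hs.1]
    have := near _ (ht.mem i)
    nlinarith [norm_nonneg (smooth δ γ (t i) - γ (t i)), hs.2]
  obtain ⟨V, hV⟩ : ∃ V, V = val fun i => γ (t i) := ⟨_, rfl⟩
  obtain ⟨W, hW⟩ : ∃ W, W = val fun i => smooth δ γ (t i) := ⟨_, rfl⟩
  have hZ : val ((fun i => γ (t i)) + s • ((fun i => smooth δ γ (t i)) - fun i => γ (t i))) =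
      fun i => V i + s * (W i - V i) := by
    rw [hV, hW]
    rfl
  rw [hZ]
  have h3 : t (k / 3) < t (j / 3) + η / 8 := by
    have := (abs_lt.1 (not_le.1 far)).1
    linarith
  have mem : ∀ i, j ≤ i → i ≤ k + 3 → t (i / 3) ∈ Icc (t (j / 3)) (t (j / 3) + η) :=
    fun i h1 h2 => by
      have l1 := ht.monotone (show i / 3 ≤ k / 3 + 1 by omega)
      have l2 := ht.step (k / 3)
      exact ⟨ht.monotone (by omega), by linarith⟩
  have win : (3 * n + 2) * (t (j / 3) + η - t (j / 3) + 2 * δ) ≤ 1 := by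
    have e : (3 * n + 2) * (1 / (4 * (3 * n + 2))) = (1 / 4 : ℝ) := by field_simp
    have l1 := mul_le_mul_of_nonneg_left hη hN.le
    have l2 := mul_le_mul_of_nonneg_left hδ' hN.le
    rw [e] at l1 l2
    linarith
  have mono : ∀ i, j ≤ i → i ≤ k + 3 → ∃ σ : ℝ, (σ = 1 ∨ σ = -1) ∧ ∀ i₁ i₂, j ≤ i₁ → i₁ ≤ i₂ →
      i₂ ≤ k + 3 → i₁ % 3 = i % 3 → i₂ % 3 = i % 3 → σ * V i₁ ≤ σ * V i₂ ∧ σ * W i₁ ≤ σ * W i₂ := by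
    intro i _ _
    obtain ⟨σ, hσ, hm1, hm2⟩ := hb.exists_monotoneOn hS hδ win (cls i)
    refine ⟨σ, hσ, fun i₁ i₂ h1 h2 h4 h5 h6 => ?_⟩
    have c1 : cls i₁ = cls i := Fin.ext h5
    have c2 : cls i₂ = cls i := Fin.ext h6
    have l := ht.monotone (show i₁ / 3 ≤ i₂ / 3 by omega)
    have r1 := hm1 (mem i₁ h1 (by omega)) (mem i₂ (by omega) h4) l
    have r2 := hm2 (mem i₁ h1 (by omega)) (mem i₂ (by omega) h4) l
    rw [hV, hW]
    change σ * γ (t (i₁ / 3)) (cls i₁) ≤ σ * γ (t (i₂ / 3)) (cls i₂) ∧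
      σ * smooth δ γ (t (i₁ / 3)) (cls i₁) ≤ σ * smooth δ γ (t (i₂ / 3)) (cls i₂)
    rw [c1, c2]
    exact ⟨r1, r2⟩
  -- The samples of the spine form a plumbers' knot, so pipes j and j + 4 are separated; some
  -- coordinate changes strictly in between. Mixed with the weak monotonicity of the smoothing, this
  -- change separates all intermediate lists for s < 1.
  obtain ⟨i, i1, i2, hne⟩ : ∃ i, j < i ∧ i ≤ j + 3 ∧ V i ≠ V (i + 3) := by
    by_contra! hc
    obtain ⟨a, ha⟩ := (gap_of_mem_K hm hK).toKSeq.sep j (j + 4) le_rfl (by omega)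
    obtain ⟨i, i1, i2, i3⟩ : ∃ i, j < i ∧ i ≤ j + 3 ∧ i % 3 = a % 3 :=
      ⟨j + 1 + (a % 3 + 3 - (j + 1) % 3) % 3, by omega, by omega, by omega⟩
    have e := hc i i1 i2
    rw [hV] at e
    rcases ha with ha | ha
    · exact absurd e (ha i (i + 3) i1.le i2 (by omega) (by omega) i3 (by omega)).ne
    · exact absurd e (ha i (i + 3) i1.le i2 (by omega) (by omega) i3 (by omega)).ne'
  obtain ⟨σ, hσ, hmono⟩ := mono i i1.le (by omega)
  have key : ∀ i₁ i₂, j ≤ i₁ → i₁ ≤ j + 3 → k ≤ i₂ → i₂ ≤ k + 3 → i₁ % 3 = i % 3 →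
      i₂ % 3 = i % 3 → σ * (V i₁ + s * (W i₁ - V i₁)) < σ * (V i₂ + s * (W i₂ - V i₂)) := by
    intro i₁ i₂ h1 h2 h4 h5 h6 h7
    obtain ⟨v1, -⟩ := hmono i₁ i h1 (by omega) (by omega) h6 rfl
    obtain ⟨v2, -⟩ := hmono i (i + 3) i1.le (by omega) (by omega) rfl (by omega)
    obtain ⟨v3, -⟩ := hmono (i + 3) i₂ (by omega) (by omega) h5 (by omega) h7
    obtain ⟨-, w1⟩ := hmono i₁ i₂ h1 (by omega) h5 h6 h7
    have v4 : σ * V i ≠ σ * V (i + 3) := fun h => hne (mul_left_cancel₀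
      (by rcases hσ with rfl | rfl <;> norm_num) h)
    have v5 : σ * V i₁ < σ * V i₂ := v1.trans_lt ((v2.lt_of_ne v4).trans_le v3)
    have := mul_lt_mul_of_pos_left v5 (sub_pos.2 hs1)
    have := mul_le_mul_of_nonneg_left w1 hs.1
    linarith
  refine ⟨i, ?_⟩
  rcases hσ with rfl | rfl
  · left
    intro i₁ i₂ h1 h2 h4 h5 h6 h7
    have := key i₁ i₂ h1 h2 h4 h5 h6 h7
    linarith
  · right
    intro i₁ i₂ h1 h2 h4 h5 h6 h7
    have := key i₁ i₂ h1 h2 h4 h5 h6 h7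
    linarith

/-- One small δ is chosen for which the smoothing has coordinate charts, lies within ρ/8 of the
spine and traces d'. Fine samples of the spine represent d and are joined to the samples of this
smoothing at the same times. The bound on η keeps pairs that are close in time within two edges of
the spine. -/
theorem Boxed.smoothClass_unique {α : ℕ → ℕ} (hα : ∀ n, 3 ≤ n → α n + 3 ≤ n) (hb : Boxed n u)
    (hS : spine n u ∈ L (3 * n + 2)) {d d' : ZerothHomotopy (Lim K (iota α))}
    (hd : Represents K (iota α) (n + 2) u d) (hd' : SmoothClass α γ d') : d' = d := by
  have hN : (0 : ℝ) < 3 * n + 2 := by positivity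
  have hr := regular_curve (by omega) hS
  have hc : Continuous γ := hr.continuous_curve _
  obtain ⟨δ₁, hδ₁, h1⟩ := hd'
  obtain ⟨δ₂, hδ₂, h2⟩ := hr.smooth_tame_coords
  obtain ⟨η₀, ρ₀, μ₀, h3⟩ := exists_tame_curve (by omega) hS
  have h3 := h3.self_of_nhds
  obtain ⟨η, ρ, μ, hη, h4⟩ := exists_tame_le (X := Unit) (x₀ := ()) (C := univ) (Γ := fun _ => γ)
    (hc.comp continuous_snd) (.of_forall fun _ => h3.zero) (.of_forall fun _ => h3.one)
    (.of_forall fun _ => h3.cube) hr.inj (fun s hs => by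
      obtain ⟨ℓ, hℓ, hm⟩ := h3.chart s hs
      exact ⟨ℓ, hℓ, η₀, h3.pos, .of_forall fun _ => hm⟩)
    (show (0 : ℝ) < 1 / (4 * (3 * n + 2)) by positivity)
  have h4 := h4.self_of_nhds
  have cont : Continuous fun p : ℝ × ℝ => smooth p.1 γ p.2 :=
    hr.continuous_smooth.comp (f := fun p : ℝ × ℝ => ((p.1, spine n u), p.2)) (by fun_prop)
  have h5 : ∀ᶠ δ in 𝓝 (0 : ℝ), ∀ x ∈ Icc (0 : ℝ) 1, ‖smooth δ γ x - γ x‖ < ρ / 8 := by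
    refine isCompact_Icc.eventually_forall_of_forall_eventually fun x _ => ?_
    have hd : Continuous fun p : ℝ × ℝ => ‖smooth p.1 γ p.2 - γ p.2‖ :=
      (cont.sub (hc.comp continuous_snd)).norm
    refine hd.continuousAt.eventually (gt_mem_nhds ?_)
    simp only [smooth_zero, sub_self, norm_zero]
    linarith [h4.rho_pos]
  obtain ⟨δ₃, hδ₃, h5⟩ := Metric.eventually_nhds_iff.1 h5
  obtain ⟨δ, hδ0, hδ⟩ := exists_between (lt_min (lt_min hδ₁ hδ₂) (lt_min hδ₃
    (show (0 : ℝ) < 1 / (4 * (3 * n + 2)) by positivity)))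
  simp only [lt_min_iff] at hδ
  obtain ⟨⟨l1, l2⟩, l3, l4⟩ := hδ
  obtain ⟨η', ρ', μ', h6⟩ := h2.self_of_nhds δ ⟨hδ0, l2⟩
  have h6 : Tame coords η' ρ' μ' (smooth δ γ) := h6.self_of_nhds
  obtain ⟨ν, hν, h7⟩ := h1 δ ⟨hδ0, l1⟩
  obtain ⟨m, t, ht, hV⟩ := hb.exists_fine hα hS.1 h4 hd
    (lt_min (lt_min h4.mesh_pos h6.mesh_pos) hν)
  have hm := hV.three_le
  have weaken : ∀ {b : ℝ}, min (min μ μ') ν ≤ b → FineTimes m b t := fun hab =>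
    ⟨ht.zero, ht.one, ht.lt, fun i => (ht.step i).trans (by linarith)⟩
  have t1 : FineTimes m μ t := weaken ((min_le_left _ _).trans (min_le_left _ _))
  have t2 : FineTimes m μ' t := weaken ((min_le_left _ _).trans (min_le_right _ _))
  have t3 : FineTimes m ν t := weaken (min_le_right _ _)
  have hj := hb.joinedIn_smooth hS.1 h4 hη hδ0.le l4.le (fun x hx => (h5 (by
    rw [Real.dist_eq, sub_zero, abs_of_pos hδ0]; exact l3) x hx).le) hm t1 hV.mem
    ((system_K hα).curve_mem h6 hm t2)
  exact (h7 m t hm t3).unique (hV.of_joinedIn hj)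

end Smoothing

/-- Smoothing inverts the maps `f n` on components. -/
theorem smoothing_f {α : ℕ → ℕ} (hα : ∀ n, 3 ≤ n → α n + 3 ≤ n)
    {G : ZerothHomotopy (Lim L (insertMid α)) → ZerothHomotopy (Lim K (iota α))}
    (hG : ∀ n w c, Represents L (insertMid α) n w c → SmoothClass α (curve n w) (G c)) {n : ℕ}
    {v : Seq} {c : ZerothHomotopy (Lim L (insertMid α))} {d : ZerothHomotopy (Lim K (iota α))}
    (hd : Represents K (iota α) n v d) (hc : Represents L (insertMid α) (3 * n) (f n v) c) :
    G c = d := by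
  have hn := hd.three_le
  obtain ⟨w, hj, hw⟩ := exists_nondegenerate hn hd.mem
  have hc := hc.of_joinedIn (joinedIn_f hn hj)
  obtain ⟨u, hu, he⟩ := (hd.of_joinedIn hj).exists_extends hα
  have hS := hc.spine hα hn hj.target_mem hw he
  exact (he.boxed hn hj.target_mem hu.mem hw).smoothClass_unique hα hS.mem hu (hG _ _ _ hS)

end Plumbers

end

theorem mainTheorem1 (α : ℕ → ℕ) (hα : ∀ n, 3 ≤ n → α n + 3 ≤ n) :
    (∀ n, 3 ≤ n → Set.MapsTo (Plumbers.iota α n) (Plumbers.K n) (Plumbers.K (n + 1)) ∧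
      ContinuousOn (Plumbers.iota α n) (Plumbers.K n) ∧
      Set.InjOn (Plumbers.iota α n) (Plumbers.K n)) ∧
    (∀ n, 3 ≤ n → Set.MapsTo (Plumbers.insertMid α n) (Plumbers.L n) (Plumbers.L (n + 1)) ∧
      ContinuousOn (Plumbers.insertMid α n) (Plumbers.L n) ∧
      Set.InjOn (Plumbers.insertMid α n) (Plumbers.L n)) ∧
    (∀ n, 3 ≤ n → ContinuousOn (Plumbers.f n) (Plumbers.K n)) ∧
    ∃ (hf : ∀ n, 3 ≤ n → Set.MapsTo (Plumbers.f n) (Plumbers.K n) (Plumbers.L (3 * n)))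
      (F : ZerothHomotopy (Plumbers.Lim Plumbers.K (Plumbers.iota α)) →
        ZerothHomotopy (Plumbers.Lim Plumbers.L (Plumbers.insertMid α))),
      (∀ (n : ℕ) (hn : 3 ≤ n) (v : Plumbers.Seq) (hv : v ∈ Plumbers.K n),
        F (Plumbers.comp Plumbers.K (Plumbers.iota α) n hn v hv) =
          Plumbers.comp Plumbers.L (Plumbers.insertMid α) (3 * n) (by omega)
            (Plumbers.f n v) (hf n hn hv)) ∧
      Function.Bijective F := by
  open Plumbers in
  have hf : ∀ n, 3 ≤ n → Set.MapsTo (f n) (K n) (L (3 * n)) := fun n hn v hv => f_mem hn hv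
  obtain ⟨G, hG⟩ := Plumbers.exists_smoothing_map hα
  have hGf : ∀ n v c d, Plumbers.Represents _ _ n v d → Plumbers.Represents _ _ _ _ c → G c = d :=
    fun n v c d => Plumbers.smoothing_f hα hG (n := n) (v := v)
  have hbij : Function.Bijective G := by
    refine ⟨Plumbers.smoothing_injective hα hG, fun d => ?_⟩
    obtain ⟨n, v, hv⟩ := Plumbers.exists_rep d
    have hn := hv.three_le
    exact ⟨_, hGf n v _ d hv ⟨by omega, hf n hn hv.mem, rfl⟩⟩
  -- The inverse of G is the required map: G[f_n(v)] = [v], which also gave surjectivity, is its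
  -- defining formula read backwards.
  let e := Equiv.ofBijective G hbij
  refine ⟨fun n hn => ⟨fun v hv => Plumbers.iota_mem hα hn hv,
      (Plumbers.continuous_iota α hn).continuousOn, (Plumbers.iota_injective α n).injOn⟩,
    fun n hn => ⟨fun v hv => Plumbers.insertMid_mem hα hn hv,
      (Plumbers.continuous_insertMid α n).continuousOn, (Plumbers.insertMid_injective α n).injOn⟩,
    fun n hn => Plumbers.continuousOn_f hn, hf, e.symm, fun n hn v hv => ?_, e.symm.bijective⟩
  rw [Equiv.symm_apply_eq]
  exact (hGf n v _ _ ⟨hn, hv, rfl⟩ ⟨by omega, hf n hn hv, rfl⟩).symm
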